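/- Let $n,k\ge 1$ be integers and let $\Omega\subset\mathbb R^n$ be a bounded open set that is locally connected at its boundary: every $x\in\partial\Omega$ has arbitrarily small neighbourhoods $V$ with $V\cap\Omega$ connected (every Lipschitz domain has this property). Let $\mathbb S$ be the space of symmetric $n\times n$ matrices. For a conforming grid $\mathcal T_h$ of finitely many closed $n$-simplices with $\Omega=\operatorname{int}\bigcup_{K\in\mathcal T_h}K$, put $h_K=\operatorname{diam}K$, $h=\max_K h_K$. Let $P_r$ denote polynomials of total degree at most $r$ (only $0$ if $r<0$), and let $\Sigma_{k,h}=\widetilde\Sigma_{k,h}+B_{k,h}$, where $$\widetilde\Sigma_{k,h}=\{\tau\in H^1(\Omega;\mathbb S):\tau|_K\in P_k(K;\mathbb S)\ \forall K\in\mathcal T_h\},$$ $$B_{k,h}=\{\tau\in H(\mathbf{div},\Omega;\mathbb S):\tau|_K\in P_k(K;\mathbb S),\ (\tau|_K)\nu=0\text{ on }\partial K\ \forall K\in\mathcal T_h\}.$$ Bubble interpolation. For $\tau\in L^2(\Omega;\mathbb S)$, $I^b_{k,h}\tau$ is on each $K$ the element $q\in P_k(K;\mathbb S)$ such that (i) for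 every proper face $\Delta$ of $K$, of dimension $\ell\in\{0,\dots,n-1\}$, all $t$ tangential and $\nu,\nu'$ normal to $\Delta$, and all $p\in P_{k-\ell-1}$, $\int_\Delta (t^Tq\nu)\,p=\int_\Delta(\nu'^Tq\nu)\,p=0$, and (ii) $\int_K q:\varsigma\,dx=\int_K\tau:\varsigma\,dx$ for all $\varsigma\in P_{k-2}(K;\mathbb S)$. Scott--Zhang interpolation. For each Lagrange node $a$ of degree $k$ choose a simplex $\sigma_a\ni a$ of the grid: $\sigma_a=K$ if $a$ is interior to the element $K$, and some $(n-1)$-dimensional face containing $a$ otherwise. Let $\psi_a\in P_k(\sigma_a)$ satisfy $\int_{\sigma_a}\psi_a p=p(a)$ for all $p\in P_k(\sigma_a)$. For $v\in H^1(\Omega)$, $I_h^{SZ}v$ is the continuous piecewise polynomial of degree at most $k$ with nodal values $(I_h^{SZ}v)(a)=\int_{\sigma_a}\psi_a v$ (with the trace of $v$ if $\sigma_a$ is a face); on tensor fields it acts entrywise. For $\tau\in H^1(\Omega;\mathbb S)$ let $I_h\tau=I_h^{SZ}\tau+I^b_{k,h}(\tau-I_h^{SZ}\tau)$. Then: 1.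 For every such grid, every choice of the $\sigma_a$ and every $\tau\in H^1(\Omega;\mathbb S)$, the interpolants $I_h^{SZ}\tau$ and $I^b_{k,h}(\tau-I_h^{SZ}\tau)$ exist and are unique, $I_h\tau\in\Sigma_{k,h}$, and $\int_K(I_h\tau-\tau):\varsigma\,dx=0$ for all $K\in\mathcal T_h$ and $\varsigma\in P_{k-2}(K;\mathbb S)$. 2. For every integer $m\ge1$ and every $\gamma$ there is a constant $C>0$, depending only on $n,k,m,\gamma,\Omega$, such that for every such grid that is shape regular with constant $\gamma$ (each $K$ contains a ball of some diameter $d_K>0$ with $h_K\le\gamma d_K$), every choice of the $\sigma_a$ and every $\tau\in H^m(\Omega;\mathbb S)$, $$\sum_{K\in\mathcal T_h}h_K^{-2}\left(\|\tau-I_h\tau\|_{0,K}^2+h_K\|\tau-I_h\tau\|_{0,\partial K}^2\right)\le C\,h^{2\min\{k,m-1\}}\,\|\tau\|_{m}^2 .$$ -/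

import Mathlib

open scoped ContDiff MeasureTheory Topology

noncomputable section

namespace FEM

open MeasureTheory Filter

/-- Points of `ℝⁿ`. -/
abbrev Pt (n : ℕ) : Type := EuclideanSpace ℝ (Fin n)

/-- Tensor fields on `ℝⁿ` (symmetry is imposed where needed). -/
abbrev TensorField (n : ℕ) : Type := Pt n → Matrix (Fin n) (Fin n) ℝ

/-! ### Sobolev spaces -/

/-- A test function on `Ω`: smooth on `ℝⁿ`, with compact support contained in `Ω`. -/
def IsTestFunction {n : ℕ} (Ω : Set (Pt n)) (φ : Pt n → ℝ) : Prop :=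
  ContDiff ℝ ∞ φ ∧ HasCompactSupport φ ∧ tsupport φ ⊆ Ω

/-- The classical partial derivative `∂_{α 0} ⋯ ∂_{α (j-1)} φ` of order `j`. -/
def partialDeriv {n j : ℕ} (α : Fin j → Fin n) (φ : Pt n → ℝ) (x : Pt n) : ℝ :=
  iteratedFDeriv ℝ j φ x (fun l => EuclideanSpace.single (α l) (1 : ℝ))

/-- `v ∈ L²(Ω)` is the weak derivative `∂_{α 0} ⋯ ∂_{α (j-1)} u` in `Ω`. -/
def HasWeakDeriv {n j : ℕ} (Ω : Set (Pt n)) (α : Fin j → Fin n) (u v : Pt n → ℝ) : Prop :=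
  MemLp v 2 (volume.restrict Ω) ∧
    ∀ φ : Pt n → ℝ, IsTestFunction Ω φ →
      ∫ x in Ω, u x * partialDeriv α φ x = (-1) ^ j * ∫ x in Ω, v x * φ x

/-- `u ∈ H^m(Ω)`. -/
def MemSobolev {n : ℕ} (Ω : Set (Pt n)) (m : ℕ) (u : Pt n → ℝ) : Prop :=
  MemLp u 2 (volume.restrict Ω) ∧
    ∀ j ≤ m, ∀ α : Fin j → Fin n, ∃ v : Pt n → ℝ, HasWeakDeriv Ω α u v

/-- The weak derivative (unique up to null sets in `Ω` when it exists). -/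
def weakDeriv {n j : ℕ} (Ω : Set (Pt n)) (α : Fin j → Fin n) (u : Pt n → ℝ) : Pt n → ℝ :=
  Classical.epsilon (HasWeakDeriv Ω α u)

/-- `‖u‖²_{m,Ω}`, the sum over `j ≤ m` of the squared `L²(Ω)`-norms of the tensors of all partial
derivatives of order `j`. -/
def sobolevNormSq {n : ℕ} (Ω : Set (Pt n)) (m : ℕ) (u : Pt n → ℝ) : ℝ :=
  ∑ j ∈ Finset.range (m + 1), ∑ α : Fin j → Fin n, ∫ x in Ω, (weakDeriv Ω α u x) ^ 2

/-- `τ ∈ H^m(Ω; 𝕊)`. For `m = 0` this is `L²(Ω; 𝕊)`. -/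
def MemSobolevSym {n : ℕ} (Ω : Set (Pt n)) (m : ℕ) (τ : TensorField n) : Prop :=
  (∀ᵐ x ∂(volume.restrict Ω), (τ x).IsSymm) ∧
    ∀ i j, MemSobolev Ω m (fun x => τ x i j)

/-- `‖τ‖²_{m,Ω}` for a tensor field. -/
def tensorSobolevNormSq {n : ℕ} (Ω : Set (Pt n)) (m : ℕ) (τ : TensorField n) : ℝ :=
  ∑ i, ∑ j, sobolevNormSq Ω m (fun x => τ x i j)

/-- `τ ∈ H(div, Ω; 𝕊)`: a symmetric square-integrable tensor field whose row-wise weak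
divergence is square-integrable. -/
def MemHdivSym {n : ℕ} (Ω : Set (Pt n)) (τ : TensorField n) : Prop :=
  MemSobolevSym Ω 0 τ ∧
    ∀ i, ∃ g : Pt n → ℝ, MemLp g 2 (volume.restrict Ω) ∧
      ∀ φ : Pt n → ℝ, IsTestFunction Ω φ →
        ∫ x in Ω, ∑ j, τ x i j * partialDeriv (fun _ : Fin 1 => j) φ x = - ∫ x in Ω, g x * φ x

/-! ### Polynomials -/

/-- `P_r`: polynomial functions on `ℝⁿ` of total degree at most `r`; only `0` for `r < 0`. -/
def IsPoly {n : ℕ} (r : ℤ) (f : Pt n → ℝ) : Prop :=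
  ∃ p : MvPolynomial (Fin n) ℝ, (p = 0 ∨ (p.totalDegree : ℤ) ≤ r) ∧
    ∀ x, f x = MvPolynomial.eval (fun i => x i) p

/-- `P_r(𝕊)`: symmetric tensor fields whose entries lie in `P_r`. -/
def IsPolySym {n : ℕ} (r : ℤ) (τ : TensorField n) : Prop :=
  (∀ x, (τ x).IsSymm) ∧ ∀ i j, IsPoly r (fun x => τ x i j)

/-- The Frobenius product `A : B`. -/
def frob {n : ℕ} (A B : Matrix (Fin n) (Fin n) ℝ) : ℝ := ∑ i, ∑ j, A i j * B i j

/-- `vᵀ A w`. -/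
def bilin {n : ℕ} (A : Matrix (Fin n) (Fin n) ℝ) (v w : Pt n) : ℝ :=
  ∑ i, ∑ j, v i * A i j * w j

/-! ### Simplices and simplicial meshes -/

/-- The closed simplex with vertex set `s`. -/
def hull {n : ℕ} (s : Finset (Pt n)) : Set (Pt n) := convexHull ℝ (s : Set (Pt n))

/-- Vectors tangential to the simplex with vertex set `s`. -/
def tangents {n : ℕ} (s : Finset (Pt n)) : Submodule ℝ (Pt n) :=
  (affineSpan ℝ (s : Set (Pt n))).direction

/-- Vectors normal to the simplex with vertex set `s`. -/
def normals {n : ℕ} (s : Finset (Pt n)) : Submodule ℝ (Pt n) := (tangents s)ᗮ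

/-- Surface measure on the simplex with vertex set `s` (Lebesgue measure when `s` spans `ℝⁿ`,
Dirac measure when `s` is a point). -/
def simplexMeasure {n : ℕ} (s : Finset (Pt n)) : Measure (Pt n) :=
  (μHE[s.card - 1] : Measure (Pt n)).restrict (hull s)

/-- Surface measure on the boundary of an `n`-dimensional simplex in `ℝⁿ`. -/
def boundaryMeasure {n : ℕ} (s : Finset (Pt n)) : Measure (Pt n) :=
  (μHE[n - 1] : Measure (Pt n)).restrict (frontier (hull s))

/-- A (conforming, finite) simplicial grid of the open set `Ω ⊆ ℝⁿ`: a finite geometric simplicial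
complex all of whose faces are faces of `n`-dimensional simplices, with `Ω` the interior of the
union of these simplices. -/
structure Mesh {n : ℕ} (Ω : Set (Pt n)) where
  complex : Geometry.SimplicialComplex ℝ (Pt n)
  finite : complex.faces.Finite
  pure : ∀ s ∈ complex.faces, ∃ t ∈ complex.faces, s ⊆ t ∧ t.card = n + 1
  interior_space : interior complex.space = Ω

variable {n : ℕ} {Ω : Set (Pt n)}

/-- The elements of the grid (each given by its `n + 1` vertices). -/
def Mesh.cells (T : Mesh Ω) : Finset (Finset (Pt n)) :=
  (T.finite.subset (Set.sep_subset T.complex.faces (fun s => s.card = n + 1))).toFinset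

/-- `h_K`. -/
def cellDiam (K : Finset (Pt n)) : ℝ := Metric.diam (hull K)

/-- `h = max_K h_K`. -/
def Mesh.size (T : Mesh Ω) : ℝ := sSup (cellDiam '' (T.cells : Set (Finset (Pt n))))

/-- Shape regularity with constant `γ`: each element `K` contains a ball of some radius `r` with
`h_K ≤ γ · 2r`. -/
def Mesh.ShapeRegular (T : Mesh Ω) (γ : ℝ) : Prop :=
  ∀ K ∈ T.cells, ∃ (c : Pt n) (r : ℝ), 0 < r ∧ Metric.closedBall c r ⊆ hull K ∧
    cellDiam K ≤ γ * (2 * r)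

/-- Every boundary point of `Ω` has arbitrarily small neighbourhoods whose intersection with `Ω`
is connected. Every Lipschitz domain has this property. -/
def LocallyConnectedAtBoundary (Ω : Set (Pt n)) : Prop :=
  ∀ x ∈ frontier Ω, ∀ U ∈ 𝓝 x, ∃ V ∈ 𝓝 x, V ⊆ U ∧ IsPreconnected (V ∩ Ω)

/-! ### Traces -/

/-- `g ∈ L²(∂K)` is the trace of `u ∈ H¹(K)`: the limit in `L²(∂K)` of `φ_l|_∂K` for some smooth
`φ_l` converging to `u` in `H¹(K)`. -/
def IsTrace (K : Finset (Pt n)) (u g : Pt n → ℝ) : Prop :=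
  MemSobolev (interior (hull K)) 1 u ∧ MemLp g 2 (boundaryMeasure K) ∧
    ∃ φ : ℕ → Pt n → ℝ, (∀ l, ContDiff ℝ ∞ (φ l)) ∧
      Tendsto (fun l => sobolevNormSq (interior (hull K)) 1 (fun x => u x - φ l x)) atTop (𝓝 0) ∧
      Tendsto (fun l => ∫ x, (g x - φ l x) ^ 2 ∂(boundaryMeasure K)) atTop (𝓝 0)

/-- The trace on `∂K` (unique up to null sets of `∂K`). -/
def trace (K : Finset (Pt n)) (u : Pt n → ℝ) : Pt n → ℝ := Classical.epsilon (IsTrace K u)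

/-- `‖τ‖²_{0,K}`. -/
def cellNormSq (K : Finset (Pt n)) (τ : TensorField n) : ℝ :=
  ∑ i, ∑ j, ∫ x in hull K, (τ x i j) ^ 2

/-- `‖τ‖²_{0,∂K}`, for the trace of `τ ∈ H¹(K; 𝕊)`. -/
def boundaryNormSq (K : Finset (Pt n)) (τ : TensorField n) : ℝ :=
  ∑ i, ∑ j, ∫ x, (trace K (fun y => τ y i j) x) ^ 2 ∂(boundaryMeasure K)

/-! ### The finite element spaces -/

/-- The bubble space `B_{K,k}`: `τ ∈ P_k(K; 𝕊)` with `τ ν = 0` on `∂K`. -/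
def IsCellBubble (K : Finset (Pt n)) (k : ℕ) (τ : TensorField n) : Prop :=
  IsPolySym k τ ∧ ∀ F ⊆ K, F.card = n → ∀ x ∈ hull F, ∀ ν ∈ normals F,
    ∀ i, ∑ j, τ x i j * ν j = 0

/-- `B_{k,h}`. -/
def Mesh.MemBubble (T : Mesh Ω) (k : ℕ) (τ : TensorField n) : Prop :=
  MemHdivSym Ω τ ∧ ∀ K ∈ T.cells, ∃ q, IsCellBubble K k q ∧
    τ =ᵐ[volume.restrict (hull K)] q

/-- The `H¹(Ω; 𝕊)`-conforming space of piecewise polynomials of degree at most `k`. -/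
def Mesh.MemLagrange (T : Mesh Ω) (k : ℕ) (τ : TensorField n) : Prop :=
  MemSobolevSym Ω 1 τ ∧ ∀ K ∈ T.cells, ∃ q, IsPolySym k q ∧
    τ =ᵐ[volume.restrict (hull K)] q

/-- `Σ_{k,h}`, the sum of the two preceding spaces. -/
def Mesh.MemStress (T : Mesh Ω) (k : ℕ) (τ : TensorField n) : Prop :=
  ∃ τ₁ τ₂, T.MemLagrange k τ₁ ∧ T.MemBubble k τ₂ ∧ τ =ᵐ[volume.restrict Ω] τ₁ + τ₂

/-! ### The Scott-Zhang interpolation -/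

/-- The Lagrange nodes of degree `k`: points of elements with barycentric coordinates in
`{0, 1/k, …, 1}`. -/
def Mesh.nodes (T : Mesh Ω) (k : ℕ) : Set (Pt n) :=
  {a | ∃ K ∈ T.cells, ∃ c : Pt n → ℕ, ∑ v ∈ K, c v = k ∧ a = ∑ v ∈ K, ((c v : ℝ) / k) • v}

/-- A choice, for each node `a`, of a simplex `σ a` of the grid containing `a`: the element `K` if
`a` is interior to `K`, and some `(n-1)`-dimensional face otherwise. -/
def Mesh.IsNodeChoice (T : Mesh Ω) (k : ℕ) (σ : Pt n → Finset (Pt n)) : Prop :=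
  ∀ a ∈ T.nodes k, σ a ∈ T.complex.faces ∧ a ∈ hull (σ a) ∧
    ((∃ K ∈ T.cells, a ∈ interior (hull K)) → (σ a).card = n + 1) ∧
    ((¬ ∃ K ∈ T.cells, a ∈ interior (hull K)) → (σ a).card = n)

/-- `ψ ∈ P_k` is the function dual to the node `a` on the simplex `s`: its `L²(s)`-product with any
`p ∈ P_k` is `p(a)`; thus it is `L²(s)`-dual to the nodal basis function of `a`. -/
def IsDualFunction (k : ℕ) (s : Finset (Pt n)) (a : Pt n) (ψ : Pt n → ℝ) : Prop :=
  IsPoly k ψ ∧ ∀ p : Pt n → ℝ, IsPoly k p → ∫ x, ψ x * p x ∂(simplexMeasure s) = p a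

/-- `c` is the Scott-Zhang nodal value of `u ∈ H¹(Ω)` at `a`, i.e. `∫_s ψ u` with `s` the simplex
chosen for `a`, `ψ` the dual function, and `u` replaced by its trace on `s` if `s` is an
`(n-1)`-dimensional face. -/
def Mesh.IsNodalValue (T : Mesh Ω) (k : ℕ) (s : Finset (Pt n)) (a : Pt n) (u : Pt n → ℝ)
    (c : ℝ) : Prop :=
  ∃ ψ, IsDualFunction k s a ψ ∧
    ((s.card = n + 1 ∧ c = ∫ x, ψ x * u x ∂(simplexMeasure s)) ∨
      (s.card = n ∧ ∃ K ∈ T.cells, s ⊆ K ∧ c = ∫ x, ψ x * trace K u x ∂(simplexMeasure s)))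

/-- `w` is the Scott-Zhang interpolant of degree `k` of `u`: on every closed element it is a
polynomial of degree at most `k`, and it takes the Scott-Zhang nodal values at the nodes
(and it is extended by zero outside the grid). -/
def Mesh.IsScottZhang (T : Mesh Ω) (k : ℕ) (σ : Pt n → Finset (Pt n)) (u w : Pt n → ℝ) : Prop :=
  (∀ K ∈ T.cells, ∃ p, IsPoly k p ∧ ∀ x ∈ hull K, w x = p x) ∧
    (∀ a ∈ T.nodes k, T.IsNodalValue k (σ a) a u (w a)) ∧
    ∀ x ∉ T.complex.space, w x = 0

/-- The scalar Scott-Zhang operator. -/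
def Mesh.scottZhang (T : Mesh Ω) (k : ℕ) (σ : Pt n → Finset (Pt n)) (u : Pt n → ℝ) : Pt n → ℝ :=
  Classical.epsilon (T.IsScottZhang k σ u)

/-- The tensorial Scott-Zhang operator `I_h^{SZ}`, acting entry by entry. -/
def Mesh.scottZhangTensor (T : Mesh Ω) (k : ℕ) (σ : Pt n → Finset (Pt n)) (τ : TensorField n) :
    TensorField n :=
  fun x => Matrix.of fun i j => T.scottZhang k σ (fun y => τ y i j) x

/-! ### The bubble interpolation and the operator `I_h` -/

/-- All degrees of freedom of the first kind of `q` on `K` vanish: for each proper face `D` of `K`,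
of dimension `ℓ = D.card - 1`, the moments of degree at most `k - ℓ - 1` over `D` of `tᵀ q ν` and of
`νᵀ q ν'`, for `t` tangential and `ν, ν'` normal to `D`. -/
def VanishingBoundaryDofs (K : Finset (Pt n)) (k : ℕ) (q : TensorField n) : Prop :=
  ∀ D ⊆ K, D.Nonempty → D ≠ K → ∀ p : Pt n → ℝ, IsPoly ((k : ℤ) - D.card) p →
    ∀ ν ∈ normals D,
      (∀ t ∈ tangents D, ∫ x, bilin (q x) t ν * p x ∂(simplexMeasure D) = 0) ∧
      (∀ ν' ∈ normals D, ∫ x, bilin (q x) ν' ν * p x ∂(simplexMeasure D) = 0)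

/-- `b` is the bubble interpolant of `τ ∈ L²(Ω; 𝕊)`: on each element it is the `q ∈ P_k(K; 𝕊)`
whose degrees of freedom of the first kind vanish and whose moments against `P_{k-2}(K; 𝕊)` are
those of `τ` (it is extended by zero outside the interiors of the elements). -/
def Mesh.IsBubbleInterp (T : Mesh Ω) (k : ℕ) (τ b : TensorField n) : Prop :=
  (∀ K ∈ T.cells, ∃ q, IsPolySym k q ∧ VanishingBoundaryDofs K k q ∧
    (∀ ς, IsPolySym ((k : ℤ) - 2) ς →
      ∫ x in hull K, frob (q x) (ς x) = ∫ x in hull K, frob (τ x) (ς x)) ∧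
    ∀ x ∈ interior (hull K), b x = q x) ∧
  ∀ x, (∀ K ∈ T.cells, x ∉ interior (hull K)) → b x = 0

/-- The bubble interpolation operator `I_{k,h}^b`. -/
def Mesh.bubbleInterp (T : Mesh Ω) (k : ℕ) (τ : TensorField n) : TensorField n :=
  Classical.epsilon (T.IsBubbleInterp k τ)

/-- `I_h τ = I_h^{SZ} τ + I_{k,h}^b (τ - I_h^{SZ} τ)`. -/
def Mesh.stressInterp (T : Mesh Ω) (k : ℕ) (σ : Pt n → Finset (Pt n)) (τ : TensorField n) :
    TensorField n :=
  T.scottZhangTensor k σ τ + T.bubbleInterp k (τ - T.scottZhangTensor k σ τ)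

end FEM

end

/-! The Scott-Zhang part supplies the order of approximation, and the bubble correction restores the
moments without spoiling it. On an element K write τ − I_hτ = (τ − p) + (p − I_h^SZ τ − b), where p
is a local polynomial approximation of τ and b is the bubble. The first part is small by
Bramble–Hilbert; the second is a polynomial, whose boundary norm is controlled by its interior norm.

Bubbles. If the first-kind degrees of freedom of q vanish, induction over the faces shows that q
maps the normals of each proper face to zero on that face (`VanishingBoundaryDofs.isFaceBubble`):
once the subfaces are settled, wᵀqν on a face of dimension ℓ is the product of the barycentric
coordinates of the face times a polynomial of degree k−ℓ−1, which is an admissible test function.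
With λ_i the barycentric coordinates and t_ij the edge vectors, it follows that λ_iλ_j divides ∇λ_iᵀ
q ∇λ_j for i ≠ j, so q = −½ Σ λ_iλ_j r_ij t_ij t_ijᵀ with r_ij in P_{k−2}. Testing q against Σ r_ij
(∇λ_i ∇λ_jᵀ + ∇λ_j ∇λ_iᵀ) bounds Σ ∫ λ_iλ_j r_ij²; this gives stability (`exists_bubble_stability`)
and uniqueness. Existence (`exists_bubble`) comes from the symmetric form Σ ∫ λ_iλ_j (t_ijᵀ ς
t_ij)(t_ijᵀ ς' t_ij). The divergence of an edge term is a derivative along that edge, whose integral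
over K vanishes because λ_iλ_j vanishes where the edge direction leaves K; hence bubbles are in
H(div).

Scott-Zhang. A nodal value reproduces polynomials, so at the node a it is compared first with the
approximation on an element containing σ_a. Any other element at a is reached by a chain of elements
sharing facets through a (`Mesh.chain`); this is where local connectedness at the boundary is used.
Across each facet the jump of the local approximations is bounded by the trace inequality, because
both sides see the same trace of τ (`Mesh.trace_ae_eq`). Shape regularity bounds the number of
elements at a node and, for n ≥ 2, makes elements along a chain comparable in size. For n = 1 sizes
need not be comparable, but then σ_a is contained in every element at a and no chain is needed
(`exists_nodal_estimate`).

No reference element is used. Inverse inequalities come from a one-variable inequality along rays,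
the trace inequality from integration along segments to a vertex, the Poincaré inequality from
segments to midpoints. All constants are therefore uniform, and the final one does not depend on Ω.
Sobolev functions are handled through smooth approximations on a simplex, obtained by contraction
and mollification. -/

noncomputable section

namespace FEM

open MeasureTheory Filter

/-! ### Polynomial functions of bounded total degree. -/

section Polynomials

variable {n : ℕ}

theorem isPoly_zero (r : ℤ) : IsPoly r (fun _ : Pt n => 0) := ⟨0, Or.inl rfl, by simp⟩

theorem IsPoly.mono {r s : ℤ} {f : Pt n → ℝ} (hf : IsPoly r f) (h : r ≤ s) : IsPoly s f := by
  obtain ⟨p, hp, hf⟩ := hf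
  exact ⟨p, hp.imp id (fun h' => h'.trans h), hf⟩

theorem IsPoly.add {r : ℤ} {f g : Pt n → ℝ} (hf : IsPoly r f) (hg : IsPoly r g) :
    IsPoly r (fun x => f x + g x) := by
  obtain ⟨p, hp, hf⟩ := hf
  obtain ⟨q, hq, hg⟩ := hg
  refine ⟨p + q, ?_, fun x => by simp only [hf, hg, map_add]⟩
  rcases hp with rfl | hp
  · rw [zero_add]; exact hq
  rcases hq with rfl | hq
  · rw [add_zero]; exact Or.inr hp
  right
  have := MvPolynomial.totalDegree_add p q
  omega

theorem IsPoly.mul {r s : ℤ} {f g : Pt n → ℝ} (hf : IsPoly r f) (hg : IsPoly s g) :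
    IsPoly (r + s) (fun x => f x * g x) := by
  obtain ⟨p, hp, hf⟩ := hf
  obtain ⟨q, hq, hg⟩ := hg
  refine ⟨p * q, ?_, fun x => by simp only [hf, hg, map_mul]⟩
  rcases hp with rfl | hp
  · left; simp
  rcases hq with rfl | hq
  · left; simp
  right
  have := MvPolynomial.totalDegree_mul p q
  omega

theorem isPoly_const (c : ℝ) {r : ℤ} (hr : 0 ≤ r) : IsPoly r (fun _ : Pt n => c) :=
  ⟨MvPolynomial.C c, Or.inr (by simpa using hr), by simp⟩

theorem IsPoly.const_mul {r : ℤ} {f : Pt n → ℝ} (hf : IsPoly r f) (c : ℝ) :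
    IsPoly r (fun x => c * f x) := by
  simpa using (isPoly_const (n := n) c le_rfl).mul hf

theorem IsPoly.mul_const {r : ℤ} {f : Pt n → ℝ} (hf : IsPoly r f) (c : ℝ) :
    IsPoly r (fun x => f x * c) := by
  simpa [mul_comm] using hf.const_mul c

theorem IsPoly.neg {r : ℤ} {f : Pt n → ℝ} (hf : IsPoly r f) : IsPoly r (fun x => - f x) := by
  simpa using hf.const_mul (-1)

theorem IsPoly.sub {r : ℤ} {f g : Pt n → ℝ} (hf : IsPoly r f) (hg : IsPoly r g) :
    IsPoly r (fun x => f x - g x) := by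
  simpa [sub_eq_add_neg] using hf.add hg.neg

theorem IsPoly.sum {ι : Type*} {r : ℤ} (s : Finset ι) {f : ι → Pt n → ℝ}
    (hf : ∀ i ∈ s, IsPoly r (f i)) : IsPoly r (fun x => ∑ i ∈ s, f i x) := by
  classical
  induction s using Finset.induction_on with
  | empty => simpa using isPoly_zero r
  | insert a s ha ih =>
    simp only [Finset.sum_insert ha]
    exact (hf a (by simp)).add (ih fun i hi => hf i (by simp [hi]))

theorem IsPoly.prod {ι : Type*} (s : Finset ι) {r : ι → ℤ} {f : ι → Pt n → ℝ}
    (hf : ∀ i ∈ s, IsPoly (r i) (f i)) : IsPoly (∑ i ∈ s, r i) (fun x => ∏ i ∈ s, f i x) := by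
  classical
  induction s using Finset.induction_on with
  | empty => simpa using isPoly_const (n := n) 1 le_rfl
  | insert a s ha ih =>
    simp only [Finset.sum_insert ha, Finset.prod_insert ha]
    exact (hf a (by simp)).mul (ih fun i hi => hf i (by simp [hi]))

theorem IsPoly.pow {r : ℤ} {f : Pt n → ℝ} (hf : IsPoly r f) (m : ℕ) :
    IsPoly (m * r) (fun x => f x ^ m) := by
  simpa using IsPoly.prod (Finset.range m) (r := fun _ => r) (f := fun _ => f) (fun _ _ => hf)

theorem isPoly_coord (i : Fin n) : IsPoly 1 (fun x : Pt n => x i) :=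
  ⟨MvPolynomial.X i, Or.inr (by simp), by simp⟩

theorem isPoly_affine (f : Pt n →ᵃ[ℝ] ℝ) : IsPoly 1 (fun x => f x) := by
  have h : ∀ x : Pt n, f x = (∑ i, x i * f.linear (EuclideanSpace.single i 1)) + f 0 := by
    intro x
    have hx : x = ∑ i, x i • EuclideanSpace.single i (1 : ℝ) := by
      ext j
      simp [Finset.sum_apply, Pi.single_apply]
    have h1 : f x = f.linear x + f 0 := by
      simpa using f.map_vadd 0 x
    rw [h1]
    conv_lhs => rw [hx]
    simp
  rw [funext h]
  exact (IsPoly.sum _ fun i _ => (isPoly_coord i).mul_const _).add (isPoly_const _ (by norm_num))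

theorem IsPoly.contDiff {r : ℤ} {f : Pt n → ℝ} (hf : IsPoly r f) {m : WithTop ℕ∞} :
    ContDiff ℝ m f := by
  obtain ⟨p, -, hf⟩ := hf
  have : f = fun x : Pt n => MvPolynomial.eval (fun i => x i) p := funext hf
  rw [this]
  simp only [MvPolynomial.eval_eq']
  refine ContDiff.sum fun d _ => contDiff_const.mul (contDiff_prod fun i _ => ?_)
  exact ContDiff.pow (by fun_prop) _

theorem IsPoly.continuous {r : ℤ} {f : Pt n → ℝ} (hf : IsPoly r f) : Continuous f :=
  (hf.contDiff (m := 0)).continuous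

/-- `P_r` as a vector space of functions. -/
def polyFun (n : ℕ) (r : ℤ) : Submodule ℝ (Pt n → ℝ) where
  carrier := {f | IsPoly r f}
  add_mem' hf hg := hf.add hg
  zero_mem' := isPoly_zero r
  smul_mem' c _ hf := hf.const_mul c

instance (r : ℤ) : FiniteDimensional ℝ (polyFun n r) := by
  let E : MvPolynomial (Fin n) ℝ →ₗ[ℝ] (Pt n → ℝ) :=
    { toFun := fun p x => MvPolynomial.eval (fun i => x i) p
      map_add' := fun p q => by ext; simp
      map_smul' := fun c p => by ext; simp }
  have h : polyFun n r ≤ (MvPolynomial.restrictTotalDegree (Fin n) ℝ r.toNat).map E := by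
    rintro f ⟨p, hp, hf⟩
    refine ⟨p, ?_, (funext hf).symm⟩
    rw [SetLike.mem_coe, MvPolynomial.mem_restrictTotalDegree]
    rcases hp with rfl | hp
    · simp
    · omega
  exact Submodule.finiteDimensional_of_le h

/-- Restriction to rays from a fixed point reduces inequalities for polynomials in n variables to
one variable. -/
theorem IsPoly.exists_polynomial_line {k : ℕ} {f : Pt n → ℝ} (hf : IsPoly k f) (c y : Pt n) :
    ∃ P : Polynomial ℝ, P.natDegree ≤ k ∧ ∀ t : ℝ, f (c + t • (y - c)) = P.eval t := by
  obtain ⟨p, hp, hf⟩ := hf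
  refine ⟨MvPolynomial.aeval
    (fun i => Polynomial.C (c i) + Polynomial.X * Polynomial.C (y i - c i)) p, ?_, fun t => ?_⟩
  · have hp' : p.totalDegree ≤ k := by
      rcases hp with rfl | hp
      · simp
      · exact_mod_cast hp
    simpa using MvPolynomial.aeval_natDegree_le (n := 1) p hp' _ (fun i => by compute_degree)
  · rw [hf, Polynomial.eval, ← Polynomial.coe_eval₂RingHom]
    have := MvPolynomial.map_aeval
      (fun i => Polynomial.C (c i) + Polynomial.X * Polynomial.C (y i - c i))
      (Polynomial.eval₂RingHom (RingHom.id ℝ) t) p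
    rw [this]
    simp only [MvPolynomial.eval, Polynomial.algebraMap_eq]
    congr 1
    simp

end Polynomials

/-! ### Homogeneous polynomials in barycentric coordinates: divisibility and Lagrange bases. -/

section Homogeneous

variable {n : ℕ} {ι : Type*} [Fintype ι]

theorem isPoly_eval_comp {k : ℕ} {P : MvPolynomial ι ℝ} (hP : P.totalDegree ≤ k)
    {l : ι → Pt n → ℝ} (hl : ∀ i, IsPoly 1 (l i)) :
    IsPoly k (fun x => MvPolynomial.eval (fun i => l i x) P) := by
  simp only [MvPolynomial.eval_eq']
  refine IsPoly.sum _ fun d hd => IsPoly.const_mul ?_ _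
  have h := IsPoly.prod Finset.univ (fun i _ => (hl i).pow (d i))
  refine h.mono ?_
  have h2 := MvPolynomial.le_totalDegree hd
  rw [Finsupp.sum_fintype _ _ (by simp)] at h2
  simp only [mul_one]
  exact_mod_cast h2.trans hP

/-- A monomial of degree e ≤ k is multiplied by the (k−e)-th power of the sum of the coordinates,
which equals 1 on the barycentric hyperplane. In homogeneous form, vanishing on a face turns into
divisibility by variables. -/
theorem IsPoly.exists_homogeneous {k : ℕ} {f : Pt n → ℝ} (hf : IsPoly k f) (v : ι → Pt n) :
    ∃ P : MvPolynomial ι ℝ, P.IsHomogeneous k ∧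
      ∀ c : ι → ℝ, ∑ i, c i = 1 → f (∑ i, c i • v i) = MvPolynomial.eval c P := by
  obtain ⟨p, hp, hf⟩ := hf
  have hp' : p.totalDegree ≤ k := by
    rcases hp with rfl | hp
    · simp
    · exact_mod_cast hp
  refine ⟨∑ d ∈ p.support, MvPolynomial.C (p.coeff d) *
    (∏ i, (∑ j, MvPolynomial.C (v j i) * MvPolynomial.X j) ^ (d i)) *
      (∑ j, MvPolynomial.X j) ^ (k - d.degree), ?_, ?_⟩
  · refine MvPolynomial.IsHomogeneous.sum _ _ _ fun d hd => ?_
    have hdk : d.degree ≤ k := (MvPolynomial.le_totalDegree hd).trans hp'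
    have h1 : (∏ i, (∑ j, MvPolynomial.C (v j i) * MvPolynomial.X j : MvPolynomial ι ℝ) ^ (d i)).IsHomogeneous
        (∑ i, 1 * d i) := by
      refine MvPolynomial.IsHomogeneous.prod _ _ _ fun i _ => MvPolynomial.IsHomogeneous.pow ?_ _
      exact MvPolynomial.IsHomogeneous.sum _ _ _ fun j _ => (MvPolynomial.isHomogeneous_X _ _).C_mul _
    have h2 : ((∑ j, MvPolynomial.X j : MvPolynomial ι ℝ) ^ (k - d.degree)).IsHomogeneous
        (1 * (k - d.degree)) :=
      (MvPolynomial.IsHomogeneous.sum _ _ _ fun j _ => MvPolynomial.isHomogeneous_X _ _).pow _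
    have h3 := (h1.C_mul (p.coeff d)).mul h2
    have h4 : d.degree = ∑ i, d i := by
      rw [Finsupp.degree_eq_sum]
    convert h3 using 1
    simp only [one_mul]
    omega
  · intro c hc
    rw [hf, MvPolynomial.eval_eq', map_sum]
    refine Finset.sum_congr rfl fun d _ => ?_
    simp only [map_mul, map_prod, map_pow, map_sum, MvPolynomial.eval_C, MvPolynomial.eval_X, hc,
      one_pow, mul_one]
    congr 1
    refine Finset.prod_congr rfl fun i _ => ?_
    congr 1
    simp [mul_comm]

/-- The remainder modulo `X i` does not involve `X i`, so its value at x is the value of `P` at x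
with the i-th entry set to 0. Vanishing on the nonnegative orthant suffices because that is a
product of infinite sets. -/
theorem X_dvd_of_eval_eq_zero [DecidableEq ι] {P : MvPolynomial ι ℝ} (i : ι)
    (h : ∀ c : ι → ℝ, (∀ j, 0 ≤ c j) → c i = 0 → MvPolynomial.eval c P = 0) :
    MvPolynomial.X i ∣ P := by
  rw [MvPolynomial.X_dvd_iff_modMonomial_eq_zero]
  set R := P.modMonomial (Finsupp.single i 1) with hR
  refine MvPolynomial.funext_set (fun _ => Set.Ici (0 : ℝ)) (fun _ => Set.Ici_infinite 0)
    fun x hx => ?_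
  have h1 : MvPolynomial.eval x R = MvPolynomial.eval (Function.update x i 0) R := by
    rw [MvPolynomial.eval_eq', MvPolynomial.eval_eq']
    refine Finset.sum_congr rfl fun d hd => ?_
    have hdi : d i = 0 := by
      by_contra hne
      refine (MvPolynomial.mem_support_iff.1 hd) ?_
      exact MvPolynomial.coeff_modMonomial_of_le _ (by
        rw [Finsupp.single_le_iff]; omega)
    congr 1
    refine Finset.prod_congr rfl fun j _ => ?_
    by_cases hj : j = i
    · subst hj; simp [hdi]
    · simp [hj]
  have h2 : MvPolynomial.eval (Function.update x i 0) P =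
      MvPolynomial.eval (Function.update x i 0) R := by
    conv_lhs => rw [← MvPolynomial.divMonomial_add_modMonomial_single P i]
    simp [hR]
  rw [h1, ← h2, map_zero]
  refine h _ (fun j => ?_) (by simp)
  by_cases hj : j = i
  · subst hj; simp
  · simpa [hj] using hx j (Set.mem_univ _)

/-- Homogeneity spreads vanishing from a face of the simplex to the cone over it, so each variable
in `S` divides `P`; distinct variables are coprime, hence their product divides `P`, and the degrees
add up. -/
theorem homogeneous_factor [DecidableEq ι] {k : ℕ} (hk : 1 ≤ k) {P : MvPolynomial ι ℝ}
    (hP : P.IsHomogeneous k) (S : Finset ι)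
    (hv : ∀ i ∈ S, ∀ c : ι → ℝ, (∀ j, 0 ≤ c j) → ∑ j, c j = 1 → c i = 0 →
      MvPolynomial.eval c P = 0) :
    ∃ Q : MvPolynomial ι ℝ, P = (∏ i ∈ S, MvPolynomial.X i) * Q ∧
      (Q = 0 ∨ Q.totalDegree + S.card ≤ k) := by
  have hdvd : (∏ i ∈ S, (MvPolynomial.X i : MvPolynomial ι ℝ)) ∣ P := by
    refine Finset.prod_dvd_of_isRelPrime ?_ fun i hi => X_dvd_of_eval_eq_zero i fun c hc hci => ?_
    · intro i _ j _ hij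
      have hirr : Irreducible (MvPolynomial.X i : MvPolynomial ι ℝ) :=
        MvPolynomial.X_prime.irreducible
      refine (hirr.isRelPrime_iff_not_dvd).2 fun h => hij ?_
      simpa [MvPolynomial.X_dvd_X] using h
    -- At the apex of the cone a homogeneous polynomial of positive degree vanishes; any other
    -- nonnegative point is rescaled to coordinate sum 1.
    · by_cases hs : ∑ j, c j = 0
      · have hc0 : c = 0 := by
          funext j
          exact (Finset.sum_eq_zero_iff_of_nonneg (fun j _ => hc j)).1 hs j (Finset.mem_univ j)
        rw [hc0, MvPolynomial.eval_eq']
        refine Finset.sum_eq_zero fun d hd => ?_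
        have hd' := hP (MvPolynomial.mem_support_iff.1 hd)
        have : ∃ j, d j ≠ 0 := by
          by_contra! hcon
          have : d = 0 := by ext j; simp [hcon]
          subst this
          simp at hd'
          omega
        obtain ⟨j, hj⟩ := this
        rw [Finset.prod_eq_zero (Finset.mem_univ j) (by simp [hj]), mul_zero]
      · have hs' : 0 ≤ ∑ j, c j := Finset.sum_nonneg fun j _ => hc j
        have h0 := hv i hi (fun j => (∑ j, c j)⁻¹ * c j)
          (fun j => mul_nonneg (inv_nonneg.2 hs') (hc j))
          (by rw [← Finset.mul_sum, inv_mul_cancel₀ hs]) (by simp [hci])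
        have h2 : MvPolynomial.eval (fun j => (∑ j, c j)⁻¹ * c j) P =
            ((∑ j, c j)⁻¹) ^ k * MvPolynomial.eval c P := by
          rw [MvPolynomial.eval_eq', MvPolynomial.eval_eq', Finset.mul_sum]
          refine Finset.sum_congr rfl fun d hd => ?_
          have hd' : ∑ j, d j = k := by
            have := hP.degree_eq_sum_deg_support hd
            rw [this, ← Finset.sum_subset (Finset.subset_univ _)]
            intro x _ hx
            simpa using hx
          simp only [mul_pow, Finset.prod_mul_distrib, Finset.prod_pow_eq_pow_sum, hd']
          ring
        rw [h2] at h0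
        exact (mul_eq_zero.1 h0).resolve_left (pow_ne_zero _ (inv_ne_zero hs))
  obtain ⟨Q, hQ⟩ := hdvd
  refine ⟨Q, hQ, ?_⟩
  by_cases hQ0 : Q = 0
  · exact Or.inl hQ0
  right
  have hprod : (∏ i ∈ S, (MvPolynomial.X i : MvPolynomial ι ℝ)) ≠ 0 :=
    Finset.prod_ne_zero_iff.2 fun i _ => MvPolynomial.X_ne_zero i
  have hP0 : P ≠ 0 := by rw [hQ]; exact mul_ne_zero hprod hQ0
  have h1 : (∏ i ∈ S, (MvPolynomial.X i : MvPolynomial ι ℝ)).totalDegree = S.card := by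
    have : (∏ i ∈ S, (MvPolynomial.X i : MvPolynomial ι ℝ)).IsHomogeneous (∑ i ∈ S, 1) :=
      MvPolynomial.IsHomogeneous.prod _ _ _ fun i _ => MvPolynomial.isHomogeneous_X _ _
    simpa using this.totalDegree hprod
  have h2 := hP.totalDegree hP0
  rw [hQ, MvPolynomial.totalDegree_mul_of_isDomain hprod hQ0, h1] at h2
  omega

theorem eval_homogeneous [DecidableEq ι] {k : ℕ} {P : MvPolynomial ι ℝ} (hP : P.IsHomogeneous k)
    (x : ι → ℝ) : MvPolynomial.eval x P =
      ∑ d ∈ Finset.univ.finsuppAntidiag k, P.coeff d * ∏ i, x i ^ d i := by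
  rw [MvPolynomial.eval_eq']
  refine Finset.sum_subset (fun d hd => ?_) (fun d _ hd => ?_)
  · rw [Finset.mem_finsuppAntidiag]
    have := hP.degree_eq_sum_deg_support hd
    refine ⟨?_, Finset.subset_univ _⟩
    rw [this, ← Finset.sum_subset (Finset.subset_univ _)]
    intro x _ hx
    simpa using hx
  · rw [MvPolynomial.notMem_support_iff.1 hd, zero_mul]

/-- The homogeneous Lagrange basis polynomial of the node `c / k`. -/
def lagrangePoly (k : ℕ) (c : ι →₀ ℕ) : MvPolynomial ι ℝ :=
  ∏ i, ∏ j ∈ Finset.range (c i), MvPolynomial.C (((c i : ℝ) - j)⁻¹) *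
    (MvPolynomial.C (k : ℝ) * MvPolynomial.X i - MvPolynomial.C (j : ℝ) * ∑ l, MvPolynomial.X l)

theorem lagrangePoly_isHomogeneous (k : ℕ) (c : ι →₀ ℕ) :
    (lagrangePoly k c).IsHomogeneous (∑ i, c i) := by
  have h : ∀ i ∈ (Finset.univ : Finset ι), (∏ j ∈ Finset.range (c i), MvPolynomial.C (((c i : ℝ) - j)⁻¹) *
      (MvPolynomial.C (k : ℝ) * MvPolynomial.X i - MvPolynomial.C (j : ℝ) * ∑ l, MvPolynomial.X l :
        MvPolynomial ι ℝ)).IsHomogeneous (∑ j ∈ Finset.range (c i), 1) := by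
    refine fun i _ => MvPolynomial.IsHomogeneous.prod _ _ _ fun j _ => ?_
    refine MvPolynomial.IsHomogeneous.C_mul (MvPolynomial.IsHomogeneous.sub ?_ ?_) _
    · exact (MvPolynomial.isHomogeneous_X _ _).C_mul _
    · exact (MvPolynomial.IsHomogeneous.sum _ _ _ fun l _ =>
        MvPolynomial.isHomogeneous_X _ _).C_mul _
  simpa [lagrangePoly] using MvPolynomial.IsHomogeneous.prod _ _ _ h

theorem eval_lagrangePoly (k : ℕ) (c : ι →₀ ℕ) {x : ι → ℝ} (hx : ∑ i, x i = 1) :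
    MvPolynomial.eval x (lagrangePoly k c) =
      ∏ i, ∏ j ∈ Finset.range (c i), ((c i : ℝ) - j)⁻¹ * (k * x i - j) := by
  simp [lagrangePoly, map_prod, map_sum, hx]

/-- Two distinct multi-indices with the same sum satisfy `d i < c i` for some `i`, and the factor
with `j = d i` then vanishes. -/
theorem eval_lagrangePoly_node {k : ℕ} (hk : 1 ≤ k) {c d : ι →₀ ℕ} (hc : ∑ i, c i = k)
    (hd : ∑ i, d i = k) [Decidable (c = d)] :
    MvPolynomial.eval (fun i => (d i : ℝ) / k) (lagrangePoly k c) = if c = d then 1 else 0 := by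
  have hk' : (k : ℝ) ≠ 0 := by positivity
  rw [eval_lagrangePoly]
  · have h1 : ∀ i, (k : ℝ) * ((d i : ℝ) / k) = d i := fun i => by field_simp
    simp only [h1]
    split_ifs with h
    · subst h
      refine Finset.prod_eq_one fun i _ => Finset.prod_eq_one fun j hj => ?_
      have : (j : ℝ) < c i := by exact_mod_cast Finset.mem_range.1 hj
      exact inv_mul_cancel₀ (by linarith)
    · have : ∃ i, d i < c i := by
        by_contra! hcon
        refine h (Finsupp.ext fun i => ?_)
        exact ((Finset.sum_eq_sum_iff_of_le fun i _ => hcon i).1 (hc.trans hd.symm)) i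
          (Finset.mem_univ i)
      obtain ⟨i, hi⟩ := this
      refine Finset.prod_eq_zero (Finset.mem_univ i) ?_
      exact Finset.prod_eq_zero (Finset.mem_range.2 hi) (by simp)
  · rw [← Finset.sum_div, div_eq_one_iff_eq hk']
    exact_mod_cast hd

/-- There are k factors in all, and each is at most k in absolute value, since c_i − j ≥ 1 and 0 ≤
x_i ≤ 1. -/
theorem abs_eval_lagrangePoly_le {k : ℕ} {c : ι →₀ ℕ} (hc : ∑ i, c i = k)
    {x : ι → ℝ} (hx0 : ∀ i, 0 ≤ x i) (hx : ∑ i, x i = 1) :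
    |MvPolynomial.eval x (lagrangePoly k c)| ≤ (k : ℝ) ^ k := by
  rw [eval_lagrangePoly k c hx, Finset.abs_prod]
  have h1 : ∀ i ∈ (Finset.univ : Finset ι),
      |∏ j ∈ Finset.range (c i), ((c i : ℝ) - j)⁻¹ * (k * x i - j)| ≤ (k : ℝ) ^ c i := by
    intro i _
    rw [Finset.abs_prod]
    have h2 : ∀ j ∈ Finset.range (c i), |((c i : ℝ) - j)⁻¹ * (k * x i - j)| ≤ (k : ℝ) := by
      intro j hj
      have hj' : j + 1 ≤ c i := Finset.mem_range.1 hj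
      have hck : c i ≤ k := hc ▸ Finset.single_le_sum (fun _ _ => Nat.zero_le _) (Finset.mem_univ i)
      have hj1 : (j : ℝ) + 1 ≤ c i := by exact_mod_cast hj'
      have hck1 : (c i : ℝ) ≤ k := by exact_mod_cast hck
      have hj0 : (0 : ℝ) ≤ j := by positivity
      have hxi : x i ≤ 1 := hx ▸ Finset.single_le_sum (fun i _ => hx0 i) (Finset.mem_univ i)
      have hxi0 := hx0 i
      rw [abs_mul, abs_inv]
      have e1 : |(c i : ℝ) - j|⁻¹ ≤ 1 := by
        apply inv_le_one_of_one_le₀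
        rw [abs_of_nonneg] <;> linarith
      have e2 : |(k : ℝ) * x i - j| ≤ k := by
        rw [abs_le]
        constructor <;> nlinarith
      calc _ ≤ 1 * (k : ℝ) := mul_le_mul e1 e2 (abs_nonneg _) zero_le_one
        _ = k := one_mul _
    calc _ ≤ ∏ j ∈ Finset.range (c i), (k : ℝ) :=
          Finset.prod_le_prod (fun _ _ => abs_nonneg _) h2
      _ = _ := by simp
  calc _ ≤ ∏ i, (k : ℝ) ^ c i := Finset.prod_le_prod (fun _ _ => abs_nonneg _) h1
    _ = _ := by rw [Finset.prod_pow_eq_pow_sum, hc]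

theorem exists_lagrange [DecidableEq ι] {k : ℕ} (hk : 1 ≤ k) (y : (ι →₀ ℕ) → ℝ) :
    ∃ P : MvPolynomial ι ℝ, P.IsHomogeneous k ∧
      (∀ c : ι →₀ ℕ, ∑ i, c i = k → MvPolynomial.eval (fun i => (c i : ℝ) / k) P = y c) ∧
      ∀ x : ι → ℝ, (∀ i, 0 ≤ x i) → ∑ i, x i = 1 → |MvPolynomial.eval x P| ≤
        (k : ℝ) ^ k * ∑ c ∈ Finset.univ.finsuppAntidiag k, |y c| := by
  refine ⟨∑ c ∈ Finset.univ.finsuppAntidiag k, MvPolynomial.C (y c) * lagrangePoly k c,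
    ?_, ?_, ?_⟩
  · refine MvPolynomial.IsHomogeneous.sum _ _ _ fun c hc => MvPolynomial.IsHomogeneous.C_mul ?_ _
    rw [Finset.mem_finsuppAntidiag] at hc
    have := lagrangePoly_isHomogeneous k c
    rwa [hc.1] at this
  · intro c hc
    rw [map_sum, Finset.sum_eq_single c]
    · rw [map_mul, eval_lagrangePoly_node hk hc hc]; simp
    · intro d hd hne
      rw [Finset.mem_finsuppAntidiag] at hd
      rw [map_mul, eval_lagrangePoly_node hk hd.1 hc, if_neg hne, mul_zero]
    · intro h
      exact absurd (Finset.mem_finsuppAntidiag.2 ⟨hc, Finset.subset_univ _⟩) h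
  · intro x hx0 hx
    rw [map_sum, Finset.mul_sum]
    refine (Finset.abs_sum_le_sum_abs _ _).trans (Finset.sum_le_sum fun c hc => ?_)
    rw [Finset.mem_finsuppAntidiag] at hc
    rw [map_mul, abs_mul, MvPolynomial.eval_C, mul_comm]
    exact mul_le_mul_of_nonneg_right (abs_eval_lagrangePoly_le hc.1 hx0 hx) (abs_nonneg _)

/-- Multi-indices label both the coefficients and the nodes, so passing from coefficients to nodal
values is a linear map between spaces of equal finite dimension. Lagrange interpolation makes it
surjective, hence injective. -/
theorem homogeneous_eq_zero_of_nodes [DecidableEq ι] {k : ℕ} (hk : 1 ≤ k) {P : MvPolynomial ι ℝ}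
    (hP : P.IsHomogeneous k)
    (h : ∀ c : ι →₀ ℕ, ∑ i, c i = k → MvPolynomial.eval (fun i => (c i : ℝ) / k) P = 0) :
    P = 0 := by
  let M : Finset (ι →₀ ℕ) := Finset.univ.finsuppAntidiag k
  let Φ : (M → ℝ) →ₗ[ℝ] (M → ℝ) :=
    { toFun := fun a c => ∑ d : M, a d * ∏ i, ((c.1 i : ℝ) / k) ^ d.1 i
      map_add' := fun a b => by ext c; simp [add_mul, Finset.sum_add_distrib]
      map_smul' := fun r a => by ext c; simp [Finset.mul_sum, mul_assoc] }
  have key : ∀ Q : MvPolynomial ι ℝ, Q.IsHomogeneous k → ∀ c : M,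
      Φ (fun d => Q.coeff d.1) c = MvPolynomial.eval (fun i => (c.1 i : ℝ) / k) Q := by
    intro Q hQ c
    rw [eval_homogeneous hQ]
    exact Finset.sum_coe_sort M (fun d => Q.coeff d * ∏ i, ((c.1 i : ℝ) / k) ^ d i)
  have hsurj : Function.Surjective Φ := by
    intro y
    obtain ⟨Q, hQ, hy, -⟩ := exists_lagrange hk (fun c => if hc : c ∈ M then y ⟨c, hc⟩ else 0)
    refine ⟨fun d => Q.coeff d.1, ?_⟩
    funext c
    rw [key Q hQ, hy c.1 (Finset.mem_finsuppAntidiag.1 c.2).1]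
    simp
  have hinj := LinearMap.injective_iff_surjective.2 hsurj
  have h0 : (fun d : M => P.coeff d.1) = 0 := by
    apply hinj
    rw [map_zero]
    funext c
    rw [key P hP, h c.1 (Finset.mem_finsuppAntidiag.1 c.2).1]
    rfl
  ext d
  rw [MvPolynomial.coeff_zero]
  by_cases hd : d ∈ M
  · exact congrFun h0 ⟨d, hd⟩
  · refine hP.coeff_eq_zero fun hdk => hd ?_
    rw [Finset.mem_finsuppAntidiag]
    refine ⟨?_, Finset.subset_univ _⟩
    rw [← hdk, Finsupp.degree_eq_sum]

end Homogeneous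

/-! ### Equivalence of norms for polynomials in one variable. -/

section OneDim

/-- The integral is a positive definite quadratic form in the coefficients, so it has a positive
minimum on the compact unit sphere. The weight `t ^ d` anticipates the Jacobian of a homothety in
dimension d; the interval stops at 1/2 so that only contracted copies of a set are used later. -/
theorem exists_polynomial_sq_le_integral (d k : ℕ) : ∃ C : ℝ, 0 < C ∧ ∀ P : Polynomial ℝ,
    P.natDegree ≤ k → ∀ s ∈ Set.Icc (0 : ℝ) 1,
      P.eval s ^ 2 ≤ C * ∫ t in (0 : ℝ)..(1 / 2), t ^ d * P.eval t ^ 2 := by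
  let p : (Fin (k + 1) → ℝ) → ℝ → ℝ := fun a t => ∑ i, a i * t ^ (i : ℕ)
  let Q : (Fin (k + 1) → ℝ) → ℝ := fun a => ∫ t in (0 : ℝ)..(1 / 2), t ^ d * p a t ^ 2
  have hpc : Continuous (fun z : (Fin (k + 1) → ℝ) × ℝ => p z.1 z.2) := by
    refine continuous_finsetSum _ fun i _ => ?_
    fun_prop
  have hQ : Continuous Q := by
    refine intervalIntegral.continuous_parametric_intervalIntegral_of_continuous' ?_ _ _
    exact (continuous_snd.pow d).mul (hpc.pow 2)
  have hhom : ∀ (r : ℝ) a, Q (r • a) = r ^ 2 * Q a := by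
    intro r a
    simp only [Q]
    rw [← intervalIntegral.integral_const_mul]
    refine intervalIntegral.integral_congr fun t _ => ?_
    have : p (r • a) t = r * p a t := by
      simp [p, Finset.mul_sum, mul_assoc]
    simp only [this]
    ring
  have hcoef : ∀ P : Polynomial ℝ, P.natDegree ≤ k →
      ∀ t, P.eval t = p (fun i => P.coeff i) t := by
    intro P hP t
    rw [Polynomial.eval_eq_sum_range' (Nat.lt_succ_of_le hP), Finset.sum_range]
  -- A nonzero polynomial has finitely many roots, hence is nonzero at some point of (0, 1/2), where
  -- the weight is positive too.
  have hpos : ∀ a, a ≠ 0 → 0 < Q a := by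
    intro a ha
    let P : Polynomial ℝ := ∑ i : Fin (k + 1), Polynomial.monomial (i : ℕ) (a i)
    have hPe : ∀ t, P.eval t = p a t := by
      intro t
      simp [P, p, Polynomial.eval_finsetSum]
    have hP0 : P ≠ 0 := by
      intro h0
      apply ha
      funext i
      have : P.coeff i = a i := by
        simp only [P, Polynomial.finsetSum_coeff, Polynomial.coeff_monomial]
        rw [Finset.sum_eq_single i]
        · simp
        · intro j _ hj
          rw [if_neg]
          exact fun h => hj (Fin.ext h)
        · simp
      rw [h0] at this
      simpa using this.symm
    have hinf : (Set.Ioo (0 : ℝ) (1 / 2)).Infinite := Set.Ioo_infinite (by norm_num)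
    obtain ⟨c, hc, hcr⟩ := hinf.exists_notMem_finset P.roots.toFinset
    have hc0 : P.eval c ≠ 0 := by
      intro h
      exact hcr (by simp [hP0, h])
    refine intervalIntegral.integral_pos (by norm_num) ?_ ?_ ⟨c, ⟨hc.1.le, hc.2.le⟩, ?_⟩
    · exact ((continuous_id.pow d).mul
        ((hpc.comp (Continuous.prodMk_right a)).pow 2)).continuousOn
    · intro x hx
      have := hx.1
      positivity
    · rw [hPe] at hc0
      have := hc.1
      positivity
  have hcomp : IsCompact (Metric.sphere (0 : Fin (k + 1) → ℝ) 1) := isCompact_sphere _ _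
  have hne : (Metric.sphere (0 : Fin (k + 1) → ℝ) 1).Nonempty :=
    ⟨fun _ => 1, by simp [pi_norm_const]⟩
  obtain ⟨a₀, ha₀, hmin⟩ := hcomp.exists_isMinOn hne hQ.continuousOn
  have ha₀' : a₀ ≠ 0 := by
    intro h
    simp [h] at ha₀
  have hm := hpos a₀ ha₀'
  have hlow : ∀ a, Q a₀ * ‖a‖ ^ 2 ≤ Q a := by
    intro a
    by_cases ha : a = 0
    · subst ha
      have := hhom 0 0
      simp at this
      simp [this]
    · have hna : ‖a‖ ≠ 0 := by simpa using ha
      have h1 : Q a₀ ≤ Q (‖a‖⁻¹ • a) := hmin (by simp [norm_smul, hna])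
      rw [hhom] at h1
      have h2 : 0 < ‖a‖ ^ 2 := by positivity
      calc Q a₀ * ‖a‖ ^ 2 ≤ (‖a‖⁻¹ ^ 2 * Q a) * ‖a‖ ^ 2 := by gcongr
        _ = Q a := by field_simp
  -- On [0, 1] the polynomial is at most k+1 times its largest coefficient, whose square is at most
  -- the integral divided by the minimum `Q a₀`.
  refine ⟨((k : ℝ) + 1) ^ 2 / Q a₀, by positivity, fun P hP s hs => ?_⟩
  have h1 : |p (fun i => P.coeff i) s| ≤ (k + 1) * ‖fun i : Fin (k + 1) => P.coeff i‖ := by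
    refine (Finset.abs_sum_le_sum_abs _ _).trans ?_
    have : ∀ i ∈ (Finset.univ : Finset (Fin (k + 1))), |P.coeff i * s ^ (i : ℕ)| ≤
        ‖fun i : Fin (k + 1) => P.coeff i‖ := by
      intro i _
      rw [abs_mul, abs_pow, abs_of_nonneg hs.1]
      have h2 : |P.coeff i| ≤ ‖fun i : Fin (k + 1) => P.coeff i‖ :=
        norm_le_pi_norm (fun i : Fin (k + 1) => P.coeff i) i
      have h3 : s ^ (i : ℕ) ≤ 1 := pow_le_one₀ hs.1 hs.2
      calc _ ≤ ‖fun i : Fin (k + 1) => P.coeff i‖ * 1 :=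
            mul_le_mul h2 h3 (pow_nonneg hs.1 _) (norm_nonneg _)
        _ = _ := mul_one _
    refine (Finset.sum_le_sum this).trans ?_
    simp
  have h2 := hlow (fun i => P.coeff i)
  have h3 : Q (fun i => P.coeff i) = ∫ t in (0 : ℝ)..(1 / 2), t ^ d * P.eval t ^ 2 := by
    simp only [Q, hcoef P hP]
  rw [← h3, hcoef P hP s]
  calc p (fun i => P.coeff i) s ^ 2 ≤ ((k + 1) * ‖fun i : Fin (k + 1) => P.coeff i‖) ^ 2 := by
        rw [← sq_abs]
        gcongr
    _ = (k + 1) ^ 2 / Q a₀ * (Q a₀ * ‖fun i : Fin (k + 1) => P.coeff i‖ ^ 2) := by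
        field_simp
    _ ≤ _ := by gcongr

end OneDim

/-! ### Inverse inequalities on sets in the Hausdorff measure of any dimension. -/

section Scaling

variable {n : ℕ}

theorem lintegral_homothety_le (d : ℕ) (c : Pt n) {t : ℝ} (ht : 0 < t) {S T : Set (Pt n)}
    (hT : MeasurableSet T) (hST : ∀ y ∈ S, c + t • (y - c) ∈ T) {f : Pt n → ENNReal}
    (hf : Measurable f) :
    ∫⁻ y in S, f (c + t • (y - c)) ∂(μHE[d] : Measure (Pt n)) ≤
      ENNReal.ofReal (t⁻¹ ^ d) * ∫⁻ y in T, f y ∂(μHE[d] : Measure (Pt n)) := by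
  have hh : ∀ y, AffineMap.homothety c t y = c + t • (y - c) := by
    intro y
    simp [AffineMap.homothety_apply, add_comm]
  have hm : Measurable (AffineMap.homothety c t : Pt n → Pt n) := by
    have : (AffineMap.homothety c t : Pt n → Pt n) = fun y => c + t • (y - c) := funext hh
    rw [this]
    fun_prop
  have hmap : (μHE[d] : Measure (Pt n)).map (AffineMap.homothety c t) =
      ENNReal.ofReal (t⁻¹ ^ d) • (μHE[d] : Measure (Pt n)) := by
    ext s hs
    rw [Measure.map_apply hm hs, euclideanHausdorffMeasure_homothety_preimage d c ht.ne' s,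
      Measure.smul_apply, smul_eq_mul, ENNReal.smul_def, smul_eq_mul]
    congr 1
    rw [ENNReal.ofReal, ENNReal.coe_inj]
    ext
    rw [Real.coe_toNNReal _ (by positivity)]
    simp [abs_of_pos ht]
  calc ∫⁻ y in S, f (c + t • (y - c)) ∂(μHE[d] : Measure (Pt n))
      ≤ ∫⁻ y in AffineMap.homothety c t ⁻¹' T, f (AffineMap.homothety c t y)
          ∂(μHE[d] : Measure (Pt n)) := by
        simp only [hh]
        exact lintegral_mono_set fun y hy => by
          rw [Set.mem_preimage, hh]; exact hST y hy
    _ = ∫⁻ y in T, f y ∂((μHE[d] : Measure (Pt n)).map (AffineMap.homothety c t)) := by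
        rw [setLIntegral_map hT hf hm]
    _ = _ := by rw [hmap, Measure.restrict_smul, lintegral_smul_measure, smul_eq_mul]

/-- The one-variable inequality is applied on every ray from `c` and integrated over `S`. After
exchanging the integrals, the homothety of ratio t contributes t^(−d), which cancels the weight t^d.
The constant does not see the shape of the sets, and this replaces scaling to a reference element.
-/
theorem exists_lintegral_poly_le (d k : ℕ) : ∃ C : ℝ, 0 < C ∧ ∀ (n : ℕ) (S T : Set (Pt n))
    (c : Pt n), (μHE[d] : Measure (Pt n)) S ≠ ⊤ → MeasurableSet T →
      (∀ t : ℝ, 0 < t → t ≤ 1 / 2 → ∀ y ∈ S, c + t • (y - c) ∈ T) →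
      ∀ f : Pt n → ℝ, IsPoly k f → ∀ s ∈ Set.Icc (0 : ℝ) 1,
        ∫⁻ y in S, ENNReal.ofReal (f (c + s • (y - c)) ^ 2) ∂(μHE[d] : Measure (Pt n)) ≤
          ENNReal.ofReal C * ∫⁻ y in T, ENNReal.ofReal (f y ^ 2) ∂(μHE[d] : Measure (Pt n)) := by
  obtain ⟨C, hC, h⟩ := exists_polynomial_sq_le_integral d k
  refine ⟨C, hC, fun n S T c hS hT hST f hf s hs => ?_⟩
  have : IsFiniteMeasure ((μHE[d] : Measure (Pt n)).restrict S) :=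
    ⟨by rw [Measure.restrict_apply_univ]; exact hS.lt_top⟩
  have hfc := hf.continuous
  have hfm : Measurable fun y => ENNReal.ofReal (f y ^ 2) := by fun_prop
  have h1 : ∀ y, ENNReal.ofReal (f (c + s • (y - c)) ^ 2) ≤ ENNReal.ofReal C *
      ∫⁻ t in Set.Ioc (0 : ℝ) (1 / 2),
        ENNReal.ofReal (t ^ d) * ENNReal.ofReal (f (c + t • (y - c)) ^ 2) := by
    intro y
    obtain ⟨P, hP, hPe⟩ := hf.exists_polynomial_line c y
    have h2 := h P hP s hs
    rw [hPe s]
    refine (ENNReal.ofReal_le_ofReal h2).trans ?_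
    rw [ENNReal.ofReal_mul hC.le]
    gcongr
    rw [intervalIntegral.integral_of_le (by norm_num), ofReal_integral_eq_lintegral_ofReal]
    · refine le_of_eq (setLIntegral_congr_fun measurableSet_Ioc fun t ht => ?_)
      have := ht.1
      rw [hPe t, ENNReal.ofReal_mul (by positivity)]
    · exact (Continuous.integrableOn_Icc (by fun_prop)).mono_set Set.Ioc_subset_Icc_self
    · refine (ae_restrict_mem measurableSet_Ioc).mono fun t ht => ?_
      have := ht.1
      simp only [Pi.zero_apply]
      positivity
  calc ∫⁻ y in S, ENNReal.ofReal (f (c + s • (y - c)) ^ 2) ∂(μHE[d] : Measure (Pt n))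
      ≤ ∫⁻ y in S, (ENNReal.ofReal C * ∫⁻ t in Set.Ioc (0 : ℝ) (1 / 2),
        ENNReal.ofReal (t ^ d) * ENNReal.ofReal (f (c + t • (y - c)) ^ 2))
          ∂(μHE[d] : Measure (Pt n)) := lintegral_mono h1
    _ = ENNReal.ofReal C * ∫⁻ t in Set.Ioc (0 : ℝ) (1 / 2), (∫⁻ y in S,
        ENNReal.ofReal (t ^ d) * ENNReal.ofReal (f (c + t • (y - c)) ^ 2)
          ∂(μHE[d] : Measure (Pt n))) := by
        rw [lintegral_const_mul' _ _ ENNReal.ofReal_ne_top, lintegral_lintegral_swap]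
        refine Measurable.aemeasurable ?_
        simp only [Function.uncurry_def]
        fun_prop
    _ ≤ ENNReal.ofReal C * ∫⁻ t in Set.Ioc (0 : ℝ) (1 / 2),
        (∫⁻ y in T, ENNReal.ofReal (f y ^ 2) ∂(μHE[d] : Measure (Pt n))) := by
        gcongr ENNReal.ofReal C * ?_
        refine setLIntegral_mono' measurableSet_Ioc fun t ht => ?_
        rw [lintegral_const_mul' _ _ ENNReal.ofReal_ne_top]
        calc _ ≤ ENNReal.ofReal (t ^ d) * (ENNReal.ofReal (t⁻¹ ^ d) *
              ∫⁻ y in T, ENNReal.ofReal (f y ^ 2) ∂(μHE[d] : Measure (Pt n))) := by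
              gcongr
              exact lintegral_homothety_le d c ht.1 hT (hST t ht.1 ht.2) hfm
          _ = _ := by
              have := ht.1
              rw [← mul_assoc, ← ENNReal.ofReal_mul (by positivity), ← mul_pow,
                mul_inv_cancel₀ this.ne', one_pow, ENNReal.ofReal_one, one_mul]
    _ ≤ _ := by
        gcongr
        rw [lintegral_const, Measure.restrict_apply_univ, Real.volume_Ioc]
        calc _ ≤ (∫⁻ y in T, ENNReal.ofReal (f y ^ 2) ∂(μHE[d] : Measure (Pt n))) * 1 := by
              gcongr
              rw [← ENNReal.ofReal_one]
              exact ENNReal.ofReal_le_ofReal (by norm_num)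
          _ = _ := mul_one _

/-- A polynomial at a point of a convex body is controlled by its mean square. -/
theorem exists_sq_le_integral_poly (d k : ℕ) : ∃ C : ℝ, 0 < C ∧ ∀ (n : ℕ) (S : Set (Pt n)),
    Convex ℝ S → IsCompact S → (μHE[d] : Measure (Pt n)) S ≠ ⊤ → ∀ f : Pt n → ℝ, IsPoly k f →
      ∀ c ∈ S, f c ^ 2 * (μHE[d] : Measure (Pt n)).real S ≤
        C * ∫ y in S, f y ^ 2 ∂(μHE[d] : Measure (Pt n)) := by
  obtain ⟨C, hC, h⟩ := exists_lintegral_poly_le d k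
  refine ⟨C, hC, fun n S hS hSc hfin f hf c hc => ?_⟩
  -- With s = 0 the left integrand is the constant `f c ^ 2`; by convexity the contracted copies of
  -- `S` stay inside `S`.
  have h1 := h n S S c hfin hSc.measurableSet (fun t ht ht1 y hy => by
    have := hS.add_smul_sub_mem hc hy (t := t) ⟨ht.le, by linarith⟩
    exact this) f hf 0 ⟨le_rfl, zero_le_one⟩
  have hint : IntegrableOn (fun y => f y ^ 2) S (μHE[d] : Measure (Pt n)) := by
    have : IsFiniteMeasure ((μHE[d] : Measure (Pt n)).restrict S) :=
      ⟨by rw [Measure.restrict_apply_univ]; exact hfin.lt_top⟩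
    obtain ⟨M, hM⟩ := hSc.exists_bound_of_continuousOn (hf.continuous.pow 2).continuousOn
    exact Integrable.of_bound (hf.continuous.pow 2).aestronglyMeasurable M
      ((ae_restrict_mem hSc.measurableSet).mono fun y hy => hM y hy)
  rw [← ofReal_integral_eq_lintegral_ofReal hint (ae_of_all _ fun y => sq_nonneg _)] at h1
  simp only [zero_smul, add_zero, lintegral_const, Measure.restrict_apply_univ] at h1
  have h2 := ENNReal.toReal_mono (ENNReal.mul_ne_top ENNReal.ofReal_ne_top ENNReal.ofReal_ne_top) h1
  rw [ENNReal.toReal_mul, ENNReal.toReal_mul, ENNReal.toReal_ofReal (sq_nonneg _),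
    ENNReal.toReal_ofReal hC.le, ENNReal.toReal_ofReal (integral_nonneg fun y => sq_nonneg _)] at h2
  exact h2

/-- The mean square of a polynomial over a convex body is controlled by that over the copy of half
the size. -/
theorem exists_integral_poly_le_half (d k : ℕ) : ∃ C : ℝ, 0 < C ∧ ∀ (n : ℕ) (S T : Set (Pt n))
    (c : Pt n), T ⊆ S → IsCompact S → IsCompact T → (μHE[d] : Measure (Pt n)) S ≠ ⊤ →
      (∀ t : ℝ, 0 < t → t ≤ 1 / 2 → ∀ y ∈ S, c + t • (y - c) ∈ T) →
      ∀ f : Pt n → ℝ, IsPoly k f →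
      ∫ y in S, f y ^ 2 ∂(μHE[d] : Measure (Pt n)) ≤
        C * ∫ y in T, f y ^ 2 ∂(μHE[d] : Measure (Pt n)) := by
  obtain ⟨C, hC, h⟩ := exists_lintegral_poly_le d k
  refine ⟨C, hC, fun n S T c hTS hSc hTc hfin hST f hf => ?_⟩
  -- With s = 1 the left side is the full integral over `S`.
  have h1 := h n S T c hfin hTc.measurableSet hST f hf 1 ⟨zero_le_one, le_rfl⟩
  have hint : IntegrableOn (fun y => f y ^ 2) S (μHE[d] : Measure (Pt n)) := by
    have : IsFiniteMeasure ((μHE[d] : Measure (Pt n)).restrict S) :=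
      ⟨by rw [Measure.restrict_apply_univ]; exact hfin.lt_top⟩
    obtain ⟨M, hM⟩ := hSc.exists_bound_of_continuousOn (hf.continuous.pow 2).continuousOn
    exact Integrable.of_bound (hf.continuous.pow 2).aestronglyMeasurable M
      ((ae_restrict_mem hSc.measurableSet).mono fun y hy => hM y hy)
  simp only [one_smul, add_sub_cancel] at h1
  rw [← ofReal_integral_eq_lintegral_ofReal hint (ae_of_all _ fun y => sq_nonneg _),
    ← ofReal_integral_eq_lintegral_ofReal (hint.mono_set hTS) (ae_of_all _ fun y => sq_nonneg _),
    ← ENNReal.ofReal_mul hC.le] at h1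
  exact (ENNReal.ofReal_le_ofReal_iff
    (mul_nonneg hC.le (integral_nonneg fun y => sq_nonneg _))).1 h1

end Scaling

/-! ### Simplices, barycentric coordinates and their gradients. -/

section Simplices

variable {n : ℕ}

theorem isCompact_hull (s : Finset (Pt n)) : IsCompact (hull s) :=
  s.finite_toSet.isCompact_convexHull (𝕜 := ℝ)

theorem convex_hull (s : Finset (Pt n)) : Convex ℝ (hull s) := convex_convexHull ℝ _

theorem hull_mono {s t : Finset (Pt n)} (h : s ⊆ t) : hull s ⊆ hull t :=
  convexHull_mono (by exact_mod_cast h)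

theorem subset_hull {s : Finset (Pt n)} {v : Pt n} (h : v ∈ s) : v ∈ hull s :=
  subset_convexHull ℝ _ (by exact_mod_cast h)

theorem mem_hull_iff {s : Finset (Pt n)} {x : Pt n} : x ∈ hull s ↔
    ∃ w : Pt n → ℝ, (∀ y ∈ s, 0 ≤ w y) ∧ ∑ y ∈ s, w y = 1 ∧ ∑ y ∈ s, w y • y = x :=
  Finset.mem_convexHull'

theorem hull_eq_empty_iff {s : Finset (Pt n)} : hull s = ∅ ↔ s = ∅ := by
  simp [hull]

theorem affine_map_sum (f : Pt n →ᵃ[ℝ] ℝ) (s : Finset (Pt n)) (w : Pt n → ℝ)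
    (hw : ∑ y ∈ s, w y = 1) : f (∑ y ∈ s, w y • y) = ∑ y ∈ s, w y * f y := by
  have h : ∀ x : Pt n, f x = f.linear x + f 0 := fun x => by simpa using f.map_vadd 0 x
  have h2 : ∑ y ∈ s, w y * f y = ∑ y ∈ s, w y * f.linear y + f 0 := by
    rw [Finset.sum_congr rfl fun y _ => by rw [h y, mul_add], Finset.sum_add_distrib,
      ← Finset.sum_mul, hw, one_mul]
  rw [h2, h, map_sum]
  simp only [map_smul, smul_eq_mul]

/-- On the affine span the Hausdorff measure is the Lebesgue measure of a Euclidean space of the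
right dimension. There the simplex is compact, hence of finite measure, and has nonempty interior,
hence of positive measure. -/
theorem simplexMeasure_hull_ne_top {s : Finset (Pt n)}
    (hs : AffineIndependent ℝ ((↑) : s → Pt n)) (hne : s.Nonempty) :
    (μHE[s.card - 1] : Measure (Pt n)) (hull s) ≠ ⊤ ∧
      (μHE[s.card - 1] : Measure (Pt n)) (hull s) ≠ 0 := by
  set A := affineSpan ℝ (hull s) with hA
  have hAs : A = affineSpan ℝ (s : Set (Pt n)) := affineSpan_convexHull _
  obtain ⟨v, hv⟩ := hne
  let p : A := ⟨v, subset_affineSpan ℝ _ (subset_hull hv)⟩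
  have hdim : Module.finrank ℝ A.direction = s.card - 1 := by
    rw [hAs, direction_affineSpan]
    have := hs.finrank_vectorSpan (n := s.card - 1) (by
      have : 0 < s.card := Finset.card_pos.2 ⟨v, hv⟩
      rw [Fintype.card_coe]; omega)
    have hr : Set.range (Subtype.val : s → Pt n) = (s : Set (Pt n)) := by ext; simp
    rwa [hr] at this
  have hne' : Nonempty A := ⟨p⟩
  have hmeas := EuclideanGeometry.euclideanHausdorffMeasure_eq p
  rw [hdim] at hmeas
  let X : Set A := Subtype.val ⁻¹' hull s
  have hX : Subtype.val '' X = hull s := by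
    ext x
    constructor
    · rintro ⟨y, hy, rfl⟩
      exact hy
    · exact fun hx => ⟨⟨x, subset_affineSpan ℝ _ hx⟩, hx, rfl⟩
  have hXc : IsClosed X := (isCompact_hull s).isClosed.preimage continuous_subtype_val
  have hval : (μHE[s.card - 1] : Measure (Pt n)) (hull s) =
      volume ((IsometryEquiv.vaddConst p) ⁻¹' X) := by
    rw [← hX, AffineSubspace.euclideanHausdorffMeasure_coe_image, hmeas,
      Measure.map_apply (IsometryEquiv.vaddConst p).continuous.measurable hXc.measurableSet]
  rw [hval]
  constructor
  · have hcomp : IsCompact X := by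
      rw [Topology.IsEmbedding.subtypeVal.isCompact_iff, hX]
      exact isCompact_hull s
    have := ((IsometryEquiv.vaddConst p).toHomeomorph.isCompact_preimage (s := X)).2 hcomp
    exact this.measure_lt_top.ne
  · have hint : (intrinsicInterior ℝ (hull s)).Nonempty :=
      Set.Nonempty.intrinsicInterior (convex_hull s) ⟨v, subset_hull hv⟩
    have hint2 : (interior X).Nonempty := by
      obtain ⟨x, y, hy, -⟩ := hint
      exact ⟨y, hy⟩
    have hopen : IsOpen ((IsometryEquiv.vaddConst p) ⁻¹' interior X) :=
      isOpen_interior.preimage (IsometryEquiv.vaddConst p).continuous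
    have hne2 : ((IsometryEquiv.vaddConst p) ⁻¹' interior X).Nonempty :=
      hint2.preimage (IsometryEquiv.vaddConst p).surjective
    intro h0
    exact (hopen.measure_pos volume hne2).ne'
      (measure_mono_null (Set.preimage_mono interior_subset) h0)

/-- The vertex set of an `n`-simplex in `ℝⁿ`. -/
def IsCell (K : Finset (Pt n)) : Prop :=
  AffineIndependent ℝ ((↑) : K → Pt n) ∧ K.card = n + 1

theorem IsCell.nonempty {K : Finset (Pt n)} (hK : IsCell K) : K.Nonempty :=
  Finset.card_pos.1 (by rw [hK.2]; omega)

/-- The vertices of an `n`-simplex as an affine basis. -/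
def IsCell.basis {K : Finset (Pt n)} (hK : IsCell K) : AffineBasis K ℝ (Pt n) :=
  ⟨(↑), hK.1, by
    rw [hK.1.affineSpan_eq_top_iff_card_eq_finrank_add_one]
    simp [hK.2]⟩

open Classical in
/-- The barycentric coordinate of the vertex `v` of the `n`-simplex `K`. -/
def bary (K : Finset (Pt n)) (v : Pt n) : Pt n →ᵃ[ℝ] ℝ :=
  if h : IsCell K ∧ v ∈ K then h.1.basis.coord ⟨v, h.2⟩ else 0

theorem bary_eq {K : Finset (Pt n)} (hK : IsCell K) (v : K) : bary K v = hK.basis.coord v := by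
  rw [bary, dif_pos ⟨hK, v.2⟩]

theorem IsCell.range_basis {K : Finset (Pt n)} (hK : IsCell K) :
    Set.range hK.basis = (K : Set (Pt n)) := by
  ext x
  constructor
  · rintro ⟨v, rfl⟩
    exact v.2
  · intro hx
    exact ⟨⟨x, hx⟩, rfl⟩

variable {K : Finset (Pt n)}

theorem bary_self (hK : IsCell K) {v : Pt n} (hv : v ∈ K) : bary K v v = 1 := by
  rw [bary_eq hK ⟨v, hv⟩]
  exact hK.basis.coord_apply_eq ⟨v, hv⟩

theorem bary_of_ne (hK : IsCell K) {v w : Pt n} (hv : v ∈ K) (hw : w ∈ K) (h : v ≠ w) :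
    bary K v w = 0 := by
  rw [bary_eq hK ⟨v, hv⟩]
  exact hK.basis.coord_apply_ne (i := ⟨v, hv⟩) (j := ⟨w, hw⟩) (fun h' => h (congrArg Subtype.val h'))

theorem sum_bary (hK : IsCell K) (x : Pt n) : ∑ v ∈ K, bary K v x = 1 := by
  rw [← Finset.sum_coe_sort]
  simp only [bary_eq hK]
  exact hK.basis.sum_coord_apply_eq_one x

theorem sum_bary_smul (hK : IsCell K) (x : Pt n) : ∑ v ∈ K, bary K v x • v = x := by
  rw [← Finset.sum_coe_sort K (fun v => bary K v x • v)]
  simp only [bary_eq hK]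
  exact hK.basis.linear_combination_coord_eq_self x

theorem mem_hull_cell (hK : IsCell K) {x : Pt n} : x ∈ hull K ↔ ∀ v ∈ K, 0 ≤ bary K v x := by
  have := hK.basis.convexHull_eq_nonneg_coord
  rw [hK.range_basis] at this
  rw [hull, this]
  simp only [Set.mem_ofPred_eq, ← bary_eq hK]
  exact ⟨fun h v hv => h ⟨v, hv⟩, fun h v => h v v.2⟩

theorem mem_interior_cell (hK : IsCell K) {x : Pt n} :
    x ∈ interior (hull K) ↔ ∀ v ∈ K, 0 < bary K v x := by
  have := hK.basis.interior_convexHull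
  rw [hK.range_basis] at this
  rw [hull, this]
  simp only [Set.mem_ofPred_eq, ← bary_eq hK]
  exact ⟨fun h v hv => h ⟨v, hv⟩, fun h v => h v v.2⟩

theorem bary_sum (hK : IsCell K) {D : Finset (Pt n)} (hD : D ⊆ K) {w : Pt n → ℝ}
    (hw : ∑ y ∈ D, w y = 1) {v : Pt n} (hv : v ∈ K) :
    bary K v (∑ y ∈ D, w y • y) = if v ∈ D then w v else 0 := by
  rw [affine_map_sum _ _ _ hw]
  split_ifs with h
  · rw [Finset.sum_eq_single v]
    · rw [bary_self hK hv, mul_one]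
    · intro y hy hne
      rw [bary_of_ne hK hv (hD hy) hne.symm, mul_zero]
    · exact fun h' => absurd h h'
  · refine Finset.sum_eq_zero fun y hy => ?_
    rw [bary_of_ne hK hv (hD hy) (fun h' => h (h' ▸ hy)), mul_zero]

theorem mem_hull_face (hK : IsCell K) {D : Finset (Pt n)} (hD : D ⊆ K) {x : Pt n} :
    x ∈ hull D ↔ x ∈ hull K ∧ ∀ v ∈ K, v ∉ D → bary K v x = 0 := by
  constructor
  · intro hx
    refine ⟨hull_mono hD hx, fun v hv hvD => ?_⟩
    obtain ⟨w, -, hw1, rfl⟩ := mem_hull_iff.1 hx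
    rw [bary_sum hK hD hw1 hv, if_neg hvD]
  · rintro ⟨hx, h0⟩
    rw [mem_hull_iff]
    refine ⟨fun v => bary K v x, fun v hv => (mem_hull_cell hK).1 hx v (hD hv), ?_, ?_⟩
    · rw [Finset.sum_subset hD fun v hv hvD => h0 v hv hvD, sum_bary hK]
    · rw [Finset.sum_subset hD fun v hv hvD => by simp [h0 v hv hvD], sum_bary_smul hK]

theorem bary_le_one (hK : IsCell K) {x : Pt n} (hx : x ∈ hull K) {v : Pt n} (hv : v ∈ K) :
    bary K v x ≤ 1 := by
  rw [← sum_bary hK x]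
  exact Finset.single_le_sum (fun w hw => (mem_hull_cell hK).1 hx w hw) hv

theorem frontier_cell (hK : IsCell K) :
    frontier (hull K) = ⋃ v ∈ K, hull (K.erase v) := by
  ext x
  rw [(isCompact_hull K).isClosed.frontier_eq, Set.mem_sdiff, Set.mem_iUnion₂]
  constructor
  · rintro ⟨hx, hxi⟩
    rw [mem_interior_cell hK] at hxi
    push Not at hxi
    obtain ⟨v, hv, hvx⟩ := hxi
    refine ⟨v, hv, (mem_hull_face hK (Finset.erase_subset _ _)).2 ⟨hx, fun w hw hwe => ?_⟩⟩
    have : w = v := by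
      by_contra hne
      exact hwe (Finset.mem_erase.2 ⟨hne, hw⟩)
    subst this
    exact le_antisymm hvx ((mem_hull_cell hK).1 hx w hw)
  · rintro ⟨v, hv, hx⟩
    refine ⟨hull_mono (Finset.erase_subset _ _) hx, fun hxi => ?_⟩
    have h1 := (mem_hull_face hK (Finset.erase_subset _ _)).1 hx
    have h2 := h1.2 v hv (Finset.notMem_erase _ _)
    exact ((mem_interior_cell hK).1 hxi v hv).ne' h2

theorem bary_continuous (K : Finset (Pt n)) (v : Pt n) : Continuous (bary K v) :=
  (bary K v).continuous_of_finiteDimensional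

theorem bary_isPoly (K : Finset (Pt n)) (v : Pt n) : IsPoly 1 (fun x => bary K v x) :=
  isPoly_affine _

theorem interior_cell_nonempty (hK : IsCell K) : (interior (hull K)).Nonempty := by
  have := hK.basis.centroid_mem_interior_convexHull
  rw [hK.range_basis] at this
  exact ⟨_, this⟩

/-- The gradient of the barycentric coordinate of `v`. -/
def baryGrad (K : Finset (Pt n)) (v : Pt n) : Pt n :=
  (InnerProductSpace.toDual ℝ (Pt n)).symm (LinearMap.toContinuousLinearMap (bary K v).linear)

theorem inner_baryGrad (K : Finset (Pt n)) (v w : Pt n) :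
    inner ℝ (baryGrad K v) w = (bary K v).linear w := by
  rw [baryGrad, InnerProductSpace.toDual_symm_apply]
  rfl

theorem bary_sub (K : Finset (Pt n)) (v x y : Pt n) :
    bary K v x - bary K v y = inner ℝ (baryGrad K v) (x - y) := by
  rw [inner_baryGrad]
  exact ((bary K v).linearMap_vsub x y).symm

theorem bary_add (K : Finset (Pt n)) (v x w : Pt n) :
    bary K v (x + w) = bary K v x + inner ℝ (baryGrad K v) w := by
  have := bary_sub K v (x + w) x
  rw [add_sub_cancel_left] at this
  linarith

theorem inner_baryGrad_sub (hK : IsCell K) {i j l : Pt n} (hi : i ∈ K) (hj : j ∈ K) (hl : l ∈ K)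
    [DecidableEq (Pt n)] :
    inner ℝ (baryGrad K i) (j - l) = (if i = j then 1 else 0) - (if i = l then 1 else 0 : ℝ) := by
  rw [← bary_sub]
  congr 1
  · split_ifs with h
    · subst h; exact bary_self hK hi
    · exact bary_of_ne hK hi hj h
  · split_ifs with h
    · subst h; exact bary_self hK hi
    · exact bary_of_ne hK hi hl h

theorem sum_inner_baryGrad (hK : IsCell K) (w : Pt n) :
    ∑ v ∈ K, inner ℝ (baryGrad K v) w = 0 := by
  have h1 := sum_bary hK w
  have h2 := sum_bary hK 0
  have : ∀ v ∈ K, inner ℝ (baryGrad K v) w = bary K v w - bary K v 0 := by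
    intro v _
    rw [bary_sub, sub_zero]
  rw [Finset.sum_congr rfl this, Finset.sum_sub_distrib, h1, h2, sub_self]

theorem sum_baryGrad (hK : IsCell K) : ∑ v ∈ K, baryGrad K v = 0 := by
  apply ext_inner_right ℝ
  intro w
  rw [sum_inner, inner_zero_left, sum_inner_baryGrad hK]

theorem sum_inner_baryGrad_smul (hK : IsCell K) (w : Pt n) :
    ∑ v ∈ K, (inner ℝ (baryGrad K v) w : ℝ) • v = w := by
  have h1 := sum_bary_smul hK w
  have h2 := sum_bary_smul hK 0
  have : ∀ v ∈ K, (inner ℝ (baryGrad K v) w : ℝ) • v = bary K v w • v - bary K v 0 • v := by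
    intro v _
    rw [← sub_smul, bary_sub, sub_zero]
  rw [Finset.sum_congr rfl this, Finset.sum_sub_distrib, h1, h2, sub_zero]

/-- Along the diameter of the ball in the direction of the gradient, the coordinate increases by the
norm of the gradient times 2r while staying in [0, 1]. -/
theorem norm_baryGrad_mul_le (hK : IsCell K) {c : Pt n} {r : ℝ} (hr : 0 ≤ r)
    (hb : Metric.closedBall c r ⊆ hull K) {v : Pt n} (hv : v ∈ K) :
    ‖baryGrad K v‖ * (2 * r) ≤ 1 := by
  set g := baryGrad K v with hg
  by_cases h0 : g = 0
  · rw [h0]; simp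
  have hg0 : ‖g‖ ≠ 0 := norm_ne_zero_iff.2 h0
  have hmem : ∀ s : ℝ, |s| = r → c + (s * ‖g‖⁻¹) • g ∈ hull K := by
    intro s hs
    apply hb
    rw [Metric.mem_closedBall, dist_eq_norm, add_sub_cancel_left, norm_smul, norm_mul, norm_inv,
      norm_norm, mul_assoc, inv_mul_cancel₀ hg0, mul_one, Real.norm_eq_abs, hs]
  have h1 := bary_le_one hK (hmem r (abs_of_nonneg hr)) hv
  have h2 := (mem_hull_cell hK).1 (hmem (-r) (by rw [abs_neg, abs_of_nonneg hr])) v hv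
  rw [bary_add, ← hg, inner_smul_right, real_inner_self_eq_norm_sq] at h1 h2
  have e : ∀ s : ℝ, s * ‖g‖⁻¹ * ‖g‖ ^ 2 = s * ‖g‖ := by
    intro s; field_simp
  rw [e] at h1 h2
  nlinarith

theorem dist_le_cellDiam {x y : Pt n} (hx : x ∈ hull K) (hy : y ∈ hull K) :
    ‖x - y‖ ≤ cellDiam K := by
  rw [← dist_eq_norm]
  exact Metric.dist_le_diam_of_mem (isCompact_hull K).isBounded hx hy

/-- The coordinate of `v` vanishes at all vertices of `D`, so its derivative vanishes along `D`.
Gradients thereby provide the normals used to read off the components of a bubble. -/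
theorem baryGrad_mem_normals (hK : IsCell K) {D : Finset (Pt n)} (hD : D ⊆ K) {v : Pt n}
    (hv : v ∈ K) (hvD : v ∉ D) : baryGrad K v ∈ normals D := by
  rw [normals, Submodule.mem_orthogonal']
  intro w hw
  rw [tangents, direction_affineSpan, vectorSpan_def] at hw
  induction hw using Submodule.span_induction with
  | mem w hw =>
    classical
    obtain ⟨a, ha, b, hb, rfl⟩ := hw
    change inner ℝ (baryGrad K v) (a - b) = 0
    rw [inner_baryGrad_sub hK hv (hD ha) (hD hb), if_neg, if_neg, sub_self]
    · rintro rfl; exact hvD hb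
    · rintro rfl; exact hvD ha
  | zero => simp
  | add x y _ _ hx hy => rw [inner_add_right, hx, hy, add_zero]
  | smul a x _ hx => rw [inner_smul_right, hx, mul_zero]

theorem sub_mem_tangents {D : Finset (Pt n)} {v w : Pt n} (hv : v ∈ D) (hw : w ∈ D) :
    v - w ∈ tangents D :=
  AffineSubspace.vsub_mem_direction (mem_affineSpan ℝ hv) (mem_affineSpan ℝ hw)

end Simplices

/-! ### Polynomials on a simplex: factorization on faces and Lagrange nodes. -/

section SimplexPolynomials

variable {n : ℕ} {K : Finset (Pt n)}

theorem sum_coe_smul (D : Finset (Pt n)) (w : Pt n → ℝ) :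
    ∑ v : D, w v • (v : Pt n) = ∑ v ∈ D, w v • v :=
  Finset.sum_coe_sort D (fun v => w v • v)

theorem exists_extend {D : Finset (Pt n)} (c : D → ℝ) : ∃ w : Pt n → ℝ, ∀ v : D, w v = c v := by
  classical
  exact ⟨fun v => if h : v ∈ D then c ⟨v, h⟩ else 0, fun v => by simp⟩

theorem hull_of_coe {D : Finset (Pt n)} {c : D → ℝ} (hc : ∀ v, 0 ≤ c v) (h1 : ∑ v, c v = 1)
    {E : Finset (Pt n)} (hE : ∀ v : D, (v : Pt n) ∉ E → c v = 0) (hED : E ⊆ D) :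
    ∑ v, c v • (v : Pt n) ∈ hull E := by
  obtain ⟨w, hw⟩ := exists_extend c
  simp only [← hw] at hc h1 hE ⊢
  rw [sum_coe_smul D w]
  rw [Finset.sum_coe_sort D w] at h1
  have h0 : ∀ v ∈ D, v ∉ E → w v = 0 := fun v hv hvE => hE ⟨v, hv⟩ hvE
  refine mem_hull_iff.2 ⟨w, fun y hy => hc ⟨y, hED hy⟩, ?_, ?_⟩
  · rw [Finset.sum_subset hED h0, h1]
  · exact Finset.sum_subset hED fun v hv hvE => by rw [h0 v hv hvE, zero_smul]

/-- In the barycentric coordinates of `D`, vanishing on each facet of `D` makes every variable a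
divisor. The cofactor has degree k − (ℓ+1) with ℓ the dimension of `D`, which is exactly the degree
admitted for the moments on `D`. -/
theorem poly_factor_on_face (hK : IsCell K) {k : ℕ} (hk : 1 ≤ k) {f : Pt n → ℝ} (hf : IsPoly k f)
    {D : Finset (Pt n)} (hD : D ⊆ K) (h0 : ∀ v ∈ D, ∀ x ∈ hull (D.erase v), f x = 0) :
    ∃ g, IsPoly ((k : ℤ) - D.card) g ∧ ∀ x ∈ hull D, f x = (∏ v ∈ D, bary K v x) * g x := by
  classical
  obtain ⟨P, hP, hPf⟩ := hf.exists_homogeneous (fun v : D => (v : Pt n))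
  obtain ⟨Q, hPQ, hQ⟩ := homogeneous_factor hk hP Finset.univ (fun i _ c hc hs hci => by
    rw [← hPf c hs]
    refine h0 i i.2 _ (hull_of_coe hc hs (fun v hv => ?_) (Finset.erase_subset _ _))
    by_cases hvi : v = i
    · rw [hvi, hci]
    · exact absurd (Finset.mem_erase.2 ⟨fun h => hvi (Subtype.ext h), v.2⟩) hv)
  refine ⟨fun x => MvPolynomial.eval (fun v : D => bary K v x) Q, ?_, fun x hx => ?_⟩
  · rcases hQ with rfl | hQ
    · simpa using isPoly_zero _
    · rw [Finset.card_univ, Fintype.card_coe] at hQ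
      refine (isPoly_eval_comp (P := Q) (k := k - D.card) (by omega)
        (l := fun (v : D) x => bary K v x) fun v => bary_isPoly K v).mono ?_
      omega
  · have hx' := (mem_hull_face hK hD).1 hx
    have e1 : ∑ v : D, bary K v x = 1 := by
      rw [Finset.sum_coe_sort D (fun v => bary K v x), Finset.sum_subset hD hx'.2, sum_bary hK]
    have e2 : ∑ v : D, bary K v x • (v : Pt n) = x := by
      rw [sum_coe_smul D (fun v => bary K v x), Finset.sum_subset hD fun v hv hvD => by
        rw [hx'.2 v hv hvD, zero_smul], sum_bary_smul hK]
    have := hPf (fun v : D => bary K v x) e1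
    rw [e2] at this
    rw [this, hPQ, map_mul, map_prod]
    simp only [MvPolynomial.eval_X]
    rw [Finset.prod_coe_sort D (fun v => bary K v x)]

theorem poly_eq_eval_bary (hK : IsCell K) {k : ℕ} {f : Pt n → ℝ} (hf : IsPoly k f) :
    ∃ P : MvPolynomial K ℝ, P.IsHomogeneous k ∧
      (∀ c : K → ℝ, ∑ i, c i = 1 → f (∑ i, c i • (i : Pt n)) = MvPolynomial.eval c P) ∧
      ∀ x, f x = MvPolynomial.eval (fun v : K => bary K v x) P := by
  obtain ⟨P, hP, hPf⟩ := hf.exists_homogeneous (fun v : K => (v : Pt n))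
  refine ⟨P, hP, hPf, fun x => ?_⟩
  rw [← hPf, sum_coe_smul K (fun v => bary K v x), sum_bary_smul hK]
  rw [Finset.sum_coe_sort K (fun v => bary K v x), sum_bary hK]

/-- The same divisibility with only two of the coordinates of `K`; since the coordinates of all of
`K` are used, the identity holds everywhere and not just on a face. -/
theorem poly_factor_two (hK : IsCell K) {k : ℕ} (hk : 1 ≤ k) {f : Pt n → ℝ} (hf : IsPoly k f)
    {i j : Pt n} (hi : i ∈ K) (hj : j ∈ K) (hij : i ≠ j)
    (h0 : ∀ x ∈ hull (K.erase i), f x = 0) (h1 : ∀ x ∈ hull (K.erase j), f x = 0) :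
    ∃ g, IsPoly ((k : ℤ) - 2) g ∧ ∀ x, f x = bary K i x * bary K j x * g x := by
  classical
  obtain ⟨P, hP, hPf, hPx⟩ := poly_eq_eval_bary hK hf
  obtain ⟨Q, hPQ, hQ⟩ := homogeneous_factor hk hP {⟨i, hi⟩, ⟨j, hj⟩} (fun l hl c hc hs hcl => by
    rw [← hPf c hs]
    have hmem : ∑ v, c v • (v : Pt n) ∈ hull (K.erase l) := by
      refine hull_of_coe hc hs (fun v hv => ?_) (Finset.erase_subset _ _)
      by_cases hvi : v = l
      · rw [hvi, hcl]
      · exact absurd (Finset.mem_erase.2 ⟨fun h => hvi (Subtype.ext h), v.2⟩) hv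
    rw [Finset.mem_insert, Finset.mem_singleton] at hl
    rcases hl with rfl | rfl
    · exact h0 _ hmem
    · exact h1 _ hmem)
  have hne : (⟨i, hi⟩ : K) ≠ ⟨j, hj⟩ := fun h => hij (congrArg Subtype.val h)
  refine ⟨fun x => MvPolynomial.eval (fun v : K => bary K v x) Q, ?_, fun x => ?_⟩
  · rcases hQ with rfl | hQ
    · simpa using isPoly_zero _
    · rw [Finset.card_pair hne] at hQ
      refine (isPoly_eval_comp (P := Q) (k := k - 2) (by omega)
        (l := fun (v : K) x => bary K v x) fun v => bary_isPoly K v).mono ?_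
      omega
  · rw [hPx, hPQ, map_mul, map_prod, Finset.prod_pair hne]
    simp

/-- The Lagrange nodes of degree `k` of the simplex with vertex set `D`. -/
def simplexNodes (D : Finset (Pt n)) (k : ℕ) : Finset (Pt n) := by
  classical
  exact ((Finset.univ : Finset D).finsuppAntidiag k).image
    (fun c => ∑ v : D, ((c v : ℝ) / k) • (v : Pt n))

theorem mem_simplexNodes {D : Finset (Pt n)} {k : ℕ} {a : Pt n} : a ∈ simplexNodes D k ↔
    ∃ c : Pt n → ℕ, ∑ v ∈ D, c v = k ∧ a = ∑ v ∈ D, ((c v : ℝ) / k) • v := by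
  classical
  simp only [simplexNodes, Finset.mem_image, Finset.mem_finsuppAntidiag]
  constructor
  · rintro ⟨c, ⟨hc, -⟩, rfl⟩
    refine ⟨fun v => if h : v ∈ D then c ⟨v, h⟩ else 0, ?_, ?_⟩
    · rw [← Finset.sum_coe_sort D]
      simpa using hc
    · rw [← sum_coe_smul]
      simp
  · rintro ⟨c, hc, rfl⟩
    refine ⟨Finsupp.equivFunOnFinite.symm (fun v : D => c v), ⟨?_, Finset.subset_univ _⟩, ?_⟩
    · simpa using (Finset.sum_coe_sort D c).trans hc
    · simpa using sum_coe_smul D (fun v => (c v : ℝ) / k)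

theorem card_simplexNodes_le (D : Finset (Pt n)) (k : ℕ) :
    (simplexNodes D k).card ≤ (k + 1) ^ D.card := by
  classical
  refine Finset.card_image_le.trans ?_
  have : ((Finset.univ : Finset D).finsuppAntidiag k).card ≤
      (Fintype.piFinset (fun _ : D => Finset.range (k + 1))).card := by
    refine Finset.card_le_card_of_injOn (fun c => (c : D → ℕ)) (fun c hc => ?_) ?_
    · rw [Finset.mem_coe, Finset.mem_finsuppAntidiag] at hc
      rw [Finset.mem_coe, Fintype.mem_piFinset]
      intro v
      rw [Finset.mem_range, Nat.lt_succ_iff, ← hc.1]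
      exact Finset.single_le_sum (fun _ _ => Nat.zero_le _) (Finset.mem_univ v)
    · exact fun a _ b _ h => DFunLike.coe_injective h
  simpa using this

theorem simplexNodes_subset_hull {D : Finset (Pt n)} {k : ℕ} (hk : 1 ≤ k) {a : Pt n}
    (ha : a ∈ simplexNodes D k) : a ∈ hull D := by
  obtain ⟨c, hc, rfl⟩ := mem_simplexNodes.1 ha
  refine mem_hull_iff.2 ⟨fun v => (c v : ℝ) / k, fun v _ => by positivity, ?_, rfl⟩
  rw [← Finset.sum_div, div_eq_one_iff_eq (by positivity)]
  exact_mod_cast hc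

/-- Only the nodes on `D` itself enter, with `D` of any dimension. This is what makes elementwise
interpolants match on common faces. -/
theorem poly_eq_zero_of_nodes {k : ℕ} (hk : 1 ≤ k) {f : Pt n → ℝ} (hf : IsPoly k f)
    {D : Finset (Pt n)} (h0 : ∀ a ∈ simplexNodes D k, f a = 0) {x : Pt n} (hx : x ∈ hull D) :
    f x = 0 := by
  classical
  obtain ⟨P, hP, hPf⟩ := hf.exists_homogeneous (fun v : D => (v : Pt n))
  have hP0 : P = 0 := by
    refine homogeneous_eq_zero_of_nodes hk hP fun c hc => ?_
    rw [← hPf]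
    · apply h0
      simp only [simplexNodes, Finset.mem_image]
      exact ⟨c, Finset.mem_finsuppAntidiag.2 ⟨hc, Finset.subset_univ _⟩, rfl⟩
    · rw [← Finset.sum_div, div_eq_one_iff_eq (by positivity)]
      exact_mod_cast hc
  obtain ⟨w, hw0, hw1, rfl⟩ := mem_hull_iff.1 hx
  rw [← sum_coe_smul, hPf (fun v : D => w v), hP0, map_zero]
  rw [Finset.sum_coe_sort D w, hw1]

theorem poly_eq_zero_of_hull (hK : IsCell K) {k : ℕ} {f : Pt n → ℝ} (hf : IsPoly k f)
    (h0 : ∀ x ∈ hull K, f x = 0) : f = 0 := by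
  classical
  -- The degree is raised to k+1 because the nodal argument needs a positive degree and k may be 0.
  obtain ⟨P, hP, hPf, hPx⟩ := poly_eq_eval_bary hK (hf.mono (s := (k + 1 : ℕ)) (by push_cast; omega))
  have hP0 : P = 0 := by
    refine homogeneous_eq_zero_of_nodes (by omega) hP fun c hc => ?_
    have hs : ∑ i, (c i : ℝ) / ((k + 1 : ℕ) : ℝ) = 1 := by
      rw [← Finset.sum_div, div_eq_one_iff_eq (by positivity)]
      exact_mod_cast hc
    rw [← hPf _ hs]
    exact h0 _ (hull_of_coe (fun v => by positivity) hs (fun v hv => absurd v.2 hv) subset_rfl)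
  funext x
  rw [hPx, hP0, map_zero]
  rfl

/-- The constant is the bound k^k for the basis functions times a bound for the number of nodes; it
is independent of the shape of `K`. -/
theorem exists_poly_interpolant (hK : IsCell K) {k : ℕ} (hk : 1 ≤ k) (y : Pt n → ℝ) :
    ∃ f, IsPoly k f ∧ (∀ a ∈ simplexNodes K k, f a = y a) ∧
      ∀ x ∈ hull K, f x ^ 2 ≤
        ((k : ℝ) ^ k * (k + 1) ^ (n + 1)) ^ 2 * ∑ a ∈ simplexNodes K k, y a ^ 2 := by
  classical
  obtain ⟨P, hP, hPn, hPb⟩ := exists_lagrange (ι := K) hk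
    (fun c => y (∑ v : K, ((c v : ℝ) / k) • (v : Pt n)))
  refine ⟨fun x => MvPolynomial.eval (fun v : K => bary K v x) P,
    isPoly_eval_comp hP.totalDegree_le (l := fun (v : K) x => bary K v x)
      fun v => bary_isPoly K v, fun a ha => ?_, fun x hx => ?_⟩
  · simp only [simplexNodes, Finset.mem_image, Finset.mem_finsuppAntidiag] at ha
    obtain ⟨c, ⟨hc, -⟩, rfl⟩ := ha
    have hb : (fun v : K => bary K v (∑ v : K, ((c v : ℝ) / k) • (v : Pt n))) =
        fun v : K => (c v : ℝ) / k := by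
      funext v
      obtain ⟨w, hw⟩ := exists_extend (fun v : K => (c v : ℝ) / k)
      have hs : ∑ v : K, (c v : ℝ) / k = 1 := by
        rw [← Finset.sum_div, div_eq_one_iff_eq (by positivity)]
        exact_mod_cast hc
      simp only [← hw] at hs ⊢
      rw [Finset.sum_coe_sort K w] at hs
      rw [sum_coe_smul, bary_sum hK subset_rfl hs v.2, if_pos v.2]
    rw [← hPn c hc, ← hb]
  · set S := ∑ a ∈ simplexNodes K k, y a ^ 2 with hS
    have h1 := hPb (fun v : K => bary K v x) (fun v => (mem_hull_cell hK).1 hx v v.2) (by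
      rw [Finset.sum_coe_sort K (fun v => bary K v x), sum_bary hK])
    have h2 : ∀ c ∈ (Finset.univ : Finset K).finsuppAntidiag k,
        |y (∑ v : K, ((c v : ℝ) / k) • (v : Pt n))| ≤ Real.sqrt S := by
      intro c hc
      apply Real.abs_le_sqrt
      refine Finset.single_le_sum (f := fun a => y a ^ 2) (fun a _ => sq_nonneg _) ?_
      exact Finset.mem_image_of_mem _ hc
    have h3 : (((Finset.univ : Finset K).finsuppAntidiag k).card : ℝ) ≤ (k + 1) ^ (n + 1) := by
      have : ((Finset.univ : Finset K).finsuppAntidiag k).card ≤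
          (Fintype.piFinset (fun _ : K => Finset.range (k + 1))).card := by
        refine Finset.card_le_card_of_injOn (fun c => (c : K → ℕ)) (fun c hc => ?_) ?_
        · rw [Finset.mem_coe, Finset.mem_finsuppAntidiag] at hc
          rw [Finset.mem_coe, Fintype.mem_piFinset]
          intro v
          rw [Finset.mem_range, Nat.lt_succ_iff, ← hc.1]
          exact Finset.single_le_sum (fun _ _ => Nat.zero_le _) (Finset.mem_univ v)
        · exact fun a _ b _ h => DFunLike.coe_injective h
      simp only [Fintype.card_piFinset, Finset.card_range, Finset.prod_const, Finset.card_univ,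
        Fintype.card_coe, hK.2] at this
      exact_mod_cast this
    have h4 : |MvPolynomial.eval (fun v : K => bary K v x) P| ≤
        (k : ℝ) ^ k * (k + 1) ^ (n + 1) * Real.sqrt S := by
      refine h1.trans ?_
      rw [mul_assoc]
      gcongr
      refine (Finset.sum_le_card_nsmul _ _ _ h2).trans ?_
      rw [nsmul_eq_mul]
      gcongr
    have hS0 : 0 ≤ S := Finset.sum_nonneg fun a _ => sq_nonneg _
    have h5 := pow_le_pow_left₀ (abs_nonneg _) h4 2
    rw [sq_abs, mul_pow _ (Real.sqrt S), Real.sq_sqrt hS0] at h5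
    exact h5

end SimplexPolynomials

/-! ### Symmetric matrices and the edge tensors of a simplex. -/

section Bilinear

variable {n : ℕ}

theorem bilin_add_left (A : Matrix (Fin n) (Fin n) ℝ) (u v w : Pt n) :
    bilin A (u + v) w = bilin A u w + bilin A v w := by
  simp [bilin, add_mul, Finset.sum_add_distrib]

theorem bilin_smul_left (A : Matrix (Fin n) (Fin n) ℝ) (c : ℝ) (v w : Pt n) :
    bilin A (c • v) w = c * bilin A v w := by
  simp [bilin, Finset.mul_sum, mul_assoc]

theorem bilin_comm {A : Matrix (Fin n) (Fin n) ℝ} (hA : A.IsSymm) (v w : Pt n) :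
    bilin A v w = bilin A w v := by
  rw [bilin, bilin, Finset.sum_comm]
  refine Finset.sum_congr rfl fun i _ => Finset.sum_congr rfl fun j _ => ?_
  rw [hA.apply i j]
  ring

theorem bilin_zero_left (A : Matrix (Fin n) (Fin n) ℝ) (w : Pt n) : bilin A 0 w = 0 := by
  simp [bilin]

theorem bilin_sum_left {ι : Type*} (A : Matrix (Fin n) (Fin n) ℝ) (s : Finset ι) (v : ι → Pt n)
    (w : Pt n) : bilin A (∑ i ∈ s, v i) w = ∑ i ∈ s, bilin A (v i) w := by
  classical
  induction s using Finset.induction_on with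
  | empty => simp [bilin_zero_left]
  | insert a s ha ih => rw [Finset.sum_insert ha, Finset.sum_insert ha, bilin_add_left, ih]

theorem bilin_add_right (A : Matrix (Fin n) (Fin n) ℝ) (u v w : Pt n) :
    bilin A u (v + w) = bilin A u v + bilin A u w := by
  simp [bilin, mul_add, Finset.sum_add_distrib]

theorem bilin_smul_right (A : Matrix (Fin n) (Fin n) ℝ) (c : ℝ) (v w : Pt n) :
    bilin A v (c • w) = c * bilin A v w := by
  simp only [bilin, Finset.mul_sum]
  refine Finset.sum_congr rfl fun i _ => Finset.sum_congr rfl fun j _ => ?_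
  simp only [PiLp.smul_apply, smul_eq_mul]
  ring

theorem bilin_sub_left (A : Matrix (Fin n) (Fin n) ℝ) (u v w : Pt n) :
    bilin A (u - v) w = bilin A u w - bilin A v w := by
  simp [bilin, sub_mul, Finset.sum_sub_distrib]

theorem bilin_sub_right (A : Matrix (Fin n) (Fin n) ℝ) (u v w : Pt n) :
    bilin A u (v - w) = bilin A u v - bilin A u w := by
  simp [bilin, mul_sub, Finset.sum_sub_distrib]

theorem bilin_sum_right {ι : Type*} (A : Matrix (Fin n) (Fin n) ℝ) (s : Finset ι) (v : ι → Pt n)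
    (w : Pt n) : bilin A w (∑ i ∈ s, v i) = ∑ i ∈ s, bilin A w (v i) := by
  classical
  induction s using Finset.induction_on with
  | empty => simp [bilin]
  | insert a s ha ih => rw [Finset.sum_insert ha, Finset.sum_insert ha, bilin_add_right, ih]

theorem bilin_single_left (A : Matrix (Fin n) (Fin n) ℝ) (a : Fin n) (w : Pt n) :
    bilin A (EuclideanSpace.single a 1) w = ∑ j, A a j * w j := by
  simp only [bilin]
  rw [Finset.sum_eq_single a]
  · simp
  · intro b _ hb
    simp [hb]
  · simp

theorem bilin_single (A : Matrix (Fin n) (Fin n) ℝ) (a b : Fin n) :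
    bilin A (EuclideanSpace.single a 1) (EuclideanSpace.single b 1) = A a b := by
  rw [bilin_single_left, Finset.sum_eq_single b]
  · simp
  · intro c _ hc
    simp [hc]
  · simp

theorem IsPolySym.bilin {r : ℤ} {q : TensorField n} (hq : IsPolySym r q) (v w : Pt n) :
    IsPoly r (fun x => bilin (q x) v w) := by
  unfold FEM.bilin
  exact IsPoly.sum _ fun i _ => IsPoly.sum _ fun j _ =>
    ((hq.2 i j).const_mul _).mul_const _

variable {K : Finset (Pt n)}

/-- This is the derivative of the identity x = Σ λ_i(x) i: the matrices formed by gradients and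
vertices are dual to each other. -/
theorem sum_coord_smul_baryGrad (hK : IsCell K) (b : Fin n) :
    ∑ i ∈ K, (i b) • baryGrad K i = EuclideanSpace.single b (1 : ℝ) := by
  apply ext_inner_right ℝ
  intro w
  rw [sum_inner, EuclideanSpace.inner_single_left]
  have := congrArg (fun z : Pt n => z b) (sum_inner_baryGrad_smul hK w)
  simp only [WithLp.ofLp_sum, Finset.sum_apply, PiLp.smul_apply, smul_eq_mul] at this
  simp only [inner_smul_left, RCLike.conj_to_real, map_one, one_mul]
  rw [← this]
  exact Finset.sum_congr rfl fun i _ => mul_comm _ _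

/-- A symmetric matrix expanded in the edge tensors of a simplex. -/
theorem matrix_eq_sum_edges (hK : IsCell K) {A : Matrix (Fin n) (Fin n) ℝ} (hA : A.IsSymm)
    (a b : Fin n) : A a b = -(1 / 2) * ∑ i ∈ K, ∑ j ∈ K,
      bilin A (baryGrad K i) (baryGrad K j) * ((j - i) a * (j - i) b) := by
  -- When (j−i)_a (j−i)_b is multiplied out, the two terms involving only one of the vertices vanish
  -- because the gradients sum to zero, and each mixed term returns −A. This accounts for the factor
  -- −1/2.
  have e1 : ∀ f : Pt n → ℝ, ∑ i ∈ K, ∑ j ∈ K, bilin A (baryGrad K i) (baryGrad K j) * f j = 0 := by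
    intro f
    rw [Finset.sum_comm]
    refine Finset.sum_eq_zero fun j _ => ?_
    rw [← Finset.sum_mul, ← bilin_sum_left, sum_baryGrad hK, bilin_zero_left, zero_mul]
  have e2 : ∀ f : Pt n → ℝ, ∑ i ∈ K, ∑ j ∈ K, bilin A (baryGrad K i) (baryGrad K j) * f i = 0 := by
    intro f
    rw [Finset.sum_comm, ← e1 f]
    exact Finset.sum_congr rfl fun i _ => Finset.sum_congr rfl fun j _ => by rw [bilin_comm hA]
  have e3 : ∀ a b : Fin n,
      ∑ i ∈ K, ∑ j ∈ K, bilin A (baryGrad K i) (baryGrad K j) * (i a * j b) = A a b := by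
    intro a b
    rw [← bilin_single A a b, ← sum_coord_smul_baryGrad hK a, ← sum_coord_smul_baryGrad hK b,
      bilin_sum_left]
    refine Finset.sum_congr rfl fun i _ => ?_
    rw [bilin_sum_right]
    refine Finset.sum_congr rfl fun j _ => ?_
    rw [bilin_smul_left, bilin_smul_right]
    ring
  have e4 : ∑ i ∈ K, ∑ j ∈ K,
      bilin A (baryGrad K i) (baryGrad K j) * ((j - i) a * (j - i) b) =
      ∑ i ∈ K, ∑ j ∈ K, bilin A (baryGrad K i) (baryGrad K j) * (j a * j b) +
      ∑ i ∈ K, ∑ j ∈ K, bilin A (baryGrad K i) (baryGrad K j) * (i a * i b) -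
      ∑ i ∈ K, ∑ j ∈ K, bilin A (baryGrad K i) (baryGrad K j) * (i a * j b) -
      ∑ i ∈ K, ∑ j ∈ K, bilin A (baryGrad K i) (baryGrad K j) * (i b * j a) := by
    simp only [← Finset.sum_add_distrib, ← Finset.sum_sub_distrib]
    refine Finset.sum_congr rfl fun i _ => Finset.sum_congr rfl fun j _ => ?_
    simp only [PiLp.sub_apply]
    ring
  rw [e4, e1 (fun j => j a * j b), e2 (fun i => i a * i b), e3, e3, hA.apply a b]
  ring

/-- Polarization: with v₀ a vertex, the values on the edges i−v₀, j−v₀ and i−j determine the mixed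
value on i−v₀ and j−v₀, and the edges at v₀ span the space. -/
theorem matrix_eq_zero_of_edges (hK : IsCell K) {A : Matrix (Fin n) (Fin n) ℝ} (hA : A.IsSymm)
    (h : ∀ i ∈ K, ∀ j ∈ K, bilin A (j - i) (j - i) = 0) : A = 0 := by
  obtain ⟨v₀, hv₀⟩ := hK.nonempty
  have h1 : ∀ i ∈ K, ∀ j ∈ K, bilin A (i - v₀) (j - v₀) = 0 := by
    intro i hi j hj
    have e1 := h v₀ hv₀ i hi
    have e2 := h v₀ hv₀ j hj
    have e3 := h j hj i hi
    have e4 : i - j = (i - v₀) - (j - v₀) := by abel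
    rw [e4, bilin_sub_left, bilin_sub_right _ (i - v₀) (i - v₀),
      bilin_sub_right _ (j - v₀) (i - v₀), e1, e2, bilin_comm hA (j - v₀) (i - v₀)] at e3
    linarith
  have h2 : ∀ w : Pt n, w = ∑ i ∈ K, (inner ℝ (baryGrad K i) w : ℝ) • (i - v₀) := by
    intro w
    simp only [smul_sub, Finset.sum_sub_distrib]
    rw [sum_inner_baryGrad_smul hK, ← Finset.sum_smul, sum_inner_baryGrad hK, zero_smul, sub_zero]
  ext a b
  rw [← bilin_single A a b, h2 (EuclideanSpace.single a 1), h2 (EuclideanSpace.single b 1),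
    bilin_sum_left]
  refine Finset.sum_eq_zero fun i hi => ?_
  rw [bilin_sum_right]
  refine Finset.sum_eq_zero fun j hj => ?_
  rw [bilin_smul_left, bilin_smul_right, h1 i hi j hj]
  simp

end Bilinear

/-! ### Integral inequalities for polynomials on an n-simplex. -/

section CellIntegrals

variable {n : ℕ} {K : Finset (Pt n)}

theorem integrableOn_of_continuous {X : Type*} [TopologicalSpace X] [MeasurableSpace X]
    [OpensMeasurableSpace X] [T2Space X] {μ : Measure X} {S : Set X}
    (hS : IsCompact S) (hfin : μ S ≠ ⊤) {f : X → ℝ} (hf : Continuous f) : IntegrableOn f S μ := by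
  have : IsFiniteMeasure (μ.restrict S) :=
    ⟨by rw [Measure.restrict_apply_univ]; exact hfin.lt_top⟩
  obtain ⟨M, hM⟩ := hS.exists_bound_of_continuousOn hf.continuousOn
  exact Integrable.of_bound hf.aestronglyMeasurable M
    ((ae_restrict_mem hS.measurableSet).mono fun y hy => hM y hy)

theorem integrableOn_hull (K : Finset (Pt n)) {f : Pt n → ℝ} (hf : Continuous f) :
    IntegrableOn f (hull K) :=
  hf.continuousOn.integrableOn_compact (isCompact_hull K)

theorem volume_hull_pos (hK : IsCell K) : 0 < volume.real (hull K) := by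
  refine ENNReal.toReal_pos ?_ (isCompact_hull K).measure_lt_top.ne
  exact ((isOpen_interior.measure_pos volume (interior_cell_nonempty hK)).trans_le
    (measure_mono interior_subset)).ne'

theorem euclideanHausdorffMeasure_eq_volume (n : ℕ) : (μHE[n] : Measure (Pt n)) = volume :=
  EuclideanSpace.euclideanHausdorffMeasure_eq_volume n

theorem exists_sq_le_integral_cell (n k : ℕ) : ∃ C : ℝ, 0 < C ∧ ∀ K : Finset (Pt n), IsCell K →
    ∀ f, IsPoly k f → ∀ x ∈ hull K, f x ^ 2 * volume.real (hull K) ≤ C * ∫ y in hull K, f y ^ 2 := by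
  obtain ⟨C, hC, h⟩ := exists_sq_le_integral_poly n k
  refine ⟨C, hC, fun K hK f hf x hx => ?_⟩
  have := h n (hull K) (convex_hull K) (isCompact_hull K)
  rw [euclideanHausdorffMeasure_eq_volume] at this
  exact this (isCompact_hull K).measure_lt_top.ne f hf x hx

/-- The edge bubble weight `λ_i λ_j` gives an equivalent norm on polynomials. -/
theorem exists_integral_poly_le_weighted (n k : ℕ) : ∃ C : ℝ, 0 < C ∧ ∀ K : Finset (Pt n),
    IsCell K → ∀ f, IsPoly k f → ∀ i ∈ K, ∀ j ∈ K,
      ∫ y in hull K, f y ^ 2 ≤ C * ∫ y in hull K, bary K i y * bary K j y * f y ^ 2 := by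
  obtain ⟨C, hC, h⟩ := exists_integral_poly_le_half n k
  refine ⟨C * (2 * (n + 1)) ^ 2, by positivity, fun K hK f hf i hi j hj => ?_⟩
  -- All barycentric coordinates of the barycentre are 1/(n+1), so contracting by a ratio of at most
  -- 1/2 towards it keeps every coordinate above δ. On the resulting set the weight is at least δ².
  set δ : ℝ := (2 * (n + 1))⁻¹ with hδ
  have hδ0 : 0 < δ := by positivity
  let w : Pt n → ℝ := fun _ => ((n : ℝ) + 1)⁻¹
  have hw : ∑ y ∈ K, w y = 1 := by
    simp only [w, Finset.sum_const, hK.2, nsmul_eq_mul]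
    push_cast
    field_simp
  set c : Pt n := ∑ y ∈ K, w y • y with hc
  have hcb : ∀ v ∈ K, bary K v c = ((n : ℝ) + 1)⁻¹ := fun v hv => by
    rw [hc, bary_sum hK subset_rfl hw hv, if_pos hv]
  let T : Set (Pt n) := hull K ∩ ⋂ v ∈ K, {x | δ ≤ bary K v x}
  have hTc : IsCompact T := by
    refine (isCompact_hull K).inter_right ?_
    exact isClosed_biInter fun v _ => isClosed_le continuous_const (bary_continuous K v)
  have hTmem : ∀ t : ℝ, 0 < t → t ≤ 1 / 2 → ∀ y ∈ hull K, c + t • (y - c) ∈ T := by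
    intro t ht ht2 y hy
    have hb : ∀ v ∈ K, δ ≤ bary K v (c + t • (y - c)) := by
      intro v hv
      rw [bary_add, inner_smul_right, ← bary_sub, hcb v hv]
      have h1 := (mem_hull_cell hK).1 hy v hv
      have h2 : ((n : ℝ) + 1)⁻¹ = 2 * δ := by rw [hδ]; field_simp
      rw [h2]
      nlinarith
    refine ⟨(mem_hull_cell hK).2 fun v hv => hδ0.le.trans (hb v hv), ?_⟩
    rw [Set.mem_iInter₂]
    exact hb
  have h1 := h n (hull K) T c Set.inter_subset_left (isCompact_hull K) hTc
  rw [euclideanHausdorffMeasure_eq_volume] at h1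
  have h2 := h1 (isCompact_hull K).measure_lt_top.ne hTmem f hf
  have hcont : Continuous fun y => bary K i y * bary K j y * f y ^ 2 :=
    ((bary_continuous K i).mul (bary_continuous K j)).mul (hf.continuous.pow 2)
  have h3 : ∫ y in T, f y ^ 2 ≤ ∫ y in T, (2 * (n + 1)) ^ 2 * (bary K i y * bary K j y * f y ^ 2) := by
    refine setIntegral_mono_on ?_ ?_ hTc.measurableSet fun y hy => ?_
    · exact (hf.continuous.pow 2).continuousOn.integrableOn_compact hTc
    · exact (continuous_const.mul hcont).continuousOn.integrableOn_compact hTc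
    · have hy2 := Set.mem_iInter₂.1 hy.2
      have e1 : δ ≤ bary K i y := hy2 i hi
      have e2 : δ ≤ bary K j y := hy2 j hj
      have e3 : δ * δ ≤ bary K i y * bary K j y := mul_le_mul e1 e2 hδ0.le (hδ0.le.trans e1)
      have e4 : (2 * ((n : ℝ) + 1)) ^ 2 * (δ * δ) = 1 := by rw [hδ]; field_simp
      calc f y ^ 2 = (2 * ((n : ℝ) + 1)) ^ 2 * (δ * δ * f y ^ 2) := by rw [← mul_assoc, e4, one_mul]
        _ ≤ _ := by gcongr
  rw [integral_const_mul] at h3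
  have h4 : ∫ y in T, bary K i y * bary K j y * f y ^ 2 ≤
      ∫ y in hull K, bary K i y * bary K j y * f y ^ 2 := by
    refine setIntegral_mono_set (integrableOn_hull K hcont) ?_ Set.inter_subset_left.eventuallyLE
    refine (ae_restrict_mem (isCompact_hull K).measurableSet).mono fun y hy => ?_
    have e1 := (mem_hull_cell hK).1 hy i hi
    have e2 := (mem_hull_cell hK).1 hy j hj
    simp only [Pi.zero_apply]
    positivity
  calc _ ≤ C * ∫ y in T, f y ^ 2 := h2
    _ ≤ C * ((2 * (n + 1)) ^ 2 * ∫ y in hull K, bary K i y * bary K j y * f y ^ 2) := by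
        gcongr
        exact h3.trans (by gcongr)
    _ = _ := by ring

theorem poly_eq_zero_of_weighted (hK : IsCell K) {k : ℕ} {f : Pt n → ℝ} (hf : IsPoly k f)
    {i j : Pt n} (hi : i ∈ K) (hj : j ∈ K)
    (h : ∫ y in hull K, bary K i y * bary K j y * f y ^ 2 = 0) {x : Pt n} (hx : x ∈ hull K) :
    f x = 0 := by
  obtain ⟨C, hC, h1⟩ := exists_integral_poly_le_weighted n k
  obtain ⟨C', hC', h2⟩ := exists_sq_le_integral_cell n k
  have h3 := h1 K hK f hf i hi j hj
  rw [h, mul_zero] at h3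
  have h4 := h2 K hK f hf x hx
  have h5 := volume_hull_pos hK
  have h6 : f x ^ 2 * volume.real (hull K) ≤ 0 := by nlinarith
  have h7 : f x ^ 2 ≤ 0 := by
    by_contra hcon
    push Not at hcon
    nlinarith [mul_pos hcon h5]
  exact pow_eq_zero_iff (two_ne_zero) |>.1 (le_antisymm h7 (sq_nonneg _))

end CellIntegrals

/-! ### Structure of tensors with vanishing boundary degrees of freedom. -/

section Bubbles

variable {n : ℕ} {K : Finset (Pt n)}

/-- On every proper face `D` of `K`, the tensor field maps normals of `D` to zero. -/
def IsFaceBubble (K : Finset (Pt n)) (q : TensorField n) : Prop :=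
  ∀ D ⊆ K, D ≠ K → ∀ x ∈ hull D, ∀ ν ∈ normals D, ∀ w, bilin (q x) w ν = 0

theorem normals_anti {D E : Finset (Pt n)} (h : D ⊆ E) : normals E ≤ normals D := by
  refine Submodule.orthogonal_le ?_
  exact AffineSubspace.direction_le (affineSpan_mono ℝ (by exact_mod_cast h))

/-- Induction over faces. A normal of `D` is also normal to the subfaces of `D`, so wᵀqν vanishes on
them and equals the product of the coordinates of `D` times some g of admissible degree. Splitting w
into a tangential and a normal part, both families of moments apply with p = g, and they leave the
integral of a nonnegative function equal to zero. -/
theorem VanishingBoundaryDofs.isFaceBubble (hK : IsCell K) {k : ℕ} (hk : 1 ≤ k) {q : TensorField n}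
    (hq : IsPolySym k q) (hv : VanishingBoundaryDofs K k q) : IsFaceBubble K q := by
  intro D
  induction D using Finset.strongInduction with
  | H D ih =>
    intro hD hDK x hx ν hν w
    have hne : D.Nonempty := by
      rw [Finset.nonempty_iff_ne_empty]
      rintro rfl
      rw [hull_eq_empty_iff.2 rfl] at hx
      exact hx
    have hf : IsPoly k (fun x => bilin (q x) w ν) := hq.bilin w ν
    obtain ⟨g, hg, hfg⟩ := poly_factor_on_face hK hk hf hD (fun v hvD y hy =>
      ih (D.erase v) (Finset.erase_ssubset hvD) ((Finset.erase_subset _ _).trans hD)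
        (fun h => (h ▸ Finset.notMem_erase v D) (hD hvD)) y hy ν
        (normals_anti (Finset.erase_subset _ _) hν) w)
    have hind : AffineIndependent ℝ ((↑) : D → Pt n) := hK.1.mono hD
    obtain ⟨hfin, hpos⟩ := simplexMeasure_hull_ne_top hind hne
    have hint : ∀ u, Integrable (fun x => bilin (q x) u ν * g x) (simplexMeasure D) := fun u =>
      integrableOn_of_continuous (isCompact_hull D) hfin ((hq.bilin u ν).continuous.mul hg.continuous)
    have h0 : ∫ x, bilin (q x) w ν * g x ∂(simplexMeasure D) = 0 := by
      obtain ⟨t, ht, ν', hν', hw⟩ := (tangents D).exists_add_mem_mem_orthogonal w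
      obtain ⟨h1, h2⟩ := hv D hD hne hDK g hg ν hν
      have : ∀ x, bilin (q x) w ν * g x = bilin (q x) t ν * g x + bilin (q x) ν' ν * g x := by
        intro x
        rw [hw, bilin_add_left, add_mul]
      simp only [this]
      rw [integral_add (hint t) (hint ν'), h1 t ht, h2 ν' hν', add_zero]
    -- With b the product of the coordinates, 0 ≤ b ≤ 1 gives (bg)² ≤ (bg)g, whose integral is the
    -- moment known to vanish.
    have h1 : ∫ x in hull D, bilin (q x) w ν ^ 2 ∂(μHE[D.card - 1] : Measure (Pt n)) ≤ 0 := by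
      rw [← h0]
      refine setIntegral_mono_on ?_ (hint w) (isCompact_hull D).measurableSet fun y hy => ?_
      · exact integrableOn_of_continuous (isCompact_hull D) hfin (hf.continuous.pow 2)
      · have hyK := hull_mono hD hy
        have e1 : 0 ≤ ∏ v ∈ D, bary K v y :=
          Finset.prod_nonneg fun v hv => (mem_hull_cell hK).1 hyK v (hD hv)
        have e2 : ∏ v ∈ D, bary K v y ≤ 1 :=
          Finset.prod_le_one (fun v hv => (mem_hull_cell hK).1 hyK v (hD hv))
            (fun v hv => bary_le_one hK hyK (hD hv))
        rw [hfg y hy]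
        have e3 : 0 ≤ (∏ v ∈ D, bary K v y) * g y ^ 2 := by positivity
        nlinarith
    obtain ⟨C, hC, hle⟩ := exists_sq_le_integral_poly (D.card - 1) k
    have h2 := hle n (hull D) (convex_hull D) (isCompact_hull D) hfin _ hf x hx
    have h3 : 0 < (μHE[D.card - 1] : Measure (Pt n)).real (hull D) := ENNReal.toReal_pos hpos hfin
    have h4 : bilin (q x) w ν ^ 2 ≤ 0 := by
      by_contra hcon
      push Not at hcon
      nlinarith [mul_pos hcon h3]
    exact pow_eq_zero_iff (two_ne_zero) |>.1 (le_antisymm h4 (sq_nonneg _))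

theorem IsFaceBubble.isCellBubble (hK : IsCell K) {k : ℕ} {q : TensorField n}
    (hq : IsPolySym k q) (hb : IsFaceBubble K q) : IsCellBubble K k q := by
  refine ⟨hq, fun F hF hcard x hx ν hν i => ?_⟩
  rw [← bilin_single_left]
  refine hb F hF (fun h => ?_) x hx ν hν _
  rw [h, hK.2] at hcard
  omega

/-- ∇λ_i is normal to the facet opposite to i, so the component with ∇λ_i and ∇λ_j vanishes on the
facets opposite to i and to j; symmetry of q is used for one of the two. -/
theorem IsFaceBubble.exists_factor (hK : IsCell K) {k : ℕ} (hk : 1 ≤ k) {q : TensorField n}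
    (hq : IsPolySym k q) (hb : IsFaceBubble K q) : ∃ r : Pt n → Pt n → Pt n → ℝ,
      (∀ i j, IsPoly ((k : ℤ) - 2) (r i j)) ∧ ∀ i ∈ K, ∀ j ∈ K, i ≠ j → ∀ x,
        bilin (q x) (baryGrad K i) (baryGrad K j) = bary K i x * bary K j x * r i j x := by
  have h : ∀ i j, ∃ r, IsPoly ((k : ℤ) - 2) r ∧ (i ∈ K → j ∈ K → i ≠ j → ∀ x,
        bilin (q x) (baryGrad K i) (baryGrad K j) = bary K i x * bary K j x * r x) := by
    intro i j
    by_cases hij : i ∈ K ∧ j ∈ K ∧ i ≠ j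
    · have hv : ∀ l ∈ K, ∀ m, ∀ x ∈ hull (K.erase l),
          bilin (q x) (baryGrad K m) (baryGrad K l) = 0 := fun l hl m x hx =>
        hb (K.erase l) (Finset.erase_subset _ _)
          (fun h => (h ▸ Finset.notMem_erase l K) hl) x hx _
          (baryGrad_mem_normals hK (Finset.erase_subset _ _) hl (Finset.notMem_erase _ _)) _
      obtain ⟨r, hr, hqr⟩ := poly_factor_two hK hk (hq.bilin (baryGrad K i) (baryGrad K j))
        hij.1 hij.2.1 hij.2.2
        (fun x hx => by rw [bilin_comm (hq.1 x)]; exact hv i hij.1 j x hx)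
        (fun x hx => hv j hij.2.1 i x hx)
      exact ⟨r, hr, fun _ _ _ => hqr⟩
    · exact ⟨0, isPoly_zero _, fun h1 h2 h3 => absurd ⟨h1, h2, h3⟩ hij⟩
  choose r hr hqr using h
  exact ⟨r, hr, fun i hi j hj hij => hqr i j hi hj hij⟩

/-- Insert the factorized components into the expansion of a symmetric matrix in edge tensors;
diagonal terms disappear because their edge vector is zero. -/
theorem IsFaceBubble.eq_sum_edges (hK : IsCell K) {q : TensorField n} {k : ℕ} (hq : IsPolySym k q)
    {r : Pt n → Pt n → Pt n → ℝ}
    (hr : ∀ i ∈ K, ∀ j ∈ K, i ≠ j → ∀ x,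
      bilin (q x) (baryGrad K i) (baryGrad K j) = bary K i x * bary K j x * r i j x)
    (x : Pt n) (a b : Fin n) : q x a b = -(1 / 2) * ∑ p ∈ K.offDiag,
      bary K p.1 x * bary K p.2 x * r p.1 p.2 x * ((p.2 - p.1) a * (p.2 - p.1) b) := by
  rw [matrix_eq_sum_edges hK (hq.1 x) a b, ← Finset.sum_product']
  congr 1
  rw [← Finset.sum_subset (s₁ := K.offDiag)]
  · refine Finset.sum_congr rfl fun p hp => ?_
    rw [Finset.mem_offDiag] at hp
    rw [hr p.1 hp.1 p.2 hp.2.1 hp.2.2]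
  · intro p hp
    rw [Finset.mem_offDiag] at hp
    exact Finset.mem_product.2 ⟨hp.1, hp.2.1⟩
  · intro p hp hpn
    rw [Finset.mem_product] at hp
    have : p.1 = p.2 := by
      by_contra hne
      exact hpn (Finset.mem_offDiag.2 ⟨hp.1, hp.2, hne⟩)
    simp [this]

end Bubbles

/-! ### L²-stability of the bubble interpolation. -/

section BubbleStability

variable {n : ℕ} {K : Finset (Pt n)}

/-- The tensor product `u wᵀ`. -/
def outer (u w : Pt n) : Matrix (Fin n) (Fin n) ℝ := Matrix.of fun a b => u a * w b

theorem frob_outer (A : Matrix (Fin n) (Fin n) ℝ) (u w : Pt n) : frob A (outer u w) = bilin A u w := by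
  simp only [frob, outer, bilin, Matrix.of_apply]
  exact Finset.sum_congr rfl fun i _ => Finset.sum_congr rfl fun j _ => by ring

theorem frob_add_right (A B C : Matrix (Fin n) (Fin n) ℝ) : frob A (B + C) = frob A B + frob A C := by
  simp [frob, mul_add, Finset.sum_add_distrib]

theorem frob_smul_right (A B : Matrix (Fin n) (Fin n) ℝ) (c : ℝ) : frob A (c • B) = c * frob A B := by
  simp only [frob, Finset.mul_sum, Matrix.smul_apply, smul_eq_mul]
  exact Finset.sum_congr rfl fun i _ => Finset.sum_congr rfl fun j _ => by ring

theorem frob_comm (A B : Matrix (Fin n) (Fin n) ℝ) : frob A B = frob B A := by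
  simp [frob, mul_comm]

theorem frob_sum_right {ι : Type*} (A : Matrix (Fin n) (Fin n) ℝ) (s : Finset ι)
    (B : ι → Matrix (Fin n) (Fin n) ℝ) : frob A (∑ i ∈ s, B i) = ∑ i ∈ s, frob A (B i) := by
  classical
  induction s using Finset.induction_on with
  | empty => simp [frob]
  | insert a s ha ih => rw [Finset.sum_insert ha, Finset.sum_insert ha, frob_add_right, ih]

theorem card_offDiag_cell_le (hK : IsCell K) : (K.offDiag.card : ℝ) ≤ ((n : ℝ) + 1) ^ 2 := by
  rw [Finset.offDiag_card, hK.2]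
  have : (n + 1) * (n + 1) - (n + 1) ≤ (n + 1) ^ 2 := by
    rw [sq]; exact Nat.sub_le _ _
  exact_mod_cast this

theorem memLp_hull_of_continuous (K : Finset (Pt n)) {f : Pt n → ℝ} (hf : Continuous f) :
    MemLp f 2 (volume.restrict (hull K)) :=
  (memLp_two_iff_integrable_sq hf.aestronglyMeasurable).2 (integrableOn_hull K (hf.pow 2))

theorem integrable_frob {τ ς : TensorField n}
    (hτ : ∀ a b, MemLp (fun x => τ x a b) 2 (volume.restrict (hull K)))
    (hς : ∀ a b, Continuous fun x => ς x a b) :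
    IntegrableOn (fun x => frob (τ x) (ς x)) (hull K) :=
  integrable_finsetSum _ fun a _ => integrable_finsetSum _ fun b _ =>
    (hτ a b).integrable_mul (memLp_hull_of_continuous K (hς a b))

theorem IsPolySym.continuous {r : ℤ} {q : TensorField n} (hq : IsPolySym r q) (a b : Fin n) :
    Continuous fun x => q x a b := (hq.2 a b).continuous

/-- Let A = Σ ∫ λ_iλ_j r_ij² be the energy of the edge coefficients and G the bound (2ρ)⁻¹ for the
gradients. A test field built from the r_ij pairs with q to 2A and has squared norm at most a
multiple of G⁴A, while the squared norm of q is at most a multiple of h⁴A. The moment condition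
therefore gives A ≲ G⁴‖τ‖², and shape regularity bounds hG by γ. -/
theorem exists_bubble_stability (n : ℕ) (hn : 1 ≤ n) (k : ℕ) (hk : 1 ≤ k) (γ : ℝ) :
    ∃ C : ℝ, 0 < C ∧ ∀ K : Finset (Pt n), IsCell K →
      ∀ (c : Pt n) (ρ : ℝ), 0 < ρ → Metric.closedBall c ρ ⊆ hull K → cellDiam K ≤ γ * (2 * ρ) →
      ∀ q : TensorField n, IsPolySym k q → IsFaceBubble K q → ∀ τ : TensorField n,
        (∀ a b, MemLp (fun x => τ x a b) 2 (volume.restrict (hull K))) →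
        (∀ ς, IsPolySym ((k : ℤ) - 2) ς →
          ∫ x in hull K, frob (q x) (ς x) = ∫ x in hull K, frob (τ x) (ς x)) →
        cellNormSq K q ≤ C * cellNormSq K τ := by
  obtain ⟨CR, hCR, hw⟩ := exists_integral_poly_le_weighted n k
  set N : ℝ := ((n : ℝ) + 1) ^ 2 with hN
  have hN0 : 0 < N := by positivity
  have hn0 : (0 : ℝ) < n := by exact_mod_cast hn
  -- The summand 1 only ensures positivity, since γ may be 0 here.
  refine ⟨n ^ 2 * N / 12 * (4 * n ^ 2 * N * CR * γ ^ 4) + 1, by positivity, ?_⟩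
  intro K hK c ρ hρ hball hdiam q hq hb τ hτ hmom
  obtain ⟨r, hr, hqr⟩ := hb.exists_factor hK hk hq
  set G : ℝ := (2 * ρ)⁻¹ with hG
  have hG0 : 0 < G := by positivity
  set h := cellDiam K with hh
  have hh0 : 0 ≤ h := Metric.diam_nonneg
  have hg : ∀ i ∈ K, ∀ a, |baryGrad K i a| ≤ G := by
    intro i hi a
    have h1 := norm_baryGrad_mul_le hK hρ.le hball hi
    have h2 : |baryGrad K i a| ≤ ‖baryGrad K i‖ := PiLp.norm_apply_le (baryGrad K i) a
    refine h2.trans ?_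
    rw [hG, ← one_div, le_div_iff₀ (by positivity)]
    exact h1
  have he : ∀ i ∈ K, ∀ j ∈ K, ∀ a, |(j - i) a| ≤ h := fun i hi j hj a =>
    (PiLp.norm_apply_le (j - i) a).trans (dist_le_cellDiam (subset_hull hj) (subset_hull hi))
  have hhG : h * G ≤ γ := by
    rw [hG, ← div_eq_mul_inv, div_le_iff₀ (by positivity)]
    exact hdiam
  let W : Pt n × Pt n → Pt n → ℝ := fun p x => bary K p.1 x * bary K p.2 x * r p.1 p.2 x ^ 2
  have hrc : ∀ i j, Continuous (r i j) := fun i j => (hr i j).continuous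
  have hWc : ∀ p, Continuous (W p) := fun p =>
    ((bary_continuous K _).mul (bary_continuous K _)).mul ((hrc _ _).pow 2)
  set A : ℝ := ∑ p ∈ K.offDiag, ∫ x in hull K, W p x with hA
  -- The factorization ∇λ_iᵀ q ∇λ_j = λ_iλ_j r_ij turns the pairing with q into twice the weighted
  -- sum of the r_ij²; the symmetrized products keep this test field in P_{k−2}(𝕊).
  let ς : TensorField n := fun x => ∑ p ∈ K.offDiag, r p.1 p.2 x •
    (outer (baryGrad K p.1) (baryGrad K p.2) + outer (baryGrad K p.2) (baryGrad K p.1))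
  have hςe : ∀ x a b, ς x a b = ∑ p ∈ K.offDiag, r p.1 p.2 x *
      (baryGrad K p.1 a * baryGrad K p.2 b + baryGrad K p.2 a * baryGrad K p.1 b) := by
    intro x a b
    simp [ς, Matrix.sum_apply, outer, mul_add]
  have hς : IsPolySym ((k : ℤ) - 2) ς := by
    refine ⟨fun x => Matrix.IsSymm.ext fun a b => ?_, fun a b => ?_⟩
    · rw [hςe, hςe]
      exact Finset.sum_congr rfl fun p _ => by ring
    · simp only [hςe]
      exact IsPoly.sum _ fun p _ => (hr _ _).mul_const _
  have hfrob : ∀ x, frob (q x) (ς x) = 2 * ∑ p ∈ K.offDiag, W p x := by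
    intro x
    simp only [ς]
    rw [frob_sum_right, Finset.mul_sum]
    refine Finset.sum_congr rfl fun p hp => ?_
    rw [Finset.mem_offDiag] at hp
    rw [frob_smul_right, frob_add_right, frob_outer, frob_outer, bilin_comm (hq.1 x)
      (baryGrad K p.2) (baryGrad K p.1), hqr p.1 hp.1 p.2 hp.2.1 hp.2.2]
    simp only [W]
    ring
  have h2A : ∫ x in hull K, frob (q x) (ς x) = 2 * A := by
    simp only [hfrob]
    rw [integral_const_mul, integral_finsetSum _ fun p _ => integrableOn_hull K (hWc p)]
  set T := cellNormSq K τ with hT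
  set Z := cellNormSq K ς with hZ
  set M : ℝ := 4 * n ^ 2 * N * G ^ 4 * CR with hM
  have hM0 : 0 < M := by positivity
  have hcard := card_offDiag_cell_le hK
  -- bound of the test field
  have hZle : Z ≤ M * A := by
    have h1 : ∀ a b, ∫ x in hull K, (ς x a b) ^ 2 ≤ N * (4 * G ^ 4) * (CR * A) := by
      intro a b
      have h2 : ∀ x, (ς x a b) ^ 2 ≤ ∑ p ∈ K.offDiag, N * (4 * G ^ 4) * r p.1 p.2 x ^ 2 := by
        intro x
        rw [hςe]
        refine (sq_sum_le_card_mul_sum_sq).trans ?_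
        rw [← Finset.mul_sum, mul_assoc]
        refine mul_le_mul hcard ?_ (Finset.sum_nonneg fun _ _ => sq_nonneg _) hN0.le
        rw [Finset.mul_sum]
        refine Finset.sum_le_sum fun p hp => ?_
        rw [Finset.mem_offDiag] at hp
        have e : |baryGrad K p.1 a * baryGrad K p.2 b + baryGrad K p.2 a * baryGrad K p.1 b| ≤
            2 * G ^ 2 := by
          refine (abs_add_le _ _).trans ?_
          rw [abs_mul, abs_mul]
          have e1 := mul_le_mul (hg p.1 hp.1 a) (hg p.2 hp.2.1 b) (abs_nonneg _) hG0.le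
          have e2 := mul_le_mul (hg p.2 hp.2.1 a) (hg p.1 hp.1 b) (abs_nonneg _) hG0.le
          linarith
        rw [mul_pow, mul_comm]
        refine mul_le_mul_of_nonneg_right ?_ (sq_nonneg _)
        rw [← sq_abs]
        calc _ ≤ (2 * G ^ 2) ^ 2 := pow_le_pow_left₀ (abs_nonneg _) e 2
          _ = _ := by ring
      have hint : ∀ p ∈ K.offDiag, IntegrableOn (fun x => N * (4 * G ^ 4) * r p.1 p.2 x ^ 2) (hull K) :=
        fun p _ => integrableOn_hull K (continuous_const.mul ((hrc _ _).pow 2))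
      calc ∫ x in hull K, (ς x a b) ^ 2
          ≤ ∫ x in hull K, ∑ p ∈ K.offDiag, N * (4 * G ^ 4) * r p.1 p.2 x ^ 2 :=
            setIntegral_mono (integrableOn_hull K ((hς.continuous a b).pow 2))
              (integrable_finsetSum _ hint) h2
        _ = N * (4 * G ^ 4) * ∑ p ∈ K.offDiag, ∫ x in hull K, r p.1 p.2 x ^ 2 := by
            rw [integral_finsetSum _ hint, Finset.mul_sum]
            exact Finset.sum_congr rfl fun p _ => integral_const_mul _ _
        _ ≤ _ := by
            gcongr
            rw [hA, Finset.mul_sum]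
            refine Finset.sum_le_sum fun p hp => ?_
            rw [Finset.mem_offDiag] at hp
            exact hw K hK _ ((hr p.1 p.2).mono (by omega)) p.1 hp.1 p.2 hp.2.1
    calc Z ≤ ∑ a : Fin n, ∑ b : Fin n, N * (4 * G ^ 4) * (CR * A) :=
          Finset.sum_le_sum fun a _ => Finset.sum_le_sum fun b _ => h1 a b
      _ = M * A := by
          simp only [Finset.sum_const, Finset.card_univ, Fintype.card_fin, nsmul_eq_mul]
          rw [hM]; ring
  have hτint : ∀ a b, IntegrableOn (fun x => (τ x a b) ^ 2) (hull K) := fun a b => (hτ a b).integrable_sq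
  have hςint : ∀ a b, IntegrableOn (fun x => (ς x a b) ^ 2) (hull K) := fun a b =>
    integrableOn_hull K ((hς.continuous a b).pow 2)
  have hi : ∀ a b, IntegrableOn
      (fun x => (1 / 2) * M * (τ x a b) ^ 2 + (1 / 2) * M⁻¹ * (ς x a b) ^ 2) (hull K) := fun a b =>
    ((hτint a b).const_mul _).add ((hςint a b).const_mul _)
  have hi' : ∀ a, IntegrableOn
      (fun x => ∑ b, ((1 / 2) * M * (τ x a b) ^ 2 + (1 / 2) * M⁻¹ * (ς x a b) ^ 2)) (hull K) := fun a =>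
    integrable_finsetSum _ fun b _ => hi a b
  -- Young's inequality weighted by M: since Z ≤ MA, the test field contributes at most A/2, and
  -- absorbing it leaves A ≤ MT/3.
  have hAle : 2 * A ≤ (1 / 2) * (M * T) + (1 / 2) * (M⁻¹ * Z) := by
    rw [← h2A, hmom ς hς]
    calc ∫ x in hull K, frob (τ x) (ς x)
        ≤ ∫ x in hull K, ∑ a, ∑ b, ((1 / 2) * M * (τ x a b) ^ 2 + (1 / 2) * M⁻¹ * (ς x a b) ^ 2) := by
          refine setIntegral_mono (integrable_frob hτ hς.continuous) ?_ fun x => ?_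
          · exact integrable_finsetSum _ fun a _ => hi' a
          · refine Finset.sum_le_sum fun a _ => Finset.sum_le_sum fun b _ => ?_
            have h1 : 0 ≤ (1 / 2) * M⁻¹ * (M * τ x a b - ς x a b) ^ 2 := by positivity
            have h2 : (1 / 2) * M⁻¹ * (M * τ x a b - ς x a b) ^ 2 =
                (1 / 2) * M * (τ x a b) ^ 2 + (1 / 2) * M⁻¹ * (ς x a b) ^ 2 - τ x a b * ς x a b := by
              field_simp
              ring
            linarith
      _ = _ := by
          rw [integral_finsetSum _ fun a _ => hi' a]
          have : ∀ a, ∫ x in hull K, ∑ b, ((1 / 2) * M * (τ x a b) ^ 2 + (1 / 2) * M⁻¹ * (ς x a b) ^ 2) =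
              ∑ b, ((1 / 2) * M * ∫ x in hull K, (τ x a b) ^ 2) +
              ∑ b, ((1 / 2) * M⁻¹ * ∫ x in hull K, (ς x a b) ^ 2) := by
            intro a
            rw [integral_finsetSum _ fun b _ => hi a b, ← Finset.sum_add_distrib]
            refine Finset.sum_congr rfl fun b _ => ?_
            rw [integral_add ((hτint a b).const_mul _) ((hςint a b).const_mul _),
              integral_const_mul, integral_const_mul]
          rw [Finset.sum_congr rfl fun a _ => this a]
          simp only [Finset.sum_add_distrib, ← Finset.mul_sum]
          rw [hT, hZ, cellNormSq, cellNormSq]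
          ring
  have hA3 : A ≤ M * T / 3 := by
    have : M⁻¹ * Z ≤ A := by
      rw [inv_mul_le_iff₀ hM0]; exact hZle
    linarith
  -- bound of the bubble
  have hqle : cellNormSq K q ≤ n ^ 2 * (1 / 4 * N * h ^ 4 * A) := by
    have h1 : ∀ a b, ∫ x in hull K, (q x a b) ^ 2 ≤ 1 / 4 * N * h ^ 4 * A := by
      intro a b
      have hint : ∀ p ∈ K.offDiag, IntegrableOn (fun x => 1 / 4 * N * h ^ 4 * W p x) (hull K) :=
        fun p _ => integrableOn_hull K (continuous_const.mul (hWc p))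
      calc ∫ x in hull K, (q x a b) ^ 2
          ≤ ∫ x in hull K, ∑ p ∈ K.offDiag, 1 / 4 * N * h ^ 4 * W p x := by
            refine setIntegral_mono_on (integrableOn_hull K ((hq.continuous a b).pow 2))
              (integrable_finsetSum _ hint) (isCompact_hull K).measurableSet fun x hx => ?_
            rw [IsFaceBubble.eq_sum_edges hK hq hqr x a b, mul_pow]
            have e0 := sq_sum_le_card_mul_sum_sq (s := K.offDiag) (f := fun p =>
              bary K p.1 x * bary K p.2 x * r p.1 p.2 x * ((p.2 - p.1) a * (p.2 - p.1) b))
            have e1 : ∑ p ∈ K.offDiag,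
                (bary K p.1 x * bary K p.2 x * r p.1 p.2 x * ((p.2 - p.1) a * (p.2 - p.1) b)) ^ 2 ≤
                ∑ p ∈ K.offDiag, h ^ 4 * W p x := by
              refine Finset.sum_le_sum fun p hp => ?_
              rw [Finset.mem_offDiag] at hp
              have l1 := (mem_hull_cell hK).1 hx p.1 hp.1
              have l2 := (mem_hull_cell hK).1 hx p.2 hp.2.1
              have l3 := bary_le_one hK hx hp.1
              have l4 := bary_le_one hK hx hp.2.1
              have l5 : bary K p.1 x * bary K p.2 x ≤ 1 := mul_le_one₀ l3 l2 l4
              have l6 : 0 ≤ bary K p.1 x * bary K p.2 x := mul_nonneg l1 l2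
              have t1 : |(p.2 - p.1) a * (p.2 - p.1) b| ≤ h ^ 2 := by
                rw [abs_mul, sq]
                exact mul_le_mul (he _ hp.1 _ hp.2.1 a) (he _ hp.1 _ hp.2.1 b) (abs_nonneg _) hh0
              have t2 : ((p.2 - p.1) a * (p.2 - p.1) b) ^ 2 ≤ h ^ 4 := by
                rw [← sq_abs]
                calc _ ≤ (h ^ 2) ^ 2 := pow_le_pow_left₀ (abs_nonneg _) t1 2
                  _ = _ := by ring
              have t3 : (bary K p.1 x * bary K p.2 x * r p.1 p.2 x) ^ 2 ≤ W p x := by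
                simp only [W]
                rw [mul_pow]
                refine mul_le_mul_of_nonneg_right ?_ (sq_nonneg _)
                nlinarith
              rw [mul_pow, mul_comm]
              exact mul_le_mul t2 t3 (sq_nonneg _) (by positivity)
            have e2 : 0 ≤ ∑ p ∈ K.offDiag, h ^ 4 * W p x :=
              (Finset.sum_nonneg fun _ _ => sq_nonneg _).trans e1
            calc _ ≤ (-(1 / 2 : ℝ)) ^ 2 * (N * ∑ p ∈ K.offDiag, h ^ 4 * W p x) := by
                  refine mul_le_mul_of_nonneg_left (e0.trans ?_) (sq_nonneg _)
                  exact mul_le_mul hcard e1 (Finset.sum_nonneg fun _ _ => sq_nonneg _) hN0.le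
              _ = _ := by
                  rw [← Finset.mul_sum, ← Finset.mul_sum]; ring
        _ = _ := by
            rw [integral_finsetSum _ hint, hA, Finset.mul_sum]
            exact Finset.sum_congr rfl fun p _ => integral_const_mul _ _
    calc _ ≤ ∑ a : Fin n, ∑ b : Fin n, (1 / 4 * N * h ^ 4 * A) :=
          Finset.sum_le_sum fun a _ => Finset.sum_le_sum fun b _ => h1 a b
      _ = _ := by
          simp only [Finset.sum_const, Finset.card_univ, Fintype.card_fin, nsmul_eq_mul]
          ring
  have hT0 : 0 ≤ T := Finset.sum_nonneg fun a _ => Finset.sum_nonneg fun b _ =>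
    integral_nonneg fun x => sq_nonneg _
  have hhG4 : h ^ 4 * G ^ 4 ≤ γ ^ 4 := by
    rw [← mul_pow]
    exact pow_le_pow_left₀ (by positivity) hhG 4
  calc cellNormSq K q ≤ n ^ 2 * (1 / 4 * N * h ^ 4 * A) := hqle
    _ ≤ n ^ 2 * (1 / 4 * N * h ^ 4 * (M * T / 3)) := by gcongr
    _ = n ^ 2 * N / 12 * (4 * n ^ 2 * N * CR * (h ^ 4 * G ^ 4)) * T := by rw [hM]; ring
    _ ≤ n ^ 2 * N / 12 * (4 * n ^ 2 * N * CR * γ ^ 4) * T := by gcongr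
    _ ≤ _ := by nlinarith

end BubbleStability

/-! ### Unique solvability for the bubble interpolant. -/

section BubbleExistence

/-- In finite dimension the range of a symmetric form is the annihilator of its kernel. Allowing a
kernel is convenient, because distinct polynomials on ℝⁿ may coincide on the simplex where the form
is integrated. -/
theorem exists_eq_of_ker_le {V : Type*} [AddCommGroup V] [Module ℝ V] [FiniteDimensional ℝ V]
    (B : V →ₗ[ℝ] V →ₗ[ℝ] ℝ) (hB : ∀ v w, B v w = B w v) (f : V →ₗ[ℝ] ℝ)
    (hf : ∀ v, B v v = 0 → f v = 0) : ∃ v, B v = f := by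
  have h1 : f ∈ (LinearMap.ker B).dualAnnihilator := by
    rw [Submodule.mem_dualAnnihilator]
    intro v hv
    apply hf
    rw [LinearMap.mem_ker.1 hv, LinearMap.zero_apply]
  rw [← LinearMap.range_dualMap_eq_dualAnnihilator_ker] at h1
  obtain ⟨φ, hφ⟩ := h1
  obtain ⟨v, rfl⟩ := (Module.evalEquiv ℝ V).surjective φ
  refine ⟨v, ?_⟩
  rw [← hφ]
  ext w
  simp [LinearMap.dualMap_apply, hB v w]

variable {n : ℕ} {K : Finset (Pt n)}

/-- `P_r(𝕊)` as a vector space. -/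
def polySymFun (n : ℕ) (r : ℤ) : Submodule ℝ (TensorField n) where
  carrier := {f | IsPolySym r f}
  add_mem' hf hg := ⟨fun x => (hf.1 x).add (hg.1 x), fun i j => (hf.2 i j).add (hg.2 i j)⟩
  zero_mem' := ⟨fun _ => Matrix.isSymm_zero, fun _ _ => isPoly_zero r⟩
  smul_mem' c _ hf := ⟨fun x => (hf.1 x).smul c, fun i j => (hf.2 i j).const_mul c⟩

instance (r : ℤ) : FiniteDimensional ℝ (polySymFun n r) := by
  let E : polySymFun n r →ₗ[ℝ] (Fin n → Fin n → polyFun n r) :=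
    { toFun := fun f i j => ⟨fun x => f.1 x i j, f.2.2 i j⟩
      map_add' := fun _ _ => rfl
      map_smul' := fun _ _ => rfl }
  refine FiniteDimensional.of_injective E fun f g h => ?_
  ext x i j
  have := congrFun (congrArg Subtype.val (congrFun (congrFun h i) j)) x
  exact this

/-- The bubble with edge coefficients read off from `A` at the point `x`. -/
def edgeBubble (K : Finset (Pt n)) (A : Matrix (Fin n) (Fin n) ℝ) (x : Pt n) :
    Matrix (Fin n) (Fin n) ℝ :=
  ∑ p ∈ K.offDiag, (bary K p.1 x * bary K p.2 x * bilin A (p.2 - p.1) (p.2 - p.1)) •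
    outer (p.2 - p.1) (p.2 - p.1)

theorem frob_edgeBubble (A B : Matrix (Fin n) (Fin n) ℝ) (x : Pt n) :
    frob (edgeBubble K A x) B = ∑ p ∈ K.offDiag, bary K p.1 x * bary K p.2 x *
      bilin A (p.2 - p.1) (p.2 - p.1) * bilin B (p.2 - p.1) (p.2 - p.1) := by
  rw [frob_comm, edgeBubble, frob_sum_right]
  exact Finset.sum_congr rfl fun p _ => by rw [frob_smul_right, frob_outer]

theorem edgeBubble_apply (A : Matrix (Fin n) (Fin n) ℝ) (x : Pt n) (a b : Fin n) :
    edgeBubble K A x a b = ∑ p ∈ K.offDiag, bary K p.1 x * bary K p.2 x *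
      bilin A (p.2 - p.1) (p.2 - p.1) * ((p.2 - p.1) a * (p.2 - p.1) b) := by
  simp [edgeBubble, Matrix.sum_apply, outer]

theorem isPolySym_edgeBubble {k : ℕ} {ς : TensorField n} (hς : IsPolySym ((k : ℤ) - 2) ς) :
    IsPolySym k (fun x => edgeBubble K (ς x) x) := by
  refine ⟨fun x => Matrix.IsSymm.ext fun a b => ?_, fun a b => ?_⟩
  · change edgeBubble K (ς x) x b a = edgeBubble K (ς x) x a b
    rw [edgeBubble_apply, edgeBubble_apply]
    exact Finset.sum_congr rfl fun p _ => by ring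
  · simp only [edgeBubble_apply]
    refine IsPoly.sum _ fun p _ => IsPoly.mul_const ?_ _
    exact (((bary_isPoly K p.1).mul (bary_isPoly K p.2)).mul (hς.bilin _ _)).mono (by omega)

/-- For an edge and a face `D`, either an endpoint lies outside `D`, and its coordinate vanishes on
`D`, or the edge is tangential to `D` and orthogonal to ν. -/
theorem isFaceBubble_edgeBubble (hK : IsCell K) (ς : TensorField n) :
    IsFaceBubble K (fun x => edgeBubble K (ς x) x) := by
  intro D hD hDK x hx ν hν w
  change bilin (edgeBubble K (ς x) x) w ν = 0
  rw [← frob_outer, frob_comm, edgeBubble, frob_sum_right]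
  refine Finset.sum_eq_zero fun p hp => ?_
  rw [Finset.mem_offDiag] at hp
  have hx' := ((mem_hull_face hK hD).1 hx).2
  rw [frob_smul_right]
  by_cases h1 : p.1 ∈ D
  · by_cases h2 : p.2 ∈ D
    · have h3 : ∑ j, (p.2 - p.1) j * ν j = 0 := by
        have := Submodule.inner_right_of_mem_orthogonal (sub_mem_tangents h2 h1) hν
        rw [PiLp.inner_apply] at this
        simpa [mul_comm] using this
      have h4 : frob (outer w ν) (outer (p.2 - p.1) (p.2 - p.1)) = 0 := by
        have : frob (outer w ν) (outer (p.2 - p.1) (p.2 - p.1)) =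
            (∑ i, w i * (p.2 - p.1) i) * ∑ j, (p.2 - p.1) j * ν j := by
          simp only [frob, outer, Matrix.of_apply]
          rw [Finset.sum_mul_sum]
          exact Finset.sum_congr rfl fun i _ => Finset.sum_congr rfl fun j _ => by ring
        rw [this, h3, mul_zero]
      rw [h4, mul_zero]
    · rw [hx' p.2 hp.2.1 h2]; ring
  · rw [hx' p.1 hp.1 h1]; ring

theorem IsFaceBubble.vanishingBoundaryDofs {q : TensorField n} (hb : IsFaceBubble K q) (k : ℕ) :
    VanishingBoundaryDofs K k q := by
  intro D hD hne hDK p hp ν hν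
  have h : ∀ w, ∫ x, bilin (q x) w ν * p x ∂(simplexMeasure D) = 0 := by
    intro w
    rw [simplexMeasure, setIntegral_congr_fun (g := fun _ => (0 : ℝ))
      (isCompact_hull D).measurableSet fun x hx => by
        simp only [hb D hD hDK x hx ν hν w, zero_mul]]
    simp
  exact ⟨fun t _ => h t, fun ν' _ => h ν'⟩

/-- The pairing of `edgeBubble` of ς with ς' is Σ ∫ λ_iλ_j (t_ijᵀ ς t_ij)(t_ijᵀ ς' t_ij), which is
symmetric. If it vanishes at (ς, ς), all edge components of ς vanish on K, hence ς does and so does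
its pairing with τ; the moment equations are thus solvable. -/
theorem exists_bubble (hK : IsCell K) (k : ℕ) (τ : TensorField n)
    (hτ : ∀ a b, MemLp (fun x => τ x a b) 2 (volume.restrict (hull K))) :
    ∃ q, IsPolySym k q ∧ VanishingBoundaryDofs K k q ∧ IsFaceBubble K q ∧
      ∀ ς, IsPolySym ((k : ℤ) - 2) ς →
        ∫ x in hull K, frob (q x) (ς x) = ∫ x in hull K, frob (τ x) (ς x) := by
  let V := polySymFun n ((k : ℤ) - 2)
  have hint : ∀ ς ς' : V, IntegrableOn (fun x => frob (edgeBubble K (ς.1 x) x) (ς'.1 x)) (hull K) :=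
    fun ς ς' => integrable_frob (fun a b => memLp_hull_of_continuous K
      ((isPolySym_edgeBubble ς.2).continuous a b)) ς'.2.continuous
  have hintτ : ∀ ς : V, IntegrableOn (fun x => frob (τ x) (ς.1 x)) (hull K) :=
    fun ς => integrable_frob hτ ς.2.continuous
  have hsymm : ∀ ς ς' : V, ∀ x, frob (edgeBubble K (ς.1 x) x) (ς'.1 x) =
      frob (edgeBubble K (ς'.1 x) x) (ς.1 x) := by
    intro ς ς' x
    rw [frob_edgeBubble, frob_edgeBubble]
    exact Finset.sum_congr rfl fun p _ => by ring
  let B : V →ₗ[ℝ] V →ₗ[ℝ] ℝ := LinearMap.mk₂ ℝ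
    (fun ς ς' => ∫ x in hull K, frob (edgeBubble K (ς.1 x) x) (ς'.1 x))
    (fun ς₁ ς₂ ς' => by
      rw [← integral_add (hint _ _) (hint _ _)]
      refine integral_congr_ae (ae_of_all _ fun x => ?_)
      simp only [hsymm _ ς']
      exact frob_add_right _ _ _)
    (fun c ς ς' => by
      rw [smul_eq_mul, ← integral_const_mul]
      refine integral_congr_ae (ae_of_all _ fun x => ?_)
      simp only [hsymm _ ς']
      exact frob_smul_right _ _ _)
    (fun ς ς₁ ς₂ => by
      rw [← integral_add (hint _ _) (hint _ _)]
      exact integral_congr_ae (ae_of_all _ fun x => frob_add_right _ _ _))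
    (fun c ς ς' => by
      rw [smul_eq_mul, ← integral_const_mul]
      exact integral_congr_ae (ae_of_all _ fun x => frob_smul_right _ _ _))
  let f : V →ₗ[ℝ] ℝ :=
    { toFun := fun ς => ∫ x in hull K, frob (τ x) (ς.1 x)
      map_add' := fun ς ς' => by
        rw [← integral_add (hintτ _) (hintτ _)]
        exact integral_congr_ae (ae_of_all _ fun x => frob_add_right _ _ _)
      map_smul' := fun c ς => by
        rw [RingHom.id_apply, smul_eq_mul, ← integral_const_mul]
        exact integral_congr_ae (ae_of_all _ fun x => frob_smul_right _ _ _) }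
  obtain ⟨ς, hς⟩ := exists_eq_of_ker_le B
    (fun ς ς' => integral_congr_ae (ae_of_all _ fun x => hsymm ς ς' x)) f (fun ς h0 => by
      have h1 : ∑ p ∈ K.offDiag, ∫ x in hull K, bary K p.1 x * bary K p.2 x *
          bilin (ς.1 x) (p.2 - p.1) (p.2 - p.1) ^ 2 = 0 := by
        rw [← h0, ← integral_finsetSum]
        · refine integral_congr_ae (ae_of_all _ fun x => ?_)
          simp only [frob_edgeBubble]
          exact Finset.sum_congr rfl fun p _ => by ring
        · exact fun p _ => integrableOn_hull K (((bary_continuous K _).mul (bary_continuous K _)).mul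
            ((ς.2.bilin _ _).continuous.pow 2))
      have h2 := (Finset.sum_eq_zero_iff_of_nonneg fun p hp => by
        rw [Finset.mem_offDiag] at hp
        refine setIntegral_nonneg (isCompact_hull K).measurableSet fun x hx => ?_
        have e1 := (mem_hull_cell hK).1 hx p.1 hp.1
        have e2 := (mem_hull_cell hK).1 hx p.2 hp.2.1
        positivity).1 h1
      have h3 : ∀ x ∈ hull K, ς.1 x = 0 := by
        intro x hx
        refine matrix_eq_zero_of_edges hK (ς.2.1 x) fun i hi j hj => ?_
        by_cases hij : i = j
        · rw [hij, sub_self, bilin_zero_left]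
        · exact poly_eq_zero_of_weighted hK (k := k) ((ς.2.bilin _ _).mono (by omega)) hi hj
            (h2 (i, j) (Finset.mem_offDiag.2 ⟨hi, hj, hij⟩)) hx
      change ∫ x in hull K, frob (τ x) (ς.1 x) = 0
      rw [setIntegral_congr_fun (g := fun _ => (0 : ℝ)) (isCompact_hull K).measurableSet
        fun x hx => by simp [h3 x hx, frob]]
      simp)
  refine ⟨fun x => edgeBubble K (ς.1 x) x, isPolySym_edgeBubble ς.2,
    (isFaceBubble_edgeBubble hK ς.1).vanishingBoundaryDofs k, isFaceBubble_edgeBubble hK ς.1,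
    fun ς' hς' => ?_⟩
  exact LinearMap.congr_fun hς (⟨ς', hς'⟩ : V)

/-- The difference is a bubble with vanishing moments, and stability against the zero field makes it
zero. -/
theorem bubble_unique (hn : 1 ≤ n) (hK : IsCell K) {k : ℕ} (hk : 1 ≤ k) {q q' : TensorField n}
    (hq : IsPolySym k q) (hq' : IsPolySym k q') (hb : VanishingBoundaryDofs K k q)
    (hb' : VanishingBoundaryDofs K k q')
    (h : ∀ ς, IsPolySym ((k : ℤ) - 2) ς →
      ∫ x in hull K, frob (q x) (ς x) = ∫ x in hull K, frob (q' x) (ς x)) : q = q' := by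
  have hd : IsPolySym k (q - q') := (polySymFun n k).sub_mem hq hq'
  have hdb : IsFaceBubble K (q - q') := by
    intro D hD hDK x hx ν hν w
    have h1 := hb.isFaceBubble hK hk hq D hD hDK x hx ν hν w
    have h2 := hb'.isFaceBubble hK hk hq' D hD hDK x hx ν hν w
    rw [← frob_outer, frob_comm] at h1 h2 ⊢
    have : (q - q') x = q x + (-1 : ℝ) • q' x := by
      simp [sub_eq_add_neg]
    rw [this, frob_add_right, frob_smul_right, h1, h2]
    ring
  obtain ⟨c, hc⟩ := interior_cell_nonempty hK
  obtain ⟨ρ, hρ, hball⟩ := Metric.nhds_basis_closedBall.mem_iff.1 (mem_interior_iff_mem_nhds.1 hc)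
  -- Any ball inside K will do: the regularity parameter is chosen so that the ball found above is
  -- admissible.
  obtain ⟨C, hC, hst⟩ := exists_bubble_stability n hn k hk (cellDiam K / (2 * ρ))
  have h1 := hst K hK c ρ hρ hball (by field_simp; rfl) _ hd hdb 0
    (fun a b => by simp) (fun ς hς => by
      have e1 : ∀ x, frob ((q - q') x) (ς x) = frob (q x) (ς x) - frob (q' x) (ς x) := by
        intro x
        have : (q - q') x = q x + (-1 : ℝ) • q' x := by
          simp [sub_eq_add_neg]
        rw [frob_comm, this, frob_add_right, frob_smul_right, frob_comm, frob_comm (ς x)]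
        ring
      simp only [e1]
      rw [integral_sub, h ς hς, sub_self]
      · simp [frob]
      · exact integrable_frob (fun a b => memLp_hull_of_continuous K (hq.continuous a b)) hς.continuous
      · exact integrable_frob (fun a b => memLp_hull_of_continuous K (hq'.continuous a b)) hς.continuous)
  have h2 : cellNormSq K (0 : TensorField n) = 0 := by simp [cellNormSq]
  rw [h2, mul_zero] at h1
  have h3 : ∀ a b, ∫ x in hull K, ((q - q') x a b) ^ 2 ≤ 0 := by
    intro a b
    refine le_trans ?_ h1
    refine le_trans ?_ (Finset.single_le_sum (f := fun a => ∑ b, ∫ x in hull K, ((q - q') x a b) ^ 2)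
      (fun a _ => Finset.sum_nonneg fun b _ => integral_nonneg fun x => sq_nonneg _)
      (Finset.mem_univ a))
    exact Finset.single_le_sum (f := fun b => ∫ x in hull K, ((q - q') x a b) ^ 2)
      (fun b _ => integral_nonneg fun x => sq_nonneg _) (Finset.mem_univ b)
  obtain ⟨C', hC', hs⟩ := exists_sq_le_integral_cell n k
  rw [← sub_eq_zero]
  funext x
  ext a b
  have h4 : (fun x => (q - q') x a b) = 0 := poly_eq_zero_of_hull hK (hd.2 a b) fun x hx => by
    have e1 := hs K hK _ (hd.2 a b) x hx
    have e2 := volume_hull_pos hK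
    have e3 := h3 a b
    have e4 : ((q - q') x a b) ^ 2 ≤ 0 := by
      by_contra hcon
      push Not at hcon
      nlinarith [mul_pos hcon e2]
    exact pow_eq_zero_iff (two_ne_zero) |>.1 (le_antisymm e4 (sq_nonneg _))
  exact congrFun h4 x

end BubbleExistence

/-! ### Polar coordinates at a vertex and the trace inequality on facets. -/

section Cone

variable {n : ℕ} {K : Finset (Pt n)}

theorem bary_homothety (K : Finset (Pt n)) (u v y : Pt n) (s : ℝ) :
    bary K u (v + s • (y - v)) = bary K u v + s * (bary K u y - bary K u v) := by
  rw [bary_add, inner_smul_right, bary_sub]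

theorem IsCell.exists_ne (hK : IsCell K) (hn : 1 ≤ n) (v : Pt n) : ∃ w ∈ K, w ≠ v := by
  have : 1 < K.card := by rw [hK.2]; omega
  exact Finset.exists_mem_ne this v

/-- Along an edge starting at v, the coordinate of v drops from 1 to 0 over a length of at most the
diameter. -/
theorem one_le_norm_baryGrad_mul (hn : 1 ≤ n) (hK : IsCell K) {v : Pt n} (hv : v ∈ K) :
    1 ≤ ‖baryGrad K v‖ * cellDiam K := by
  classical
  obtain ⟨w, hw, hwv⟩ := hK.exists_ne hn v
  have h1 := inner_baryGrad_sub hK hv hv hw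
  rw [if_pos rfl, if_neg hwv.symm, sub_zero] at h1
  rw [← h1]
  exact (real_inner_le_norm _ _).trans (mul_le_mul_of_nonneg_left
    (dist_le_cellDiam (subset_hull hv) (subset_hull hw)) (norm_nonneg _))

theorem norm_baryGrad_pos (hn : 1 ≤ n) (hK : IsCell K) {v : Pt n} (hv : v ∈ K) :
    0 < ‖baryGrad K v‖ := by
  have h1 := one_le_norm_baryGrad_mul hn hK hv
  refine (norm_nonneg _).lt_of_ne fun h => ?_
  rw [← h, zero_mul] at h1
  linarith

theorem facet_measure (hn : 1 ≤ n) (hK : IsCell K) {v : Pt n} (hv : v ∈ K) :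
    (μHE[n - 1] : Measure (Pt n)) (hull (K.erase v)) ≠ ⊤ ∧
      (μHE[n - 1] : Measure (Pt n)) (hull (K.erase v)) ≠ 0 := by
  have hc : (K.erase v).card = n := by rw [Finset.card_erase_of_mem hv, hK.2]; rfl
  have := simplexMeasure_hull_ne_top (s := K.erase v)
    (hK.1.mono (Finset.coe_subset.2 (Finset.erase_subset v K)))
    (Finset.card_pos.1 (by omega))
  rwa [hc] at this

theorem eq_erase_of_card (hK : IsCell K) {F : Finset (Pt n)} (hF : F ⊆ K) (hc : F.card = n) :
    ∃ v ∈ K, F = K.erase v := by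
  have h1 : (K \ F).card = 1 := by
    rw [Finset.card_sdiff_of_subset hF, hK.2, hc]; omega
  obtain ⟨v, hv⟩ := Finset.card_eq_one.1 h1
  have hvK : v ∈ K \ F := by rw [hv]; simp
  refine ⟨v, (Finset.mem_sdiff.1 hvK).1, ?_⟩
  rw [← Finset.sdiff_singleton_eq_erase, ← hv, Finset.sdiff_sdiff_eq_self hF]

/-- The slice of K at height λ_v = 1 − s is the opposite facet shrunk towards v by the ratio s. -/
theorem mem_cone_iff (hK : IsCell K) {v : Pt n} (hv : v ∈ K) {s : ℝ} (hs : 0 < s) (hs1 : s < 1)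
    (y : Pt n) : v + s • (y - v) ∈ hull K ∧ bary K v (v + s • (y - v)) = 1 - s ↔
      y ∈ hull (K.erase v) := by
  have hb : bary K v v = 1 := bary_self hK hv
  rw [mem_hull_face hK (Finset.erase_subset v K), bary_homothety, hb, mem_hull_cell hK]
  constructor
  · rintro ⟨h1, h2⟩
    have h0 : bary K v y = 0 := by
      have : s * bary K v y = 0 := by linarith
      exact (mul_eq_zero.1 this).resolve_left hs.ne'
    refine ⟨(mem_hull_cell hK).2 fun u hu => ?_, fun u hu hue => ?_⟩
    · by_cases huv : u = v
      · rw [huv, h0]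
      · have := h1 u hu
        rw [bary_homothety, bary_of_ne hK hu hv huv] at this
        have h3 : 0 ≤ s * bary K u y := by linarith
        exact nonneg_of_mul_nonneg_right h3 hs
    · have : u = v := by
        by_contra h
        exact hue (Finset.mem_erase.2 ⟨h, hu⟩)
      rw [this, h0]
  · rintro ⟨h1, h2⟩
    have h0 : bary K v y = 0 := h2 v hv (Finset.notMem_erase v K)
    refine ⟨fun u hu => ?_, by rw [h0]; ring⟩
    have h3 := (mem_hull_cell hK).1 h1 u hu
    rw [bary_homothety]
    by_cases huv : u = v
    · rw [huv, hb, h0]; linarith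
    · rw [bary_of_ne hK hu hv huv]
      have := mul_nonneg hs.le h3
      linarith

/-- Slice by the hyperplanes λ_v = 1 − s. Each slice is a copy of the opposite facet at ratio s,
whence s^(n−1), and the factor in front is the height of K over that facet. -/
theorem volume_cone (hn : 1 ≤ n) (hK : IsCell K) {v : Pt n} (hv : v ∈ K) {t : Set (Pt n)}
    (ht : MeasurableSet t) :
    volume (t ∩ hull K) = ENNReal.ofReal ‖baryGrad K v‖⁻¹ * ∫⁻ s in Set.Ioo (0 : ℝ) 1,
      ENNReal.ofReal (s ^ (n - 1)) *
        (μHE[n - 1] : Measure (Pt n)) ({y | v + s • (y - v) ∈ t} ∩ hull (K.erase v)) := by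
  set g := baryGrad K v with hg
  have hg0 : 0 < ‖g‖ := norm_baryGrad_pos hn hK hv
  -- This is the altitude vector from v to the hyperplane of the opposite facet: λ_v decreases by 1
  -- along it.
  set w : Pt n := (-(‖g‖ ^ 2)⁻¹) • g with hw
  have hwn : ‖w‖ = ‖g‖⁻¹ := by
    rw [hw, norm_smul, norm_neg, norm_inv, norm_pow, norm_norm]
    field_simp
  have hw0 : w ≠ 0 := by
    rw [← norm_pos_iff, hwn]; positivity
  have key := EuclideanGeometry.euclideanHausdorffMeasure_eq_lintegral v hw0
    (ht.inter (isCompact_hull K).measurableSet)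
  rw [finrank_euclideanSpace, Fintype.card_fin, euclideanHausdorffMeasure_eq_volume, ← ofReal_norm,
    hwn] at key
  rw [key, ← lintegral_indicator measurableSet_Ioo]
  congr 1
  have hlev : ∀ (s : ℝ) (y : Pt n), y ∈ AffineSubspace.mk' (s • w +ᵥ v) (Submodule.span ℝ {w})ᗮ ↔
      bary K v y = 1 - s := by
    intro s y
    have hgw : inner ℝ g w = -1 := by
      rw [hw, inner_smul_right, real_inner_self_eq_norm_sq]
      field_simp
    rw [AffineSubspace.mem_mk', Submodule.mem_orthogonal_singleton_iff_inner_right, hw,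
      real_inner_smul_left, vsub_eq_sub, vadd_eq_add, ← hw, ← sub_sub, sub_right_comm, inner_sub_right, inner_smul_right,
      hgw, ← bary_sub, bary_self hK hv]
    have : -(‖g‖ ^ 2)⁻¹ ≠ 0 := by
      rw [neg_ne_zero]; positivity
    rw [mul_eq_zero, or_iff_right this]
    constructor <;> intro h <;> linarith
  have hae : ∀ᵐ s : ℝ, s ≠ 0 ∧ s ≠ 1 := by
    refine (ae_iff.2 ?_ : ∀ᵐ s : ℝ, s ≠ 0).and (ae_iff.2 ?_) <;> simp
  refine lintegral_congr_ae ?_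
  filter_upwards [hae] with s hs
  by_cases hs01 : s ∈ Set.Ioo (0 : ℝ) 1
  · rw [Set.indicator_of_mem hs01]
    have himg : t ∩ hull K ∩ (AffineSubspace.mk' (s • w +ᵥ v) (Submodule.span ℝ {w})ᗮ : Set (Pt n)) =
        AffineMap.homothety v s '' ({y | v + s • (y - v) ∈ t} ∩ hull (K.erase v)) := by
      ext z
      constructor
      · rintro ⟨⟨hzt, hzK⟩, hz⟩
        have hz' := (hlev s z).1 hz
        have e : v + s • ((v + s⁻¹ • (z - v)) - v) = z := by
          rw [add_sub_cancel_left, smul_smul, mul_inv_cancel₀ hs.1, one_smul, add_sub_cancel]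
        refine ⟨v + s⁻¹ • (z - v), ⟨?_, ?_⟩, ?_⟩
        · rw [Set.mem_ofPred_eq, e]; exact hzt
        · rw [← mem_cone_iff hK hv hs01.1 hs01.2, e]
          exact ⟨hzK, hz'⟩
        · rw [AffineMap.homothety_apply, vsub_eq_sub, vadd_eq_add, add_comm, e]
      · rintro ⟨y, ⟨hyt, hy⟩, rfl⟩
        rw [AffineMap.homothety_apply, vsub_eq_sub, vadd_eq_add]
        rw [← mem_cone_iff hK hv hs01.1 hs01.2] at hy
        rw [Set.mem_ofPred_eq, add_comm] at hyt
        rw [add_comm] at hy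
        exact ⟨⟨hyt, hy.1⟩, (hlev s _).2 hy.2⟩
    rw [himg, euclideanHausdorffMeasure_homothety_image _ _ hs.1, ENNReal.smul_def, smul_eq_mul,
      ENNReal.ofReal_pow hs01.1.le]
    congr 1
    rw [ENNReal.coe_pow, ← enorm_eq_nnnorm, Real.enorm_eq_ofReal hs01.1.le]
  · rw [Set.indicator_of_notMem hs01]
    have : t ∩ hull K ∩ (AffineSubspace.mk' (s • w +ᵥ v) (Submodule.span ℝ {w})ᗮ : Set (Pt n)) = ∅ := by
      rw [Set.eq_empty_iff_forall_notMem]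
      rintro z ⟨⟨_, hzK⟩, hz⟩
      have hz' := (hlev s z).1 hz
      have h1 := (mem_hull_cell hK).1 hzK v hv
      have h2 := bary_le_one hK hzK hv
      exact hs01 ⟨lt_of_le_of_ne (by linarith) hs.1.symm, lt_of_le_of_ne (by linarith) hs.2⟩
    rw [this, measure_empty]

/-- The slicing formula for sets says that the volume on K is, up to the height, the image of the
measure s^(n−1) ds times the facet measure; integrals follow by transport and Tonelli. -/
theorem lintegral_cone (hn : 1 ≤ n) (hK : IsCell K) {v : Pt n} (hv : v ∈ K) {f : Pt n → ENNReal}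
    (hf : Measurable f) :
    ∫⁻ y in hull (K.erase v), (∫⁻ s in Set.Ioo (0 : ℝ) 1,
      ENNReal.ofReal (s ^ (n - 1)) * f (v + s • (y - v))) ∂(μHE[n - 1] : Measure (Pt n)) =
      ENNReal.ofReal ‖baryGrad K v‖ * ∫⁻ x in hull K, f x := by
  set μF := (μHE[n - 1] : Measure (Pt n)).restrict (hull (K.erase v)) with hμF
  have : IsFiniteMeasure μF := ⟨by
    rw [hμF, Measure.restrict_apply_univ]; exact (facet_measure hn hK hv).1.lt_top⟩
  have hm : Measurable fun s : ℝ => ENNReal.ofReal (s ^ (n - 1)) := by fun_prop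
  have hP : Measurable fun p : ℝ × Pt n => v + p.1 • (p.2 - v) := by fun_prop
  have key : volume.restrict (hull K) = ENNReal.ofReal ‖baryGrad K v‖⁻¹ • Measure.map
      (fun p : ℝ × Pt n => v + p.1 • (p.2 - v))
      (((volume.restrict (Set.Ioo (0 : ℝ) 1)).withDensity fun s => ENNReal.ofReal (s ^ (n - 1))).prod
        μF) := by
    ext t ht
    rw [Measure.restrict_apply ht, volume_cone hn hK hv ht, Measure.smul_apply,
      Measure.map_apply hP ht, Measure.prod_apply (hP ht),
      lintegral_withDensity_eq_lintegral_mul _ hm (measurable_measure_prodMk_left (hP ht)), smul_eq_mul]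
    congr 1
    refine lintegral_congr fun s => ?_
    rw [Pi.mul_apply, hμF, Measure.restrict_apply]
    · rfl
    · exact measurable_prodMk_left (hP ht)
  have hg0 : 0 < ‖baryGrad K v‖ := norm_baryGrad_pos hn hK hv
  rw [key, lintegral_smul_measure, smul_eq_mul, ← mul_assoc, ← ENNReal.ofReal_mul hg0.le,
    mul_inv_cancel₀ hg0.ne', ENNReal.ofReal_one, one_mul, lintegral_map hf hP]
  refine Eq.trans (lintegral_congr fun y => ?_) (lintegral_prod_symm' _ (hf.comp hP)).symm
  rw [lintegral_withDensity_eq_lintegral_mul _ hm]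
  · rfl
  · exact hf.comp (hP.comp measurable_prodMk_right)

/-- The area of the facet opposite to `v`. -/
theorem facet_measure_eq (hn : 1 ≤ n) (hK : IsCell K) {v : Pt n} (hv : v ∈ K) :
    (μHE[n - 1] : Measure (Pt n)).real (hull (K.erase v)) =
      n * ‖baryGrad K v‖ * volume.real (hull K) := by
  -- For the constant function the ray integral is ∫ s^(n−1) ds = 1/n.
  have h := lintegral_cone hn hK hv (f := fun _ => 1) measurable_const
  have hn0 : (0 : ℝ) < n := by exact_mod_cast hn
  have h1 : ∫⁻ s in Set.Ioo (0 : ℝ) 1, ENNReal.ofReal (s ^ (n - 1)) * 1 = ENNReal.ofReal (n : ℝ)⁻¹ := by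
    simp only [mul_one]
    rw [← ofReal_integral_eq_lintegral_ofReal, ← integral_Ioc_eq_integral_Ioo,
      ← intervalIntegral.integral_of_le zero_le_one, integral_pow]
    · congr 1
      have : ((n - 1 : ℕ) : ℝ) + 1 = n := by
        exact_mod_cast Nat.sub_add_cancel hn
      rw [this, one_pow, zero_pow (by omega), sub_zero, one_div]
    · exact ((continuous_pow (n - 1)).integrableOn_Icc (a := 0) (b := 1)).mono_set Set.Ioo_subset_Icc_self
    · filter_upwards [ae_restrict_mem measurableSet_Ioo] with s hs
      exact pow_nonneg hs.1.le _
  simp only [h1] at h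
  rw [lintegral_const, lintegral_const, one_mul, Measure.restrict_apply_univ,
    Measure.restrict_apply_univ] at h
  have h2 := congrArg ENNReal.toReal h
  rw [ENNReal.toReal_mul, ENNReal.toReal_mul, ENNReal.toReal_ofReal (by positivity),
    ENNReal.toReal_ofReal (by positivity)] at h2
  rw [Measure.real, Measure.real, mul_assoc, ← h2]
  field_simp

/-- Fundamental theorem of calculus for s^n φ² on the segment from v to y: the power s^n removes the
contribution of the vertex and leaves the Jacobian s^(n−1) of polar coordinates. -/
theorem sq_le_integral_segment (hn : 1 ≤ n) {v y : Pt n} {h : ℝ} (hvy : ‖y - v‖ ≤ h) {φ : Pt n → ℝ}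
    (hφ : ContDiff ℝ 1 φ) :
    φ y ^ 2 ≤ ∫ s in (0 : ℝ)..1, s ^ (n - 1) * ((n + 1) * φ (v + s • (y - v)) ^ 2 +
      h ^ 2 * ‖fderiv ℝ φ (v + s • (y - v))‖ ^ 2) := by
  have hd : Differentiable ℝ φ := hφ.differentiable one_ne_zero
  have hdc : Continuous (fderiv ℝ φ) := hφ.continuous_fderiv one_ne_zero
  have hφc := hφ.continuous
  have hline : ∀ s : ℝ, HasDerivAt (fun s : ℝ => v + s • (y - v)) (y - v) s := by
    intro s
    simpa using ((hasDerivAt_id s).smul_const (y - v)).const_add v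
  have hder : ∀ s : ℝ, HasDerivAt (fun s : ℝ => s ^ n * φ (v + s • (y - v)) ^ 2)
      (n * s ^ (n - 1) * φ (v + s • (y - v)) ^ 2 +
        s ^ n * (2 * φ (v + s • (y - v)) * fderiv ℝ φ (v + s • (y - v)) (y - v))) s := by
    intro s
    have h1 := (hd (v + s • (y - v))).hasFDerivAt.comp_hasDerivAt s (hline s)
    have h2 := (hasDerivAt_pow n s).mul (h1.pow 2)
    refine h2.congr_deriv ?_
    norm_num
  have hcont : Continuous fun s : ℝ => n * s ^ (n - 1) * φ (v + s • (y - v)) ^ 2 +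
        s ^ n * (2 * φ (v + s • (y - v)) * fderiv ℝ φ (v + s • (y - v)) (y - v)) := by fun_prop
  have hcont2 : Continuous fun s : ℝ => s ^ (n - 1) * ((n + 1) * φ (v + s • (y - v)) ^ 2 +
      h ^ 2 * ‖fderiv ℝ φ (v + s • (y - v))‖ ^ 2) := by fun_prop
  have hftc := intervalIntegral.integral_eq_sub_of_hasDerivAt (a := 0) (b := 1) (fun s _ => hder s)
    (hcont.intervalIntegrable _ _)
  have e1 : φ y ^ 2 = (1 : ℝ) ^ n * φ (v + (1 : ℝ) • (y - v)) ^ 2 -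
      (0 : ℝ) ^ n * φ (v + (0 : ℝ) • (y - v)) ^ 2 := by
    rw [zero_pow (by omega), one_pow, one_smul, add_sub_cancel]; ring
  rw [e1, ← hftc]
  refine intervalIntegral.integral_mono_on zero_le_one (hcont.intervalIntegrable _ _)
    (hcont2.intervalIntegrable _ _) fun s hs => ?_
  set z := v + s • (y - v)
  set D := fderiv ℝ φ z (y - v) with hD
  have hDle : D ^ 2 ≤ h ^ 2 * ‖fderiv ℝ φ z‖ ^ 2 := by
    rw [← mul_pow, ← sq_abs]
    refine pow_le_pow_left₀ (abs_nonneg _) ?_ 2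
    rw [← Real.norm_eq_abs, mul_comm]
    exact ((fderiv ℝ φ z).le_opNorm _).trans (mul_le_mul_of_nonneg_left hvy (norm_nonneg _))
  have hs' : s ^ n = s ^ (n - 1) * s := by rw [← pow_succ, Nat.sub_add_cancel hn]
  rw [hs']
  have h0 : 0 ≤ s ^ (n - 1) := pow_nonneg hs.1 _
  have h1 : s * (2 * φ z * D) ≤ φ z ^ 2 + D ^ 2 := by
    have t1 : 2 * φ z * D ≤ φ z ^ 2 + D ^ 2 := by nlinarith [sq_nonneg (φ z - D)]
    have t2 : 0 ≤ φ z ^ 2 + D ^ 2 := by positivity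
    calc s * (2 * φ z * D) ≤ s * (φ z ^ 2 + D ^ 2) := mul_le_mul_of_nonneg_left t1 hs.1
      _ ≤ 1 * (φ z ^ 2 + D ^ 2) := mul_le_mul_of_nonneg_right hs.2 t2
      _ = _ := one_mul _
  calc _ = s ^ (n - 1) * (n * φ z ^ 2 + s * (2 * φ z * D)) := by ring
    _ ≤ _ := mul_le_mul_of_nonneg_left (by linarith) h0

/-- The trace inequality on the facet opposite to `v`. -/
theorem integral_facet_sq_le (hn : 1 ≤ n) (hK : IsCell K) {v : Pt n} (hv : v ∈ K) {φ : Pt n → ℝ}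
    (hφ : ContDiff ℝ 1 φ) :
    ∫ y in hull (K.erase v), φ y ^ 2 ∂(μHE[n - 1] : Measure (Pt n)) ≤
      ‖baryGrad K v‖ * ((n + 1) * (∫ x in hull K, φ x ^ 2) +
        cellDiam K ^ 2 * ∫ x in hull K, ‖fderiv ℝ φ x‖ ^ 2) := by
  have hdc : Continuous (fderiv ℝ φ) := hφ.continuous_fderiv one_ne_zero
  have hφc := hφ.continuous
  set h := cellDiam K
  set G : Pt n → ℝ := fun x => (n + 1) * φ x ^ 2 + h ^ 2 * ‖fderiv ℝ φ x‖ ^ 2 with hG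
  have hGc : Continuous G := by fun_prop
  have hG0 : ∀ x, 0 ≤ G x := fun x => by simp only [hG]; positivity
  have hGi : ∫ x in hull K, G x = (n + 1) * (∫ x in hull K, φ x ^ 2) +
      h ^ 2 * ∫ x in hull K, ‖fderiv ℝ φ x‖ ^ 2 := by
    simp only [hG]
    rw [integral_add (integrableOn_hull K (by fun_prop)) (integrableOn_hull K (by fun_prop)),
      integral_const_mul, integral_const_mul]
  rw [← hGi, ← ENNReal.ofReal_le_ofReal_iff
    (mul_nonneg (norm_nonneg _) (integral_nonneg hG0)), ENNReal.ofReal_mul (norm_nonneg _),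
    ofReal_integral_eq_lintegral_ofReal (integrableOn_hull K hGc) (ae_of_all _ hG0),
    ← lintegral_cone hn hK hv (by fun_prop),
    ofReal_integral_eq_lintegral_ofReal
      (integrableOn_of_continuous (isCompact_hull _) (facet_measure hn hK hv).1 (by fun_prop))
      (ae_of_all _ fun y => sq_nonneg _)]
  refine setLIntegral_mono' (isCompact_hull _).measurableSet fun y hy => ?_
  have hyK : y ∈ hull K := hull_mono (Finset.erase_subset v K) hy
  have hcont : Continuous fun s : ℝ => s ^ (n - 1) * G (v + s • (y - v)) := by fun_prop
  have h1 := sq_le_integral_segment hn (dist_le_cellDiam hyK (subset_hull hv)) hφ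
  rw [intervalIntegral.integral_of_le zero_le_one, integral_Ioc_eq_integral_Ioo] at h1
  refine (ENNReal.ofReal_le_ofReal h1).trans (le_of_eq ?_)
  rw [ofReal_integral_eq_lintegral_ofReal]
  · refine setLIntegral_congr_fun measurableSet_Ioo fun s hs => ?_
    rw [ENNReal.ofReal_mul (pow_nonneg hs.1.le _)]
  · exact (hcont.integrableOn_Icc (a := 0) (b := 1)).mono_set Set.Ioo_subset_Icc_self
  · filter_upwards [ae_restrict_mem measurableSet_Ioo] with s hs
    exact mul_nonneg (pow_nonneg hs.1.le _) (hG0 _)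

end Cone

/-! ### Classical partial derivatives of any order. -/

section PartialDerivatives

variable {n : ℕ}

theorem partialDeriv_zero (α : Fin 0 → Fin n) (φ : Pt n → ℝ) : partialDeriv α φ = φ := by
  funext x
  simp [partialDeriv]

theorem partialDeriv_succ {j : ℕ} (α : Fin (j + 1) → Fin n) {φ : Pt n → ℝ} (hφ : ContDiff ℝ ∞ φ)
    (x : Pt n) : partialDeriv α φ x =
      fderiv ℝ (partialDeriv (fun l => α l.succ) φ) x (EuclideanSpace.single (α 0) 1) := by
  have hd : DifferentiableAt ℝ (iteratedFDeriv ℝ j φ) x :=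
    (hφ.differentiable_iteratedFDeriv (by exact_mod_cast WithTop.coe_lt_top (j : ℕ))).differentiableAt
  have := fderiv_continuousMultilinear_apply_const_apply hd
    (fun l => EuclideanSpace.single (α l.succ) (1 : ℝ)) (EuclideanSpace.single (α 0) 1)
  rw [partialDeriv, iteratedFDeriv_succ_apply_left]
  exact this.symm

theorem partialDeriv_one (i : Fin n) (φ : Pt n → ℝ) (x : Pt n) :
    partialDeriv (fun _ : Fin 1 => i) φ x = fderiv ℝ φ x (EuclideanSpace.single i 1) := by
  rw [partialDeriv, iteratedFDeriv_one_apply]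

theorem contDiff_partialDeriv {j : ℕ} (α : Fin j → Fin n) {φ : Pt n → ℝ} (hφ : ContDiff ℝ ∞ φ) :
    ContDiff ℝ ∞ (partialDeriv α φ) := by
  induction j with
  | zero => rwa [partialDeriv_zero]
  | succ j ih =>
    have : partialDeriv α φ = fun x => fderiv ℝ (partialDeriv (fun l => α l.succ) φ) x
        (EuclideanSpace.single (α 0) 1) := funext fun x => partialDeriv_succ α hφ x
    rw [this]
    exact ((ih fun l => α l.succ).fderiv_right (m := ∞) (by simp)).clm_apply contDiff_const

theorem tsupport_partialDeriv_subset {j : ℕ} (α : Fin j → Fin n) (φ : Pt n → ℝ) :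
    tsupport (partialDeriv α φ) ⊆ tsupport φ := by
  refine (closure_mono fun x hx => ?_).trans (tsupport_iteratedFDeriv_subset (𝕜 := ℝ) j (f := φ))
  rw [Function.mem_support] at hx ⊢
  intro h
  exact hx (by rw [partialDeriv, h]; rfl)

theorem partialDeriv_add {j : ℕ} (α : Fin j → Fin n) {φ ψ : Pt n → ℝ} (hφ : ContDiff ℝ ∞ φ)
    (hψ : ContDiff ℝ ∞ ψ) :
    partialDeriv α (fun x => φ x + ψ x) = fun x => partialDeriv α φ x + partialDeriv α ψ x := by
  induction j with
  | zero => simp only [partialDeriv_zero]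
  | succ j ih =>
    funext x
    rw [partialDeriv_succ α (hφ.add hψ), ih, partialDeriv_succ α hφ, partialDeriv_succ α hψ,
      fderiv_fun_add]
    · rfl
    · exact ((contDiff_partialDeriv _ hφ).differentiable (by simp)).differentiableAt
    · exact ((contDiff_partialDeriv _ hψ).differentiable (by simp)).differentiableAt

theorem partialDeriv_const_mul {j : ℕ} (α : Fin j → Fin n) {φ : Pt n → ℝ} (hφ : ContDiff ℝ ∞ φ)
    (c : ℝ) : partialDeriv α (fun x => c * φ x) = fun x => c * partialDeriv α φ x := by
  induction j with
  | zero => simp only [partialDeriv_zero]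
  | succ j ih =>
    funext x
    rw [partialDeriv_succ α (contDiff_const.mul hφ), ih, partialDeriv_succ α hφ, fderiv_const_mul]
    · rfl
    · exact ((contDiff_partialDeriv _ hφ).differentiable (by simp)).differentiableAt

theorem partialDeriv_sub {j : ℕ} (α : Fin j → Fin n) {φ ψ : Pt n → ℝ} (hφ : ContDiff ℝ ∞ φ)
    (hψ : ContDiff ℝ ∞ ψ) :
    partialDeriv α (fun x => φ x - ψ x) = fun x => partialDeriv α φ x - partialDeriv α ψ x := by
  have h1 : (fun x => φ x - ψ x) = fun x => φ x + (-1) * ψ x := by funext x; ring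
  rw [h1, partialDeriv_add α hφ (contDiff_const.mul hψ), partialDeriv_const_mul α hψ]
  funext x; ring

theorem partialDeriv_comp_affine {j : ℕ} (α : Fin j → Fin n) {φ : Pt n → ℝ} (hφ : ContDiff ℝ ∞ φ)
    (c : ℝ) (w : Pt n) :
    partialDeriv α (fun x => φ (c • x + w)) = fun x => c ^ j * partialDeriv α φ (c • x + w) := by
  induction j with
  | zero => simp only [partialDeriv_zero, pow_zero, one_mul]
  | succ j ih =>
    funext x
    have hs : ContDiff ℝ ∞ fun x : Pt n => c • x + w := by fun_prop
    rw [partialDeriv_succ α (φ := fun x => φ (c • x + w)) (hφ.comp hs), ih, partialDeriv_succ α hφ]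
    set ψ := partialDeriv (fun l => α l.succ) φ
    have hψ : Differentiable ℝ ψ := (contDiff_partialDeriv _ hφ).differentiable (by simp)
    have h1 : HasFDerivAt (fun x : Pt n => c • x + w) (c • ContinuousLinearMap.id ℝ (Pt n)) x :=
      ((hasFDerivAt_id x).const_smul c).add_const w
    have h2 := ((hψ (c • x + w)).hasFDerivAt.comp x h1).const_mul (c ^ j)
    have h3 := h2.fderiv
    simp only [Function.comp_def] at h3
    rw [h3]
    simp only [smul_apply, ContinuousLinearMap.comp_apply,
      ContinuousLinearMap.id_apply, map_smul, smul_eq_mul]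
    ring

end PartialDerivatives

/-! ### Weak derivatives and Sobolev spaces. -/

section WeakDerivatives

variable {n : ℕ}

theorem IsTestFunction.mono {Ω U : Set (Pt n)} (h : U ⊆ Ω) {φ : Pt n → ℝ} (hφ : IsTestFunction U φ) :
    IsTestFunction Ω φ := ⟨hφ.1, hφ.2.1, hφ.2.2.trans h⟩

theorem IsTestFunction.memLp_partialDeriv {Ω U : Set (Pt n)} {φ : Pt n → ℝ} (hφ : IsTestFunction Ω φ)
    {j : ℕ} (α : Fin j → Fin n) : MemLp (partialDeriv α φ) 2 (volume.restrict U) :=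
  ((contDiff_partialDeriv α hφ.1).continuous.memLp_of_hasCompactSupport
    (hφ.2.1.of_isClosed_subset isClosed_closure (tsupport_partialDeriv_subset α φ))).restrict U

theorem IsTestFunction.memLp {Ω U : Set (Pt n)} {φ : Pt n → ℝ} (hφ : IsTestFunction Ω φ) :
    MemLp φ 2 (volume.restrict U) :=
  (hφ.1.continuous.memLp_of_hasCompactSupport hφ.2.1).restrict U

theorem HasWeakDeriv.unique {Ω : Set (Pt n)} (hΩ : IsOpen Ω) {j : ℕ} {α : Fin j → Fin n}
    {u v v' : Pt n → ℝ} (h : HasWeakDeriv Ω α u v) (h' : HasWeakDeriv Ω α u v') :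
    v =ᵐ[volume.restrict Ω] v' := by
  have hsub : MemLp (fun x => v x - v' x) 2 (volume.restrict Ω) := h.1.sub h'.1
  have key := hΩ.ae_eq_zero_of_integral_contDiff_smul_eq_zero (μ := volume)
    (f := fun x => v x - v' x) ?_ ?_
  · refine (ae_restrict_iff' hΩ.measurableSet).2 ?_
    filter_upwards [key] with x hx hxΩ
    exact sub_eq_zero.1 (hx hxΩ)
  · intro x hx
    obtain ⟨r, hr, hb⟩ := Metric.nhds_basis_closedBall.mem_iff.1 (hΩ.mem_nhds hx)
    refine ⟨Metric.closedBall x r, mem_nhdsWithin_of_mem_nhds (Metric.closedBall_mem_nhds x hr), ?_⟩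
    have : IsFiniteMeasure (volume.restrict (Metric.closedBall x r)) :=
      ⟨by rw [Measure.restrict_apply_univ]; exact measure_closedBall_lt_top⟩
    exact (hsub.mono_measure (Measure.restrict_mono hb le_rfl)).integrable (by norm_num)
  · intro φ h1 h2 h3
    have hφ : IsTestFunction Ω φ := ⟨h1, h2, h3⟩
    have e := (h.2 φ hφ).symm.trans (h'.2 φ hφ)
    have hne : (-1 : ℝ) ^ j ≠ 0 := pow_ne_zero _ (by norm_num)
    have e' := mul_left_cancel₀ hne e
    rw [← setIntegral_eq_integral_of_forall_compl_eq_zero (s := Ω)]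
    · have : ∀ x, φ x • (v x - v' x) = v x * φ x - v' x * φ x := fun x => by
        rw [smul_eq_mul]; ring
      simp only [this]
      refine (integral_sub (h.1.integrable_mul hφ.memLp) (h'.1.integrable_mul hφ.memLp)).trans ?_
      simp only [Pi.mul_apply]
      rw [e', sub_self]
    · intro x hx
      rw [image_eq_zero_of_notMem_tsupport fun hx' => hx (h3 hx'), zero_smul]

theorem weakDeriv_spec {Ω : Set (Pt n)} {j : ℕ} {α : Fin j → Fin n} {u : Pt n → ℝ}
    (h : ∃ v, HasWeakDeriv Ω α u v) : HasWeakDeriv Ω α u (weakDeriv Ω α u) :=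
  Classical.epsilon_spec h

theorem HasWeakDeriv.weakDeriv_ae {Ω : Set (Pt n)} (hΩ : IsOpen Ω) {j : ℕ} {α : Fin j → Fin n}
    {u v : Pt n → ℝ} (h : HasWeakDeriv Ω α u v) : weakDeriv Ω α u =ᵐ[volume.restrict Ω] v :=
  (weakDeriv_spec ⟨v, h⟩).unique hΩ h

theorem HasWeakDeriv.mono {Ω U : Set (Pt n)} (hU : U ⊆ Ω) {j : ℕ} {α : Fin j → Fin n}
    {u v : Pt n → ℝ} (h : HasWeakDeriv Ω α u v) : HasWeakDeriv U α u v := by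
  refine ⟨h.1.mono_measure (Measure.restrict_mono hU le_rfl), fun φ hφ => ?_⟩
  have h1 := h.2 φ (hφ.mono hU)
  have e1 : ∀ x ∉ U, u x * partialDeriv α φ x = 0 := fun x hx => by
    rw [image_eq_zero_of_notMem_tsupport fun h' => hx (hφ.2.2 (tsupport_partialDeriv_subset α φ h')),
      mul_zero]
  have e2 : ∀ x ∉ U, v x * φ x = 0 := fun x hx => by
    rw [image_eq_zero_of_notMem_tsupport fun h' => hx (hφ.2.2 h'), mul_zero]
  rw [setIntegral_eq_integral_of_forall_compl_eq_zero e1,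
    setIntegral_eq_integral_of_forall_compl_eq_zero e2]
  rwa [setIntegral_eq_integral_of_forall_compl_eq_zero fun x hx => e1 x fun h' => hx (hU h'),
    setIntegral_eq_integral_of_forall_compl_eq_zero fun x hx => e2 x fun h' => hx (hU h')] at h1

theorem HasWeakDeriv.congr {Ω : Set (Pt n)} {j : ℕ} {α : Fin j → Fin n}
    {u u' v v' : Pt n → ℝ} (h : HasWeakDeriv Ω α u v) (hu : u =ᵐ[volume.restrict Ω] u')
    (hv : v =ᵐ[volume.restrict Ω] v') : HasWeakDeriv Ω α u' v' := by
  refine ⟨(memLp_congr_ae hv).1 h.1, fun φ hφ => ?_⟩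
  have h1 := h.2 φ hφ
  have e1 : ∫ x in Ω, u x * partialDeriv α φ x = ∫ x in Ω, u' x * partialDeriv α φ x :=
    integral_congr_ae (hu.mono fun x hx => by simp only [hx])
  have e2 : ∫ x in Ω, v x * φ x = ∫ x in Ω, v' x * φ x :=
    integral_congr_ae (hv.mono fun x hx => by simp only [hx])
  rwa [e1, e2] at h1

theorem HasWeakDeriv.add {Ω : Set (Pt n)} {j : ℕ} {α : Fin j → Fin n} {u u' v v' : Pt n → ℝ}
    (h : HasWeakDeriv Ω α u v) (h' : HasWeakDeriv Ω α u' v') (hu : MemLp u 2 (volume.restrict Ω))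
    (hu' : MemLp u' 2 (volume.restrict Ω)) :
    HasWeakDeriv Ω α (fun x => u x + u' x) (fun x => v x + v' x) := by
  refine ⟨h.1.add h'.1, fun φ hφ => ?_⟩
  have e1 : ∫ x in Ω, (u x + u' x) * partialDeriv α φ x =
      (∫ x in Ω, u x * partialDeriv α φ x) + ∫ x in Ω, u' x * partialDeriv α φ x := by
    simp only [add_mul]
    exact integral_add (hu.integrable_mul (hφ.memLp_partialDeriv α))
      (hu'.integrable_mul (hφ.memLp_partialDeriv α))
  have e2 : ∫ x in Ω, (v x + v' x) * φ x = (∫ x in Ω, v x * φ x) + ∫ x in Ω, v' x * φ x := by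
    simp only [add_mul]
    exact integral_add (h.1.integrable_mul hφ.memLp) (h'.1.integrable_mul hφ.memLp)
  rw [e1, e2, h.2 φ hφ, h'.2 φ hφ]
  ring

theorem HasWeakDeriv.const_mul {Ω : Set (Pt n)} {j : ℕ} {α : Fin j → Fin n} {u v : Pt n → ℝ}
    (h : HasWeakDeriv Ω α u v) (c : ℝ) :
    HasWeakDeriv Ω α (fun x => c * u x) (fun x => c * v x) := by
  refine ⟨h.1.const_mul c, fun φ hφ => ?_⟩
  simp only [mul_assoc]
  rw [integral_const_mul, integral_const_mul, h.2 φ hφ]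
  ring

theorem HasWeakDeriv.sub {Ω : Set (Pt n)} {j : ℕ} {α : Fin j → Fin n} {u u' v v' : Pt n → ℝ}
    (h : HasWeakDeriv Ω α u v) (h' : HasWeakDeriv Ω α u' v') (hu : MemLp u 2 (volume.restrict Ω))
    (hu' : MemLp u' 2 (volume.restrict Ω)) :
    HasWeakDeriv Ω α (fun x => u x - u' x) (fun x => v x - v' x) := by
  have := h.add (h'.const_mul (-1)) hu (hu'.const_mul (-1))
  simpa only [neg_one_mul, ← sub_eq_add_neg] using this

theorem hasWeakDeriv_zero {Ω : Set (Pt n)} {α : Fin 0 → Fin n} {u : Pt n → ℝ}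
    (hu : MemLp u 2 (volume.restrict Ω)) : HasWeakDeriv Ω α u u :=
  ⟨hu, fun φ _ => by simp [partialDeriv_zero]⟩

/-- The integration by parts is done on all of ℝⁿ against a compactly supported test function, so no
regularity of `U` is needed. -/
theorem hasWeakDeriv_of_contDiff {U : Set (Pt n)} {i : Fin n} {φ : Pt n → ℝ} (hφ : ContDiff ℝ ∞ φ)
    (hm : MemLp (partialDeriv (fun _ : Fin 1 => i) φ) 2 (volume.restrict U)) :
    HasWeakDeriv U (fun _ : Fin 1 => i) φ (partialDeriv (fun _ : Fin 1 => i) φ) := by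
  refine ⟨hm, fun ψ hψ => ?_⟩
  rw [setIntegral_eq_integral_of_forall_compl_eq_zero fun x hx => by
      rw [image_eq_zero_of_notMem_tsupport fun h' =>
        hx (hψ.2.2 (tsupport_partialDeriv_subset _ ψ h')), mul_zero],
    setIntegral_eq_integral_of_forall_compl_eq_zero fun x hx => by
      rw [image_eq_zero_of_notMem_tsupport fun h' => hx (hψ.2.2 h'), mul_zero]]
  simp only [partialDeriv_one, pow_one, neg_one_mul]
  have c1 := (contDiff_partialDeriv (fun _ : Fin 1 => i) hφ).continuous
  have c2 := (contDiff_partialDeriv (fun _ : Fin 1 => i) hψ.1).continuous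
  have s2 : HasCompactSupport (partialDeriv (fun _ : Fin 1 => i) ψ) :=
    hψ.2.1.of_isClosed_subset isClosed_closure (tsupport_partialDeriv_subset _ ψ)
  simp only [funext (partialDeriv_one i φ), funext (partialDeriv_one i ψ)] at c1 c2 s2
  refine integral_mul_fderiv_eq_neg_fderiv_mul_of_integrable ?_ ?_ ?_
    (fun x _ => (hφ.differentiable (by simp)).differentiableAt)
    (fun x _ => (hψ.1.differentiable (by simp)).differentiableAt)
  · exact (c1.mul hψ.1.continuous).integrable_of_hasCompactSupport hψ.2.1.mul_left
  · exact (hφ.continuous.mul c2).integrable_of_hasCompactSupport s2.mul_left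
  · exact (hφ.continuous.mul hψ.1.continuous).integrable_of_hasCompactSupport hψ.2.1.mul_left

/-- The product rule for weak derivatives; a cut-off function with support in `Ω` yields a weak
derivative in a larger set `U`. -/
theorem HasWeakDeriv.mul_smooth {Ω U : Set (Pt n)} {i : Fin n} {u g χ : Pt n → ℝ}
    (hχ : ContDiff ℝ ∞ χ) (hχc : HasCompactSupport χ) (hΩ : MeasurableSet Ω) (hU : MeasurableSet U)
    (hΩU : Ω ⊆ U) (h0 : ∀ x ∈ U \ Ω, x ∉ tsupport χ)
    (htest : ∀ φ, IsTestFunction U φ → IsTestFunction Ω (fun x => χ x * φ x))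
    (hu : MemLp u 2 (volume.restrict Ω)) (h : HasWeakDeriv Ω (fun _ : Fin 1 => i) u g) :
    HasWeakDeriv U (fun _ : Fin 1 => i) (fun x => χ x * u x)
      (fun x => χ x * g x + partialDeriv (fun _ : Fin 1 => i) χ x * u x) ∧
    MemLp (fun x => χ x * u x) 2 (volume.restrict U) := by
  -- On `U` outside `Ω` the cut-off vanishes, so the product is the extension by zero whatever
  -- values the second factor takes there.
  have hmul : ∀ η : Pt n → ℝ, Continuous η → tsupport η ⊆ tsupport χ → ∀ f : Pt n → ℝ,
      MemLp f 2 (volume.restrict Ω) → MemLp (fun x => η x * f x) 2 (volume.restrict U) := by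
    intro η hη hs f hf
    obtain ⟨C, hC⟩ := hη.bounded_above_of_compact_support
      (hχc.of_isClosed_subset isClosed_closure hs)
    have h1 : MemLp (fun x => η x * f x) 2 (volume.restrict Ω) :=
      MemLp.of_le_mul (c := C) hf (hη.aestronglyMeasurable.mul hf.1) (ae_of_all _ fun x => by
        rw [norm_mul]; exact mul_le_mul_of_nonneg_right (hC x) (norm_nonneg _))
    have h2 := ((memLp_indicator_iff_restrict hΩ).2 h1).restrict U
    refine (memLp_congr_ae ?_).1 h2
    filter_upwards [ae_restrict_mem hU] with x hx
    by_cases hxΩ : x ∈ Ω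
    · rw [Set.indicator_of_mem hxΩ]
    · rw [Set.indicator_of_notMem hxΩ, image_eq_zero_of_notMem_tsupport
        fun h' => h0 x ⟨hx, hxΩ⟩ (hs h'), zero_mul]
  have hdc := (contDiff_partialDeriv (fun _ : Fin 1 => i) hχ).continuous
  have hds := tsupport_partialDeriv_subset (fun _ : Fin 1 => i) χ
  have m1 := hmul χ hχ.continuous le_rfl u hu
  have m2 := hmul χ hχ.continuous le_rfl g h.1
  have m3 := hmul _ hdc hds u hu
  refine ⟨⟨m2.add m3, fun φ hφ => ?_⟩, m1⟩
  have key := h.2 _ (htest φ hφ)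
  have hpd : ∀ x, partialDeriv (fun _ : Fin 1 => i) (fun x => χ x * φ x) x =
      χ x * partialDeriv (fun _ : Fin 1 => i) φ x + φ x * partialDeriv (fun _ : Fin 1 => i) χ x := by
    intro x
    rw [partialDeriv_one, partialDeriv_one, partialDeriv_one,
      fderiv_fun_mul (hχ.differentiable (by simp)).differentiableAt
        (hφ.1.differentiable (by simp)).differentiableAt]
    rfl
  simp only [hpd] at key
  have hz : ∀ x ∈ U \ Ω, χ x = 0 := fun x hx => image_eq_zero_of_notMem_tsupport (h0 x hx)
  have hz' : ∀ x ∈ U \ Ω, partialDeriv (fun _ : Fin 1 => i) χ x = 0 := fun x hx =>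
    image_eq_zero_of_notMem_tsupport fun h' => h0 x hx (hds h')
  rw [← setIntegral_eq_of_subset_of_forall_sdiff_eq_zero hU hΩU fun x hx => by
      rw [hz x hx, hz' x hx]; ring,
    ← setIntegral_eq_of_subset_of_forall_sdiff_eq_zero hU hΩU fun x hx => by
      rw [hz x hx]; ring] at key
  have i1 : IntegrableOn (fun x => χ x * u x * partialDeriv (fun _ : Fin 1 => i) φ x) U :=
    m1.integrable_mul (hφ.memLp_partialDeriv (fun _ : Fin 1 => i))
  have i2 : IntegrableOn (fun x => χ x * g x * φ x) U := m2.integrable_mul hφ.memLp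
  have i3 : IntegrableOn (fun x => partialDeriv (fun _ : Fin 1 => i) χ x * u x * φ x) U :=
    m3.integrable_mul hφ.memLp
  have e1 : ∫ x in U, u x * (χ x * partialDeriv (fun _ : Fin 1 => i) φ x +
      φ x * partialDeriv (fun _ : Fin 1 => i) χ x) =
      (∫ x in U, χ x * u x * partialDeriv (fun _ : Fin 1 => i) φ x) +
        ∫ x in U, partialDeriv (fun _ : Fin 1 => i) χ x * u x * φ x := by
    rw [← integral_add i1 i3]
    exact integral_congr_ae (ae_of_all _ fun x => by ring)
  have e2 : ∫ x in U, (χ x * g x + partialDeriv (fun _ : Fin 1 => i) χ x * u x) * φ x =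
      (∫ x in U, χ x * g x * φ x) + ∫ x in U, partialDeriv (fun _ : Fin 1 => i) χ x * u x * φ x := by
    rw [← integral_add i2 i3]
    exact integral_congr_ae (ae_of_all _ fun x => by ring)
  have e3 : ∫ x in U, g x * (χ x * φ x) = ∫ x in U, χ x * g x * φ x :=
    integral_congr_ae (ae_of_all _ fun x => by ring)
  rw [e1, e3] at key
  rw [e2]
  linarith

theorem memSobolev_one {Ω : Set (Pt n)} {u : Pt n → ℝ} (hu : MemLp u 2 (volume.restrict Ω))
    (h : ∀ i, ∃ v, HasWeakDeriv Ω (fun _ : Fin 1 => i) u v) : MemSobolev Ω 1 u := by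
  refine ⟨hu, fun j hj α => ?_⟩
  interval_cases j
  · exact ⟨u, hasWeakDeriv_zero hu⟩
  · obtain ⟨v, hv⟩ := h (α 0)
    have : α = fun _ => α 0 := funext fun l => by rw [Subsingleton.elim l 0]
    exact ⟨v, by rw [this]; exact hv⟩

theorem sobolevNormSq_one {Ω : Set (Pt n)} (hΩ : IsOpen Ω) {u : Pt n → ℝ}
    (hu : MemLp u 2 (volume.restrict Ω)) {g : Fin n → Pt n → ℝ}
    (h : ∀ i, HasWeakDeriv Ω (fun _ : Fin 1 => i) u (g i)) :
    sobolevNormSq Ω 1 u = (∫ x in Ω, u x ^ 2) + ∑ i, ∫ x in Ω, g i x ^ 2 := by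
  rw [sobolevNormSq, Finset.sum_range_succ, Finset.sum_range_one]
  congr 1
  · rw [Fintype.sum_unique]
    exact integral_congr_ae (((hasWeakDeriv_zero (α := default) hu).weakDeriv_ae hΩ).mono
      fun x hx => by simp only [hx])
  · refine Fintype.sum_equiv (Equiv.funUnique (Fin 1) (Fin n)) _ _ fun α => ?_
    have : α = fun _ => α 0 := funext fun l => by rw [Subsingleton.elim l 0]
    have h1 : HasWeakDeriv Ω α u (g (α 0)) := by rw [this]; exact h (α 0)
    exact integral_congr_ae ((h1.weakDeriv_ae hΩ).mono fun x hx => by simp only [hx]; rfl)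

theorem MemSobolev.mono {Ω U : Set (Pt n)} (hU : U ⊆ Ω) {m : ℕ} {u : Pt n → ℝ}
    (h : MemSobolev Ω m u) : MemSobolev U m u :=
  ⟨h.1.mono_measure (Measure.restrict_mono hU le_rfl), fun j hj α =>
    (h.2 j hj α).imp fun _ hv => hv.mono hU⟩

theorem MemSobolev.of_le {Ω : Set (Pt n)} {m m' : ℕ} (hm : m' ≤ m) {u : Pt n → ℝ}
    (h : MemSobolev Ω m u) : MemSobolev Ω m' u := ⟨h.1, fun j hj => h.2 j (hj.trans hm)⟩

theorem MemSobolev.sub {Ω : Set (Pt n)} {m : ℕ} {u v : Pt n → ℝ}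
    (hu : MemSobolev Ω m u) (hv : MemSobolev Ω m v) : MemSobolev Ω m (fun x => u x - v x) :=
  ⟨hu.1.sub hv.1, fun j hj α => by
    obtain ⟨a, ha⟩ := hu.2 j hj α
    obtain ⟨b, hb⟩ := hv.2 j hj α
    exact ⟨_, ha.sub hb hu.1 hv.1⟩⟩

end WeakDerivatives

/-! ### Convolution, and continuity of affine changes of variables in L². -/

section Mollification

variable {n : ℕ}

/-- The convolution of `v` with the kernel `k`. -/
def conv (v k : Pt n → ℝ) : Pt n → ℝ :=
  MeasureTheory.convolution v k (ContinuousLinearMap.mul ℝ ℝ) volume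

theorem conv_apply (v k : Pt n → ℝ) (x : Pt n) : conv v k x = ∫ t, v t * k (x - t) := rfl

theorem conv_apply_swap (v k : Pt n → ℝ) (x : Pt n) : conv v k x = ∫ t, v (x - t) * k t :=
  convolution_eq_swap _

theorem contDiff_conv {v k : Pt n → ℝ} (hv : LocallyIntegrable v) (hk : ContDiff ℝ ∞ k)
    (hc : HasCompactSupport k) : ContDiff ℝ ∞ (conv v k) :=
  hc.contDiff_convolution_right _ hv hk

theorem partialDeriv_conv {v k : Pt n → ℝ} (hv : LocallyIntegrable v) (hk : ContDiff ℝ ∞ k)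
    (hc : HasCompactSupport k) {j : ℕ} (α : Fin j → Fin n) :
    partialDeriv α (conv v k) = conv v (partialDeriv α k) := by
  induction j with
  | zero => simp only [partialDeriv_zero]
  | succ j ih =>
    funext x
    rw [partialDeriv_succ α (contDiff_conv hv hk hc), ih]
    set κ := partialDeriv (fun l => α l.succ) k with hκ
    have hκd : ContDiff ℝ ∞ κ := contDiff_partialDeriv _ hk
    have hκc : HasCompactSupport κ :=
      hc.of_isClosed_subset isClosed_closure (tsupport_partialDeriv_subset _ k)
    have h1 := hκc.hasFDerivAt_convolution_right (ContinuousLinearMap.mul ℝ ℝ) (μ := volume) hv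
      (hκd.of_le (by simp)) x
    rw [conv, h1.fderiv, convolution_precompR_apply _ hv (hκc.fderiv ℝ)
      (hκd.continuous_fderiv (by simp))]
    have : partialDeriv α k = fun a => fderiv ℝ κ a (EuclideanSpace.single (α 0) 1) :=
      funext fun a => partialDeriv_succ α hk a
    rw [this]
    rfl

/-- Away from the boundary, mollification commutes with weak differentiation. -/
theorem HasWeakDeriv.conv_eq {Ω : Set (Pt n)} (hΩ : MeasurableSet Ω) {j : ℕ} {α : Fin j → Fin n}
    {u v k : Pt n → ℝ} (h : HasWeakDeriv Ω α u v) (hk : ContDiff ℝ ∞ k) (hc : HasCompactSupport k)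
    {x : Pt n} (hx : ∀ y, x - y ∈ tsupport k → y ∈ Ω) :
    conv (Ω.indicator u) (partialDeriv α k) x = conv (Ω.indicator v) k x := by
  have hφ : ContDiff ℝ ∞ fun y : Pt n => k ((-1 : ℝ) • y + x) := hk.comp (by fun_prop)
  have e0 : ∀ y : Pt n, (-1 : ℝ) • y + x = x - y := fun y => by rw [neg_one_smul]; abel
  have htest : IsTestFunction Ω (fun y : Pt n => k ((-1 : ℝ) • y + x)) := by
    refine ⟨hφ, ?_, ?_⟩
    · simp only [e0]
      exact hc.comp_homeomorph (Homeomorph.subLeft x)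
    · simp only [e0]
      intro y hy
      refine hx y ?_
      have := tsupport_comp_subset_preimage k (f := fun y : Pt n => x - y) (by fun_prop) hy
      exact this
  have key := h.2 _ htest
  rw [partialDeriv_comp_affine α hk] at key
  simp only [e0] at key
  have h1 : ∀ w κ : Pt n → ℝ, conv (Ω.indicator w) κ x = ∫ y in Ω, w y * κ (x - y) := by
    intro w κ
    rw [conv_apply, ← integral_indicator hΩ]
    refine integral_congr_ae (ae_of_all _ fun y => ?_)
    by_cases hy : y ∈ Ω <;> simp [hy]
  rw [h1, h1]
  have h2 : ∫ y in Ω, u y * ((-1 : ℝ) ^ j * partialDeriv α k (x - y)) =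
      (-1) ^ j * ∫ y in Ω, u y * partialDeriv α k (x - y) := by
    rw [← integral_const_mul]
    exact integral_congr_ae (ae_of_all _ fun y => by ring)
  rw [h2] at key
  exact mul_left_cancel₀ (pow_ne_zero _ (by norm_num)) key

theorem quasi_affine {c : ℝ} (hc : c ≠ 0) (w : Pt n) :
    Measure.map (fun x : Pt n => c • x + w) volume = ENNReal.ofReal |(c ^ n)⁻¹| • volume := by
  have h1 : (fun x : Pt n => c • x + w) = (fun x => x + w) ∘ fun x => c • x := rfl
  rw [h1, ← Measure.map_map (measurable_add_const w) (measurable_const_smul c),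
    Measure.map_addHaar_smul _ hc, Measure.map_smul, map_add_right_eq_self, finrank_euclideanSpace,
    Fintype.card_fin]

/-- Continuity of translations and dilations in `L²`. -/
theorem eLpNorm_affine_sub_le {v : Pt n → ℝ} (hv : MemLp v 2 volume) {ε : ENNReal} (hε : ε ≠ 0) :
    ∃ η : ℝ, 0 < η ∧ η ≤ 1 / 2 ∧ ∀ c : ℝ, 1 - η ≤ c → c ≤ 1 → ∀ w : Pt n, ‖w‖ ≤ η →
      eLpNorm (fun x => v (c • x + w) - v x) 2 volume ≤ ε := by
  -- The factor 2^(n/2) bounds the effect on the L²-norm of substituting cx + w with c ≥ 1/2. The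
  -- tolerance ε₁ below is fitted to the splitting v∘A − v = (v−g)∘A + (g∘A − g) − (v−g), with A the
  -- affine map and g continuous of compact support.
  set D : ENNReal := ENNReal.ofReal (2 ^ n) ^ (1 / (2 : ENNReal)).toReal with hD
  have hDt : D ≠ ⊤ := ENNReal.rpow_ne_top_of_nonneg (by simp) ENNReal.ofReal_ne_top
  obtain ⟨ε₁, hε₁, hε₁t, hle⟩ : ∃ ε₁ : ENNReal, ε₁ ≠ 0 ∧ ε₁ ≠ ⊤ ∧ D * ε₁ + (ε₁ + ε₁) ≤ ε := by
    have hcont : Tendsto (fun t : ENNReal => D * t + (t + t)) (𝓝 0) (𝓝 0) := by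
      have : Tendsto (fun t : ENNReal => D * t + (t + t)) (𝓝 0) (𝓝 (D * 0 + (0 + 0))) :=
        (ENNReal.Tendsto.const_mul tendsto_id (Or.inr hDt)).add (tendsto_id.add tendsto_id)
      simpa using this
    obtain ⟨δ, hδ, hδε⟩ := (ENNReal.nhds_zero_basis.eventually_iff).1
      (hcont.eventually (Iio_mem_nhds (pos_iff_ne_zero.2 hε)))
    obtain ⟨t, ht0, htδ⟩ := exists_between (lt_min hδ (zero_lt_one (α := ENNReal)))
    exact ⟨t, ht0.ne', ((htδ.trans_le (min_le_right _ _)).trans ENNReal.one_lt_top).ne,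
      (hδε (htδ.trans_le (min_le_left _ _))).le⟩
  obtain ⟨g, hgc, hge, hgcont, hgm⟩ := hv.exists_hasCompactSupport_eLpNorm_sub_le (by norm_num) hε₁
  obtain ⟨R, hR, hRs⟩ : ∃ R : ℝ, 0 < R ∧ ∀ x, R < ‖x‖ → g x = 0 := by
    obtain ⟨R, hR⟩ := hgc.isBounded.subset_closedBall 0
    refine ⟨max R 1, by positivity, fun x hx => image_eq_zero_of_notMem_tsupport fun h => ?_⟩
    have := hR h
    rw [mem_closedBall_zero_iff] at this
    exact absurd (this.trans (le_max_left R 1)) (not_le.2 hx)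
  -- Outside this ball g vanishes both at x and at cx + w, because c ≥ 1/2 and ‖w‖ ≤ 1/2.
  set S := Metric.closedBall (0 : Pt n) (2 * (R + 1)) with hS
  have hSt : volume S ≠ ⊤ := measure_closedBall_lt_top.ne
  obtain ⟨ε₂, hε₂, hε₂le⟩ : ∃ ε₂ : ℝ, 0 < ε₂ ∧
      volume S ^ (2 : ENNReal).toReal⁻¹ * ENNReal.ofReal ε₂ ≤ ε₁ := by
    have hcont : Tendsto (fun t : ℝ => volume S ^ (2 : ENNReal).toReal⁻¹ * ENNReal.ofReal t) (𝓝 0)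
        (𝓝 0) := by
      have : Tendsto (fun t : ℝ => volume S ^ (2 : ENNReal).toReal⁻¹ * ENNReal.ofReal t) (𝓝 0)
        (𝓝 (volume S ^ (2 : ENNReal).toReal⁻¹ * ENNReal.ofReal 0)) :=
        ENNReal.Tendsto.const_mul (ENNReal.continuous_ofReal.tendsto 0)
          (Or.inr (ENNReal.rpow_ne_top_of_nonneg (by simp) hSt))
      simpa using this
    obtain ⟨δ, hδ, hδε⟩ := Metric.eventually_nhds_iff.1
      (hcont.eventually (Iio_mem_nhds (pos_iff_ne_zero.2 hε₁)))
    exact ⟨δ / 2, by positivity, (hδε (by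
      rw [Real.dist_eq, sub_zero, abs_of_pos (by positivity)]; linarith)).le⟩
  have huc : UniformContinuous g := hgc.uniformContinuous_of_continuous hgcont
  obtain ⟨δ, hδ, hgδ⟩ := Metric.uniformContinuous_iff.1 huc ε₂ hε₂
  refine ⟨min (1 / 2) (δ / (2 * (2 * (R + 1) + 1))), by positivity, min_le_left _ _,
    fun c hc hc1 w hw => ?_⟩
  set η := min (1 / 2) (δ / (2 * (2 * (R + 1) + 1))) with hη
  have hη1 : η ≤ 1 / 2 := min_le_left _ _
  have hη2 : η * (2 * (R + 1) + 1) < δ := by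
    have : η ≤ δ / (2 * (2 * (R + 1) + 1)) := min_le_right _ _
    rw [le_div_iff₀ (by positivity)] at this
    nlinarith
  have hc2 : 1 / 2 ≤ c := by linarith
  have hc0 : c ≠ 0 := by linarith
  have hmeas : Measurable fun x : Pt n => c • x + w := by fun_prop
  have hac : Measure.map (fun x : Pt n => c • x + w) volume ≪ volume := by
    rw [quasi_affine hc0]
    exact Measure.smul_absolutelyContinuous
  have hvg : MemLp (v - g) 2 volume := hv.sub hgm
  -- the three parts
  have p1 : eLpNorm (fun x => (v - g) (c • x + w)) 2 volume ≤ D * ε₁ := by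
    have : eLpNorm (fun x => (v - g) (c • x + w)) 2 volume =
        eLpNorm (v - g) 2 (Measure.map (fun x : Pt n => c • x + w) volume) :=
      (eLpNorm_map_measure (hvg.1.mono_ac hac) hmeas.aemeasurable).symm
    rw [this, quasi_affine hc0, eLpNorm_smul_measure_of_ne_top (by norm_num), smul_eq_mul]
    refine mul_le_mul' (ENNReal.rpow_le_rpow (ENNReal.ofReal_le_ofReal ?_) (by simp)) hge
    rw [abs_of_pos (by positivity), ← inv_pow]
    exact pow_le_pow_left₀ (by positivity) (by rw [inv_le_comm₀ (by positivity) (by norm_num)]; linarith) n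
  have p2 : eLpNorm (fun x => g (c • x + w) - g x) 2 volume ≤ ε₁ := by
    have hsupp : Function.support (fun x => g (c • x + w) - g x) ⊆ S := by
      intro x hx
      by_contra hxS
      rw [hS, mem_closedBall_zero_iff, not_le] at hxS
      refine hx ?_
      have h1 : R < ‖c • x + w‖ := by
        have e1 : ‖c • x‖ ≤ ‖c • x + w‖ + ‖w‖ := by
          simpa using norm_sub_le (c • x + w) w
        rw [norm_smul, Real.norm_eq_abs, abs_of_pos (by linarith)] at e1
        nlinarith
      simp only
      rw [hRs _ h1, hRs x (by linarith), sub_zero]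
    rw [← eLpNorm_restrict_eq_of_support_subset hsupp]
    refine (eLpNorm_le_of_ae_bound (C := ε₂) ?_).trans (by rwa [Measure.restrict_apply_univ])
    filter_upwards [ae_restrict_mem (Metric.isClosed_closedBall.measurableSet)] with x hx
    rw [hS, mem_closedBall_zero_iff] at hx
    rw [← dist_eq_norm]
    refine (hgδ ?_).le
    have e1 : c • x + w - x = (-(1 - c)) • x + w := by module
    rw [dist_eq_norm, e1]
    have e2 : ‖(-(1 - c)) • x‖ ≤ η * (2 * (R + 1)) := by
      rw [norm_smul, norm_neg, Real.norm_eq_abs, abs_of_nonneg (by linarith)]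
      exact mul_le_mul (by linarith) hx (norm_nonneg _) (by positivity)
    linarith [norm_add_le ((-(1 - c)) • x) w]
  have p3 : eLpNorm (fun x => (v - g) x) 2 volume ≤ ε₁ := hge
  have ms1 : AEStronglyMeasurable (fun x => (v - g) (c • x + w)) volume :=
    (hvg.1.mono_ac hac).comp_measurable hmeas
  have ms2 : AEStronglyMeasurable (fun x => g (c • x + w) - g x) volume := by
    have : Continuous fun x => g (c • x + w) - g x := by fun_prop
    exact this.aestronglyMeasurable
  have hdecomp : (fun x => v (c • x + w) - v x) = (fun x => (v - g) (c • x + w)) +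
      ((fun x => g (c • x + w) - g x) - fun x => (v - g) x) := by
    funext x
    simp only [Pi.add_apply, Pi.sub_apply]
    ring
  rw [hdecomp]
  refine (eLpNorm_add_le ms1 (ms2.sub hvg.1) (by norm_num)).trans (le_trans ?_ hle)
  exact add_le_add p1 ((eLpNorm_sub_le ms2 hvg.1 (by norm_num)).trans (add_le_add p2 p3))

end Mollification

/-! ### Density of smooth functions in Sobolev spaces on a simplex and on ℝⁿ. -/

section Density

variable {n : ℕ}

theorem eLpNorm_two_sq {X : Type*} [MeasurableSpace X] {μ : Measure X} (f : X → ℝ) :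
    eLpNorm f 2 μ ^ 2 = ∫⁻ x, ‖f x‖ₑ ^ 2 ∂μ := by
  have := eLpNorm_nnreal_pow_eq_lintegral (f := f) (μ := μ) (p := 2) two_ne_zero
  simpa using this

/-- The convolution averages translates against the probability density `k`. By Jensen and Tonelli
its L²-distance from v is no worse than that of the translates in the support of `k`. -/
theorem eLpNorm_conv_sub_le_aux {v k : Pt n → ℝ} (hv : MemLp v 2 volume) (hvm : Measurable v)
    (hk : Continuous k) (hc : HasCompactSupport k) (hk0 : ∀ t, 0 ≤ k t) (hk1 : ∫ t, k t = 1) {c : ℝ}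
    {w : Pt n} {ε : ENNReal}
    (h : ∀ t, k t ≠ 0 → eLpNorm (fun x => v (c • x + (w - t)) - v x) 2 volume ≤ ε) :
    eLpNorm (fun x => conv v k (c • x + w) - v x) 2 volume ≤ ε := by
  set ν := (volume : Measure (Pt n)).withDensity fun t => ENNReal.ofReal (k t) with hν
  have hkm : Measurable fun t => ENNReal.ofReal (k t) := by fun_prop
  have hprob : IsProbabilityMeasure ν := ⟨by
    rw [hν, withDensity_apply _ MeasurableSet.univ, Measure.restrict_univ,
      ← ofReal_integral_eq_lintegral_ofReal (hk.integrable_of_hasCompactSupport hc)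
        (ae_of_all _ hk0), hk1, ENNReal.ofReal_one]⟩
  have hloc : LocallyIntegrable v volume := hv.locallyIntegrable (by norm_num)
  have hpt : ∀ x, ‖conv v k (c • x + w) - v x‖ₑ ^ 2 ≤ ∫⁻ t, ‖v (c • x + (w - t)) - v x‖ₑ ^ 2 ∂ν := by
    intro x
    have hint : Integrable fun t => v (c • x + w - t) * k t :=
      (hc.convolutionExists_right (ContinuousLinearMap.mul ℝ ℝ) hloc hk (c • x + w)).integrable_swap
    have e1 : conv v k (c • x + w) - v x = ∫ t, (v (c • x + (w - t)) - v x) * k t := by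
      have e2 : v x = ∫ t, v x * k t := by rw [integral_const_mul, hk1, mul_one]
      rw [conv_apply_swap]
      conv_lhs => rw [e2]
      rw [← integral_sub hint ((hk.integrable_of_hasCompactSupport hc).const_mul _)]
      refine integral_congr_ae (ae_of_all _ fun t => ?_)
      simp only [add_sub_assoc]
      ring
    have hfm : Measurable fun t => v (c • x + (w - t)) - v x := by fun_prop
    have e3 : ‖conv v k (c • x + w) - v x‖ₑ ≤ eLpNorm (fun t => v (c • x + (w - t)) - v x) 1 ν := by
      rw [e1, eLpNorm_one_eq_lintegral_enorm, hν,
        lintegral_withDensity_eq_lintegral_mul _ hkm hfm.enorm]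
      refine (enorm_integral_le_lintegral_enorm _).trans (le_of_eq (lintegral_congr fun t => ?_))
      rw [enorm_mul, Pi.mul_apply, mul_comm, Real.enorm_eq_ofReal (hk0 t)]
    rw [← eLpNorm_two_sq]
    exact pow_le_pow_left' (e3.trans (eLpNorm_le_eLpNorm_of_exponent_le (by norm_num)
      hfm.aestronglyMeasurable)) 2
  have hsq : eLpNorm (fun x => conv v k (c • x + w) - v x) 2 volume ^ 2 ≤ ε ^ 2 := by
    rw [eLpNorm_two_sq]
    calc _ ≤ ∫⁻ x, ∫⁻ t, ‖v (c • x + (w - t)) - v x‖ₑ ^ 2 ∂ν := lintegral_mono hpt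
      _ = ∫⁻ t, ∫⁻ x, ‖v (c • x + (w - t)) - v x‖ₑ ^ 2 ∂volume ∂ν := by
          refine lintegral_lintegral_swap (Measurable.aemeasurable ?_)
          unfold Function.uncurry
          fun_prop
      _ ≤ ∫⁻ _, ε ^ 2 ∂ν := by
          refine lintegral_mono_ae ?_
          rw [hν, ae_withDensity_iff hkm]
          refine ae_of_all _ fun t ht => ?_
          rw [← eLpNorm_two_sq]
          exact pow_le_pow_left' (h t fun h0 => ht (by rw [h0, ENNReal.ofReal_zero])) 2
      _ = ε ^ 2 := by rw [lintegral_const, measure_univ, mul_one]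
  by_contra hcon
  rw [not_le] at hcon
  exact absurd hsq (not_le.2 (ENNReal.pow_right_strictMono two_ne_zero hcon))

theorem eLpNorm_conv_sub_le {v k : Pt n → ℝ} (hv : MemLp v 2 volume)
    (hk : Continuous k) (hc : HasCompactSupport k) (hk0 : ∀ t, 0 ≤ k t) (hk1 : ∫ t, k t = 1) {c : ℝ}
    (hc0 : c ≠ 0) {w : Pt n} {ε : ENNReal}
    (h : ∀ t, k t ≠ 0 → eLpNorm (fun x => v (c • x + (w - t)) - v x) 2 volume ≤ ε) :
    eLpNorm (fun x => conv v k (c • x + w) - v x) 2 volume ≤ ε := by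
  obtain ⟨v', hv'm, hvv'⟩ := hv.1
  have e1 : conv v k = conv v' k := funext fun x =>
    integral_congr_ae (hvv'.mono fun t ht => by simp only [ht])
  have hac : ∀ w : Pt n, (fun x => v (c • x + w)) =ᵐ[volume] fun x => v' (c • x + w) := fun w => by
    have hq : Measure.QuasiMeasurePreserving (fun x : Pt n => c • x + w) volume volume :=
      ⟨by fun_prop, by rw [quasi_affine hc0]; exact Measure.smul_absolutelyContinuous⟩
    exact hq.ae_eq_comp hvv'
  have e2 : eLpNorm (fun x => conv v k (c • x + w) - v x) 2 volume =
      eLpNorm (fun x => conv v' k (c • x + w) - v' x) 2 volume :=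
    eLpNorm_congr_ae (hvv'.mono fun x hx => by simp only [e1, hx])
  rw [e2]
  refine eLpNorm_conv_sub_le_aux ((memLp_congr_ae hvv').1 hv) hv'm.measurable hk hc hk0 hk1
    fun t ht => ?_
  refine le_trans (le_of_eq (eLpNorm_congr_ae ?_)) (h t ht)
  filter_upwards [hvv', hac (w - t)] with x h1 h2
  rw [h1, h2]

/-- The approximation is the mollification of u evaluated at cx + w. It depends on u only, not on α;
its derivatives are those of u mollified, times c^j, as long as the mollifier sees only points of Ω.
The eventual form lets one η serve finitely many derivatives at once. -/
theorem HasWeakDeriv.eventually_approx {Ω : Set (Pt n)} (hΩ : MeasurableSet Ω) {j : ℕ}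
    {α : Fin j → Fin n} {u v : Pt n → ℝ} (hu : MemLp u 2 (volume.restrict Ω))
    (h : HasWeakDeriv Ω α u v) {ε : ENNReal} (hε : ε ≠ 0) :
    ∀ᶠ η in 𝓝[>] (0 : ℝ), ∀ (c : ℝ) (w : Pt n) (β : ContDiffBump (0 : Pt n)), 1 - η ≤ c → c ≤ 1 →
      ‖w‖ ≤ η → β.rOut ≤ η → ∀ S ⊆ Ω, MeasurableSet S →
      (∀ x ∈ S, Metric.closedBall (c • x + w) β.rOut ⊆ Ω) →
      eLpNorm (fun x => v x - partialDeriv α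
        (fun x => conv (Ω.indicator u) (β.normed volume) (c • x + w)) x) 2 (volume.restrict S) ≤ ε := by
  have hU : MemLp (Ω.indicator u) 2 volume := (memLp_indicator_iff_restrict hΩ).2 hu
  have hV : MemLp (Ω.indicator v) 2 volume := (memLp_indicator_iff_restrict hΩ).2 h.1
  have hε2 : ε / 2 ≠ 0 := (ENNReal.half_pos hε).ne'
  obtain ⟨η₀, hη₀, hη₀2, haff⟩ := eLpNorm_affine_sub_le hV hε2
  have hlim : Tendsto (fun η : ℝ => ENNReal.ofReal (j * η) * eLpNorm (Ω.indicator v) 2 volume) (𝓝 0)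
      (𝓝 0) := by
    have : Tendsto (fun η : ℝ => ENNReal.ofReal (j * η) * eLpNorm (Ω.indicator v) 2 volume) (𝓝 0)
        (𝓝 (ENNReal.ofReal (j * 0) * eLpNorm (Ω.indicator v) 2 volume)) :=
      ENNReal.Tendsto.mul_const ((ENNReal.continuous_ofReal.comp (continuous_const_mul _)).tendsto 0)
        (Or.inr hV.2.ne)
    simpa using this
  have hlim' := (hlim.mono_left nhdsWithin_le_nhds : Tendsto _ (𝓝[>] (0 : ℝ)) _).eventually
    (Iio_mem_nhds (pos_iff_ne_zero.2 hε2))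
  filter_upwards [hlim', Ioo_mem_nhdsGT (half_pos hη₀)] with η h1 hη c w β hc hc1 hw hβ S hSΩ hS hball
  have hc0 : 0 < c := by linarith [hη.1, hη.2]
  set k := β.normed volume with hkdef
  have hkd : ContDiff ℝ ∞ k := β.contDiff_normed
  have hkc : HasCompactSupport k := β.hasCompactSupport_normed
  have hpd : ∀ x ∈ S, partialDeriv α (fun x => conv (Ω.indicator u) k (c • x + w)) x =
      c ^ j * conv (Ω.indicator v) k (c • x + w) := by
    intro x hx
    have hloc := hU.locallyIntegrable (by norm_num)
    rw [partialDeriv_comp_affine α (contDiff_conv hloc hkd hkc), partialDeriv_conv hloc hkd hkc]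
    refine congrArg (c ^ j * ·) (h.conv_eq hΩ hkd hkc ?_)
    intro y hy
    rw [hkdef, β.tsupport_normed_eq, mem_closedBall_zero_iff] at hy
    exact hball x hx (by rwa [mem_closedBall_iff_norm'])
  set A : Pt n → ℝ := fun x => conv (Ω.indicator v) k (c • x + w) - Ω.indicator v x with hA
  have hAm : AEStronglyMeasurable A volume :=
    (((contDiff_conv (hV.locallyIntegrable (by norm_num)) hkd hkc).continuous.comp
      (by fun_prop)).aestronglyMeasurable).sub hV.1
  have hAle : eLpNorm A 2 volume ≤ ε / 2 := by
    refine eLpNorm_conv_sub_le hV hkd.continuous hkc (fun t => β.nonneg_normed t) β.integral_normed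
      hc0.ne' fun t ht => ?_
    have ht' : ‖t‖ < β.rOut := by
      have : t ∈ Function.support k := ht
      rwa [hkdef, β.support_normed_eq, mem_ball_zero_iff] at this
    refine haff c (by linarith [hη.2]) hc1 (w - t) ?_
    linarith [norm_sub_le w t, hη.2]
  have hcj : c ^ j ≤ 1 := pow_le_one₀ hc0.le hc1
  have hcj' : 1 - c ^ j ≤ j * η := by
    have := one_add_mul_le_pow (a := c - 1) (by linarith) j
    rw [add_sub_cancel] at this
    nlinarith [Nat.cast_nonneg (α := ℝ) j]
  -- The error is (1 − c^j) v minus c^j times the mollification error; the first part is small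
  -- because 1 − c^j ≤ jη.
  have e1 : eLpNorm (fun x => v x - partialDeriv α
        (fun x => conv (Ω.indicator u) k (c • x + w)) x) 2 (volume.restrict S) =
      eLpNorm ((fun x => (1 - c ^ j) * Ω.indicator v x) - fun x => c ^ j * A x) 2 (volume.restrict S) := by
    refine eLpNorm_congr_ae ?_
    filter_upwards [ae_restrict_mem hS] with x hx
    rw [hpd x hx]
    simp only [hA, Pi.sub_apply, Set.indicator_of_mem (hSΩ hx)]
    ring
  rw [e1]
  refine (eLpNorm_mono_measure _ Measure.restrict_le_self).trans ((eLpNorm_sub_le (hV.1.const_mul _)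
    (hAm.const_mul _) (by norm_num)).trans ((add_le_add ?_ ?_).trans (le_of_eq (ENNReal.add_halves ε))))
  · refine le_trans (le_of_eq (eLpNorm_const_smul (1 - c ^ j) (Ω.indicator v) 2 volume)) ?_
    refine le_trans (mul_le_mul' ?_ le_rfl) h1.le
    rw [Real.enorm_eq_ofReal (by linarith)]
    exact ENNReal.ofReal_le_ofReal hcj'
  · refine le_trans (le_of_eq (eLpNorm_const_smul (c ^ j) A 2 volume)) ?_
    refine le_trans (mul_le_mul' (b := 1) ?_ hAle) (le_of_eq (one_mul _))
    rw [Real.enorm_eq_ofReal (by positivity)]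
    exact ENNReal.ofReal_le_one.2 hcj

/-- Smooth functions are dense in `H^m` of the interior of a simplex. -/
theorem exists_smooth_approx {K : Finset (Pt n)} (hK : IsCell K) {m : ℕ} {u : Pt n → ℝ}
    (hu : MemSobolev (interior (hull K)) m u) {ε : ENNReal} (hε : ε ≠ 0) :
    ∃ φ : Pt n → ℝ, ContDiff ℝ ∞ φ ∧ ∀ j ≤ m, ∀ α : Fin j → Fin n,
      eLpNorm (fun x => weakDeriv (interior (hull K)) α u x - partialDeriv α φ x) 2
        (volume.restrict (interior (hull K))) ≤ ε := by
  set U := interior (hull K) with hU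
  have hUm : MeasurableSet U := isOpen_interior.measurableSet
  obtain ⟨b, hb⟩ := interior_cell_nonempty hK
  obtain ⟨r, hr, hball⟩ := Metric.nhds_basis_closedBall.mem_iff.1 (mem_interior_iff_mem_nhds.1 hb)
  have hev : ∀ᶠ η in 𝓝[>] (0 : ℝ), ∀ j ∈ Finset.range (m + 1), ∀ α : Fin j → Fin n,
      ∀ (c : ℝ) (w : Pt n) (β : ContDiffBump (0 : Pt n)), 1 - η ≤ c → c ≤ 1 →
      ‖w‖ ≤ η → β.rOut ≤ η → ∀ S ⊆ U, MeasurableSet S →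
      (∀ x ∈ S, Metric.closedBall (c • x + w) β.rOut ⊆ U) →
      eLpNorm (fun x => weakDeriv U α u x - partialDeriv α
        (fun x => conv (U.indicator u) (β.normed volume) (c • x + w)) x) 2 (volume.restrict S) ≤ ε := by
    rw [Filter.eventually_all_finset]
    intro j hj
    rw [Filter.eventually_all]
    intro α
    exact (weakDeriv_spec (hu.2 j (Nat.lt_succ_iff.1 (Finset.mem_range.1 hj)) α)).eventually_approx hUm
      hu.1 hε
  obtain ⟨η, hη, hη0⟩ := (hev.and (Ioo_mem_nhdsGT one_pos)).exists
  -- K is contracted by the factor 1 − s towards the interior point b, which leaves room for a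
  -- mollifier of radius sr. The denominator keeps the contraction s, the shift s‖b‖ and the radius
  -- sr below η together.
  set s := η / (1 + ‖b‖ + r) with hs
  have hs0 : 0 < s := div_pos hη0.1 (by positivity)
  have hsη : s * (1 + ‖b‖ + r) = η := div_mul_cancel₀ _ (by positivity)
  have hsb : 0 ≤ s * ‖b‖ := by positivity
  have hsr : 0 < s * r := by positivity
  have hsη' : s + s * ‖b‖ + s * r = η := by rw [← hsη]; ring
  let β : ContDiffBump (0 : Pt n) := ⟨s * r / 2, s * r, by positivity, by linarith⟩
  refine ⟨fun x => conv (U.indicator u) (β.normed volume) ((1 - s) • x + s • b), ?_, fun j hj α => ?_⟩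
  · exact (contDiff_conv (((memLp_indicator_iff_restrict hUm).2 hu.1).locallyIntegrable (by norm_num))
      β.contDiff_normed β.hasCompactSupport_normed).comp (by fun_prop)
  · refine hη j (Finset.mem_range.2 (Nat.lt_succ_of_le hj)) α (1 - s) (s • b) β (by linarith) (by linarith)
      ?_ (by change s * r ≤ η; linarith) U le_rfl hUm fun x hx z hz => ?_
    · rw [norm_smul, Real.norm_eq_abs, abs_of_pos hs0]; linarith
    · have hz' : ‖z - ((1 - s) • x + s • b)‖ ≤ s * r := by
        rw [← dist_eq_norm]; exact hz
      -- A point z within sr of the contracted x is (1−s)x + sy with y in the ball about b; it is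
      -- interior because x is interior and y lies in K.
      set y := s⁻¹ • (z - (1 - s) • x) with hy
      have hyK : y ∈ hull K := by
        refine hball ?_
        rw [mem_closedBall_iff_norm]
        have : y - b = s⁻¹ • (z - ((1 - s) • x + s • b)) := by
          rw [hy, ← sub_sub, smul_sub s⁻¹ (z - (1 - s) • x), smul_smul, inv_mul_cancel₀ hs0.ne', one_smul]
        rw [this, norm_smul, norm_inv, Real.norm_eq_abs, abs_of_pos hs0, inv_mul_le_iff₀ hs0]
        exact hz'
      have hzc : z = (1 - s) • x + s • y := by
        rw [hy, smul_smul, mul_inv_cancel₀ hs0.ne', one_smul, add_sub_cancel]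
      rw [hzc]
      exact (convex_hull K).combo_interior_self_mem_interior hx hyK (by linarith [hη0.2]) hs0.le (by ring)

/-- Smooth functions are dense in `H¹(ℝⁿ)`. -/
theorem exists_smooth_approx_univ {u : Pt n → ℝ} {g : Fin n → Pt n → ℝ} (hu : MemLp u 2 volume)
    (hg : ∀ i, HasWeakDeriv Set.univ (fun _ : Fin 1 => i) u (g i)) {ε : ENNReal} (hε : ε ≠ 0) :
    ∃ φ : Pt n → ℝ, ContDiff ℝ ∞ φ ∧ eLpNorm (fun x => u x - φ x) 2 volume ≤ ε ∧
      ∀ i, eLpNorm (fun x => g i x - partialDeriv (fun _ : Fin 1 => i) φ x) 2 volume ≤ ε := by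
  have hu' : MemLp u 2 (volume.restrict Set.univ) := by rwa [Measure.restrict_univ]
  have h0 := (hasWeakDeriv_zero (α := (finZeroElim : Fin 0 → Fin n)) hu').eventually_approx
    MeasurableSet.univ hu' hε
  have h1 := Filter.eventually_all.2 fun i => (hg i).eventually_approx MeasurableSet.univ hu' hε
  obtain ⟨η, ⟨H0, H1⟩, hη⟩ := ((h0.and h1).and (Ioo_mem_nhdsGT one_pos)).exists
  let β : ContDiffBump (0 : Pt n) := ⟨η / 2, η, by linarith [hη.1], by linarith [hη.1]⟩
  have hη1 := hη.1
  refine ⟨fun x => conv (Set.univ.indicator u) (β.normed volume) ((1 : ℝ) • x + 0), ?_, ?_, fun i => ?_⟩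
  · rw [Set.indicator_univ]
    exact (contDiff_conv (hu.locallyIntegrable (by norm_num))
      β.contDiff_normed β.hasCompactSupport_normed).comp (by fun_prop)
  · have := H0 1 0 β (by linarith) le_rfl (by rw [norm_zero]; exact hη1.le) le_rfl Set.univ le_rfl
      MeasurableSet.univ fun x _ => Set.subset_univ _
    rwa [Measure.restrict_univ, partialDeriv_zero] at this
  · have := H1 i 1 0 β (by linarith) le_rfl (by rw [norm_zero]; exact hη1.le) le_rfl Set.univ le_rfl
      MeasurableSet.univ fun x _ => Set.subset_univ _
    rwa [Measure.restrict_univ] at this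

end Density

/-! ### The Poincaré inequality on a simplex. -/

section Poincare

variable {n : ℕ} {K : Finset (Pt n)}

/-- Fundamental theorem of calculus and Cauchy–Schwarz on the half segment. Stopping at the midpoint
keeps the parameter above 1/2, so that the Jacobian t^(−n) of the later substitution stays bounded.
-/
theorem sq_sub_midpoint_le {x y : Pt n} {h : ℝ} (hxy : ‖y - x‖ ≤ h) {φ : Pt n → ℝ}
    (hφ : ContDiff ℝ 1 φ) : (φ y - φ (x + (1 / 2 : ℝ) • (y - x))) ^ 2 ≤
      ∫ t in (1 / 2 : ℝ)..1, 1 / 2 * h ^ 2 * ‖fderiv ℝ φ (x + t • (y - x))‖ ^ 2 := by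
  have hd : Differentiable ℝ φ := hφ.differentiable one_ne_zero
  have hdc : Continuous (fderiv ℝ φ) := hφ.continuous_fderiv one_ne_zero
  have hder : ∀ t : ℝ, HasDerivAt (fun t : ℝ => φ (x + t • (y - x)))
      (fderiv ℝ φ (x + t • (y - x)) (y - x)) t := by
    intro t
    have h0 : HasDerivAt (fun s : ℝ => x + s • (y - x)) (y - x) t := by
      simpa using ((hasDerivAt_id t).smul_const (y - x)).const_add x
    exact (hd (x + t • (y - x))).hasFDerivAt.comp_hasDerivAt t h0
  set f : ℝ → ℝ := fun t => fderiv ℝ φ (x + t • (y - x)) (y - x) with hf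
  have hfc : Continuous f := by simp only [hf]; fun_prop
  have e1 : φ y - φ (x + (1 / 2 : ℝ) • (y - x)) = ∫ t in (1 / 2 : ℝ)..1, f t := by
    rw [intervalIntegral.integral_eq_sub_of_hasDerivAt (fun t _ => hder t) (hfc.intervalIntegrable _ _)]
    simp
  set A := ∫ t in (1 / 2 : ℝ)..1, f t with hA
  -- The interval has length 1/2, so 2A is the mean of f; nonnegativity of the variance is the
  -- Cauchy–Schwarz inequality needed.
  have e2 : 0 ≤ ∫ t in (1 / 2 : ℝ)..1, (f t - 2 * A) ^ 2 :=
    intervalIntegral.integral_nonneg (by norm_num) fun t _ => sq_nonneg _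
  have e3 : ∫ t in (1 / 2 : ℝ)..1, (f t - 2 * A) ^ 2 =
      (∫ t in (1 / 2 : ℝ)..1, f t ^ 2) - 2 * A ^ 2 := by
    have : ∀ t, (f t - 2 * A) ^ 2 = f t ^ 2 - (4 * A) * f t + 4 * A ^ 2 := fun t => by ring
    simp only [this]
    rw [intervalIntegral.integral_add
        ((by fun_prop : Continuous fun t => f t ^ 2 - (4 * A) * f t).intervalIntegrable _ _)
        (continuous_const.intervalIntegrable _ _),
      intervalIntegral.integral_sub ((by fun_prop : Continuous fun t => f t ^ 2).intervalIntegrable _ _)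
        ((by fun_prop : Continuous fun t => (4 * A) * f t).intervalIntegrable _ _), intervalIntegral.integral_const_mul,
      intervalIntegral.integral_const, ← hA, smul_eq_mul]
    ring
  have e4 : A ^ 2 ≤ ∫ t in (1 / 2 : ℝ)..1, 1 / 2 * f t ^ 2 := by
    rw [intervalIntegral.integral_const_mul]; linarith
  rw [e1]
  refine e4.trans (intervalIntegral.integral_mono_on (by norm_num)
    ((by fun_prop : Continuous _).intervalIntegrable _ _)
    ((by fun_prop : Continuous _).intervalIntegrable _ _) fun t _ => ?_)
  rw [mul_assoc]
  refine mul_le_mul_of_nonneg_left ?_ (by norm_num)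
  rw [← mul_pow, ← sq_abs]
  refine pow_le_pow_left₀ (abs_nonneg _) ?_ 2
  rw [← Real.norm_eq_abs, mul_comm]
  exact ((fderiv ℝ φ _).le_opNorm _).trans (mul_le_mul_of_nonneg_left hxy (norm_nonneg _))

/-- For fixed t the substitution z = x + t(y − x) maps K into itself and costs at most 2^n, since t
≥ 1/2. -/
theorem lintegral_sq_sub_midpoint_le {x : Pt n} (hx : x ∈ hull K) {φ : Pt n → ℝ}
    (hφ : ContDiff ℝ 1 φ) :
    ∫⁻ y in hull K, ENNReal.ofReal ((φ y - φ (x + (1 / 2 : ℝ) • (y - x))) ^ 2) ≤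
      ENNReal.ofReal (1 / 4 * 2 ^ n * cellDiam K ^ 2) *
        ∫⁻ y in hull K, ENNReal.ofReal (‖fderiv ℝ φ y‖ ^ 2) := by
  have hdc : Continuous (fderiv ℝ φ) := hφ.continuous_fderiv one_ne_zero
  set h := cellDiam K
  set Q := ∫⁻ y in hull K, ENNReal.ofReal (‖fderiv ℝ φ y‖ ^ 2)
  have hS := (isCompact_hull K).measurableSet
  calc _ ≤ ∫⁻ y in hull K, ∫⁻ t in Set.Ioc (1 / 2 : ℝ) 1,
        ENNReal.ofReal (1 / 2 * h ^ 2) * ENNReal.ofReal (‖fderiv ℝ φ (x + t • (y - x))‖ ^ 2) := by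
        refine setLIntegral_mono' hS fun y hy => ?_
        have h1 := sq_sub_midpoint_le (dist_le_cellDiam hy hx) hφ
        rw [intervalIntegral.integral_of_le (by norm_num)] at h1
        refine (ENNReal.ofReal_le_ofReal h1).trans (le_of_eq ?_)
        rw [ofReal_integral_eq_lintegral_ofReal]
        · refine lintegral_congr fun t => ?_
          rw [ENNReal.ofReal_mul (by positivity)]
        · exact ((by fun_prop : Continuous fun t : ℝ =>
            1 / 2 * h ^ 2 * ‖fderiv ℝ φ (x + t • (y - x))‖ ^ 2).integrableOn_Icc
              (a := 1 / 2) (b := 1)).mono_set Set.Ioc_subset_Icc_self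
        · exact ae_of_all _ fun t => by positivity
    _ = ∫⁻ t in Set.Ioc (1 / 2 : ℝ) 1, ∫⁻ y in hull K,
        ENNReal.ofReal (1 / 2 * h ^ 2) * ENNReal.ofReal (‖fderiv ℝ φ (x + t • (y - x))‖ ^ 2) := by
        refine lintegral_lintegral_swap (Measurable.aemeasurable ?_)
        unfold Function.uncurry
        fun_prop
    _ ≤ ∫⁻ t in Set.Ioc (1 / 2 : ℝ) 1, ENNReal.ofReal (1 / 2 * h ^ 2) * (ENNReal.ofReal (2 ^ n) * Q) := by
        refine setLIntegral_mono' measurableSet_Ioc fun t ht => ?_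
        have ht0 : 0 < t := by linarith [ht.1]
        rw [lintegral_const_mul _ (by fun_prop)]
        refine mul_le_mul' le_rfl ?_
        have h2 := lintegral_homothety_le n x ht0 (S := hull K) hS
          (fun y hy => by
            have := (convex_hull K).add_smul_sub_mem hx hy (t := t) ⟨ht0.le, ht.2⟩
            exact this)
          (f := fun y => ENNReal.ofReal (‖fderiv ℝ φ y‖ ^ 2)) (by fun_prop)
        rw [euclideanHausdorffMeasure_eq_volume] at h2
        refine h2.trans (mul_le_mul' (ENNReal.ofReal_le_ofReal ?_) le_rfl)
        refine pow_le_pow_left₀ (by positivity) ?_ n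
        rw [inv_le_comm₀ ht0 (by norm_num)]
        linarith [ht.1]
    _ = _ := by
        rw [lintegral_const, Measure.restrict_apply_univ, Real.volume_Ioc, ← mul_assoc,
          ← ENNReal.ofReal_mul (by positivity), mul_right_comm, ← ENNReal.ofReal_mul (by positivity)]
        congr 2
        ring

/-- The mean value over a simplex. -/
def cellMean (K : Finset (Pt n)) (φ : Pt n → ℝ) : ℝ := (volume.real (hull K))⁻¹ * ∫ x in hull K, φ x

/-- The two sides differ by the variance of φ over K. -/
theorem mul_sq_sub_cellMean_le (hK : IsCell K) {φ : Pt n → ℝ} (hφ : Continuous φ) (a : ℝ) :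
    volume.real (hull K) * (a - cellMean K φ) ^ 2 ≤ ∫ y in hull K, (a - φ y) ^ 2 := by
  have hV := volume_hull_pos hK
  set V := volume.real (hull K) with hVd
  set A := cellMean K φ with hA
  have hI : ∫ y in hull K, φ y = V * A := by
    rw [hA, cellMean, ← mul_assoc, mul_inv_cancel₀ hV.ne', one_mul]
  have key : ∀ b : ℝ, ∫ y in hull K, (b - φ y) ^ 2 = V * b ^ 2 - 2 * b * (V * A) + ∫ y in hull K, φ y ^ 2 := by
    intro b
    have : ∀ y, (b - φ y) ^ 2 = b ^ 2 - 2 * b * φ y + φ y ^ 2 := fun y => by ring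
    simp only [this]
    rw [integral_add (integrableOn_hull K (by fun_prop)) (integrableOn_hull K (by fun_prop)),
      integral_sub (integrableOn_hull K (by fun_prop)) (integrableOn_hull K (by fun_prop)),
      setIntegral_const, integral_const_mul, hI, smul_eq_mul]
  have h0 : 0 ≤ ∫ y in hull K, (A - φ y) ^ 2 := integral_nonneg fun y => sq_nonneg _
  rw [key] at h0 ⊢
  nlinarith

/-- The Poincaré inequality on a simplex. -/
theorem poincare (hK : IsCell K) {φ : Pt n → ℝ} (hφ : ContDiff ℝ 1 φ) :
    ∫ x in hull K, (φ x - cellMean K φ) ^ 2 ≤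
      2 ^ n * cellDiam K ^ 2 * ∫ x in hull K, ‖fderiv ℝ φ x‖ ^ 2 := by
  have hdc : Continuous (fderiv ℝ φ) := hφ.continuous_fderiv one_ne_zero
  have hφc := hφ.continuous
  have hV := volume_hull_pos hK
  have hS := (isCompact_hull K).measurableSet
  have hVt : volume (hull K) ≠ ⊤ := (isCompact_hull K).measure_lt_top.ne
  set V := volume.real (hull K) with hVd
  set h := cellDiam K with hh
  set Q := ∫⁻ y in hull K, ENNReal.ofReal (‖fderiv ℝ φ y‖ ^ 2) with hQ
  set E : Pt n → Pt n → ENNReal := fun x y =>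
    ENNReal.ofReal ((φ y - φ (x + (1 / 2 : ℝ) • (y - x))) ^ 2) with hE
  have hEm : Measurable (Function.uncurry E) := by
    unfold Function.uncurry
    simp only [hE]
    fun_prop
  have hEx : ∀ x, Measurable (E x) := fun x => by simp only [hE]; fun_prop
  have hEy : ∀ y, Measurable (fun x => E x y) := fun y => by simp only [hE]; fun_prop
  have h1 : ENNReal.ofReal V * ENNReal.ofReal (∫ x in hull K, (φ x - cellMean K φ) ^ 2) ≤
      ∫⁻ x in hull K, ∫⁻ y in hull K, ENNReal.ofReal ((φ x - φ y) ^ 2) := by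
    rw [ofReal_integral_eq_lintegral_ofReal (integrableOn_hull K (by fun_prop))
      (ae_of_all _ fun x => sq_nonneg _), ← lintegral_const_mul _ (by fun_prop)]
    refine lintegral_mono fun x => ?_
    rw [← ENNReal.ofReal_mul hV.le, ← ofReal_integral_eq_lintegral_ofReal
      (integrableOn_hull K (by fun_prop)) (ae_of_all _ fun x => sq_nonneg _)]
    exact ENNReal.ofReal_le_ofReal (mul_sq_sub_cellMean_le hK hφc _)
  -- The midpoint is common to both orders of the pair, so φ x − φ y splits there into two
  -- differences of the same kind with x and y exchanged.
  have h2 : ∀ x y, ENNReal.ofReal ((φ x - φ y) ^ 2) ≤ 2 * E y x + 2 * E x y := by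
    intro x y
    have e : y + (1 / 2 : ℝ) • (x - y) = x + (1 / 2 : ℝ) • (y - x) := by module
    simp only [hE, e]
    set m := φ (x + (1 / 2 : ℝ) • (y - x))
    have h2 : (2 : ENNReal) = ENNReal.ofReal 2 := by simp
    rw [h2, ← ENNReal.ofReal_mul (by norm_num),
      ← ENNReal.ofReal_mul (by norm_num), ← ENNReal.ofReal_add (by positivity) (by positivity)]
    refine ENNReal.ofReal_le_ofReal ?_
    nlinarith [sq_nonneg (φ x - m + (φ y - m))]
  have h3 : ∫⁻ x in hull K, ∫⁻ y in hull K, ENNReal.ofReal ((φ x - φ y) ^ 2) ≤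
      4 * ∫⁻ x in hull K, ∫⁻ y in hull K, E x y := by
    calc _ ≤ ∫⁻ x in hull K, (2 * (∫⁻ y in hull K, E y x) + 2 * ∫⁻ y in hull K, E x y) := by
          refine lintegral_mono fun x => ?_
          rw [← lintegral_const_mul _ (hEy x), ← lintegral_const_mul _ (hEx x),
            ← lintegral_add_left ((hEy x).const_mul _)]
          exact lintegral_mono fun y => h2 x y
      _ = 2 * (∫⁻ x in hull K, ∫⁻ y in hull K, E y x) + 2 * ∫⁻ x in hull K, ∫⁻ y in hull K, E x y := by
          have m1 : Measurable fun x => ∫⁻ y in hull K, E y x :=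
            (hEm.comp measurable_swap).lintegral_prod_right'
          have m2 : Measurable fun x => ∫⁻ y in hull K, E x y := hEm.lintegral_prod_right'
          rw [lintegral_add_left (m1.const_mul _), lintegral_const_mul _ m1, lintegral_const_mul _ m2]
      _ = _ := by
          rw [lintegral_lintegral_swap (f := fun x y => E y x) (hEm.comp measurable_swap).aemeasurable,
            ← add_mul]
          norm_num
  have h4 : ∫⁻ x in hull K, ∫⁻ y in hull K, E x y ≤
      ENNReal.ofReal (1 / 4 * 2 ^ n * h ^ 2) * Q * ENNReal.ofReal V := by
    calc _ ≤ ∫⁻ x in hull K, ENNReal.ofReal (1 / 4 * 2 ^ n * h ^ 2) * Q :=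
          setLIntegral_mono' hS fun x hx => lintegral_sq_sub_midpoint_le hx hφ
      _ = _ := by
          rw [lintegral_const, Measure.restrict_apply_univ, hVd, Measure.real, ENNReal.ofReal_toReal hVt]
  have hQr : Q = ENNReal.ofReal (∫ x in hull K, ‖fderiv ℝ φ x‖ ^ 2) :=
    (ofReal_integral_eq_lintegral_ofReal (integrableOn_hull K (by fun_prop))
      (ae_of_all _ fun x => sq_nonneg _)).symm
  have hI0 : 0 ≤ ∫ x in hull K, ‖fderiv ℝ φ x‖ ^ 2 := integral_nonneg fun x => sq_nonneg _
  have h5 := h1.trans (h3.trans (mul_le_mul' le_rfl h4))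
  rw [hQr, ← ENNReal.ofReal_mul hV.le, ← ENNReal.ofReal_mul (by positivity),
    ← ENNReal.ofReal_mul (by positivity), show (4 : ENNReal) = ENNReal.ofReal 4 by simp,
    ← ENNReal.ofReal_mul (by norm_num), ENNReal.ofReal_le_ofReal_iff (by positivity)] at h5
  have h6 : V * ∫ x in hull K, (φ x - cellMean K φ) ^ 2 ≤
      V * (2 ^ n * h ^ 2 * ∫ x in hull K, ‖fderiv ℝ φ x‖ ^ 2) := h5.trans (le_of_eq (by ring))
  exact le_of_mul_le_mul_left h6 hV

end Poincare

/-! ### Polynomial approximation of smooth functions on a simplex. -/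

section BrambleHilbert

variable {n : ℕ} {K : Finset (Pt n)}

theorem fderiv_fderiv_comm {φ : Pt n → ℝ} (hφ : ContDiff ℝ ∞ φ) (x v w : Pt n) :
    fderiv ℝ (fun y => fderiv ℝ φ y w) x v = fderiv ℝ (fun y => fderiv ℝ φ y v) x w := by
  have hd : DifferentiableAt ℝ (fderiv ℝ φ) x :=
    ((hφ.fderiv_right (m := ∞) (by simp)).differentiable (by simp)).differentiableAt
  have e : ∀ a b : Pt n, fderiv ℝ (fun y => fderiv ℝ φ y a) x b = fderiv ℝ (fderiv ℝ φ) x b a := by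
    intro a b
    have h := (hd.hasFDerivAt.clm_apply (hasFDerivAt_const a x)).fderiv
    rw [h]
    simp
  rw [e, e]
  exact ((hφ.contDiffAt (x := x)).isSymmSndFDerivAt (by
    rw [minSmoothness_of_isRCLikeNormedField]; exact WithTop.coe_le_coe.2 (le_top (a := (2 : ℕ∞))))).eq v w

/-- The derivative in the direction of the `i`-th coordinate, as an operator on smooth functions. -/
def smoothDeriv (i : Fin n) (φ : {φ : Pt n → ℝ // ContDiff ℝ ∞ φ}) : {φ : Pt n → ℝ // ContDiff ℝ ∞ φ} :=
  ⟨fun x => fderiv ℝ φ.1 x (EuclideanSpace.single i 1),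
    (φ.2.fderiv_right (m := ∞) (by simp)).clm_apply contDiff_const⟩

instance : LeftCommutative (smoothDeriv (n := n)) :=
  ⟨fun _ _ φ => Subtype.ext (funext fun x => fderiv_fderiv_comm φ.2 x _ _)⟩

/-- As a fold of commuting operators, a mixed derivative is manifestly independent of the order of
its indices. -/
theorem partialDeriv_eq_foldr {j : ℕ} (α : Fin j → Fin n) {φ : Pt n → ℝ} (hφ : ContDiff ℝ ∞ φ) :
    partialDeriv α φ = ((List.ofFn α).foldr smoothDeriv ⟨φ, hφ⟩).1 := by
  induction j with
  | zero => rw [partialDeriv_zero, List.ofFn_zero]; rfl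
  | succ j ih =>
    funext x
    rw [partialDeriv_succ α hφ, ih, List.ofFn_succ]
    rfl

theorem partialDeriv_comp_perm {j : ℕ} (α : Fin j → Fin n) (σ : Equiv.Perm (Fin j)) {φ : Pt n → ℝ}
    (hφ : ContDiff ℝ ∞ φ) : partialDeriv (α ∘ σ) φ = partialDeriv α φ := by
  rw [partialDeriv_eq_foldr _ hφ, partialDeriv_eq_foldr _ hφ,
    (Equiv.Perm.ofFn_comp_perm σ α).foldr_eq]

/-- Let M be the mean of the r-th derivative and take g(x) = M(x,…,x)/r!. The r-th derivative of x ↦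
M(x,…,x) is a sum over the r! permutations, whose terms agree because mixed derivatives commute. -/
theorem exists_poly_of_mean (K : Finset (Pt n)) (r : ℕ) {φ : Pt n → ℝ} (hφ : ContDiff ℝ ∞ φ) :
    ∃ g : Pt n → ℝ, IsPoly r g ∧ ∀ (α : Fin r → Fin n) (x : Pt n),
      partialDeriv α g x = cellMean K (partialDeriv α φ) := by
  set M : ContinuousMultilinearMap ℝ (fun _ : Fin r => Pt n) ℝ :=
    (volume.real (hull K))⁻¹ • ∫ y in hull K, iteratedFDeriv ℝ r φ y with hM
  have hcont : Continuous (iteratedFDeriv ℝ r φ) :=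
    hφ.continuous_iteratedFDeriv (by exact_mod_cast le_top)
  have hint : IntegrableOn (iteratedFDeriv ℝ r φ) (hull K) :=
    hcont.continuousOn.integrableOn_compact (isCompact_hull K)
  have hMα : ∀ α : Fin r → Fin n, M (fun l => EuclideanSpace.single (α l) 1) =
      cellMean K (partialDeriv α φ) := by
    intro α
    have := (ContinuousMultilinearMap.apply ℝ (fun _ : Fin r => Pt n) ℝ
      (fun l => EuclideanSpace.single (α l) (1 : ℝ))).integral_comp_comm hint
    rw [hM, cellMean, smul_apply, smul_eq_mul]
    exact congrArg _ this.symm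
  have hexp : ∀ x : Pt n, M (fun _ => x) =
      ∑ α : Fin r → Fin n, (∏ l, x (α l)) * cellMean K (partialDeriv α φ) := by
    intro x
    have e : (fun _ : Fin r => x) = fun _ : Fin r => ∑ i, x i • EuclideanSpace.single i (1 : ℝ) := by
      funext l
      ext i
      simp [Finset.sum_apply, Pi.single_apply]
    rw [e]
    have h1 := M.toMultilinearMap.map_sum (fun (_ : Fin r) (i : Fin n) => x i • EuclideanSpace.single i (1 : ℝ))
    refine h1.trans (Finset.sum_congr rfl fun α _ => ?_)
    have h2 := M.toMultilinearMap.map_smul_univ (fun l => x (α l))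
      (fun l => EuclideanSpace.single (α l) (1 : ℝ))
    refine h2.trans ?_
    rw [smul_eq_mul, ← hMα α]
    rfl
  have hpoly : IsPoly r (fun x => M (fun _ => x)) := by
    simp only [hexp]
    refine IsPoly.sum _ fun α _ => IsPoly.mul_const ?_ _
    have := IsPoly.prod Finset.univ (r := fun _ : Fin r => (1 : ℤ)) (f := fun l x => x (α l))
      fun l _ => isPoly_coord (α l)
    simpa using this
  refine ⟨fun x => ((r.factorial : ℝ)⁻¹) * M (fun _ => x), hpoly.const_mul _, fun α x => ?_⟩
  rw [partialDeriv_const_mul α hpoly.contDiff]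
  have h3 := M.iteratedFDeriv_comp_diagonal x (fun l => EuclideanSpace.single (α l) (1 : ℝ))
  have h4 : ∀ σ : Equiv.Perm (Fin r), M (fun i => EuclideanSpace.single (α (σ i)) (1 : ℝ)) =
      cellMean K (partialDeriv α φ) := by
    intro σ
    rw [← partialDeriv_comp_perm α σ hφ]
    exact hMα (α ∘ σ)
  rw [Finset.sum_congr rfl fun σ _ => h4 σ, Finset.sum_const, Finset.card_univ, Fintype.card_perm,
    Fintype.card_fin, nsmul_eq_mul] at h3
  change _ * iteratedFDeriv ℝ r (fun x => M fun _ => x) x _ = _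
  rw [h3, ← mul_assoc, inv_mul_cancel₀ (by exact_mod_cast r.factorial_ne_zero), one_mul]

/-- The squared `L²`-seminorm of the derivatives of order `j` on a simplex. -/
def semiSq (K : Finset (Pt n)) (j : ℕ) (φ : Pt n → ℝ) : ℝ :=
  ∑ α : Fin j → Fin n, ∫ x in hull K, partialDeriv α φ x ^ 2

theorem semiSq_nonneg (K : Finset (Pt n)) (j : ℕ) (φ : Pt n → ℝ) : 0 ≤ semiSq K j φ :=
  Finset.sum_nonneg fun _ _ => integral_nonneg fun _ => sq_nonneg _

theorem semiSq_zero (K : Finset (Pt n)) (φ : Pt n → ℝ) : semiSq K 0 φ = ∫ x in hull K, φ x ^ 2 := by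
  rw [semiSq, Fintype.sum_unique, partialDeriv_zero]

theorem norm_fderiv_sq_le (φ : Pt n → ℝ) (x : Pt n) :
    ‖fderiv ℝ φ x‖ ^ 2 ≤ ∑ i, partialDeriv (fun _ : Fin 1 => i) φ x ^ 2 := by
  set L := fderiv ℝ φ x with hL
  have h0 : 0 ≤ ∑ i, partialDeriv (fun _ : Fin 1 => i) φ x ^ 2 := Finset.sum_nonneg fun _ _ => sq_nonneg _
  have h1 : ‖L‖ ≤ √(∑ i, partialDeriv (fun _ : Fin 1 => i) φ x ^ 2) := by
    refine L.opNorm_le_bound (Real.sqrt_nonneg _) fun w => ?_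
    have e : L w = ∑ i, partialDeriv (fun _ : Fin 1 => i) φ x * w i := by
      have hw : w = ∑ i, w i • EuclideanSpace.single i (1 : ℝ) := by
        ext i
        simp [Finset.sum_apply, Pi.single_apply]
      conv_lhs => rw [hw]
      rw [map_sum]
      refine Finset.sum_congr rfl fun i _ => ?_
      rw [map_smul, partialDeriv_one, smul_eq_mul, mul_comm]
    rw [e, EuclideanSpace.norm_eq, ← Real.sqrt_mul h0, Real.norm_eq_abs]
    refine Real.abs_le_sqrt ?_
    refine (Finset.sum_mul_sq_le_sq_mul_sq _ _ _).trans (le_of_eq ?_)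
    simp
  calc ‖L‖ ^ 2 ≤ √(∑ i, partialDeriv (fun _ : Fin 1 => i) φ x ^ 2) ^ 2 :=
        pow_le_pow_left₀ (norm_nonneg _) h1 2
    _ = _ := Real.sq_sqrt h0

theorem integral_norm_fderiv_sq_le (K : Finset (Pt n)) {φ : Pt n → ℝ} (hφ : ContDiff ℝ ∞ φ) :
    ∫ x in hull K, ‖fderiv ℝ φ x‖ ^ 2 ≤
      ∑ i, ∫ x in hull K, partialDeriv (fun _ : Fin 1 => i) φ x ^ 2 := by
  have hc : ∀ i, IntegrableOn (fun x => partialDeriv (fun _ : Fin 1 => i) φ x ^ 2) (hull K) := fun i =>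
    integrableOn_hull K ((contDiff_partialDeriv _ hφ).continuous.pow 2)
  have hdc : Continuous (fderiv ℝ φ) := hφ.continuous_fderiv (by simp)
  rw [← integral_finsetSum _ fun i _ => hc i]
  exact setIntegral_mono (integrableOn_hull K (by fun_prop)) (integrable_finsetSum _ fun i _ => hc i)
    fun x => norm_fderiv_sq_le φ x

theorem semiSq_one (K : Finset (Pt n)) (φ : Pt n → ℝ) :
    semiSq K 1 φ = ∑ i, ∫ x in hull K, partialDeriv (fun _ : Fin 1 => i) φ x ^ 2 := by
  refine Fintype.sum_equiv (Equiv.funUnique (Fin 1) (Fin n)) _ _ fun α => ?_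
  have : α = fun _ => α 0 := funext fun l => by rw [Subsingleton.elim l 0]
  conv_lhs => rw [this]
  rfl

theorem semiSq_succ (K : Finset (Pt n)) (j : ℕ) {φ : Pt n → ℝ} (hφ : ContDiff ℝ ∞ φ) :
    semiSq K (j + 1) φ = ∑ α : Fin j → Fin n, semiSq K 1 (partialDeriv α φ) := by
  simp only [semiSq_one]
  rw [semiSq, ← (Fin.consEquiv fun _ => Fin n).sum_comp, Fintype.sum_prod_type, Finset.sum_comm]
  refine Finset.sum_congr rfl fun α _ => Finset.sum_congr rfl fun i _ => ?_
  refine integral_congr_ae (ae_of_all _ fun x => ?_)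
  simp only [partialDeriv_one, partialDeriv_succ _ hφ]
  rfl

/-- The Bramble–Hilbert lemma. -/
theorem bramble_hilbert (hK : IsCell K) (r : ℕ) {φ : Pt n → ℝ} (hφ : ContDiff ℝ ∞ φ) :
    ∃ p, IsPoly r p ∧
      semiSq K 0 (fun x => φ x - p x) ≤
        (2 ^ n) ^ (r + 1) * cellDiam K ^ (2 * (r + 1)) * semiSq K (r + 1) φ ∧
      semiSq K 1 (fun x => φ x - p x) ≤
        (2 ^ n) ^ (r + 1) * cellDiam K ^ (2 * r) * semiSq K (r + 1) φ := by
  have h2 : (1 : ℝ) ≤ 2 ^ n := one_le_pow₀ (by norm_num)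
  induction r generalizing φ with
  | zero =>
    have hp : IsPoly ((0 : ℕ) : ℤ) (fun _ : Pt n => cellMean K φ) := isPoly_const _ (by simp)
    refine ⟨fun _ => cellMean K φ, hp, ?_, ?_⟩
    · rw [semiSq_zero, semiSq_one]
      have := (poincare hK (hφ.of_le (by simp))).trans (mul_le_mul_of_nonneg_left
        (integral_norm_fderiv_sq_le K hφ) (by positivity))
      simpa using this
    · have : semiSq K 1 (fun x => φ x - cellMean K φ) = semiSq K 1 φ := by
        rw [semiSq_one, semiSq_one]
        refine Finset.sum_congr rfl fun i _ => integral_congr_ae (ae_of_all _ fun x => ?_)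
        simp only [partialDeriv_one, fderiv_sub_const]
      rw [this]
      simp only [zero_add, pow_one, mul_zero, pow_zero, mul_one]
      exact le_mul_of_one_le_left (semiSq_nonneg _ _ _) h2
  | succ r ih =>
    -- Subtracting g makes every derivative of order r+1 mean-free, so Poincaré trades one more
    -- derivative for a factor h². The induction hypothesis for φ − g then supplies the lower-order
    -- part of the polynomial.
    obtain ⟨g, hg, hgα⟩ := exists_poly_of_mean K (r + 1) hφ
    have hψ : ContDiff ℝ ∞ fun x => φ x - g x := hφ.sub hg.contDiff
    obtain ⟨p, hp, h0, h1⟩ := ih hψ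
    have hred : semiSq K (r + 1) (fun x => φ x - g x) ≤
        2 ^ n * cellDiam K ^ 2 * semiSq K (r + 1 + 1) φ := by
      rw [semiSq_succ K (r + 1) hφ, Finset.mul_sum]
      refine Finset.sum_le_sum fun α _ => ?_
      rw [partialDeriv_sub α hφ hg.contDiff]
      simp only [hgα]
      rw [semiSq_one]
      have hα := contDiff_partialDeriv α hφ
      exact (poincare hK (hα.of_le (by simp))).trans (mul_le_mul_of_nonneg_left
        (integral_norm_fderiv_sq_le K hα) (by positivity))
    have hh : 0 ≤ cellDiam K := Metric.diam_nonneg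
    refine ⟨fun x => p x + g x, (hp.mono (by simp)).add hg, ?_, ?_⟩
    · have e : (fun x => φ x - (p x + g x)) = fun x => φ x - g x - p x := by funext x; ring
      rw [e]
      refine h0.trans ((mul_le_mul_of_nonneg_left hred (by positivity)).trans (le_of_eq ?_))
      ring
    · have e : (fun x => φ x - (p x + g x)) = fun x => φ x - g x - p x := by funext x; ring
      rw [e]
      refine h1.trans ((mul_le_mul_of_nonneg_left hred (by positivity)).trans (le_of_eq ?_))
      ring

end BrambleHilbert

/-! ### Square integrals and L²-norms. -/

section SquareIntegrals

variable {X : Type*} [MeasurableSpace X] {μ : Measure X} {n : ℕ}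

theorem integral_sq_sub_le {f g : X → ℝ} (hf : MemLp f 2 μ) (hg : MemLp g 2 μ) :
    ∫ x, (f x - g x) ^ 2 ∂μ ≤ 2 * (∫ x, f x ^ 2 ∂μ) + 2 * ∫ x, g x ^ 2 ∂μ := by
  rw [← integral_const_mul, ← integral_const_mul,
    ← integral_add (hf.integrable_sq.const_mul 2) (hg.integrable_sq.const_mul 2)]
  refine integral_mono (hf.sub hg).integrable_sq
    ((hf.integrable_sq.const_mul 2).add (hg.integrable_sq.const_mul 2)) fun x => ?_
  show (f x - g x) ^ 2 ≤ 2 * f x ^ 2 + 2 * g x ^ 2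
  nlinarith [sq_nonneg (f x + g x)]

theorem eLpNorm_two_sq_eq_ofReal {f : X → ℝ} (hf : MemLp f 2 μ) :
    eLpNorm f 2 μ ^ 2 = ENNReal.ofReal (∫ x, f x ^ 2 ∂μ) := by
  rw [eLpNorm_two_sq, ofReal_integral_eq_lintegral_ofReal hf.integrable_sq
    (ae_of_all _ fun x => sq_nonneg _)]
  refine lintegral_congr fun x => ?_
  rw [Real.enorm_eq_ofReal_abs, ← ENNReal.ofReal_pow (abs_nonneg _), sq_abs]

theorem integral_sq_le_of_eLpNorm_le {f : X → ℝ} (hf : MemLp f 2 μ) {ε : ℝ} (hε : 0 ≤ ε)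
    (h : eLpNorm f 2 μ ≤ ENNReal.ofReal ε) : ∫ x, f x ^ 2 ∂μ ≤ ε ^ 2 := by
  have := pow_le_pow_left' h 2
  rwa [eLpNorm_two_sq_eq_ofReal hf, ← ENNReal.ofReal_pow hε,
    ENNReal.ofReal_le_ofReal_iff (by positivity)] at this

theorem eLpNorm_lt_of_integral_sq_lt {f : X → ℝ} (hf : MemLp f 2 μ) {ε : ℝ} (hε : 0 < ε)
    (h : ∫ x, f x ^ 2 ∂μ < ε ^ 2) : eLpNorm f 2 μ < ENNReal.ofReal ε := by
  rw [← ENNReal.pow_lt_pow_left_iff two_ne_zero, eLpNorm_two_sq_eq_ofReal hf,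
    ← ENNReal.ofReal_pow hε.le]
  exact (ENNReal.ofReal_lt_ofReal_iff (by positivity)).2 h

theorem restrict_interior_hull (K : Finset (Pt n)) :
    (volume : Measure (Pt n)).restrict (interior (hull K)) = volume.restrict (hull K) :=
  Measure.restrict_congr_set (interior_ae_eq_of_null_frontier ((convex_hull K).addHaar_frontier volume))

end SquareIntegrals

/-! ### Traces of H¹-functions on the boundary of a simplex. -/

section Traces

variable {n : ℕ} {K : Finset (Pt n)}

theorem boundaryMeasure_univ_lt_top (hn : 1 ≤ n) (hK : IsCell K) :
    boundaryMeasure K Set.univ < ⊤ := by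
  rw [boundaryMeasure, Measure.restrict_apply_univ, frontier_cell hK]
  refine (measure_biUnion_finset_le K _).trans_lt ?_
  rw [ENNReal.sum_lt_top]
  exact fun v hv => (facet_measure hn hK hv).1.lt_top

theorem memLp_boundary (hn : 1 ≤ n) (hK : IsCell K) {φ : Pt n → ℝ} (hφ : Continuous φ) :
    MemLp φ 2 (boundaryMeasure K) := by
  refine (memLp_two_iff_integrable_sq hφ.aestronglyMeasurable).2 ?_
  have hc : IsCompact (frontier (hull K)) := (isCompact_hull K).of_isClosed_subset isClosed_frontier
    (isCompact_hull K).isClosed.frontier_subset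
  refine integrableOn_of_continuous hc ?_ (hφ.pow 2)
  have := boundaryMeasure_univ_lt_top hn hK
  rw [boundaryMeasure, Measure.restrict_apply_univ] at this
  exact this.ne

/-- The sum of the norms of the gradients of the barycentric coordinates. -/
def gradSum (K : Finset (Pt n)) : ℝ := ∑ v ∈ K, ‖baryGrad K v‖

theorem gradSum_nonneg (K : Finset (Pt n)) : 0 ≤ gradSum K :=
  Finset.sum_nonneg fun _ _ => norm_nonneg _

/-- The boundary is the union of the facets opposite to the vertices, and the facet inequalities add
up; overlaps only enlarge the right-hand side. -/
theorem integral_boundary_sq_le (hn : 1 ≤ n) (hK : IsCell K) {φ : Pt n → ℝ} (hφ : ContDiff ℝ ∞ φ) :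
    ∫ x, φ x ^ 2 ∂(boundaryMeasure K) ≤
      gradSum K * ((n + 1) * semiSq K 0 φ + cellDiam K ^ 2 * semiSq K 1 φ) := by
  have h1 : boundaryMeasure K ≤
      Measure.sum fun v : K => (μHE[n - 1] : Measure (Pt n)).restrict (hull (K.erase v)) := by
    rw [boundaryMeasure, frontier_cell hK, show (⋃ v ∈ K, hull (K.erase v)) = ⋃ v : K, hull (K.erase v) by
      ext; simp]
    exact Measure.restrict_iUnion_le
  have hi : ∀ v : K, Integrable (fun x => φ x ^ 2)
      ((μHE[n - 1] : Measure (Pt n)).restrict (hull (K.erase v))) := fun v =>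
    integrableOn_of_continuous (isCompact_hull _) (facet_measure hn hK v.2).1 (hφ.continuous.pow 2)
  rw [Measure.sum_fintype] at h1
  have h2 := integral_mono_measure h1 (ae_of_all _ fun x => sq_nonneg (φ x))
    (integrable_finsetSum_measure.2 fun v _ => hi v)
  rw [integral_finsetSum_measure fun v _ => hi v] at h2
  refine h2.trans ?_
  rw [gradSum, Finset.sum_mul, ← Finset.sum_coe_sort K]
  refine Finset.sum_le_sum fun v _ => (integral_facet_sq_le hn hK v.2 (hφ.of_le (by simp))).trans ?_
  rw [semiSq_zero, semiSq_one]
  gcongr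
  exact integral_norm_fderiv_sq_le K hφ

theorem MemSobolev.hasWeakDeriv {Ω : Set (Pt n)} {u : Pt n → ℝ} (hu : MemSobolev Ω 1 u) (i : Fin n) :
    HasWeakDeriv Ω (fun _ : Fin 1 => i) u (weakDeriv Ω (fun _ : Fin 1 => i) u) :=
  weakDeriv_spec (hu.2 1 le_rfl _)

theorem memSobolev_of_contDiff (K : Finset (Pt n)) {φ : Pt n → ℝ} (hφ : ContDiff ℝ ∞ φ) :
    MemSobolev (interior (hull K)) 1 φ := by
  refine memSobolev_one ?_ fun i => ⟨_, hasWeakDeriv_of_contDiff hφ ?_⟩ <;> rw [restrict_interior_hull]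
  · exact memLp_hull_of_continuous K hφ.continuous
  · exact memLp_hull_of_continuous K (contDiff_partialDeriv _ hφ).continuous

/-- The `H¹`-seminorm on the interior of a simplex, squared. -/
def gradSq (K : Finset (Pt n)) (u : Pt n → ℝ) : ℝ :=
  ∑ i, ∫ x in hull K, weakDeriv (interior (hull K)) (fun _ : Fin 1 => i) u x ^ 2

theorem gradSq_nonneg (K : Finset (Pt n)) (u : Pt n → ℝ) : 0 ≤ gradSq K u :=
  Finset.sum_nonneg fun _ _ => integral_nonneg fun _ => sq_nonneg _

theorem gradSq_eq {u : Pt n → ℝ} {g : Fin n → Pt n → ℝ}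
    (h : ∀ i, HasWeakDeriv (interior (hull K)) (fun _ : Fin 1 => i) u (g i)) :
    gradSq K u = ∑ i, ∫ x in hull K, g i x ^ 2 := by
  refine Finset.sum_congr rfl fun i _ => integral_congr_ae ?_
  rw [← restrict_interior_hull]
  exact ((h i).weakDeriv_ae isOpen_interior).mono fun x hx => by simp only [hx]

theorem gradSq_contDiff (K : Finset (Pt n)) {φ : Pt n → ℝ} (hφ : ContDiff ℝ ∞ φ) :
    gradSq K φ = semiSq K 1 φ := by
  rw [semiSq_one]
  exact gradSq_eq fun i => hasWeakDeriv_of_contDiff hφ (by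
    rw [restrict_interior_hull]
    exact memLp_hull_of_continuous K (contDiff_partialDeriv _ hφ).continuous)

theorem sobolevNormSq_cell {u : Pt n → ℝ} (hu : MemSobolev (interior (hull K)) 1 u) :
    sobolevNormSq (interior (hull K)) 1 u = (∫ x in hull K, u x ^ 2) + gradSq K u := by
  rw [sobolevNormSq_one isOpen_interior hu.1 hu.hasWeakDeriv, restrict_interior_hull, gradSq]

theorem gradSq_sub_le {u v : Pt n → ℝ} (hu : MemSobolev (interior (hull K)) 1 u)
    (hv : MemSobolev (interior (hull K)) 1 v) :
    gradSq K (fun x => u x - v x) ≤ 2 * gradSq K u + 2 * gradSq K v := by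
  rw [gradSq_eq fun i => (hu.hasWeakDeriv i).sub (hv.hasWeakDeriv i) hu.1 hv.1, gradSq, gradSq,
    Finset.mul_sum, Finset.mul_sum, ← Finset.sum_add_distrib]
  refine Finset.sum_le_sum fun i _ => ?_
  have h1 := (hu.hasWeakDeriv i).1
  have h2 := (hv.hasWeakDeriv i).1
  rw [restrict_interior_hull] at h1 h2
  exact integral_sq_sub_le h1 h2

theorem MemSobolev.memLp_hull {m : ℕ} {u : Pt n → ℝ} (hu : MemSobolev (interior (hull K)) m u) :
    MemLp u 2 (volume.restrict (hull K)) := by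
  rw [← restrict_interior_hull]; exact hu.1

theorem MemSobolev.congr {Ω : Set (Pt n)} {m : ℕ} {u u' : Pt n → ℝ} (hu : MemSobolev Ω m u)
    (h : u =ᵐ[volume.restrict Ω] u') : MemSobolev Ω m u' :=
  ⟨(memLp_congr_ae h).1 hu.1, fun j hj α => (hu.2 j hj α).imp fun _ hv => hv.congr h (ae_eq_refl _)⟩

/-- The weighted `H¹`-norm that controls the trace. -/
def traceBound (K : Finset (Pt n)) (u : Pt n → ℝ) : ℝ :=
  gradSum K * ((n + 1) * (∫ x in hull K, u x ^ 2) + cellDiam K ^ 2 * gradSq K u)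

theorem traceBound_sub_le {u v : Pt n → ℝ} (hu : MemSobolev (interior (hull K)) 1 u)
    (hv : MemSobolev (interior (hull K)) 1 v) :
    traceBound K (fun x => u x - v x) ≤ 2 * traceBound K u + 2 * traceBound K v := by
  have h1 := integral_sq_sub_le hu.memLp_hull hv.memLp_hull
  have h2 := gradSq_sub_le hu hv
  have h3 := gradSum_nonneg K
  have h4 : traceBound K (fun x => u x - v x) ≤ gradSum K *
      ((n + 1) * (2 * (∫ x in hull K, u x ^ 2) + 2 * ∫ x in hull K, v x ^ 2) +
        cellDiam K ^ 2 * (2 * gradSq K u + 2 * gradSq K v)) := by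
    rw [traceBound]
    gcongr
  refine h4.trans (le_of_eq ?_)
  rw [traceBound, traceBound]
  ring

theorem traceBound_le_sobolev {u : Pt n → ℝ} (hu : MemSobolev (interior (hull K)) 1 u) :
    traceBound K u ≤ gradSum K * ((n + 1) + cellDiam K ^ 2) * sobolevNormSq (interior (hull K)) 1 u := by
  have h1 := gradSum_nonneg K
  have h2 := gradSq_nonneg K u
  have h3 : 0 ≤ ∫ x in hull K, u x ^ 2 := integral_nonneg fun _ => sq_nonneg _
  rw [sobolevNormSq_cell hu, traceBound, mul_assoc]
  refine mul_le_mul_of_nonneg_left ?_ h1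
  have : 0 ≤ cellDiam K ^ 2 * ∫ x in hull K, u x ^ 2 := by positivity
  have : 0 ≤ ((n : ℝ) + 1) * gradSq K u := by positivity
  nlinarith

theorem isTrace_of_contDiff (hn : 1 ≤ n) (hK : IsCell K) {φ : Pt n → ℝ} (hφ : ContDiff ℝ ∞ φ) :
    IsTrace K φ φ := by
  refine ⟨memSobolev_of_contDiff K hφ, memLp_boundary hn hK hφ.continuous, fun _ => φ, fun _ => hφ, ?_, ?_⟩
  · have e : sobolevNormSq (interior (hull K)) 1 (fun x => φ x - φ x) = 0 := by
      have h0 : ContDiff ℝ ∞ fun x : Pt n => φ x - φ x := hφ.sub hφ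
      rw [sobolevNormSq_cell (memSobolev_of_contDiff K h0), gradSq_contDiff K h0, semiSq_one]
      simp [partialDeriv_one]
    simp only [e]
    exact tendsto_const_nhds
  · simp

theorem IsTrace.sub (hn : 1 ≤ n) (hK : IsCell K) {u u' g g' : Pt n → ℝ} (h : IsTrace K u g)
    (h' : IsTrace K u' g') : IsTrace K (fun x => u x - u' x) (fun x => g x - g' x) := by
  obtain ⟨hu, hg, φ, hφ, h1, h2⟩ := h
  obtain ⟨hu', hg', φ', hφ', h1', h2'⟩ := h'
  refine ⟨hu.sub hu', hg.sub hg', fun l x => φ l x - φ' l x, fun l => (hφ l).sub (hφ' l), ?_, ?_⟩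
  · refine squeeze_zero (fun l => ?_) (fun l => ?_)
      (by simpa using (h1.const_mul 2).add (h1'.const_mul 2))
    · exact Finset.sum_nonneg fun _ _ => Finset.sum_nonneg fun _ _ => integral_nonneg fun _ => sq_nonneg _
    · have a := hu.sub (memSobolev_of_contDiff K (hφ l))
      have a' := hu'.sub (memSobolev_of_contDiff K (hφ' l))
      have e : (fun x => u x - u' x - (φ l x - φ' l x)) = fun x => (u x - φ l x) - (u' x - φ' l x) := by
        funext x; ring
      rw [e, sobolevNormSq_cell (a.sub a'), sobolevNormSq_cell a, sobolevNormSq_cell a']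
      have t1 := integral_sq_sub_le a.memLp_hull a'.memLp_hull
      have t2 := gradSq_sub_le a a'
      linarith
  · refine squeeze_zero (fun l => integral_nonneg fun _ => sq_nonneg _) (fun l => ?_)
      (by simpa using (h2.const_mul 2).add (h2'.const_mul 2))
    have e : ∀ x, g x - g' x - (φ l x - φ' l x) = (g x - φ l x) - (g' x - φ' l x) := fun x => by ring
    simp only [e]
    exact integral_sq_sub_le (hg.sub (memLp_boundary hn hK (hφ l).continuous))
      (hg'.sub (memLp_boundary hn hK (hφ' l).continuous))

theorem IsTrace.congr {u u' g : Pt n → ℝ} (h : IsTrace K u g)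
    (he : u =ᵐ[volume.restrict (interior (hull K))] u') : IsTrace K u' g := by
  obtain ⟨hu, hg, φ, hφ, h1, h2⟩ := h
  refine ⟨hu.congr he, hg, φ, hφ, ?_, h2⟩
  refine h1.congr fun l => ?_
  have a := hu.sub (memSobolev_of_contDiff K (hφ l))
  have e : (fun x => u x - φ l x) =ᵐ[volume.restrict (interior (hull K))] fun x => u' x - φ l x :=
    he.mono fun x hx => by simp only [hx]
  rw [sobolevNormSq_one isOpen_interior a.1 a.hasWeakDeriv, sobolevNormSq_one isOpen_interior
    (a.congr e).1 fun i => (a.hasWeakDeriv i).congr e (ae_eq_refl _)]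
  congr 1
  exact integral_congr_ae (e.mono fun x hx => by simp only [hx])

/-- The trace inequality. -/
theorem IsTrace.integral_sq_le (hn : 1 ≤ n) (hK : IsCell K) {u g : Pt n → ℝ} (h : IsTrace K u g) :
    ∫ x, g x ^ 2 ∂(boundaryMeasure K) ≤ 4 * traceBound K u := by
  obtain ⟨hu, hg, φ, hφ, h1, h2⟩ := h
  set c := gradSum K * ((n + 1) + cellDiam K ^ 2) with hc
  -- Writing g = (g − φ_l) + φ_l and φ_l = u − (u − φ_l) costs a factor 2 each time, which explains
  -- the 4; the remaining terms tend to zero.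
  have hlim : Tendsto (fun l => 4 * traceBound K u + (4 * (c * sobolevNormSq (interior (hull K)) 1
      (fun x => u x - φ l x)) + 2 * ∫ x, (g x - φ l x) ^ 2 ∂(boundaryMeasure K))) atTop
      (𝓝 (4 * traceBound K u + (4 * (c * 0) + 2 * 0))) :=
    tendsto_const_nhds.add (((h1.const_mul c).const_mul 4).add (h2.const_mul 2))
  simp only [mul_zero, add_zero] at hlim
  refine ge_of_tendsto' hlim fun l => ?_
  have mφ := memLp_boundary hn hK (hφ l).continuous
  have sφ := memSobolev_of_contDiff K (hφ l)
  have e1 := integral_sq_sub_le (hg.sub mφ) mφ.neg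
  simp only [Pi.sub_apply, Pi.neg_apply, sub_neg_eq_add, sub_add_cancel, neg_sq] at e1
  have e2 := integral_boundary_sq_le hn hK (hφ l)
  rw [semiSq_zero, ← gradSq_contDiff K (hφ l)] at e2
  have e3 := traceBound_sub_le hu (hu.sub sφ)
  simp only [sub_sub_cancel] at e3
  have e4 := traceBound_le_sobolev (hu.sub sφ)
  have e5 : ∫ x, φ l x ^ 2 ∂(boundaryMeasure K) ≤ traceBound K (φ l) := e2
  linarith

/-- Smooth approximations with error 2^(−l) in H¹(K) have, by the trace inequality for smooth
functions, boundary values that are Cauchy in L²(∂K). The limit is a trace. -/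
theorem exists_isTrace (hn : 1 ≤ n) (hK : IsCell K) {u : Pt n → ℝ}
    (hu : MemSobolev (interior (hull K)) 1 u) : ∃ g, IsTrace K u g := by
  set c := gradSum K * ((n + 1) + cellDiam K ^ 2) * (1 + n) with hc
  have hc0 : 0 ≤ c := by have := gradSum_nonneg K; positivity
  have hex : ∀ l : ℕ, ∃ φ : Pt n → ℝ, ContDiff ℝ ∞ φ ∧
      sobolevNormSq (interior (hull K)) 1 (fun x => u x - φ x) ≤ (1 + n) * ((1 / 2) ^ l) ^ 2 := by
    intro l
    obtain ⟨φ, hφ, h⟩ := exists_smooth_approx hK hu (ε := ENNReal.ofReal ((1 / 2) ^ l)) (by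
      rw [Ne, ENNReal.ofReal_eq_zero, not_le]; positivity)
    have sφ := memSobolev_of_contDiff K hφ
    have hm : MemLp (fun x => u x - φ x) 2 (volume.restrict (interior (hull K))) := hu.1.sub sφ.1
    refine ⟨φ, hφ, ?_⟩
    have hwd : ∀ i, HasWeakDeriv (interior (hull K)) (fun _ : Fin 1 => i) φ
        (partialDeriv (fun _ : Fin 1 => i) φ) := fun i => hasWeakDeriv_of_contDiff hφ (by
      rw [restrict_interior_hull]
      exact memLp_hull_of_continuous K (contDiff_partialDeriv _ hφ).continuous)
    rw [sobolevNormSq_one isOpen_interior hm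
      fun i => (hu.hasWeakDeriv i).sub (hwd i) hu.1 sφ.1]
    have e0 : ∫ x in interior (hull K), (u x - φ x) ^ 2 ≤ ((1 / 2) ^ l) ^ 2 := by
      refine integral_sq_le_of_eLpNorm_le hm (by positivity) ((le_of_eq (eLpNorm_congr_ae ?_)).trans
        (h 0 (Nat.zero_le _) finZeroElim))
      refine ((hasWeakDeriv_zero hu.1 (α := (finZeroElim : Fin 0 → Fin n))).weakDeriv_ae isOpen_interior).mono fun x hx => ?_
      simp only [hx, partialDeriv_zero]
    have e1 : ∀ i, ∫ x in interior (hull K), (weakDeriv (interior (hull K)) (fun _ : Fin 1 => i) u x -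
        partialDeriv (fun _ : Fin 1 => i) φ x) ^ 2 ≤ ((1 / 2) ^ l) ^ 2 := fun i =>
      integral_sq_le_of_eLpNorm_le ((hu.hasWeakDeriv i).1.sub (hwd i).1) (by positivity)
        (h 1 le_rfl _)
    have e2 := Finset.sum_le_sum fun i (_ : i ∈ Finset.univ) => e1 i
    simp only [Finset.sum_const, Finset.card_univ, Fintype.card_fin, nsmul_eq_mul] at e2
    rw [add_mul, one_mul]
    exact add_le_add e0 e2
  choose φ hφ hφu using hex
  have hm : ∀ l, MemLp (φ l) 2 (boundaryMeasure K) := fun l => memLp_boundary hn hK (hφ l).continuous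
  have hcau : ∀ l l', ∫ x, (φ l x - φ l' x) ^ 2 ∂(boundaryMeasure K) ≤
      2 * (c * ((1 / 2) ^ l) ^ 2) + 2 * (c * ((1 / 2) ^ l') ^ 2) := by
    intro l l'
    have s := memSobolev_of_contDiff K (hφ l)
    have s' := memSobolev_of_contDiff K (hφ l')
    have h1 := integral_boundary_sq_le hn hK ((hφ l).sub (hφ l'))
    rw [semiSq_zero, ← gradSq_contDiff K ((hφ l).sub (hφ l'))] at h1
    have h2 := traceBound_sub_le (hu.sub s') (hu.sub s)
    simp only [sub_sub_sub_cancel_left] at h2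
    have t : ∀ l, traceBound K (fun x => u x - φ l x) ≤ c * ((1 / 2) ^ l) ^ 2 := by
      intro l
      refine (traceBound_le_sobolev (hu.sub (memSobolev_of_contDiff K (hφ l)))).trans ?_
      have := mul_le_mul_of_nonneg_left (hφu l)
        (mul_nonneg (gradSum_nonneg K) (by positivity : (0 : ℝ) ≤ (n + 1) + cellDiam K ^ 2))
      refine this.trans (le_of_eq ?_)
      rw [hc]; ring
    have h3 := t l
    have h4 := t l'
    have h5 : ∫ x, (φ l x - φ l' x) ^ 2 ∂(boundaryMeasure K) ≤ traceBound K (fun x => φ l x - φ l' x) := h1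
    linarith
  -- The rate (2c+1)2^(−N) is summable and strictly dominates the Cauchy estimate, since 4c <
  -- (2c+1)².
  obtain ⟨g, hg, hgl⟩ := Lp.cauchy_complete_eLpNorm (p := 2) (μ := boundaryMeasure K) (by norm_num) hm
    (B := fun N => ENNReal.ofReal ((2 * c + 1) * (1 / 2) ^ N)) (by
      rw [← ENNReal.ofReal_tsum_of_nonneg (fun _ => by positivity)
        (summable_geometric_two.mul_left _)]
      exact ENNReal.ofReal_ne_top) (fun N l l' hl hl' => by
      refine eLpNorm_lt_of_integral_sq_lt ((hm l).sub (hm l')) (by positivity) ?_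
      have a : ∀ l, N ≤ l → ((1 / 2 : ℝ) ^ l) ^ 2 ≤ ((1 / 2) ^ N) ^ 2 := fun l hl =>
        pow_le_pow_left₀ (by positivity) (pow_le_pow_of_le_one (by norm_num) (by norm_num) hl) 2
      have h1 := hcau l l'
      have h2 := mul_le_mul_of_nonneg_left (a l hl) hc0
      have h3 := mul_le_mul_of_nonneg_left (a l' hl') hc0
      have h4 : (0 : ℝ) < ((1 / 2) ^ N) ^ 2 := by positivity
      simp only [Pi.sub_apply]
      rw [mul_pow]
      have h5 : 4 * c * ((1 / 2) ^ N) ^ 2 < (2 * c + 1) ^ 2 * ((1 / 2) ^ N) ^ 2 :=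
        mul_lt_mul_of_pos_right (by nlinarith) h4
      linarith)
  refine ⟨g, hu, hg, φ, hφ, ?_, ?_⟩
  · refine squeeze_zero (fun l => ?_) hφu ?_
    · exact Finset.sum_nonneg fun _ _ => Finset.sum_nonneg fun _ _ => integral_nonneg fun _ => sq_nonneg _
    · have := (((tendsto_pow_atTop_nhds_zero_of_lt_one (r := (1 / 2 : ℝ)) (by norm_num)
        (by norm_num)).pow 2).const_mul (1 + (n : ℝ)))
      simpa using this
  · have h1 : ∀ l, ∫ x, (g x - φ l x) ^ 2 ∂(boundaryMeasure K) =
        ((eLpNorm (φ l - g) 2 (boundaryMeasure K)) ^ 2).toReal := by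
      intro l
      rw [eLpNorm_two_sq_eq_ofReal ((hm l).sub hg), ENNReal.toReal_ofReal
        (integral_nonneg fun _ => sq_nonneg _)]
      exact integral_congr_ae (ae_of_all _ fun x => by simp only [Pi.sub_apply]; ring)
    simp only [h1]
    have h2 : Tendsto (fun l => eLpNorm (φ l - g) 2 (boundaryMeasure K) ^ 2) atTop (𝓝 0) := by
      have := ENNReal.Tendsto.pow (n := 2) hgl
      simpa using this
    have := (ENNReal.tendsto_toReal ENNReal.zero_ne_top).comp h2
    rw [ENNReal.toReal_zero] at this
    exact this

theorem isTrace_trace (hn : 1 ≤ n) (hK : IsCell K) {u : Pt n → ℝ}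
    (hu : MemSobolev (interior (hull K)) 1 u) : IsTrace K u (trace K u) :=
  Classical.epsilon_spec (exists_isTrace hn hK hu)

end Traces

/-! ### Traces on a common facet agree from both sides. -/

section TraceLocality

variable {n : ℕ} {K : Finset (Pt n)}

theorem exists_bound_smooth {χ : Pt n → ℝ} (hχ : ContDiff ℝ ∞ χ) (hχc : HasCompactSupport χ) :
    ∃ M, 0 ≤ M ∧ (∀ x, |χ x| ≤ M) ∧ ∀ i x, |partialDeriv (fun _ : Fin 1 => i) χ x| ≤ M := by
  obtain ⟨M₀, h₀⟩ := hχ.continuous.bounded_above_of_compact_support hχc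
  have h1 : ∀ i : Fin n, ∃ C, ∀ x, ‖partialDeriv (fun _ : Fin 1 => i) χ x‖ ≤ C := fun i =>
    (contDiff_partialDeriv _ hχ).continuous.bounded_above_of_compact_support
      (hχc.of_isClosed_subset (isClosed_tsupport _) (tsupport_partialDeriv_subset _ _))
  choose M₁ h₁ using h1
  have hp : ∀ i, 0 ≤ M₁ i := fun i => (norm_nonneg _).trans (h₁ i 0)
  refine ⟨M₀ + ∑ i, M₁ i, ?_, fun x => ?_, fun i x => ?_⟩
  · exact add_nonneg ((norm_nonneg _).trans (h₀ 0)) (Finset.sum_nonneg fun i _ => hp i)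
  · exact (h₀ x).trans (le_add_of_nonneg_right (Finset.sum_nonneg fun i _ => hp i))
  · refine (h₁ i x).trans ((Finset.single_le_sum (fun i _ => hp i) (Finset.mem_univ i)).trans ?_)
    exact le_add_of_nonneg_left ((norm_nonneg _).trans (h₀ 0))

theorem integral_sq_mul_le {X : Type*} [MeasurableSpace X] {μ : Measure X} {f a : X → ℝ}
    (hf : MemLp f 2 μ) {M : ℝ} (ha : ∀ x, |a x| ≤ M) :
    ∫ x, (a x * f x) ^ 2 ∂μ ≤ M ^ 2 * ∫ x, f x ^ 2 ∂μ := by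
  rw [← integral_const_mul]
  refine integral_mono_of_nonneg (ae_of_all _ fun x => sq_nonneg _)
    (hf.integrable_sq.const_mul _) (ae_of_all _ fun x => ?_)
  show (a x * f x) ^ 2 ≤ M ^ 2 * f x ^ 2
  rw [mul_pow]
  exact mul_le_mul_of_nonneg_right (sq_le_sq' (by linarith [(abs_le.1 (ha x)).1]) (abs_le.1 (ha x)).2)
    (sq_nonneg _)

theorem hasWeakDeriv_smooth_mul {U : Set (Pt n)} (hU : MeasurableSet U) {i : Fin n}
    {u g χ : Pt n → ℝ} (hχ : ContDiff ℝ ∞ χ) (hχc : HasCompactSupport χ)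
    (hu : MemLp u 2 (volume.restrict U)) (h : HasWeakDeriv U (fun _ : Fin 1 => i) u g) :
    HasWeakDeriv U (fun _ : Fin 1 => i) (fun x => χ x * u x)
      (fun x => χ x * g x + partialDeriv (fun _ : Fin 1 => i) χ x * u x) ∧
    MemLp (fun x => χ x * u x) 2 (volume.restrict U) :=
  HasWeakDeriv.mul_smooth hχ hχc hU hU subset_rfl (fun _ hx => absurd hx.1 hx.2)
    (fun _ hφ => ⟨hχ.mul hφ.1, hφ.2.1.mul_left, (tsupport_mul_subset_right).trans hφ.2.2⟩) hu h

/-- Multiplication by a cut-off is bounded in H¹(K) and in L²(∂K), so the approximating sequence may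
be multiplied too. This localizes traces. -/
theorem IsTrace.mul_smooth (hn : 1 ≤ n) (hK : IsCell K) {u g χ : Pt n → ℝ} (hχ : ContDiff ℝ ∞ χ)
    (hχc : HasCompactSupport χ) (h : IsTrace K u g) :
    IsTrace K (fun x => χ x * u x) (fun x => χ x * g x) := by
  obtain ⟨M, hM, h0, h1⟩ := exists_bound_smooth hχ hχc
  obtain ⟨hu, hg, φ, hφ, l1, l2⟩ := h
  have hO : MeasurableSet (interior (hull K)) := isOpen_interior.measurableSet
  have key : ∀ v, MemSobolev (interior (hull K)) 1 v →
      MemSobolev (interior (hull K)) 1 (fun x => χ x * v x) ∧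
      sobolevNormSq (interior (hull K)) 1 (fun x => χ x * v x) ≤
        (M ^ 2 * (3 + 2 * n)) * sobolevNormSq (interior (hull K)) 1 v := by
    intro v hv
    have hm := fun i => hasWeakDeriv_smooth_mul hO hχ hχc hv.1 (hv.hasWeakDeriv i)
    have hmv : MemLp (fun x => χ x * v x) 2 (volume.restrict (interior (hull K))) :=
      hv.1.of_le_mul (c := M) ((hχ.continuous.aestronglyMeasurable).mul hv.1.1)
        (ae_of_all _ fun x => by
          rw [norm_mul]; exact mul_le_mul_of_nonneg_right (h0 x) (norm_nonneg _))
    refine ⟨memSobolev_one hmv fun i => ⟨_, (hm i).1⟩, ?_⟩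
    rw [sobolevNormSq_one isOpen_interior hmv fun i => (hm i).1,
      sobolevNormSq_one isOpen_interior hv.1 hv.hasWeakDeriv]
    have a0 := integral_sq_mul_le hv.1 h0
    have a1 : ∀ i, ∫ x in interior (hull K), (χ x * weakDeriv (interior (hull K)) (fun _ : Fin 1 => i) v x
        + partialDeriv (fun _ : Fin 1 => i) χ x * v x) ^ 2 ≤
        2 * (M ^ 2 * ∫ x in interior (hull K), weakDeriv (interior (hull K)) (fun _ : Fin 1 => i) v x ^ 2)
          + 2 * (M ^ 2 * ∫ x in interior (hull K), v x ^ 2) := by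
      intro i
      have b := (hv.hasWeakDeriv i).1.integrable_sq.const_mul (2 * M ^ 2)
      have b' := hv.1.integrable_sq.const_mul (2 * M ^ 2)
      rw [← mul_assoc, ← mul_assoc, ← integral_const_mul, ← integral_const_mul, ← integral_add b b']
      refine integral_mono_of_nonneg (ae_of_all _ fun x => sq_nonneg _) (b.add b')
        (ae_of_all _ fun x => ?_)
      have c0 := sq_le_sq' (abs_le.1 (h0 x)).1 (abs_le.1 (h0 x)).2
      have c1 := sq_le_sq' (abs_le.1 (h1 i x)).1 (abs_le.1 (h1 i x)).2
      simp only
      set D := weakDeriv (interior (hull K)) (fun _ : Fin 1 => i) v x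
      nlinarith [mul_le_mul_of_nonneg_right c0 (sq_nonneg D), mul_le_mul_of_nonneg_right c1
        (sq_nonneg (v x)), sq_nonneg (χ x * D - partialDeriv (fun _ : Fin 1 => i) χ x * v x)]
    have a2 := Finset.sum_le_sum fun i (_ : i ∈ Finset.univ) => a1 i
    simp only [Finset.sum_add_distrib, ← Finset.mul_sum, Finset.sum_const, Finset.card_univ,
      Fintype.card_fin, nsmul_eq_mul] at a2
    have p0 : 0 ≤ M ^ 2 * ∫ x in interior (hull K), v x ^ 2 :=
      mul_nonneg (sq_nonneg _) (integral_nonneg fun _ => sq_nonneg _)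
    have p1 : 0 ≤ M ^ 2 * ∑ i, ∫ x in interior (hull K),
        weakDeriv (interior (hull K)) (fun _ : Fin 1 => i) v x ^ 2 :=
      mul_nonneg (sq_nonneg _) (Finset.sum_nonneg fun _ _ => integral_nonneg fun _ => sq_nonneg _)
    have p2 := mul_nonneg (Nat.cast_nonneg (α := ℝ) n) p1
    nlinarith
  refine ⟨(key u hu).1, ?_, fun l x => χ x * φ l x, fun l => hχ.mul (hφ l), ?_, ?_⟩
  · exact hg.of_le_mul (c := M) ((hχ.continuous.aestronglyMeasurable).mul hg.1)
      (ae_of_all _ fun x => by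
        rw [norm_mul]; exact mul_le_mul_of_nonneg_right (h0 x) (norm_nonneg _))
  · refine squeeze_zero (fun l => ?_) (fun l => ?_)
      (by simpa using l1.const_mul (M ^ 2 * (3 + 2 * n)))
    · exact Finset.sum_nonneg fun _ _ => Finset.sum_nonneg fun _ _ => integral_nonneg fun _ => sq_nonneg _
    · simp only [← mul_sub]
      exact (key _ (hu.sub (memSobolev_of_contDiff K (hφ l)))).2
  · refine squeeze_zero (fun l => integral_nonneg fun _ => sq_nonneg _) (fun l => ?_)
      (by simpa using l2.const_mul (M ^ 2))
    simp only [← mul_sub]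
    exact integral_sq_mul_le (hg.sub (memLp_boundary hn hK (hφ l).continuous)) h0

theorem simplexMeasure_le_boundaryMeasure (hK : IsCell K) {F : Finset (Pt n)} (hF : F ⊆ K)
    (hc : F.card = n) : simplexMeasure F ≤ boundaryMeasure K := by
  obtain ⟨v, hv, rfl⟩ := eq_erase_of_card hK hF hc
  rw [simplexMeasure, boundaryMeasure, hc]
  refine Measure.restrict_mono_set _ ?_
  rw [frontier_cell hK]
  exact Set.subset_biUnion_of_mem (u := fun v => hull (K.erase v)) hv

theorem IsTrace.integral_facet_sq_le (hn : 1 ≤ n) (hK : IsCell K) {F : Finset (Pt n)} (hF : F ⊆ K)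
    (hc : F.card = n) {u g : Pt n → ℝ} (h : IsTrace K u g) :
    ∫ x, g x ^ 2 ∂(simplexMeasure F) ≤ 4 * traceBound K u :=
  (integral_mono_measure (simplexMeasure_le_boundaryMeasure hK hF hc)
    (ae_of_all _ fun _ => sq_nonneg _) h.2.1.integrable_sq).trans (h.integral_sq_le hn hK)

theorem IsTrace.memLp_facet (hK : IsCell K) {F : Finset (Pt n)} (hF : F ⊆ K)
    (hc : F.card = n) {u g : Pt n → ℝ} (h : IsTrace K u g) : MemLp g 2 (simplexMeasure F) :=
  h.2.1.mono_measure (simplexMeasure_le_boundaryMeasure hK hF hc)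

/-- Traces from the two sides of a facet agree for a function with weak derivatives across it. -/
theorem IsTrace.ae_eq_of_global (hn : 1 ≤ n) {K' F : Finset (Pt n)} (hK : IsCell K) (hK' : IsCell K')
    (hF : F ⊆ K) (hF' : F ⊆ K') (hc : F.card = n) {w g g' : Pt n → ℝ} {D : Fin n → Pt n → ℝ}
    (hw : MemLp w 2 volume) (hD : ∀ i, HasWeakDeriv Set.univ (fun _ : Fin 1 => i) w (D i))
    (hg : IsTrace K w g) (hg' : IsTrace K' w g') : g =ᵐ[simplexMeasure F] g' := by
  set c : Finset (Pt n) → ℝ := fun K => gradSum K * ((n + 1) + cellDiam K ^ 2) with hcdef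
  have hc0 : ∀ K, 0 ≤ c K := fun K => by
    have := gradSum_nonneg K
    simp only [hcdef]; positivity
  -- One smooth φ approximates w on all of ℝⁿ, so both traces are compared with the same values of φ
  -- on the facet.
  have key : ∀ ε : ℝ, 0 < ε → ∫ x, (g x - g' x) ^ 2 ∂(simplexMeasure F) ≤
      8 * (1 + n) * (c K + c K') * ε ^ 2 := by
    intro ε hε
    obtain ⟨φ, hφ, e0, e1⟩ := exists_smooth_approx_univ hw hD (ε := ENNReal.ofReal ε) (by
      rw [Ne, ENNReal.ofReal_eq_zero, not_le]; exact hε)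
    have one : ∀ K, IsCell K → F ⊆ K → ∀ g, IsTrace K w g →
        MemLp (fun x => g x - φ x) 2 (simplexMeasure F) ∧
        ∫ x, (g x - φ x) ^ 2 ∂(simplexMeasure F) ≤ 4 * (c K * ((1 + n) * ε ^ 2)) := by
      intro K hK hF g hg
      have t := hg.sub hn hK (isTrace_of_contDiff hn hK hφ)
      refine ⟨t.memLp_facet hK hF hc, (t.integral_facet_sq_le hn hK hF hc).trans ?_⟩
      refine mul_le_mul_of_nonneg_left ((traceBound_le_sobolev t.1).trans ?_) (by norm_num)
      refine mul_le_mul_of_nonneg_left ?_ (hc0 K)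
      have hwd : ∀ i, HasWeakDeriv (interior (hull K)) (fun _ : Fin 1 => i) (fun x => w x - φ x)
          (fun x => D i x - partialDeriv (fun _ : Fin 1 => i) φ x) := fun i =>
        ((hD i).mono (Set.subset_univ _)).sub (hasWeakDeriv_of_contDiff hφ (by
          rw [restrict_interior_hull]
          exact memLp_hull_of_continuous K (contDiff_partialDeriv _ hφ).continuous))
          (hw.restrict _) (memSobolev_of_contDiff K hφ).1
      rw [sobolevNormSq_one isOpen_interior t.1.1 hwd, add_mul, one_mul]
      refine add_le_add (integral_sq_le_of_eLpNorm_le t.1.1 hε.le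
        ((eLpNorm_mono_measure _ Measure.restrict_le_self).trans e0)) ?_
      have e2 := Finset.sum_le_sum fun i (_ : i ∈ Finset.univ) =>
        integral_sq_le_of_eLpNorm_le (hwd i).1 hε.le
          ((eLpNorm_mono_measure _ Measure.restrict_le_self).trans (e1 i))
      simpa only [Finset.sum_const, Finset.card_univ, Fintype.card_fin, nsmul_eq_mul] using e2
    obtain ⟨m1, b1⟩ := one K hK hF g hg
    obtain ⟨m2, b2⟩ := one K' hK' hF' g' hg'
    have := integral_sq_sub_le m1 m2
    simp only [sub_sub_sub_cancel_right] at this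
    refine this.trans ?_
    nlinarith
  have hm := (hg.memLp_facet hK hF hc).sub (hg'.memLp_facet hK' hF' hc)
  have h0 : ∫ x, (g x - g' x) ^ 2 ∂(simplexMeasure F) = 0 := by
    refine le_antisymm ?_ (integral_nonneg fun _ => sq_nonneg _)
    have lim : Tendsto (fun ε : ℝ => 8 * (1 + n) * (c K + c K') * ε ^ 2) (𝓝[>] 0)
        (𝓝 (8 * (1 + n) * (c K + c K') * 0 ^ 2)) :=
      ((by fun_prop : Continuous fun ε : ℝ => 8 * (1 + n) * (c K + c K') * ε ^ 2).tendsto 0).mono_left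
        nhdsWithin_le_nhds
    simp only [ne_eq, OfNat.ofNat_ne_zero, not_false_eq_true, zero_pow, mul_zero] at lim
    exact ge_of_tendsto lim (eventually_mem_nhdsWithin.mono fun ε hε => key ε hε)
  have h2 := (integral_eq_zero_iff_of_nonneg (fun x => sq_nonneg _) hm.integrable_sq).1 h0
  exact h2.mono fun x hx => sub_eq_zero.1 (pow_eq_zero_iff two_ne_zero |>.1 hx)

/-- A facet of F has finite measure in its own dimension, hence measure zero one dimension higher.
For n = 1 it is empty. -/
theorem simplexMeasure_boundary (hn : 1 ≤ n) (hK : IsCell K) {F : Finset (Pt n)} (hF : F ⊆ K)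
    (hc : F.card = n) {v : Pt n} (hv : v ∈ F) : simplexMeasure F (hull (F.erase v)) = 0 := by
  refine le_antisymm ((Measure.restrict_apply_le _ _).trans (le_of_eq ?_)) bot_le
  rcases (F.erase v).eq_empty_or_nonempty with h | h
  · rw [h, hull_eq_empty_iff.2 rfl, measure_empty]
  · have hcard : (F.erase v).card = n - 1 := by rw [Finset.card_erase_of_mem hv, hc]
    have h1 := (simplexMeasure_hull_ne_top (s := F.erase v)
      (hK.1.mono (fun x hx => hF (Finset.mem_of_mem_erase hx))) h).1
    have h2 : (F.erase v).card - 1 < F.card - 1 := by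
      have := h.card_pos
      omega
    exact (Measure.euclideanHausdorffMeasure_zero_or_top h2 _).resolve_right h1

/-- A function in `H¹(Ω)` has a well defined trace on a facet with relative interior in `Ω`. -/
theorem trace_ae_eq (hn : 1 ≤ n) {Ω : Set (Pt n)} (hΩ : IsOpen Ω) {K' F : Finset (Pt n)}
    (hK : IsCell K) (hK' : IsCell K')
    (hF : F ⊆ K) (hF' : F ⊆ K') (hc : F.card = n) (hKΩ : interior (hull K) ⊆ Ω)
    (hKΩ' : interior (hull K') ⊆ Ω)
    (hFΩ : ∀ x ∈ hull F, (∀ v ∈ F, x ∉ hull (F.erase v)) → x ∈ Ω)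
    {u : Pt n → ℝ} (hu : MemSobolev Ω 1 u) : trace K u =ᵐ[simplexMeasure F] trace K' u := by
  have t := isTrace_trace hn hK (hu.mono hKΩ)
  have t' := isTrace_trace hn hK' (hu.mono hKΩ')
  have hloc : ∀ x ∈ Ω, ∃ V ∈ 𝓝 x, simplexMeasure F {y ∈ V | trace K u y ≠ trace K' u y} = 0 := by
    intro x hx
    -- A cut-off supported in Ω and equal to 1 at x makes χu a function in H¹(ℝⁿ), to which the
    -- global comparison applies; dividing by χ gives equality near x.
    obtain ⟨χ, c1, c2, c3, -, c5⟩ := exists_contDiff_tsupport_subset (n := ⊤) (hΩ.mem_nhds hx)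
    have hχ : ContDiff ℝ ∞ χ := c3
    have hw := fun i : Fin n => HasWeakDeriv.mul_smooth (U := Set.univ) (i := i) hχ c2 hΩ.measurableSet
      MeasurableSet.univ (Set.subset_univ _) (fun y hy hy' => hy.2 (c1 hy'))
      (fun φ hφ => ⟨hχ.mul hφ.1, c2.mul_right, (tsupport_mul_subset_left).trans c1⟩) hu.1
      (hu.hasWeakDeriv i)
    have hw0 := (hw ⟨0, hn⟩).2
    rw [Measure.restrict_univ] at hw0
    have h := IsTrace.ae_eq_of_global hn hK hK' hF hF' hc hw0 (fun i => (hw i).1)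
      (t.mul_smooth hn hK hχ c2) (t'.mul_smooth hn hK' hχ c2)
    refine ⟨{y | χ y ≠ 0}, (isOpen_ne_fun hχ.continuous continuous_const).mem_nhds ?_, ?_⟩
    · rw [Set.mem_ofPred_eq, c5]; exact one_ne_zero
    · refine measure_mono_null (fun y hy => ?_) h
      intro e
      exact hy.2 (mul_left_cancel₀ hy.1 e)
  have h1 : simplexMeasure F {y ∈ Ω | trace K u y ≠ trace K' u y} = 0 := by
    refine measure_null_of_locally_null _ fun x hx => ?_
    obtain ⟨V, hV, h⟩ := hloc x hx.1
    refine ⟨V ∩ {y ∈ Ω | trace K u y ≠ trace K' u y}, ?_, measure_mono_null ?_ h⟩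
    · rw [Set.inter_comm]
      exact inter_mem_nhdsWithin _ hV
    · exact fun y hy => ⟨hy.1, hy.2.2⟩
  have h2 : simplexMeasure F (⋃ v ∈ F, hull (F.erase v)) = 0 :=
    (measure_biUnion_null_iff F.countable_toSet).2 fun v hv => simplexMeasure_boundary hn hK hF hc hv
  have h3 : ∀ᵐ x ∂(simplexMeasure F), x ∈ hull F :=
    ae_restrict_mem (isCompact_hull F).isClosed.measurableSet
  filter_upwards [h3, measure_eq_zero_iff_ae_notMem.1 h1, measure_eq_zero_iff_ae_notMem.1 h2]
    with x a b c
  by_contra hne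
  simp only [Set.mem_iUnion, not_exists] at c
  exact b ⟨hFΩ x a c, hne⟩

end TraceLocality

/-! ### Geometry of conforming grids and chains of elements. -/

section MeshGeometry

variable {n : ℕ} {Ω : Set (Pt n)} (T : Mesh Ω)

theorem Mesh.mem_cells {K : Finset (Pt n)} : K ∈ T.cells ↔ K ∈ T.complex.faces ∧ K.card = n + 1 := by
  simp [Mesh.cells]

theorem Mesh.isCell {K : Finset (Pt n)} (hK : K ∈ T.cells) : IsCell K :=
  ⟨T.complex.indep (T.mem_cells.1 hK).1, (T.mem_cells.1 hK).2⟩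

theorem Mesh.mem_space {x : Pt n} : x ∈ T.complex.space ↔ ∃ K ∈ T.cells, x ∈ hull K := by
  rw [Geometry.SimplicialComplex.mem_space_iff]
  constructor
  · rintro ⟨s, hs, hx⟩
    obtain ⟨t, ht, hst, hc⟩ := T.pure s hs
    exact ⟨t, T.mem_cells.2 ⟨ht, hc⟩, hull_mono hst hx⟩
  · rintro ⟨K, hK, hx⟩
    exact ⟨K, (T.mem_cells.1 hK).1, hx⟩

include T in
theorem Mesh.isOpen : IsOpen Ω := T.interior_space ▸ isOpen_interior

theorem Mesh.subset_space : Ω ⊆ T.complex.space := by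
  conv_lhs => rw [← T.interior_space]
  exact interior_subset

theorem Mesh.interior_subset {K : Finset (Pt n)} (hK : K ∈ T.cells) : interior (hull K) ⊆ Ω := by
  conv_rhs => rw [← T.interior_space]
  refine interior_mono fun x hx => T.mem_space.2 ⟨K, hK, hx⟩

theorem Mesh.hull_subset_closure {K : Finset (Pt n)} (hK : K ∈ T.cells) : hull K ⊆ closure Ω := by
  have h := (convex_hull K).closure_interior_eq_closure_of_nonempty_interior
    (interior_cell_nonempty (T.isCell hK))
  rw [(isCompact_hull K).isClosed.closure_eq] at h
  rw [← h]
  exact closure_mono (T.interior_subset hK)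

theorem Mesh.mem_hull_inter {s t : Finset (Pt n)} (hs : s ∈ T.complex.faces)
    (ht : t ∈ T.complex.faces) {x : Pt n} (hxs : x ∈ hull s) (hxt : x ∈ hull t) : x ∈ hull (s ∩ t) := by
  have := T.complex.inter_subset_convexHull hs ht ⟨hxs, hxt⟩
  rwa [← Finset.coe_inter] at this

/-- Conformity puts x in the hull of the common vertices; all barycentric coordinates of x are
positive, so no vertex of K can be missing. -/
theorem Mesh.subset_of_mem_interior {K s : Finset (Pt n)} (hK : K ∈ T.cells)
    (hs : s ∈ T.complex.faces) {x : Pt n} (hx : x ∈ interior (hull K)) (hxs : x ∈ hull s) : K ⊆ s := by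
  have h := T.mem_hull_inter (T.mem_cells.1 hK).1 hs (_root_.interior_subset hx) hxs
  rw [mem_hull_face (T.isCell hK) Finset.inter_subset_left] at h
  intro v hv
  by_contra hvs
  exact ((mem_interior_cell (T.isCell hK)).1 hx v hv).ne' (h.2 v hv fun h' =>
    hvs (Finset.mem_inter.1 h').2)

theorem Mesh.eq_of_mem_interior {K K' : Finset (Pt n)} (hK : K ∈ T.cells) (hK' : K' ∈ T.cells)
    {x : Pt n} (hx : x ∈ interior (hull K)) (hx' : x ∈ hull K') : K = K' :=
  Finset.eq_of_subset_of_card_le (T.subset_of_mem_interior hK (T.mem_cells.1 hK').1 hx hx') (by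
    rw [(T.isCell hK).2, (T.isCell hK').2])

theorem Mesh.disjoint_interior :
    (T.cells : Set (Finset (Pt n))).PairwiseDisjoint fun K => interior (hull K) := by
  intro K hK K' hK' hne
  refine Set.disjoint_left.2 fun x hx hx' => hne ?_
  exact T.eq_of_mem_interior hK hK' hx (_root_.interior_subset hx')

theorem Mesh.ae_eq_biUnion : (⋃ K ∈ T.cells, interior (hull K)) =ᵐ[volume] Ω := by
  refine Filter.EventuallyLE.antisymm ?_ ?_
  · refine Filter.Eventually.of_forall fun x hx => ?_
    obtain ⟨K, hK, hx⟩ := Set.mem_iUnion₂.1 hx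
    exact T.interior_subset hK hx
  · have h : volume (⋃ K ∈ T.cells, frontier (hull K)) = 0 :=
      (measure_biUnion_null_iff T.cells.countable_toSet).2 fun K _ =>
        (convex_hull K).addHaar_frontier volume
    refine (measure_eq_zero_iff_ae_notMem.1 h).mono fun x hx hxΩ => ?_
    obtain ⟨K, hK, hxK⟩ := T.mem_space.1 (T.subset_space hxΩ)
    refine Set.mem_biUnion hK ?_
    by_contra hn
    exact hx (Set.mem_biUnion hK ⟨subset_closure hxK, hn⟩)

theorem Mesh.integral_eq_sum {f : Pt n → ℝ} (hf : ∀ K ∈ T.cells, IntegrableOn f (hull K)) :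
    ∫ x in Ω, f x = ∑ K ∈ T.cells, ∫ x in hull K, f x := by
  rw [← Measure.restrict_congr_set T.ae_eq_biUnion, integral_biUnion_finset _
    (fun K _ => isOpen_interior.measurableSet) T.disjoint_interior fun K hK =>
      (hf K hK).mono_set _root_.interior_subset]
  exact Finset.sum_congr rfl fun K _ => by rw [restrict_interior_hull]

theorem Mesh.ae_iff {p : Pt n → Prop} :
    (∀ᵐ x ∂(volume.restrict Ω), p x) ↔ ∀ K ∈ T.cells, ∀ᵐ x ∂(volume.restrict (hull K)), p x := by
  rw [← Measure.restrict_congr_set T.ae_eq_biUnion, ae_restrict_biUnion_finset_iff]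
  simp only [restrict_interior_hull]

/-- Both coordinates are affine and vanish on the common facet, so they are proportional; evaluation
at b gives the factor, whose sign tells on which side of the facet b lies. -/
theorem IsCell.bary_face_eq {K K' F : Finset (Pt n)} (hK : IsCell K) (hK' : IsCell K') {a b : Pt n}
    (ha : a ∈ K) (hb : b ∈ K') (hF : F = K.erase a) (hF' : F = K'.erase b) (y : Pt n) :
    bary K a y = bary K' b y * bary K a b := by
  conv_lhs => rw [← sum_bary_smul hK' y, affine_map_sum _ _ _ (sum_bary hK' y)]
  rw [← Finset.add_sum_erase _ _ hb, Finset.sum_eq_zero, add_zero]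
  intro v hv
  rw [← hF', hF] at hv
  rw [bary_of_ne hK ha (Finset.mem_of_mem_erase hv) (Finset.ne_of_mem_erase hv).symm, mul_zero]

theorem pos_bary_of_relint {K F : Finset (Pt n)} (hK : IsCell K) (hF : F ⊆ K) {x : Pt n}
    (hx : x ∈ hull F) (hx' : ∀ v ∈ F, x ∉ hull (F.erase v)) {v : Pt n} (hv : v ∈ F) :
    0 < bary K v x := by
  have h := (mem_hull_face hK hF).1 hx
  refine lt_of_le_of_ne ((mem_hull_cell hK).1 h.1 v (hF hv)) fun h0 => hx' v hv ?_
  refine (mem_hull_face hK ((Finset.erase_subset _ _).trans hF)).2 ⟨h.1, fun w hw hwF => ?_⟩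
  by_cases hwv : w = v
  · rw [hwv, h0]
  · exact h.2 w hw fun h' => hwF (Finset.mem_erase.2 ⟨hwv, h'⟩)

/-- The relative interior of a facet shared by two elements lies in the domain. -/
theorem Mesh.relint_subset {K K' F : Finset (Pt n)} (hK : K ∈ T.cells) (hK' : K' ∈ T.cells)
    (hne : K ≠ K') (hF : F ⊆ K) (hF' : F ⊆ K') (hc : F.card = n) {x : Pt n} (hx : x ∈ hull F)
    (hx' : ∀ v ∈ F, x ∉ hull (F.erase v)) : x ∈ Ω := by
  have cK := T.isCell hK
  have cK' := T.isCell hK'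
  obtain ⟨a, ha, rfl⟩ := eq_erase_of_card cK hF hc
  obtain ⟨b, hb, hFb⟩ := eq_erase_of_card cK' hF' hc
  have hrel := cK.bary_face_eq cK' ha hb rfl hFb
  have pos : ∀ v ∈ K.erase a, 0 < bary K v x := fun v hv => pos_bary_of_relint cK hF hx hx' hv
  have pos' : ∀ v ∈ K.erase a, 0 < bary K' v x := fun v hv => pos_bary_of_relint cK' hF' hx hx' hv
  have hax : bary K a x = 0 := ((mem_hull_face cK hF).1 hx).2 a ha (Finset.notMem_erase a K)
  have ev : ∀ᶠ y in 𝓝 x, (∀ v ∈ K.erase a, 0 < bary K v y) ∧ ∀ v ∈ K.erase a, 0 < bary K' v y := by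
    refine Filter.Eventually.and ?_ ?_ <;> rw [Filter.eventually_all_finset]
    · exact fun v hv => (bary_continuous K v).continuousAt.eventually_const_lt (pos v hv)
    · exact fun v hv => (bary_continuous K' v).continuousAt.eventually_const_lt (pos' v hv)
  -- Negative: the elements lie on opposite sides and together fill a neighbourhood of x. Zero: the
  -- coordinate of a would vanish identically. Positive: they lie on the same side and their
  -- interiors meet, which conformity forbids.
  rcases lt_trichotomy (bary K a b) 0 with hneg | h0 | hpos
  · rw [← T.interior_space, mem_interior_iff_mem_nhds]
    filter_upwards [ev] with y hy
    rw [T.mem_space]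
    rcases le_or_gt 0 (bary K a y) with h | h
    · refine ⟨K, hK, (mem_hull_cell cK).2 fun v hv => ?_⟩
      by_cases hva : v = a
      · rwa [hva]
      · exact (hy.1 v (Finset.mem_erase.2 ⟨hva, hv⟩)).le
    · refine ⟨K', hK', (mem_hull_cell cK').2 fun v hv => ?_⟩
      by_cases hvb : v = b
      · rw [hrel y] at h
        rw [hvb]
        by_contra hcon
        exact absurd h (not_lt.2 (mul_nonneg_of_nonpos_of_nonpos (not_le.1 hcon).le hneg.le))
      · exact (hy.2 v (hFb ▸ Finset.mem_erase.2 ⟨hvb, hv⟩)).le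
  · have := hrel a
    rw [h0, mul_zero, bary_self cK ha] at this
    exact absurd this one_ne_zero
  · exfalso
    have hcont : Tendsto (fun s : ℝ => x + s • (a - x)) (𝓝[>] 0) (𝓝 x) := by
      have : Continuous fun s : ℝ => x + s • (a - x) := by fun_prop
      simpa using (this.tendsto 0).mono_left nhdsWithin_le_nhds
    obtain ⟨s, hs, hs0⟩ := ((hcont.eventually ev).and eventually_mem_nhdsWithin).exists
    have hs0 : 0 < s := hs0
    have hay : bary K a (x + s • (a - x)) = s := by
      rw [bary_homothety, hax, bary_self cK ha]; ring
    refine hne (T.eq_of_mem_interior hK hK' (x := x + s • (a - x)) ?_ ?_)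
    · refine (mem_interior_cell cK).2 fun v hv => ?_
      by_cases hva : v = a
      · rwa [hva, hay]
      · exact hs.1 v (Finset.mem_erase.2 ⟨hva, hv⟩)
    · refine (mem_hull_cell cK').2 fun v hv => ?_
      by_cases hvb : v = b
      · have := hrel (x + s • (a - x))
        rw [hay] at this
        rw [hvb]
        by_contra hcon
        have := mul_nonpos_of_nonpos_of_nonneg (not_le.1 hcon).le hpos.le
        linarith
      · exact (hs.2 v (hFb ▸ Finset.mem_erase.2 ⟨hvb, hv⟩)).le

/-! #### Chains of elements at a point -/

/-- Two elements share a facet that contains the point `a`. -/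
def Mesh.Adjacent (a : Pt n) (K K' : Finset (Pt n)) : Prop :=
  K ∈ T.cells ∧ K' ∈ T.cells ∧ (K ∩ K').card = n ∧ a ∈ hull (K ∩ K')

variable {T}

theorem Mesh.Adjacent.symm {a : Pt n} {K K' : Finset (Pt n)} (h : T.Adjacent a K K') :
    T.Adjacent a K' K :=
  ⟨h.2.1, h.1, by rw [Finset.inter_comm]; exact h.2.2.1, by rw [Finset.inter_comm]; exact h.2.2.2⟩

theorem Mesh.adjacent_of_ne {a : Pt n} {K K' : Finset (Pt n)} (hK : K ∈ T.cells) (hK' : K' ∈ T.cells)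
    (hne : K ≠ K') (hc : n ≤ (K ∩ K').card) (ha : a ∈ hull (K ∩ K')) : T.Adjacent a K K' := by
  refine ⟨hK, hK', le_antisymm ?_ hc, ha⟩
  by_contra hcon
  have h1 : K ∩ K' = K := Finset.eq_of_subset_of_card_le Finset.inter_subset_left (by
    rw [(T.isCell hK).2]; omega)
  have h2 : K ∩ K' = K' := Finset.eq_of_subset_of_card_le Finset.inter_subset_right (by
    rw [(T.isCell hK').2]; omega)
  exact hne (h1.symm.trans h2)

/-- Together with y, a face with fewer than n vertices spans a proper affine subspace, which
contains every point z whose segment from y meets the face. Thus almost every segment from y avoids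
such faces. -/
theorem volume_shadow (y : Pt n) (D : Finset (Pt n)) (hD : D.card < n) (hy : y ∉ hull D) :
    volume {z | ∃ x ∈ hull D, x ∈ segment ℝ y z} = 0 := by
  set E := insert y D with hE
  have hne : affineSpan ℝ (E : Set (Pt n)) ≠ ⊤ := by
    intro h
    have h1 : vectorSpan ℝ (E : Set (Pt n)) = ⊤ := by
      rw [← direction_affineSpan, h, AffineSubspace.direction_top]
    have h2 := finrank_vectorSpan_range_le ℝ ((↑) : E → Pt n) (n := E.card - 1) (by
      rw [Fintype.card_coe, Nat.sub_add_cancel]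
      exact Finset.card_pos.2 ⟨y, Finset.mem_insert_self _ _⟩)
    rw [show Set.range ((↑) : E → Pt n) = (E : Set (Pt n)) from Subtype.range_coe, h1, finrank_top,
      finrank_euclideanSpace_fin] at h2
    have h3 := Finset.card_insert_le y D
    rw [← hE] at h3
    omega
  refine measure_mono_null ?_ (Measure.addHaar_affineSubspace volume _ hne)
  rintro z ⟨x, hx, hxz⟩
  rw [segment_eq_image_lineMap] at hxz
  obtain ⟨t, -, rfl⟩ := hxz
  have ht : t ≠ 0 := by
    rintro rfl
    rw [AffineMap.lineMap_apply_zero] at hx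
    exact hy hx
  have hyE : y ∈ affineSpan ℝ (E : Set (Pt n)) :=
    subset_affineSpan ℝ _ (Finset.mem_coe.2 (Finset.mem_insert_self _ _))
  have hxE : AffineMap.lineMap y z t ∈ affineSpan ℝ (E : Set (Pt n)) :=
    affineSpan_mono ℝ (Finset.coe_subset.2 (Finset.subset_insert y D))
      (convexHull_subset_affineSpan _ hx)
  have := AffineMap.lineMap_mem t⁻¹ hyE hxE
  convert! this using 1
  simp [AffineMap.lineMap_apply, smul_smul, inv_mul_cancel₀ ht]

/-- The finitely many faces not containing `a` are closed, hence stay at a positive distance. This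
carries adjacency at nearby points over to `a`. -/
theorem Mesh.exists_ball (T : Mesh Ω) (a : Pt n) : ∃ r : ℝ, 0 < r ∧
    ∀ s ∈ T.complex.faces, ∀ x ∈ Metric.ball a r, x ∈ hull s → a ∈ hull s := by
  have h : ∀ᶠ x in 𝓝 a, ∀ s ∈ T.finite.toFinset, x ∈ hull s → a ∈ hull s := by
    rw [Filter.eventually_all_finset]
    intro s _
    by_cases hs : a ∈ hull s
    · exact Filter.Eventually.of_forall fun _ _ => hs
    · filter_upwards [(isCompact_hull s).isClosed.isOpen_compl.mem_nhds hs] with x hx hx'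
      exact absurd hx' hx
  obtain ⟨r, hr, hb⟩ := Metric.eventually_nhds_iff_ball.1 h
  exact ⟨r, hr, fun s hs x hx hxs => hb x hx s (T.finite.mem_toFinset.2 hs) hxs⟩

/-- At a point of the domain, any two elements are joined by a chain of elements through facets. -/
theorem Mesh.chain_of_mem {a : Pt n} (ha : a ∈ Ω) {K K' : Finset (Pt n)} (hK : K ∈ T.cells)
    (hK' : K' ∈ T.cells) (haK : a ∈ hull K) (haK' : a ∈ hull K') :
    Relation.ReflTransGen (T.Adjacent a) K K' := by
  obtain ⟨r, hr, hb⟩ := T.exists_ball a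
  obtain ⟨ρ, hρ, hΩ⟩ := Metric.isOpen_iff.1 T.isOpen a ha
  set B := Metric.ball a (min r ρ) with hB
  have hB0 : 0 < min r ρ := lt_min hr hρ
  have hmeet : ∀ K ∈ T.cells, a ∈ hull K → (B ∩ interior (hull K)).Nonempty := by
    intro K hK haK
    have h := (convex_hull K).closure_interior_eq_closure_of_nonempty_interior
      (interior_cell_nonempty (T.isCell hK))
    rw [(isCompact_hull K).isClosed.closure_eq] at h
    rw [← h] at haK
    exact mem_closure_iff.1 haK _ Metric.isOpen_ball (Metric.mem_ball_self hB0)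
  obtain ⟨y, hyB, hyK⟩ := hmeet K hK haK
  -- A generic endpoint z is chosen so that the segment from y to z misses all faces of codimension
  -- at least 2.
  have hnull : volume (⋃ D ∈ T.finite.toFinset, ⋃ _ : D.card < n,
      {z | ∃ x ∈ hull D, x ∈ segment ℝ y z}) = 0 := by
    refine (measure_biUnion_null_iff (Finset.countable_toSet _)).2 fun D hD =>
      measure_iUnion_null fun hc => volume_shadow y D hc fun hy => ?_
    have h1 := Finset.card_le_card
      (T.subset_of_mem_interior hK (T.finite.mem_toFinset.1 hD) hyK hy)
    rw [(T.isCell hK).2] at h1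
    omega
  have hpos : volume (B ∩ interior (hull K')) ≠ 0 :=
    ((Metric.isOpen_ball.inter isOpen_interior).measure_pos _ (hmeet K' hK' haK')).ne'
  obtain ⟨z, ⟨hzB, hzK⟩, hz⟩ : ∃ z ∈ B ∩ interior (hull K'), z ∉ ⋃ D ∈ T.finite.toFinset,
      ⋃ _ : D.card < n, {z | ∃ x ∈ hull D, x ∈ segment ℝ y z} := by
    by_contra! hcon
    exact hpos (measure_mono_null hcon hnull)
  by_contra hnot
  classical
  set S := T.cells.filter fun L => a ∈ hull L with hS
  have memS : ∀ {L}, L ∈ S ↔ L ∈ T.cells ∧ a ∈ hull L := by simp [hS]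
  have hclosed : ∀ S' : Finset (Finset (Pt n)), IsClosed (⋃ L ∈ S', hull L) := fun S' =>
    S'.finite_toSet.isClosed_biUnion fun L _ => (isCompact_hull L).isClosed
  have hseg : segment ℝ y z ⊆ B := (convex_ball a _).segment_subset hyB hzB
  -- The elements at a are split into those reachable from K and the others. The segment is
  -- connected, so some point of it lies in both unions; the common face there has at least n
  -- vertices, which makes a reachable element adjacent to an unreachable one.
  obtain ⟨x, hx, hx1, hx2⟩ := isPreconnected_closed_iff.1
    (convex_segment (𝕜 := ℝ) y z).isPreconnected _ _
    (hclosed (S.filter fun L => Relation.ReflTransGen (T.Adjacent a) K L))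
    (hclosed (S.filter fun L => ¬ Relation.ReflTransGen (T.Adjacent a) K L))
    (fun x hx => by
      obtain ⟨L, hL, hxL⟩ := T.mem_space.1 (T.subset_space (hΩ
        (Metric.ball_subset_ball (min_le_right _ _) (hseg hx))))
      have hLS : L ∈ S := memS.2 ⟨hL, hb L (T.mem_cells.1 hL).1 x
        (Metric.ball_subset_ball (min_le_left _ _) (hseg hx)) hxL⟩
      by_cases h : Relation.ReflTransGen (T.Adjacent a) K L
      · exact Or.inl (Set.mem_biUnion (Finset.mem_filter.2 ⟨hLS, h⟩) hxL)
      · exact Or.inr (Set.mem_biUnion (Finset.mem_filter.2 ⟨hLS, h⟩) hxL))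
    ⟨y, left_mem_segment ℝ y z, Set.mem_biUnion (Finset.mem_filter.2 ⟨memS.2 ⟨hK, haK⟩, .refl⟩)
      (_root_.interior_subset hyK)⟩
    ⟨z, right_mem_segment ℝ y z, Set.mem_biUnion (Finset.mem_filter.2 ⟨memS.2 ⟨hK', haK'⟩, hnot⟩)
      (_root_.interior_subset hzK)⟩
  simp only [Set.mem_iUnion, exists_prop, Finset.mem_filter, memS] at hx1 hx2
  obtain ⟨L, ⟨⟨hL, -⟩, h1⟩, hxL⟩ := hx1
  obtain ⟨L', ⟨⟨hL', -⟩, h2⟩, hxL'⟩ := hx2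
  have hfL := (T.mem_cells.1 hL).1
  have hxLL := T.mem_hull_inter hfL (T.mem_cells.1 hL').1 hxL hxL'
  have hne : (L ∩ L').Nonempty := by
    rw [Finset.nonempty_iff_ne_empty]
    intro h
    rw [h, hull_eq_empty_iff.2 rfl] at hxLL
    exact hxLL
  have hface := T.complex.down_closed hfL Finset.inter_subset_left hne
  refine h2 (h1.tail (Mesh.adjacent_of_ne hL hL' (fun h => h2 (h ▸ h1)) ?_
    (hb _ hface x (Metric.ball_subset_ball (min_le_left _ _) (hseg hx)) hxLL)))
  by_contra hcard
  refine hz (Set.mem_biUnion (T.finite.mem_toFinset.2 hface) (Set.mem_iUnion.2 ⟨not_le.1 hcard, ?_⟩))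
  exact ⟨x, hxLL, hx⟩

/-- At any point of the grid, any two elements are joined by a chain of elements through facets. -/
theorem Mesh.chain (hloc : LocallyConnectedAtBoundary Ω) {a : Pt n} {K K' : Finset (Pt n)}
    (hK : K ∈ T.cells) (hK' : K' ∈ T.cells) (haK : a ∈ hull K) (haK' : a ∈ hull K') :
    Relation.ReflTransGen (T.Adjacent a) K K' := by
  by_cases ha : a ∈ Ω
  · exact Mesh.chain_of_mem ha hK hK' haK haK'
  obtain ⟨r, hr, hb⟩ := T.exists_ball a
  have hfr : a ∈ frontier Ω := by
    rw [T.isOpen.frontier_eq]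
    exact ⟨T.hull_subset_closure hK haK, ha⟩
  obtain ⟨V, hV, hVr, hVc⟩ := hloc a hfr _ (Metric.ball_mem_nhds a hr)
  have hmeet : ∀ K ∈ T.cells, a ∈ hull K → ((V ∩ Ω) ∩ hull K).Nonempty := by
    intro K hK haK
    have h := (convex_hull K).closure_interior_eq_closure_of_nonempty_interior
      (interior_cell_nonempty (T.isCell hK))
    rw [(isCompact_hull K).isClosed.closure_eq] at h
    rw [← h] at haK
    obtain ⟨x, hx, hxK⟩ := mem_closure_iff_nhds.1 haK V hV
    exact ⟨x, ⟨hx, T.interior_subset hK hxK⟩, _root_.interior_subset hxK⟩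
  by_contra hnot
  classical
  set S := T.cells.filter fun L => a ∈ hull L with hS
  have memS : ∀ {L}, L ∈ S ↔ L ∈ T.cells ∧ a ∈ hull L := by simp [hS]
  have hclosed : ∀ S' : Finset (Finset (Pt n)), IsClosed (⋃ L ∈ S', hull L) := fun S' =>
    S'.finite_toSet.isClosed_biUnion fun L _ => (isCompact_hull L).isClosed
  obtain ⟨y, hy, hyK⟩ := hmeet K hK haK
  obtain ⟨z, hz, hzK⟩ := hmeet K' hK' haK'
  -- The same splitting, now on the connected set V ∩ Ω. The point found lies in Ω, where the
  -- interior case yields a chain between the two elements, and this chain passes through a as well.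
  obtain ⟨x, hx, hx1, hx2⟩ := isPreconnected_closed_iff.1 hVc _ _
    (hclosed (S.filter fun L => Relation.ReflTransGen (T.Adjacent a) K L))
    (hclosed (S.filter fun L => ¬ Relation.ReflTransGen (T.Adjacent a) K L))
    (fun x hx => by
      obtain ⟨L, hL, hxL⟩ := T.mem_space.1 (T.subset_space hx.2)
      have hLS : L ∈ S := memS.2 ⟨hL, hb L (T.mem_cells.1 hL).1 x (hVr hx.1) hxL⟩
      by_cases h : Relation.ReflTransGen (T.Adjacent a) K L
      · exact Or.inl (Set.mem_biUnion (Finset.mem_filter.2 ⟨hLS, h⟩) hxL)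
      · exact Or.inr (Set.mem_biUnion (Finset.mem_filter.2 ⟨hLS, h⟩) hxL))
    ⟨y, hy, Set.mem_biUnion (Finset.mem_filter.2 ⟨memS.2 ⟨hK, haK⟩, .refl⟩) hyK⟩
    ⟨z, hz, Set.mem_biUnion (Finset.mem_filter.2 ⟨memS.2 ⟨hK', haK'⟩, hnot⟩) hzK⟩
  simp only [Set.mem_iUnion, exists_prop, Finset.mem_filter, memS] at hx1 hx2
  obtain ⟨L, ⟨⟨hL, -⟩, h1⟩, hxL⟩ := hx1
  obtain ⟨L', ⟨⟨hL', -⟩, h2⟩, hxL'⟩ := hx2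
  refine h2 (h1.trans (Relation.ReflTransGen.mono (fun M M' hM => ?_) _ _
    (Mesh.chain_of_mem hx.2 hL hL' hxL hxL')))
  refine ⟨hM.1, hM.2.1, hM.2.2.1, hb _ ?_ x (hVr hx.1) hM.2.2.2⟩
  refine T.complex.down_closed (T.mem_cells.1 hM.1).1 Finset.inter_subset_left ?_
  rw [Finset.nonempty_iff_ne_empty]
  intro h
  have := hM.2.2.2
  rw [h, hull_eq_empty_iff.2 rfl] at this
  exact this

end MeshGeometry

/-! ### Telescoping estimates along chains. -/

section Chains

/-- Each link charges both of its ends, so inner vertices are charged twice. The extra `d u` on the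
left closes the induction, because prepending a link charges the former starting vertex once more.
-/
theorem sum_walk_le {V : Type*} {G : SimpleGraph V} {x d : V → ℝ}
    (hx : ∀ u v, G.Adj u v → |x u - x v| ≤ d u + d v) (hd : ∀ w, 0 ≤ d w) {u v : V}
    (p : G.Walk u v) : |x u - x v| + d u ≤ 2 * (p.support.map d).sum := by
  induction p with
  | nil => simp only [sub_self, abs_zero, SimpleGraph.Walk.support_nil, List.map_cons, List.map_nil,
      List.sum_cons, List.sum_nil]; linarith [hd ‹_›]
  | cons h p ih =>
    rename_i u v w
    rw [SimpleGraph.Walk.support_cons, List.map_cons, List.sum_cons]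
    have h1 := hx _ _ h
    have h2 := abs_sub_le (x u) (x v) (x w)
    linarith

/-- Differences along a chain in a finite set are controlled by the sum over the set. -/
theorem abs_sub_le_of_chain {V : Type*} {R : V → V → Prop} {S : Finset V} {x d : V → ℝ}
    (hx : ∀ u v, R u v → u ∈ S ∧ v ∈ S ∧ |x u - x v| ≤ d u + d v) (hd : ∀ w, 0 ≤ d w) {u v : V}
    (h : Relation.ReflTransGen R u v) : |x u - x v| ≤ 2 * ∑ w ∈ S, d w := by
  classical
  set G : SimpleGraph V := SimpleGraph.fromRel R with hG
  have hadj : ∀ a b, G.Adj a b → a ∈ S ∧ b ∈ S ∧ |x a - x b| ≤ d a + d b := by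
    intro a b hab
    rw [hG, SimpleGraph.fromRel_adj] at hab
    rcases hab.2 with h | h
    · exact hx a b h
    · obtain ⟨h1, h2, h3⟩ := hx b a h
      exact ⟨h2, h1, by rw [abs_sub_comm]; linarith⟩
  have hreach : G.Reachable u v := by
    induction h with
    | refl => exact SimpleGraph.Reachable.refl _
    | @tail b c _ hbc ih =>
      by_cases e : b = c
      · exact e ▸ ih
      · exact ih.trans (SimpleGraph.Adj.reachable ((SimpleGraph.fromRel_adj R b c).2 ⟨e, Or.inl hbc⟩))
  obtain ⟨p⟩ := hreach
  by_cases huv : u = v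
  · rw [huv, sub_self, abs_zero]
    exact mul_nonneg (by norm_num) (Finset.sum_nonneg fun w _ => hd w)
  -- A path visits no vertex twice, so the sum along it is at most the sum over the finite set.
  have h1 := sum_walk_le (fun a b hab => (hadj a b hab).2.2) hd (p.toPath : G.Walk u v)
  have h2 := List.sum_toFinset d p.toPath.2.support_nodup
  have h3 : (p.toPath : G.Walk u v).support.toFinset ⊆ S := by
    have hu : ∀ {a b : V} (q : G.Walk a b), a ∈ S → ∀ w ∈ q.support, w ∈ S := by
      intro a b q
      induction q with
      | nil => intro ha w hw; rw [SimpleGraph.Walk.support_nil, List.mem_singleton] at hw; rwa [hw]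
      | cons h q ih =>
        intro ha w hw
        rw [SimpleGraph.Walk.support_cons, List.mem_cons] at hw
        rcases hw with rfl | hw
        · exact ha
        · exact ih (hadj _ _ h).2.1 w hw
    have hu0 : u ∈ S := by
      rcases Relation.ReflTransGen.cases_head h with rfl | ⟨c, hc, -⟩
      · exact absurd rfl huv
      · exact (hx _ _ hc).1
    intro w hw
    exact hu _ hu0 w (List.mem_toFinset.1 hw)
  have h4 := Finset.sum_le_sum_of_subset_of_nonneg h3 fun w _ _ => hd w
  linarith [hd u]

/-- A positive quantity comparable across each link of a chain is comparable at its ends. -/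
theorem le_pow_mul_of_chain {V : Type*} {R : V → V → Prop} {S : Finset V} {f : V → ℝ} {c : ℝ}
    (hc : 1 ≤ c) (hf : ∀ u ∈ S, 0 < f u)
    (hx : ∀ u v, R u v → u ∈ S ∧ v ∈ S ∧ f u ≤ c * f v ∧ f v ≤ c * f u) {u v : V} (hu : u ∈ S)
    (hv : v ∈ S) (h : Relation.ReflTransGen R u v) : f u ≤ c ^ S.card * f v := by
  have hc0 : 0 < c := by linarith
  -- On the logarithmic scale the comparison of neighbours is additive, with half of log c charged
  -- to each end of a link.
  have key := abs_sub_le_of_chain (R := R) (S := S) (x := fun w => Real.log (f w))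
    (d := fun _ => Real.log c / 2) (fun a b hab => ?_)
    (fun _ => div_nonneg (Real.log_nonneg hc) (by norm_num)) h
  · rw [Finset.sum_const, nsmul_eq_mul] at key
    have h1 := (abs_le.1 key).2
    rw [← Real.log_le_log_iff (hf u hu) (mul_pos (pow_pos hc0 _) (hf v hv)),
      Real.log_mul (pow_pos hc0 _).ne' (hf v hv).ne', Real.log_pow]
    linarith
  · obtain ⟨ha, hb, h1, h2⟩ := hx a b hab
    refine ⟨ha, hb, abs_le.2 ⟨?_, ?_⟩⟩
    · have := Real.log_le_log (hf b hb) h2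
      rw [Real.log_mul hc0.ne' (hf a ha).ne'] at this
      linarith
    · have := Real.log_le_log (hf a ha) h1
      rw [Real.log_mul hc0.ne' (hf b hb).ne'] at this
      linarith

end Chains

/-! ### Consequences of shape regularity. -/

section Regularity

variable {n : ℕ} {K : Finset (Pt n)} {γ : ℝ}

/-- Shape regularity of one element. -/
def RegularCell (γ : ℝ) (K : Finset (Pt n)) : Prop :=
  ∃ (c : Pt n) (r : ℝ), 0 < r ∧ Metric.closedBall c r ⊆ hull K ∧ cellDiam K ≤ γ * (2 * r)

theorem cellDiam_pos (hn : 1 ≤ n) (hK : IsCell K) : 0 < cellDiam K := by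
  obtain ⟨v, hv⟩ := hK.nonempty
  have h1 := one_le_norm_baryGrad_mul hn hK hv
  by_contra h
  nlinarith [norm_nonneg (baryGrad K v)]

theorem RegularCell.norm_baryGrad_mul_le (hK : IsCell K) (h : RegularCell γ K) (hγ : 0 ≤ γ)
    {v : Pt n} (hv : v ∈ K) : ‖baryGrad K v‖ * cellDiam K ≤ γ := by
  obtain ⟨c, r, hr, hb, hd⟩ := h
  have h1 := FEM.norm_baryGrad_mul_le hK hr.le hb hv
  calc ‖baryGrad K v‖ * cellDiam K ≤ ‖baryGrad K v‖ * (γ * (2 * r)) :=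
        mul_le_mul_of_nonneg_left hd (norm_nonneg _)
    _ = γ * (‖baryGrad K v‖ * (2 * r)) := by ring
    _ ≤ γ * 1 := mul_le_mul_of_nonneg_left h1 hγ
    _ = γ := mul_one γ

theorem RegularCell.one_le (hn : 1 ≤ n) (hK : IsCell K) (h : RegularCell γ K) : 1 ≤ γ := by
  have hγ : 0 ≤ γ := by
    obtain ⟨c, r, hr, hb, hd⟩ := h
    by_contra hneg
    have := cellDiam_pos hn hK
    nlinarith
  obtain ⟨v, hv⟩ := hK.nonempty
  exact (one_le_norm_baryGrad_mul hn hK hv).trans (h.norm_baryGrad_mul_le hK hγ hv)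

theorem RegularCell.gradSum_mul_le (hn : 1 ≤ n) (hK : IsCell K) (h : RegularCell γ K) :
    gradSum K * cellDiam K ≤ (n + 1) * γ := by
  have hγ := h.one_le hn hK
  rw [gradSum, Finset.sum_mul]
  refine (Finset.sum_le_sum fun v hv => h.norm_baryGrad_mul_le hK (by linarith) hv).trans ?_
  rw [Finset.sum_const, hK.2, nsmul_eq_mul]
  push_cast
  exact le_rfl

variable {Ω : Set (Pt n)} {T : Mesh Ω}

/-- For n ≥ 2 a common facet contains an edge. Its length is at most the diameter of K' and, by the
bound for the gradients of K, at least the diameter of K divided by γ. -/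
theorem Mesh.Adjacent.cellDiam_le (hn : 2 ≤ n) (hT : T.ShapeRegular γ) {a : Pt n}
    {K K' : Finset (Pt n)} (h : T.Adjacent a K K') : cellDiam K ≤ γ * cellDiam K' := by
  obtain ⟨hK, hK', hc, -⟩ := h
  have cK := T.isCell hK
  have hγ := RegularCell.one_le (by omega) cK (hT K hK)
  obtain ⟨v, hv, w, hw, hvw⟩ := Finset.one_lt_card.1 (show 1 < (K ∩ K').card by omega)
  have hvK := Finset.mem_inter.1 hv
  have hwK := Finset.mem_inter.1 hw
  have h1 : (1 : ℝ) ≤ ‖baryGrad K v‖ * ‖v - w‖ := by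
    have := inner_baryGrad_sub cK hvK.1 hvK.1 hwK.1
    rw [if_pos rfl, if_neg hvw, sub_zero] at this
    rw [← this]
    exact real_inner_le_norm _ _
  have h2 := dist_le_cellDiam (subset_hull hvK.2) (subset_hull hwK.2)
  have h3 := RegularCell.norm_baryGrad_mul_le cK (hT K hK) (by linarith) hvK.1
  have h4 := cellDiam_pos (by omega) cK
  have h5 := cellDiam_pos (by omega) (T.isCell hK')
  have h6 : 1 ≤ ‖baryGrad K v‖ * cellDiam K' :=
    h1.trans (mul_le_mul_of_nonneg_left h2 (norm_nonneg _))
  calc cellDiam K = cellDiam K * 1 := (mul_one _).symm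
    _ ≤ cellDiam K * (‖baryGrad K v‖ * cellDiam K') := mul_le_mul_of_nonneg_left h6 h4.le
    _ = (‖baryGrad K v‖ * cellDiam K) * cellDiam K' := by ring
    _ ≤ γ * cellDiam K' := mul_le_mul_of_nonneg_right h3 h5.le

/-- The area of the common facet is n|∇λ| times the volume, computed from either side; the gradients
are comparable to inverse diameters, and the diameters to each other. -/
theorem Mesh.Adjacent.volume_le (hn : 2 ≤ n) (hT : T.ShapeRegular γ) {a : Pt n}
    {K K' : Finset (Pt n)} (h : T.Adjacent a K K') :
    volume.real (hull K) ≤ γ ^ 2 * volume.real (hull K') := by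
  have hd := h.cellDiam_le hn hT
  obtain ⟨hK, hK', hc, -⟩ := h
  have cK := T.isCell hK
  have cK' := T.isCell hK'
  have hγ := RegularCell.one_le (by omega) cK (hT K hK)
  obtain ⟨v, hv, hF⟩ := eq_erase_of_card cK Finset.inter_subset_left hc
  obtain ⟨v', hv', hF'⟩ := eq_erase_of_card cK' Finset.inter_subset_right hc
  have e : (n : ℝ) * (‖baryGrad K v‖ * volume.real (hull K)) =
      n * (‖baryGrad K' v'‖ * volume.real (hull K')) := by
    rw [← mul_assoc, ← mul_assoc, ← facet_measure_eq (by omega) cK hv,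
      ← facet_measure_eq (by omega) cK' hv', ← hF, ← hF']
  have e' := mul_left_cancel₀ (by positivity) e
  have h1 := one_le_norm_baryGrad_mul (by omega) cK hv
  have h2 := RegularCell.norm_baryGrad_mul_le cK' (hT K' hK') (by linarith) hv'
  have p := volume_hull_pos cK
  have p' := volume_hull_pos cK'
  have q := cellDiam_pos (by omega) cK
  calc volume.real (hull K) ≤ (‖baryGrad K v‖ * cellDiam K) * volume.real (hull K) := by nlinarith
    _ = cellDiam K * (‖baryGrad K v‖ * volume.real (hull K)) := by ring
    _ = cellDiam K * (‖baryGrad K' v'‖ * volume.real (hull K')) := by rw [e']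
    _ ≤ (γ * cellDiam K') * (‖baryGrad K' v'‖ * volume.real (hull K')) :=
        mul_le_mul_of_nonneg_right hd (by positivity)
    _ = γ * (‖baryGrad K' v'‖ * cellDiam K') * volume.real (hull K') := by ring
    _ ≤ γ * γ * volume.real (hull K') := by gcongr
    _ = γ ^ 2 * volume.real (hull K') := by ring

open Classical in
/-- The elements that contain the point `a`. -/
def Mesh.star (T : Mesh Ω) (a : Pt n) : Finset (Finset (Pt n)) := T.cells.filter fun L => a ∈ hull L

theorem Mesh.mem_star {a : Pt n} {L : Finset (Pt n)} : L ∈ T.star a ↔ L ∈ T.cells ∧ a ∈ hull L := by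
  simp [Mesh.star]

theorem Mesh.Adjacent.mem_star {a : Pt n} {K K' : Finset (Pt n)} (h : T.Adjacent a K K') :
    K ∈ T.star a ∧ K' ∈ T.star a :=
  ⟨Mesh.mem_star.2 ⟨h.1, hull_mono Finset.inter_subset_left h.2.2.2⟩,
    Mesh.mem_star.2 ⟨h.2.1, hull_mono Finset.inter_subset_right h.2.2.2⟩⟩

/-- Packing: shrink every element at a towards a to the diameter δ of the smallest one. Each
shrunken copy contains a ball of radius δ/(2γ); these balls lie in disjoint elements and in the ball
of radius δ about a, and their volumes are compared. -/
theorem Mesh.card_star_le (hn : 1 ≤ n) (hγ : 0 ≤ γ) (hT : T.ShapeRegular γ) (a : Pt n) :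
    ((T.star a).card : ℝ) ≤ (2 * γ) ^ n := by
  rcases (T.star a).eq_empty_or_nonempty with h0 | hne
  · rw [h0, Finset.card_empty, Nat.cast_zero]
    positivity
  have hγ : 1 ≤ γ := by
    obtain ⟨K, hK⟩ := hne
    have := (Mesh.mem_star.1 hK).1
    exact RegularCell.one_le hn (T.isCell this) (hT K this)
  obtain ⟨L, hL, hmin⟩ := (T.star a).exists_min_image cellDiam hne
  set δ := cellDiam L with hδ
  have hδ0 : 0 < δ := cellDiam_pos hn (T.isCell (Mesh.mem_star.1 hL).1)
  have hex : ∀ K ∈ T.star a, ∃ c : Pt n, Metric.ball c (δ / (2 * γ)) ⊆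
      interior (hull K) ∩ Metric.closedBall a δ := by
    intro K hK
    obtain ⟨hKT, haK⟩ := Mesh.mem_star.1 hK
    obtain ⟨c, r, hr, hb, hd⟩ := hT K hKT
    have hK0 := cellDiam_pos hn (T.isCell hKT)
    set s := δ / cellDiam K with hs
    have hs0 : 0 < s := div_pos hδ0 hK0
    have hs1 : s ≤ 1 := (div_le_one hK0).2 (hmin K hK)
    have hsK : s * cellDiam K = δ := div_mul_cancel₀ _ hK0.ne'
    -- Under the contraction the inscribed radius r becomes sr = δr/h_K, and h_K ≤ 2γr.
    have hrad : δ / (2 * γ) ≤ s * r := by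
      rw [div_le_iff₀ (by positivity), ← hsK]
      nlinarith
    have hsub : ∀ y ∈ Metric.ball (a + s • (c - a)) (δ / (2 * γ)), ∃ z ∈ hull K, y = a + s • (z - a) := by
      intro y hy
      refine ⟨a + s⁻¹ • (y - a), hb ?_, ?_⟩
      · rw [mem_closedBall_iff_norm]
        rw [mem_ball_iff_norm] at hy
        have e : a + s⁻¹ • (y - a) - c = s⁻¹ • (y - (a + s • (c - a))) := by
          rw [← sub_sub, smul_sub s⁻¹ (y - a), smul_smul, inv_mul_cancel₀ hs0.ne', one_smul]
          abel
        rw [e, norm_smul, norm_inv, Real.norm_of_nonneg hs0.le, inv_mul_le_iff₀ hs0]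
        exact (hy.le.trans hrad)
      · rw [add_sub_cancel_left, smul_smul, mul_inv_cancel₀ hs0.ne', one_smul, add_sub_cancel]
    refine ⟨a + s • (c - a), Set.subset_inter (interior_maximal (fun y hy => ?_) Metric.isOpen_ball)
      fun y hy => ?_⟩
    · obtain ⟨z, hz, rfl⟩ := hsub y hy
      exact (convex_hull K).add_smul_sub_mem haK hz ⟨hs0.le, hs1⟩
    · obtain ⟨z, hz, rfl⟩ := hsub y hy
      rw [mem_closedBall_iff_norm, add_sub_cancel_left, norm_smul, Real.norm_of_nonneg hs0.le, ← hsK]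
      exact mul_le_mul_of_nonneg_left (dist_le_cellDiam hz haK) hs0.le
  choose! c hc using hex
  have hvol : volume (⋃ K ∈ T.star a, Metric.ball (c K) (δ / (2 * γ))) ≤ volume (Metric.closedBall a δ) :=
    measure_mono (Set.iUnion₂_subset fun K hK => (hc K hK).trans Set.inter_subset_right)
  rw [measure_biUnion_finset (fun K hK K' hK' hne => ?_) fun _ _ => Metric.isOpen_ball.measurableSet] at hvol
  · have hb : ∀ x : Pt n, volume (Metric.ball x (δ / (2 * γ))) =
        ENNReal.ofReal ((δ / (2 * γ)) ^ n) * volume (Metric.ball (0 : Pt n) 1) := fun x => by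
      rw [Measure.addHaar_ball_of_pos _ _ (by positivity), finrank_euclideanSpace_fin]
    simp only [hb] at hvol
    rw [Finset.sum_const, nsmul_eq_mul, Measure.addHaar_closedBall _ _ hδ0.le,
      finrank_euclideanSpace_fin, ← mul_assoc] at hvol
    have h1 := (ENNReal.mul_le_mul_iff_left (Metric.measure_ball_pos volume (0 : Pt n) one_pos).ne'
      Metric.isBounded_ball.measure_lt_top.ne).1 hvol
    rw [← ENNReal.ofReal_natCast, ← ENNReal.ofReal_mul (by positivity),
      ENNReal.ofReal_le_ofReal_iff (by positivity), div_pow, mul_div_assoc', div_le_iff₀ (by positivity),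
      mul_comm] at h1
    exact le_of_mul_le_mul_left h1 (by positivity)
  · refine (T.disjoint_interior (Mesh.mem_star.1 hK).1 (Mesh.mem_star.1 hK').1 hne).mono
      ((hc K hK).trans Set.inter_subset_left) ((hc K' hK').trans Set.inter_subset_left)

end Regularity

/-! ### Polynomial approximation of Sobolev functions on a simplex. -/

section Approximation

variable {n : ℕ} {K : Finset (Pt n)}

/-- The squared `H^r`-seminorm on the interior of a simplex. -/
def weakSemiSq (K : Finset (Pt n)) (r : ℕ) (u : Pt n → ℝ) : ℝ :=
  ∑ α : Fin r → Fin n, ∫ x in hull K, weakDeriv (interior (hull K)) α u x ^ 2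

theorem weakSemiSq_nonneg (K : Finset (Pt n)) (r : ℕ) (u : Pt n → ℝ) : 0 ≤ weakSemiSq K r u :=
  Finset.sum_nonneg fun _ _ => integral_nonneg fun _ => sq_nonneg _

theorem MemSobolev.memLp_weakDeriv {m j : ℕ} (hj : j ≤ m) {u : Pt n → ℝ}
    (hu : MemSobolev (interior (hull K)) m u) (α : Fin j → Fin n) :
    MemLp (weakDeriv (interior (hull K)) α u) 2 (volume.restrict (hull K)) := by
  rw [← restrict_interior_hull]
  exact (weakDeriv_spec (hu.2 j hj α)).1

/-- Bramble–Hilbert is applied to a smooth approximation of u, and the slack δ absorbs the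
approximation error. The seminorm of u may vanish, so δ is kept and sent to zero only in the final
estimate. -/
theorem exists_poly_approx (hn : 1 ≤ n) (hK : IsCell K) (s : ℕ) {u : Pt n → ℝ}
    (hu : MemSobolev (interior (hull K)) (s + 1) u) {δ : ℝ} (hδ : 0 < δ) :
    ∃ p, IsPoly s p ∧
      ∫ x in hull K, (u x - p x) ^ 2 ≤
        (4 * (2 ^ n) ^ (s + 1) + 1) * (cellDiam K ^ (2 * (s + 1)) * (weakSemiSq K (s + 1) u + δ)) ∧
      cellDiam K ^ 2 * gradSq K (fun x => u x - p x) ≤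
        (4 * (2 ^ n) ^ (s + 1) + 1) * (cellDiam K ^ (2 * (s + 1)) * (weakSemiSq K (s + 1) u + δ)) := by
  have hh := cellDiam_pos hn hK
  set h := cellDiam K with hhdef
  set M : ℝ := (2 ^ n) ^ (s + 1) with hM
  have hM0 : 0 < M := by positivity
  set N : ℝ := (n : ℝ) ^ (s + 1) with hN
  have hN0 : 0 ≤ N := by positivity
  -- Q collects the coefficients of ε² in both estimates; ε is then fixed by Qε² = h^(2(s+1)) δ.
  set Q : ℝ := 2 + 2 * n * h ^ 2 + 4 * M * h ^ (2 * (s + 1)) * N with hQ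
  have hQ0 : 0 < Q := by positivity
  set ε : ℝ := Real.sqrt (h ^ (2 * (s + 1)) * δ / Q) with hε
  have hε0 : 0 < ε := Real.sqrt_pos.2 (by positivity)
  have hεQ : Q * ε ^ 2 = h ^ (2 * (s + 1)) * δ := by
    rw [hε, Real.sq_sqrt (by positivity), mul_div_cancel₀ _ hQ0.ne']
  obtain ⟨φ, hφ, happ⟩ := exists_smooth_approx hK hu (ε := ENNReal.ofReal ε) (by
    rw [Ne, ENNReal.ofReal_eq_zero, not_le]; exact hε0)
  obtain ⟨p, hp, b0, b1⟩ := bramble_hilbert hK s hφ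
  have hu1 : MemSobolev (interior (hull K)) 1 u := hu.of_le (by omega)
  have sφ := memSobolev_of_contDiff K hφ
  have hφp : ContDiff ℝ ∞ fun x => φ x - p x := hφ.sub hp.contDiff
  have hd : ∀ (j : ℕ) (α : Fin j → Fin n), MemLp (partialDeriv α φ) 2 (volume.restrict (hull K)) :=
    fun j α => memLp_hull_of_continuous K (contDiff_partialDeriv _ hφ).continuous
  have hest : ∀ j ≤ s + 1, ∀ α : Fin j → Fin n,
      ∫ x in hull K, (weakDeriv (interior (hull K)) α u x - partialDeriv α φ x) ^ 2 ≤ ε ^ 2 :=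
    fun j hj α => integral_sq_le_of_eLpNorm_le ((hu.memLp_weakDeriv hj α).sub (hd j α)) hε0.le (by
      rw [← restrict_interior_hull]; exact happ j hj α)
  have e0 : ∫ x in hull K, (u x - φ x) ^ 2 ≤ ε ^ 2 := by
    refine (le_of_eq (integral_congr_ae ?_)).trans (hest 0 (by omega) finZeroElim)
    rw [← restrict_interior_hull]
    refine ((hasWeakDeriv_zero hu.1 (α := (finZeroElim : Fin 0 → Fin n))).weakDeriv_ae
      isOpen_interior).mono fun x hx => ?_
    simp only [hx, partialDeriv_zero]
  have e1 : gradSq K (fun x => u x - φ x) ≤ n * ε ^ 2 := by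
    rw [gradSq_eq fun i => (hu1.hasWeakDeriv i).sub (hasWeakDeriv_of_contDiff hφ (by
      rw [restrict_interior_hull]; exact hd 1 _)) hu1.1 sφ.1]
    refine (Finset.sum_le_sum fun i _ => hest 1 (by omega) _).trans ?_
    simp
  have e2 : semiSq K (s + 1) φ ≤ 2 * weakSemiSq K (s + 1) u + 2 * (N * ε ^ 2) := by
    have : ∀ α : Fin (s + 1) → Fin n, ∫ x in hull K, partialDeriv α φ x ^ 2 ≤
        2 * (∫ x in hull K, weakDeriv (interior (hull K)) α u x ^ 2) + 2 * ε ^ 2 := by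
      intro α
      have w := hu.memLp_weakDeriv le_rfl α
      have := integral_sq_sub_le w (w.sub (hd _ α))
      simp only [Pi.sub_apply, sub_sub_cancel] at this
      linarith [hest (s + 1) le_rfl α]
    refine (Finset.sum_le_sum fun α _ => this α).trans (le_of_eq ?_)
    rw [Finset.sum_add_distrib, ← Finset.mul_sum, weakSemiSq, Finset.sum_const, Finset.card_univ,
      Fintype.card_fun, Fintype.card_fin, Fintype.card_fin, nsmul_eq_mul, hN]
    push_cast
    ring
  rw [semiSq_zero] at b0
  rw [← gradSq_contDiff K hφp] at b1
  have hS := weakSemiSq_nonneg K (s + 1) u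
  have hsum : ∀ x, u x - p x = (u x - φ x) - (-(φ x - p x)) := fun x => by ring
  have hH : 0 < h ^ (2 * (s + 1)) := by positivity
  have f0 := integral_sq_sub_le (hu1.sub sφ).memLp_hull (memLp_hull_of_continuous K hφp.continuous).neg
  simp only [Pi.neg_apply, neg_sq, ← hsum] at f0
  have f1 := gradSq_sub_le (hu1.sub sφ) (memSobolev_of_contDiff K (φ := fun x => -(φ x - p x)) hφp.neg)
  rw [show gradSq K (fun x => -(φ x - p x)) = gradSq K (fun x => φ x - p x) by
    have hφn : ContDiff ℝ ∞ fun x => -(φ x - p x) := hφp.neg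
    rw [gradSq_contDiff K hφp, gradSq_contDiff K hφn, semiSq_one, semiSq_one]
    refine Finset.sum_congr rfl fun i _ => integral_congr_ae (ae_of_all _ fun x => ?_)
    simp only [partialDeriv_one, fderiv_fun_neg, neg_apply, neg_sq]] at f1
  simp only [← hsum] at f1
  have hb0 : M * h ^ (2 * (s + 1)) * semiSq K (s + 1) φ ≤
      M * h ^ (2 * (s + 1)) * (2 * weakSemiSq K (s + 1) u + 2 * (N * ε ^ 2)) :=
    mul_le_mul_of_nonneg_left e2 (by positivity)
  have hpow : h ^ 2 * h ^ (2 * s) = h ^ (2 * (s + 1)) := by rw [← pow_add]; congr 1; ring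
  have key : 2 * ε ^ 2 + 2 * n * h ^ 2 * ε ^ 2 + 4 * M * h ^ (2 * (s + 1)) * (N * ε ^ 2) =
      h ^ (2 * (s + 1)) * δ := by rw [← hεQ, hQ]; ring
  have hεn : 0 ≤ 2 * n * h ^ 2 * ε ^ 2 := by positivity
  have hp1 : 0 ≤ h ^ (2 * (s + 1)) * weakSemiSq K (s + 1) u := by positivity
  have hp2 : 0 ≤ M * (h ^ (2 * (s + 1)) * δ) := by positivity
  refine ⟨p, hp, ?_, ?_⟩
  · nlinarith
  · have g1 : h ^ 2 * gradSq K (fun x => u x - p x) ≤ h ^ 2 *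
        (2 * (n * ε ^ 2) + 2 * (M * h ^ (2 * s) * semiSq K (s + 1) φ)) :=
      mul_le_mul_of_nonneg_left (by linarith) (by positivity)
    have g2 : h ^ 2 * (2 * (n * ε ^ 2) + 2 * (M * h ^ (2 * s) * semiSq K (s + 1) φ)) =
        2 * n * h ^ 2 * ε ^ 2 + 2 * (M * h ^ (2 * (s + 1)) * semiSq K (s + 1) φ) := by
      rw [← hpow]; ring
    have hε2 : 0 ≤ 2 * ε ^ 2 := by positivity
    nlinarith

end Approximation

/-! ### Dual functions of Lagrange nodes. -/

section Duality

theorem integral_mul_sq_le {X : Type*} [MeasurableSpace X] {μ : Measure X} {f g : X → ℝ}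
    (hf : MemLp f 2 μ) (hg : MemLp g 2 μ) :
    (∫ x, f x * g x ∂μ) ^ 2 ≤ (∫ x, f x ^ 2 ∂μ) * ∫ x, g x ^ 2 ∂μ := by
  have hfg : Integrable (fun x => f x * g x) μ := hf.integrable_mul hg
  have h : ∀ t : ℝ, 0 ≤ (∫ x, f x ^ 2 ∂μ) * (t * t) + (2 * ∫ x, f x * g x ∂μ) * t + ∫ x, g x ^ 2 ∂μ := by
    intro t
    have e : ∫ x, (t * f x + g x) ^ 2 ∂μ =
        (∫ x, f x ^ 2 ∂μ) * (t * t) + (2 * ∫ x, f x * g x ∂μ) * t + ∫ x, g x ^ 2 ∂μ := by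
      have e1 : ∀ x, (t * f x + g x) ^ 2 = (t * t) * f x ^ 2 + (2 * t) * (f x * g x) + g x ^ 2 :=
        fun x => by ring
      have i1 : Integrable (fun x => (t * t) * f x ^ 2) μ := hf.integrable_sq.const_mul _
      have i2 : Integrable (fun x => (2 * t) * (f x * g x)) μ := hfg.const_mul _
      have i12 : Integrable (fun x => (t * t) * f x ^ 2 + (2 * t) * (f x * g x)) μ := i1.add i2
      simp only [e1]
      rw [integral_add i12 hg.integrable_sq, integral_add i1 i2, integral_const_mul, integral_const_mul]
      ring
    rw [← e]
    exact integral_nonneg fun x => sq_nonneg _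
  have := discrim_le_zero h
  rw [discrim] at this
  nlinarith

variable {n : ℕ}

theorem memLp_simplexMeasure {s : Finset (Pt n)}
    (hfin : (μHE[s.card - 1] : Measure (Pt n)) (hull s) ≠ ⊤) {f : Pt n → ℝ} (hf : Continuous f) :
    MemLp f 2 (simplexMeasure s) :=
  (memLp_two_iff_integrable_sq hf.aestronglyMeasurable).2
    (integrableOn_of_continuous (isCompact_hull s) hfin (hf.pow 2))

theorem exists_sq_le_integral_simplex (d k : ℕ) : ∃ C : ℝ, 0 < C ∧ ∀ (n : ℕ) (s : Finset (Pt n)),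
    s.card = d + 1 → (μHE[s.card - 1] : Measure (Pt n)) (hull s) ≠ ⊤ → ∀ f, IsPoly k f →
    ∀ a ∈ hull s, f a ^ 2 * (simplexMeasure s).real Set.univ ≤ C * ∫ x, f x ^ 2 ∂(simplexMeasure s) := by
  obtain ⟨C, hC, h⟩ := exists_sq_le_integral_poly d k
  refine ⟨C, hC, fun n s hc hfin f hf a ha => ?_⟩
  rw [simplexMeasure, measureReal_restrict_apply_univ]
  rw [hc, Nat.add_sub_cancel] at hfin ⊢
  exact h n (hull s) (convex_hull s) (isCompact_hull s) hfin f hf a ha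

/-- Point evaluation vanishes on every polynomial with zero mean square on s, by the inverse
inequality, so it is represented by the L²(s)-form. -/
theorem exists_dualFunction {s : Finset (Pt n)} (hs : s.Nonempty)
    (hfin : (μHE[s.card - 1] : Measure (Pt n)) (hull s) ≠ ⊤)
    (hpos : (μHE[s.card - 1] : Measure (Pt n)) (hull s) ≠ 0) (k : ℕ) {a : Pt n} (ha : a ∈ hull s) :
    ∃ ψ, IsDualFunction k s a ψ := by
  have mem : ∀ p : polyFun n k, MemLp (p : Pt n → ℝ) 2 (simplexMeasure s) := fun p =>
    memLp_simplexMeasure hfin (IsPoly.continuous p.2)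
  have hint : ∀ p q : polyFun n k, Integrable (fun x => p.1 x * q.1 x) (simplexMeasure s) := fun p q =>
    (mem p).integrable_mul (mem q)
  let B : polyFun n k →ₗ[ℝ] polyFun n k →ₗ[ℝ] ℝ := LinearMap.mk₂ ℝ
    (fun p q => ∫ x, p.1 x * q.1 x ∂(simplexMeasure s))
    (fun p p' q => by
      rw [← integral_add (hint p q) (hint p' q)]
      exact integral_congr_ae (ae_of_all _ fun x => by
        simp only [Submodule.coe_add, Pi.add_apply]; ring))
    (fun c p q => by
      rw [smul_eq_mul, ← integral_const_mul]
      exact integral_congr_ae (ae_of_all _ fun x => by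
        simp only [Submodule.coe_smul, Pi.smul_apply, smul_eq_mul]; ring))
    (fun p q q' => by
      rw [← integral_add (hint p q) (hint p q')]
      exact integral_congr_ae (ae_of_all _ fun x => by
        simp only [Submodule.coe_add, Pi.add_apply]; ring))
    (fun c p q => by
      rw [smul_eq_mul, ← integral_const_mul]
      exact integral_congr_ae (ae_of_all _ fun x => by
        simp only [Submodule.coe_smul, Pi.smul_apply, smul_eq_mul]; ring))
  let f : polyFun n k →ₗ[ℝ] ℝ :=
    { toFun := fun p => p.1 a
      map_add' := fun p q => rfl
      map_smul' := fun c p => rfl }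
  obtain ⟨C, hC, h⟩ := exists_sq_le_integral_simplex (s.card - 1) k
  have hc : s.card = s.card - 1 + 1 := (Nat.sub_add_cancel hs.card_pos).symm
  have hm : 0 < (simplexMeasure s).real Set.univ := by
    rw [simplexMeasure, measureReal_restrict_apply_univ, Measure.real, ENNReal.toReal_pos_iff]
    exact ⟨pos_iff_ne_zero.2 hpos, hfin.lt_top⟩
  obtain ⟨ψ, hψ⟩ := exists_eq_of_ker_le B
    (fun p q => integral_congr_ae (ae_of_all _ fun x => mul_comm _ _)) f (fun p hp => by
      have h1 := h n s hc hfin p.1 p.2 a ha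
      have h2 : ∫ x, p.1 x ^ 2 ∂(simplexMeasure s) = 0 := by
        rw [← hp]
        exact integral_congr_ae (ae_of_all _ fun x => sq _)
      rw [h2, mul_zero] at h1
      have h3 : p.1 a ^ 2 ≤ 0 := by
        by_contra hcon
        nlinarith [mul_pos (not_le.1 hcon) hm]
      exact pow_eq_zero_iff two_ne_zero |>.1 (le_antisymm h3 (sq_nonneg _)))
  refine ⟨ψ.1, ψ.2, fun p hp => ?_⟩
  exact LinearMap.congr_fun hψ (⟨p, hp⟩ : polyFun n k)

/-- The difference is orthogonal to itself on s. Uniqueness holds only on s, as polynomials on ℝⁿ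
are not determined by a facet; only values on s enter nodal values. -/
theorem IsDualFunction.unique {s : Finset (Pt n)} (hs : s.Nonempty)
    (hfin : (μHE[s.card - 1] : Measure (Pt n)) (hull s) ≠ ⊤)
    (hpos : (μHE[s.card - 1] : Measure (Pt n)) (hull s) ≠ 0) {k : ℕ} {a : Pt n}
    {ψ ψ' : Pt n → ℝ} (h : IsDualFunction k s a ψ) (h' : IsDualFunction k s a ψ') {x : Pt n}
    (hx : x ∈ hull s) : ψ x = ψ' x := by
  have hd := h.1.sub h'.1
  have m := memLp_simplexMeasure hfin h.1.continuous
  have m' := memLp_simplexMeasure hfin h'.1.continuous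
  have md := memLp_simplexMeasure hfin hd.continuous
  have h0 : ∫ x, (ψ x - ψ' x) ^ 2 ∂(simplexMeasure s) = 0 := by
    have e : ∀ x, (ψ x - ψ' x) ^ 2 = ψ x * (ψ x - ψ' x) - ψ' x * (ψ x - ψ' x) := fun x => by ring
    simp only [e]
    have i1 : Integrable (fun x => ψ x * (ψ x - ψ' x)) (simplexMeasure s) := m.integrable_mul md
    have i2 : Integrable (fun x => ψ' x * (ψ x - ψ' x)) (simplexMeasure s) := m'.integrable_mul md
    rw [integral_sub i1 i2, h.2 _ hd, h'.2 _ hd, sub_self]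
  obtain ⟨C, hC, hb⟩ := exists_sq_le_integral_simplex (s.card - 1) k
  have h1 := hb n s (Nat.sub_add_cancel hs.card_pos).symm hfin _ hd x hx
  have hm : 0 < (simplexMeasure s).real Set.univ := by
    rw [simplexMeasure, measureReal_restrict_apply_univ, Measure.real, ENNReal.toReal_pos_iff]
    exact ⟨pos_iff_ne_zero.2 hpos, hfin.lt_top⟩
  rw [h0, mul_zero] at h1
  have h3 : (ψ x - ψ' x) ^ 2 ≤ 0 := by
    by_contra hcon
    nlinarith [mul_pos (not_le.1 hcon) hm]
  exact sub_eq_zero.1 (pow_eq_zero_iff two_ne_zero |>.1 (le_antisymm h3 (sq_nonneg _)))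

/-- The dual function of a node reproduces values up to an error controlled in `L²`. -/
theorem exists_dual_bound (d k : ℕ) : ∃ C : ℝ, 0 < C ∧ ∀ (n : ℕ) (s : Finset (Pt n)),
    s.card = d + 1 → (μHE[s.card - 1] : Measure (Pt n)) (hull s) ≠ ⊤ → ∀ a ∈ hull s,
    ∀ ψ, IsDualFunction k s a ψ → ∀ p, IsPoly k p → ∀ u, MemLp u 2 (simplexMeasure s) →
      ((∫ x, ψ x * u x ∂(simplexMeasure s)) - p a) ^ 2 * (simplexMeasure s).real Set.univ ≤
        C * ∫ x, (u x - p x) ^ 2 ∂(simplexMeasure s) := by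
  obtain ⟨C, hC, h⟩ := exists_sq_le_integral_simplex d k
  refine ⟨C, hC, fun n s hc hfin a ha ψ hψ p hp u hu => ?_⟩
  have mψ := memLp_simplexMeasure hfin hψ.1.continuous
  have mp := memLp_simplexMeasure hfin hp.continuous
  have hup : MemLp (fun x => u x - p x) 2 (simplexMeasure s) := hu.sub mp
  have e : (∫ x, ψ x * u x ∂(simplexMeasure s)) - p a = ∫ x, ψ x * (u x - p x) ∂(simplexMeasure s) := by
    have i1 : Integrable (fun x => ψ x * u x) (simplexMeasure s) := mψ.integrable_mul hu
    have i2 : Integrable (fun x => ψ x * p x) (simplexMeasure s) := mψ.integrable_mul mp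
    rw [← hψ.2 p hp, ← integral_sub i1 i2]
    exact integral_congr_ae (ae_of_all _ fun x => (mul_sub _ _ _).symm)
  -- Testing ψ against itself gives ‖ψ‖² = ψ(a). Combined with the inverse inequality ψ(a)² m ≤
  -- C‖ψ‖², this yields ψ(a) m ≤ C, and Cauchy–Schwarz finishes.
  have e2 : ∫ x, ψ x ^ 2 ∂(simplexMeasure s) = ψ a := by
    rw [← hψ.2 ψ hψ.1]
    exact integral_congr_ae (ae_of_all _ fun x => sq _)
  have h1 := h n s hc hfin ψ hψ.1 a ha
  have h2 := integral_mul_sq_le mψ hup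
  rw [← e, e2] at h2
  rw [e2] at h1
  have h3 : 0 ≤ ψ a := by rw [← e2]; exact integral_nonneg fun _ => sq_nonneg _
  have hI : 0 ≤ ∫ x, (u x - p x) ^ 2 ∂(simplexMeasure s) := integral_nonneg fun _ => sq_nonneg _
  set m := (simplexMeasure s).real Set.univ with hm
  have hm0 : 0 ≤ m := measureReal_nonneg
  have h4 : ψ a * m ≤ C := by
    rcases h3.eq_or_lt with h0 | h0
    · rw [← h0, zero_mul]; exact hC.le
    · refine le_of_mul_le_mul_left ?_ h0
      linarith [show ψ a * (ψ a * m) = ψ a ^ 2 * m by ring]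
  calc _ ≤ (ψ a * ∫ x, (u x - p x) ^ 2 ∂(simplexMeasure s)) * m := mul_le_mul_of_nonneg_right h2 hm0
    _ = (ψ a * m) * ∫ x, (u x - p x) ^ 2 ∂(simplexMeasure s) := by ring
    _ ≤ _ := mul_le_mul_of_nonneg_right h4 hI

end Duality

/-! ### Bounds for polynomials by nodal values and by interior norms. -/

section PolynomialBounds

variable {n : ℕ} {K : Finset (Pt n)} {γ : ℝ}

theorem sq_le_sum_nodes (hK : IsCell K) {k : ℕ} (hk : 1 ≤ k) {f : Pt n → ℝ} (hf : IsPoly k f)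
    {x : Pt n} (hx : x ∈ hull K) :
    f x ^ 2 ≤ ((k : ℝ) ^ k * (k + 1) ^ (n + 1)) ^ 2 * ∑ a ∈ simplexNodes K k, f a ^ 2 := by
  obtain ⟨g, hg, hgn, hgb⟩ := exists_poly_interpolant hK hk f
  have := poly_eq_zero_of_nodes hk (hf.sub hg) (D := K) (fun a ha => by rw [hgn a ha, sub_self]) hx
  rw [sub_eq_zero.1 this]
  exact hgb x hx

theorem boundaryMeasure_real_le (hn : 1 ≤ n) (hK : IsCell K) :
    (boundaryMeasure K).real Set.univ ≤ n * gradSum K * volume.real (hull K) := by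
  rw [boundaryMeasure, measureReal_restrict_apply_univ, frontier_cell hK]
  refine (measureReal_biUnion_finset_le K _).trans (le_of_eq ?_)
  rw [gradSum, Finset.mul_sum, Finset.sum_mul]
  exact Finset.sum_congr rfl fun v hv => facet_measure_eq hn hK hv

/-- The squared maximum on K is at most C times the mean square, and the ratio of boundary area to
volume is at most n times the sum of the gradients, hence of order γ over the diameter. -/
theorem exists_boundary_poly_le (n k : ℕ) (hn : 1 ≤ n) : ∃ C : ℝ, 0 < C ∧ ∀ (γ : ℝ)
    (K : Finset (Pt n)), IsCell K → RegularCell γ K → ∀ f, IsPoly k f →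
    cellDiam K * ∫ x, f x ^ 2 ∂(boundaryMeasure K) ≤ C * γ * ∫ x in hull K, f x ^ 2 := by
  obtain ⟨C, hC, h⟩ := exists_sq_le_integral_cell n k
  refine ⟨C * n * (n + 1), by positivity, fun γ K hK hγ f hf => ?_⟩
  have hv := volume_hull_pos hK
  set I := ∫ x in hull K, f x ^ 2 with hI
  have hI0 : 0 ≤ I := integral_nonneg fun _ => sq_nonneg _
  have hsup : ∀ x ∈ hull K, f x ^ 2 ≤ C * I / volume.real (hull K) := fun x hx => by
    rw [le_div_iff₀ hv]; exact h K hK f hf x hx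
  have hfin : IsFiniteMeasure (boundaryMeasure K) := ⟨boundaryMeasure_univ_lt_top hn hK⟩
  have h1 : ∫ x, f x ^ 2 ∂(boundaryMeasure K) ≤
      ∫ _, C * I / volume.real (hull K) ∂(boundaryMeasure K) := by
    refine integral_mono_ae (memLp_boundary hn hK hf.continuous).integrable_sq (integrable_const _) ?_
    refine (ae_restrict_mem isClosed_frontier.measurableSet).mono fun x hx => hsup x ?_
    exact (isCompact_hull K).isClosed.frontier_subset hx
  rw [integral_const, smul_eq_mul] at h1
  have h2 := mul_le_mul_of_nonneg_right (boundaryMeasure_real_le hn hK)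
    (by positivity : 0 ≤ C * I / volume.real (hull K))
  have h3 := hγ.gradSum_mul_le hn hK
  have h4 := cellDiam_pos hn hK
  calc cellDiam K * ∫ x, f x ^ 2 ∂(boundaryMeasure K)
      ≤ cellDiam K * (n * gradSum K * volume.real (hull K) * (C * I / volume.real (hull K))) :=
        mul_le_mul_of_nonneg_left (h1.trans h2) h4.le
    _ = n * (C * I) * (gradSum K * cellDiam K) := by field_simp
    _ ≤ n * (C * I) * ((n + 1) * γ) := mul_le_mul_of_nonneg_left h3 (by positivity)
    _ = C * n * (n + 1) * γ * I := by ring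

end PolynomialBounds

/-! ### Well-posedness of the Scott-Zhang interpolation. -/

section ScottZhang

variable {n : ℕ} {Ω : Set (Pt n)} {T : Mesh Ω} {k : ℕ}

theorem simplexNodes_mono {D K : Finset (Pt n)} (h : D ⊆ K) : simplexNodes D k ⊆ simplexNodes K k := by
  intro a ha
  obtain ⟨c, hc, rfl⟩ := mem_simplexNodes.1 ha
  refine mem_simplexNodes.2 ⟨fun v => if v ∈ D then c v else 0, ?_, ?_⟩
  · rw [Finset.sum_ite_mem, Finset.inter_eq_right.2 h, hc]
  · refine Finset.sum_subset_zero_on_sdiff h (fun v hv => ?_) (fun v hv => ?_)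
    · simp only [if_neg (Finset.mem_sdiff.1 hv).2, Nat.cast_zero, zero_div, zero_smul]
    · simp only [if_pos hv]

theorem Mesh.mem_nodes {a : Pt n} : a ∈ T.nodes k ↔ ∃ K ∈ T.cells, a ∈ simplexNodes K k := by
  simp only [Mesh.nodes, Set.mem_ofPred_eq, mem_simplexNodes]

/-- On a face the coordinates of the remaining vertices vanish, hence so do the corresponding
integers. Conforming elements therefore see the same nodes on their common face. -/
theorem mem_simplexNodes_face (hk : 1 ≤ k) {K D : Finset (Pt n)} (hK : IsCell K) (hD : D ⊆ K)
    {a : Pt n} (ha : a ∈ simplexNodes K k) (haD : a ∈ hull D) : a ∈ simplexNodes D k := by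
  obtain ⟨c, hc, rfl⟩ := mem_simplexNodes.1 ha
  have hk0 : (k : ℝ) ≠ 0 := by positivity
  have hw : ∑ v ∈ K, ((c v : ℝ) / k) = 1 := by
    rw [← Finset.sum_div, ← Nat.cast_sum, hc, div_self hk0]
  have h0 : ∀ v ∈ K, v ∉ D → c v = 0 := fun v hv hvD => by
    have := ((mem_hull_face hK hD).1 haD).2 v hv hvD
    rw [bary_sum hK subset_rfl hw hv, if_pos hv, div_eq_zero_iff, or_iff_left hk0] at this
    exact_mod_cast this
  refine mem_simplexNodes.2 ⟨c, ?_, ?_⟩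
  · rw [← hc]
    exact Finset.sum_subset hD fun v hv hvD => h0 v hv hvD
  · refine (Finset.sum_subset hD fun v hv hvD => ?_).symm
    rw [h0 v hv hvD, Nat.cast_zero, zero_div, zero_smul]

theorem Mesh.mem_simplexNodes_of_mem_hull (hk : 1 ≤ k) {K L : Finset (Pt n)} (hK : K ∈ T.cells)
    (hL : L ∈ T.cells) {a : Pt n} (ha : a ∈ simplexNodes K k) (haL : a ∈ hull L) :
    a ∈ simplexNodes L k :=
  simplexNodes_mono Finset.inter_subset_right (mem_simplexNodes_face hk (T.isCell hK)
    Finset.inter_subset_left ha (T.mem_hull_inter (T.mem_cells.1 hK).1 (T.mem_cells.1 hL).1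
      (simplexNodes_subset_hull hk ha) haL))

/-- Continuous piecewise polynomials are determined by their nodal values, which are arbitrary. -/
theorem Mesh.exists_lagrange (T : Mesh Ω) (hk : 1 ≤ k) (c : Pt n → ℝ) : ∃ w : Pt n → ℝ,
    (∀ K ∈ T.cells, ∃ p, IsPoly k p ∧ ∀ x ∈ hull K, w x = p x) ∧
    (∀ a ∈ T.nodes k, w a = c a) ∧ ∀ x ∉ T.complex.space, w x = 0 := by
  classical
  have hp : ∀ K ∈ T.cells, ∃ p, IsPoly k p ∧ ∀ a ∈ simplexNodes K k, p a = c a := fun K hK => by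
    obtain ⟨p, h1, h2, -⟩ := exists_poly_interpolant (T.isCell hK) hk c
    exact ⟨p, h1, h2⟩
  choose! p hp hpc using hp
  -- Two local interpolants agree at the nodes of the common face, hence on the whole face, so the
  -- choice of element in the definition of w is immaterial.
  have hcons : ∀ K ∈ T.cells, ∀ L ∈ T.cells, ∀ x ∈ hull K, x ∈ hull L → p K x = p L x := by
    intro K hK L hL x hx hxL
    refine sub_eq_zero.1 (poly_eq_zero_of_nodes hk ((hp K hK).sub (hp L hL)) (D := K ∩ L)
      (fun a ha => ?_) (T.mem_hull_inter (T.mem_cells.1 hK).1 (T.mem_cells.1 hL).1 hx hxL))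
    rw [hpc K hK a (simplexNodes_mono Finset.inter_subset_left ha),
      hpc L hL a (simplexNodes_mono Finset.inter_subset_right ha), sub_self]
  set w : Pt n → ℝ := fun x => if h : ∃ K ∈ T.cells, x ∈ hull K then p h.choose x else 0 with hw
  have hwK : ∀ K ∈ T.cells, ∀ x ∈ hull K, w x = p K x := by
    intro K hK x hx
    have h : ∃ K ∈ T.cells, x ∈ hull K := ⟨K, hK, hx⟩
    simp only [hw, dif_pos h]
    exact hcons _ h.choose_spec.1 K hK x h.choose_spec.2 hx
  refine ⟨w, fun K hK => ⟨p K, hp K hK, hwK K hK⟩, fun a ha => ?_, fun x hx => ?_⟩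
  · obtain ⟨K, hK, haK⟩ := Mesh.mem_nodes.1 ha
    rw [hwK K hK a (simplexNodes_subset_hull hk haK), hpc K hK a haK]
  · rw [T.mem_space] at hx
    simp only [hw, dif_neg hx]

theorem Mesh.lagrange_unique (hk : 1 ≤ k) {w w' : Pt n → ℝ}
    (h : ∀ K ∈ T.cells, ∃ p, IsPoly k p ∧ ∀ x ∈ hull K, w x = p x)
    (h' : ∀ K ∈ T.cells, ∃ p, IsPoly k p ∧ ∀ x ∈ hull K, w' x = p x)
    (hn : ∀ a ∈ T.nodes k, w a = w' a) (h0 : ∀ x ∉ T.complex.space, w x = 0)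
    (h0' : ∀ x ∉ T.complex.space, w' x = 0) : w = w' := by
  funext x
  by_cases hx : x ∈ T.complex.space
  · obtain ⟨K, hK, hxK⟩ := T.mem_space.1 hx
    obtain ⟨p, hp, hpw⟩ := h K hK
    obtain ⟨q, hq, hqw⟩ := h' K hK
    rw [hpw x hxK, hqw x hxK]
    refine sub_eq_zero.1 (poly_eq_zero_of_nodes hk (hp.sub hq) (D := K) (fun a ha => ?_) hxK)
    have haK := simplexNodes_subset_hull hk ha
    rw [← hpw a haK, ← hqw a haK, hn a (Mesh.mem_nodes.2 ⟨K, hK, ha⟩), sub_self]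
  · rw [h0 x hx, h0' x hx]

theorem Mesh.face_measure {s : Finset (Pt n)} (hs : s ∈ T.complex.faces) :
    (μHE[s.card - 1] : Measure (Pt n)) (hull s) ≠ ⊤ ∧ (μHE[s.card - 1] : Measure (Pt n)) (hull s) ≠ 0 :=
  simplexMeasure_hull_ne_top (T.complex.indep hs) (T.complex.nonempty_of_mem_faces hs)

/-- The trace on a facet does not depend on the element used to define it. -/
theorem Mesh.trace_ae_eq (hn : 1 ≤ n) {u : Pt n → ℝ} (hu : MemSobolev Ω 1 u)
    {K K' F : Finset (Pt n)} (hK : K ∈ T.cells) (hK' : K' ∈ T.cells) (hF : F ⊆ K) (hF' : F ⊆ K')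
    (hc : F.card = n) : trace K u =ᵐ[simplexMeasure F] trace K' u := by
  by_cases e : K = K'
  · rw [e]
  · exact FEM.trace_ae_eq hn T.isOpen (T.isCell hK) (T.isCell hK') hF hF' hc (T.interior_subset hK)
      (T.interior_subset hK') (fun x hx hx' => T.relint_subset hK hK' e hF hF' hc hx hx') hu

/-- The value depends neither on the dual function, which is unique on s, nor on the element used
for the trace, as traces from both sides agree almost everywhere on s. -/
theorem Mesh.existsUnique_nodalValue (hn : 1 ≤ n) {u : Pt n → ℝ} (hu : MemSobolev Ω 1 u)
    {s : Finset (Pt n)} (hs : s ∈ T.complex.faces) (hc : s.card = n + 1 ∨ s.card = n) {a : Pt n}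
    (ha : a ∈ hull s) : ∃! c, T.IsNodalValue k s a u c := by
  have hne := T.complex.nonempty_of_mem_faces hs
  obtain ⟨hfin, hpos⟩ := Mesh.face_measure hs
  obtain ⟨ψ, hψ⟩ := exists_dualFunction hne hfin hpos k ha
  have hmem : ∀ᵐ x ∂(simplexMeasure s), x ∈ hull s :=
    ae_restrict_mem (isCompact_hull s).isClosed.measurableSet
  have hcongr : ∀ ψ', IsDualFunction k s a ψ' → ∀ v : Pt n → ℝ,
      ∫ x, ψ' x * v x ∂(simplexMeasure s) = ∫ x, ψ x * v x ∂(simplexMeasure s) := fun ψ' hψ' v =>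
    integral_congr_ae (hmem.mono fun x hx => by simp only [hψ'.unique hne hfin hpos hψ hx])
  rcases hc with hc | hc
  · refine ⟨∫ x, ψ x * u x ∂(simplexMeasure s), ⟨ψ, hψ, Or.inl ⟨hc, rfl⟩⟩, ?_⟩
    rintro c ⟨ψ', hψ', ⟨-, rfl⟩ | ⟨h, -⟩⟩
    · exact hcongr ψ' hψ' u
    · omega
  · obtain ⟨K, hKf, hsK, hKc⟩ := T.pure s hs
    have hK : K ∈ T.cells := T.mem_cells.2 ⟨hKf, hKc⟩
    refine ⟨∫ x, ψ x * trace K u x ∂(simplexMeasure s), ⟨ψ, hψ, Or.inr ⟨hc, K, hK, hsK, rfl⟩⟩, ?_⟩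
    rintro c ⟨ψ', hψ', ⟨h, -⟩ | ⟨-, K', hK', hsK', rfl⟩⟩
    · omega
    · rw [hcongr ψ' hψ']
      refine integral_congr_ae ((Mesh.trace_ae_eq hn hu hK' hK hsK' hsK hc).mono fun x hx => ?_)
      simp only [hx]

theorem Mesh.IsNodeChoice.card {σ : Pt n → Finset (Pt n)} (hσ : T.IsNodeChoice k σ) {a : Pt n}
    (ha : a ∈ T.nodes k) : (σ a).card = n + 1 ∨ (σ a).card = n := by
  obtain ⟨-, -, h1, h2⟩ := hσ a ha
  by_cases h : ∃ K ∈ T.cells, a ∈ interior (hull K)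
  · exact Or.inl (h1 h)
  · exact Or.inr (h2 h)

theorem Mesh.existsUnique_scottZhang (hn : 1 ≤ n) (hk : 1 ≤ k) {σ : Pt n → Finset (Pt n)}
    (hσ : T.IsNodeChoice k σ) {u : Pt n → ℝ} (hu : MemSobolev Ω 1 u) :
    ∃! w, T.IsScottZhang k σ u w := by
  have h : ∀ a ∈ T.nodes k, ∃! c, T.IsNodalValue k (σ a) a u c := fun a ha =>
    Mesh.existsUnique_nodalValue hn hu (hσ a ha).1 (hσ.card ha) (hσ a ha).2.1
  have h' : ∀ a ∈ T.nodes k, ∃ c, T.IsNodalValue k (σ a) a u c := fun a ha => (h a ha).exists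
  choose! c hc using h'
  obtain ⟨w, h1, h2, h3⟩ := T.exists_lagrange hk c
  refine ⟨w, ⟨h1, fun a ha => by rw [h2 a ha]; exact hc a ha, h3⟩, ?_⟩
  rintro w' ⟨g1, g2, g3⟩
  refine Mesh.lagrange_unique hk g1 h1 (fun a ha => ?_) g3 h3
  rw [h2 a ha]
  exact (h a ha).unique (g2 a ha) (hc a ha)

theorem Mesh.isScottZhang_scottZhang (hn : 1 ≤ n) (hk : 1 ≤ k) {σ : Pt n → Finset (Pt n)}
    (hσ : T.IsNodeChoice k σ) {u : Pt n → ℝ} (hu : MemSobolev Ω 1 u) :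
    T.IsScottZhang k σ u (T.scottZhang k σ u) :=
  Classical.epsilon_spec (Mesh.existsUnique_scottZhang hn hk hσ hu).exists

theorem trace_congr {K : Finset (Pt n)} {u u' : Pt n → ℝ}
    (h : u =ᵐ[volume.restrict (interior (hull K))] u') : trace K u = trace K u' := by
  rw [trace, trace]
  congr 1
  funext g
  exact propext ⟨fun hg => hg.congr h, fun hg => hg.congr h.symm⟩

/-- Nodal values are integrals of u or of its traces, both insensitive to null sets. Almost
everywhere symmetry of τ thus gives exact symmetry of the interpolant. -/
theorem Mesh.scottZhang_congr {σ : Pt n → Finset (Pt n)} {u u' : Pt n → ℝ}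
    (hσ : T.IsNodeChoice k σ) (h : u =ᵐ[volume.restrict Ω] u') :
    T.scottZhang k σ u = T.scottZhang k σ u' := by
  have hK : ∀ K ∈ T.cells, u =ᵐ[volume.restrict (hull K)] u' := T.ae_iff.1 h
  have key : ∀ u u' : Pt n → ℝ, (∀ K ∈ T.cells, u =ᵐ[volume.restrict (hull K)] u') →
      ∀ w, T.IsScottZhang k σ u w → T.IsScottZhang k σ u' w := by
    rintro u u' hK w ⟨h1, h2, h3⟩
    refine ⟨h1, fun a ha => ?_, h3⟩
    obtain ⟨ψ, hψ, ⟨hc, e⟩ | ⟨hc, K, hKT, hsK, e⟩⟩ := h2 a ha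
    · refine ⟨ψ, hψ, Or.inl ⟨hc, e.trans (integral_congr_ae ?_)⟩⟩
      have := hK _ (T.mem_cells.2 ⟨(hσ a ha).1, hc⟩)
      rw [simplexMeasure, hc, Nat.add_sub_cancel, euclideanHausdorffMeasure_eq_volume]
      exact this.mono fun x hx => by simp only [hx]
    · refine ⟨ψ, hψ, Or.inr ⟨hc, K, hKT, hsK, ?_⟩⟩
      rw [e, trace_congr]
      rw [restrict_interior_hull]
      exact hK K hKT
  rw [Mesh.scottZhang, Mesh.scottZhang]
  congr 1
  funext w
  exact propext ⟨key u u' hK w, key u' u (fun K h => (hK K h).symm) w⟩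

end ScottZhang

/-! ### Lipschitz functions and integrals of directional derivatives. -/

section Lipschitz

/-- A function that agrees with an `L`-Lipschitz function on each member of a finite closed cover
is `L`-Lipschitz. -/
theorem lipschitzWith_of_closed_cover {E : Type*} [NormedAddCommGroup E] [NormedSpace ℝ E] {ι : Type*}
    [Finite ι] {A : ι → Set E} (hA : ∀ i, IsClosed (A i)) (hcov : ∀ x, ∃ i, x ∈ A i) {f : E → ℝ}
    {g : ι → E → ℝ} {L : NNReal} (hg : ∀ i, LipschitzWith L (g i)) (hfg : ∀ i, ∀ x ∈ A i, f x = g i x) :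
    LipschitzWith L f := by
  have hcont : Continuous f := (locallyFinite_of_finite A).continuous
    (Set.eq_univ_of_forall fun x => Set.mem_iUnion.2 (hcov x)) hA
    (fun i => (hg i).continuous.continuousOn.congr (hfg i))
  refine LipschitzWith.of_dist_le_mul fun x y => ?_
  set c : ℝ → E := fun t => y + t • (x - y) with hc
  have hcc : Continuous c := by fun_prop
  have hB : ∀ t : ℝ, HasDerivAt (fun t : ℝ => (L * dist x y) * t) (L * dist x y) t := fun t => by
    simpa using (hasDerivAt_id t).const_mul (L * dist x y)
  have key := image_le_of_liminf_slope_right_le_deriv_boundary (f := fun t => |f (c t) - f (c 0)|)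
    (a := 0) (b := 1) (B := fun t => (L * dist x y) * t) (B' := fun _ => L * dist x y)
    (by fun_prop) (by simp) (by fun_prop) (fun t _ => (hB t).hasDerivWithinAt) (fun t _ r hr => ?_)
    (Set.right_mem_Icc.2 zero_le_one)
  · simp only [mul_one, hc, one_smul, zero_smul, add_zero, add_sub_cancel] at key
    rw [Real.dist_eq]
    exact key
  -- Some member of the finite cover contains points of the segment accumulating at t from the
  -- right, and being closed it contains the point at t too; there f has the slope of g i, which
  -- suffices for the comparison theorem.
  · obtain ⟨i, hi⟩ : ∃ i, ∃ᶠ z in 𝓝[>] t, c z ∈ A i := by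
      by_contra! h
      obtain ⟨z, hz⟩ := (Filter.eventually_all.2 h).exists
      obtain ⟨i, hi⟩ := hcov (c z)
      exact hz i hi
    have hti : c t ∈ A i := (hA i).mem_of_frequently_of_tendsto hi
      ((hcc.tendsto t).mono_left nhdsWithin_le_nhds)
    refine (hi.and_eventually eventually_mem_nhdsWithin).mono fun z hz => ?_
    have hz0 : 0 < z - t := sub_pos.2 hz.2
    refine lt_of_le_of_lt ?_ hr
    rw [slope_def_field, div_le_iff₀ hz0]
    have h1 : |f (c z) - f (c t)| ≤ L * dist (c z) (c t) := by
      rw [hfg i _ hz.1, hfg i _ hti, ← Real.dist_eq]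
      exact (hg i).dist_le_mul _ _
    have h2 : dist (c z) (c t) = (z - t) * dist x y := by
      rw [hc, dist_add_left, dist_eq_norm, ← sub_smul, norm_smul, Real.norm_of_nonneg hz0.le,
        dist_eq_norm]
    rw [h2] at h1
    have h3 := abs_sub_le (f (c z)) (f (c t)) (f (c 0))
    linarith

variable {n : ℕ}

/-- The integral of a directional derivative over a set invariant in that direction vanishes. -/
theorem setIntegral_lineDeriv_eq_zero {f : Pt n → ℝ} {L : NNReal} (hf : LipschitzWith L f)
    (hfc : HasCompactSupport f) {v : Pt n} {A : Set (Pt n)} (hA : MeasurableSet A)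
    (hAv : ∀ (x : Pt n) (s : ℝ), x + s • v ∈ A ↔ x ∈ A) : ∫ x in A, lineDeriv ℝ f x v = 0 := by
  -- The convergence of difference quotients needs an integrable weight. Cutting A down to S loses
  -- nothing, because for shifts by tv with 0 ≤ t ≤ 1 the quotient vanishes off S.
  set S := Metric.cthickening ‖v‖ (tsupport f) with hS
  have hSc : IsCompact S := IsCompact.cthickening hfc
  have hSm : MeasurableSet S := hSc.isClosed.measurableSet
  have hout : ∀ x ∉ S, ∀ t : ℝ, 0 ≤ t → t ≤ 1 → f (x + t • v) = 0 := by
    intro x hx t ht ht1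
    by_contra hne
    refine hx (Metric.mem_cthickening_of_dist_le x (x + t • v) _ _ (subset_tsupport _ hne) ?_)
    rw [dist_self_add_right, norm_smul, Real.norm_of_nonneg ht]
    exact mul_le_of_le_one_left (norm_nonneg v) ht1
  have hg : Integrable ((A ∩ S).indicator fun _ => (1 : ℝ)) (volume : Measure (Pt n)) :=
    (integrable_indicator_iff (hA.inter hSm)).2 (integrableOn_const
      ((measure_mono Set.inter_subset_right).trans_lt hSc.measure_lt_top).ne)
  have hlim := hf.integral_inv_smul_sub_mul_tendsto_integral_lineDeriv_mul hg v
  have hfi : Integrable f := hf.continuous.integrable_of_hasCompactSupport hfc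
  -- A is invariant under the shift, so the difference quotient is that of f restricted to A, and
  -- its integral is zero by translation invariance of the measure.
  have hzero : ∀ᶠ t : ℝ in 𝓝[>] 0,
      ∫ x, (t⁻¹ • (f (x + t • v) - f x)) * (A ∩ S).indicator (fun _ => (1 : ℝ)) x = 0 := by
    filter_upwards [Ioc_mem_nhdsGT zero_lt_one] with t ht
    have e : ∀ x, (t⁻¹ • (f (x + t • v) - f x)) * (A ∩ S).indicator (fun _ => (1 : ℝ)) x =
        t⁻¹ * (A.indicator f (x + t • v) - A.indicator f x) := by
      intro x
      by_cases hxA : x ∈ A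
      · rw [Set.indicator_of_mem hxA, Set.indicator_of_mem ((hAv x t).2 hxA), smul_eq_mul]
        by_cases hxS : x ∈ S
        · have hAS : x ∈ A ∩ S := ⟨hxA, hxS⟩
          rw [Set.indicator_of_mem hAS, mul_one]
        · have h1 := hout x hxS t ht.1.le ht.2
          have h2 := hout x hxS 0 le_rfl zero_le_one
          rw [zero_smul, add_zero] at h2
          rw [h1, h2, sub_self, mul_zero, zero_mul]
      · rw [Set.indicator_of_notMem hxA, Set.indicator_of_notMem (fun h => hxA ((hAv x t).1 h)),
          Set.indicator_of_notMem (fun h => hxA h.1), mul_zero, sub_self, mul_zero]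
    simp only [e]
    have hi : Integrable (A.indicator f) := hfi.indicator hA
    rw [integral_const_mul, integral_sub (hi.comp_add_right (t • v)) hi,
      integral_add_right_eq_self, sub_self, mul_zero]
  have h0 := tendsto_nhds_unique hlim (tendsto_const_nhds.congr' (hzero.mono fun t ht => ht.symm))
  rw [← integral_indicator hA, ← h0]
  refine integral_congr_ae (ae_of_all _ fun x => ?_)
  by_cases hxA : x ∈ A
  · by_cases hxS : x ∈ S
    · have hAS : x ∈ A ∩ S := ⟨hxA, hxS⟩
      simp only [Set.indicator_of_mem hxA, Set.indicator_of_mem hAS, mul_one]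
    · have hx : x ∉ tsupport f := fun h => hxS (Metric.self_subset_cthickening _ h)
      have : lineDeriv ℝ f x v = 0 := by
        rw [(notMem_tsupport_iff_eventuallyEq.1 hx).lineDeriv_eq]
        simp [lineDeriv]
      simp only [Set.indicator_of_mem hxA, this, zero_mul]
  · simp only [Set.indicator_of_notMem hxA,
      Set.indicator_of_notMem (fun h : x ∈ A ∩ S => hxA h.1), mul_zero]

theorem ae_bary_ne_zero {K : Finset (Pt n)} (hK : IsCell K) {a : Pt n} (ha : a ∈ K) :
    ∀ᵐ x : Pt n, bary K a x ≠ 0 := by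
  have h : volume ((AffineSubspace.comap (bary K a) (AffineSubspace.mk' (0 : ℝ) ⊥) :
      AffineSubspace ℝ (Pt n)) : Set (Pt n)) = 0 := by
    refine Measure.addHaar_affineSubspace _ _ fun htop => ?_
    have : a ∈ AffineSubspace.comap (bary K a) (AffineSubspace.mk' (0 : ℝ) ⊥) := by
      rw [htop]; exact AffineSubspace.mem_top ℝ _ a
    rw [AffineSubspace.mem_comap, AffineSubspace.mem_mk', bary_self hK ha] at this
    simp at this
  refine (measure_eq_zero_iff_ae_notMem.1 h).mono fun x hx h0 => hx ?_
  rw [SetLike.mem_coe, AffineSubspace.mem_comap, AffineSubspace.mem_mk', h0]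
  simp

/-- Integration of the derivative along an edge of a product of the two barycentric coordinates of
the edge. -/
theorem integral_fderiv_edge {K : Finset (Pt n)} (hK : IsCell K) {a b : Pt n} (ha : a ∈ K)
    (hb : b ∈ K) {ρ : Pt n → ℝ} (hρ : ContDiff ℝ ∞ ρ) (hρc : HasCompactSupport ρ) :
    ∫ x in hull K, fderiv ℝ (fun x => bary K a x * bary K b x * ρ x) x (b - a) = 0 := by
  set F : Pt n → ℝ := fun x => bary K a x * bary K b x * ρ x with hF
  have hba : ∀ v, ContDiff ℝ ∞ (fun x => bary K v x) := fun v => (bary_isPoly K v).contDiff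
  have hFs : ContDiff ℝ ∞ F := ((hba a).mul (hba b)).mul hρ
  have hFc : HasCompactSupport F := hρc.mul_left
  -- Positive parts make the product vanish beyond the two facets that the direction b − a crosses,
  -- and f stays Lipschitz because λ_aλ_bρ vanishes on those facets.
  set f : Pt n → ℝ := fun x => max (bary K a x) 0 * max (bary K b x) 0 * ρ x with hfdef
  have hfc : HasCompactSupport f := hρc.mul_left
  obtain ⟨L, hL⟩ := ContDiff.lipschitzWith_of_hasCompactSupport hFc hFs (by simp)
  have cont := bary_continuous K
  have hf : LipschitzWith L f := by
    refine lipschitzWith_of_closed_cover (ι := Fin 3)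
      (A := ![{x | 0 ≤ bary K a x} ∩ {x | 0 ≤ bary K b x}, {x | bary K a x ≤ 0}, {x | bary K b x ≤ 0}])
      (g := ![F, fun _ => 0, fun _ => 0]) ?_ ?_ ?_ ?_
    · intro i
      fin_cases i
      · exact (isClosed_le continuous_const (cont a)).inter (isClosed_le continuous_const (cont b))
      · exact isClosed_le (cont a) continuous_const
      · exact isClosed_le (cont b) continuous_const
    · intro x
      rcases le_total 0 (bary K a x) with h | h
      · rcases le_total 0 (bary K b x) with h' | h'
        · exact ⟨0, h, h'⟩
        · exact ⟨2, h'⟩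
      · exact ⟨1, h⟩
    · intro i
      fin_cases i
      · exact hL
      · exact (LipschitzWith.const 0).weaken bot_le
      · exact (LipschitzWith.const 0).weaken bot_le
    · intro i x hx
      fin_cases i
      · have hx1 : 0 ≤ bary K a x := hx.1
        have hx2 : 0 ≤ bary K b x := hx.2
        simp only [hfdef, hF, max_eq_left hx1, max_eq_left hx2]; rfl
      · have hx1 : bary K a x ≤ 0 := hx
        simp only [hfdef, max_eq_right hx1, zero_mul]; rfl
      · have hx1 : bary K b x ≤ 0 := hx
        simp only [hfdef, max_eq_right hx1, mul_zero, zero_mul]; rfl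
  -- The other coordinates are constant along b − a, so this cylinder is invariant. In it f equals F
  -- on the interior of K and, off a null set, vanishes locally elsewhere; the integral over K
  -- becomes one over the cylinder.
  set A : Set (Pt n) := ⋂ l ∈ K, ⋂ _ : l ≠ a ∧ l ≠ b, {x | 0 < bary K l x} with hAdef
  have memA : ∀ {x}, x ∈ A ↔ ∀ l ∈ K, l ≠ a ∧ l ≠ b → 0 < bary K l x := by
    intro x; simp only [hAdef, Set.mem_iInter, Set.mem_ofPred_eq]
  have hA : IsOpen A := by
    refine isOpen_biInter_finset fun l _ => isOpen_iInter_of_finite fun _ => ?_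
    exact isOpen_lt continuous_const (cont l)
  have h0 := setIntegral_lineDeriv_eq_zero hf hfc (v := b - a) hA.measurableSet (fun x s => by
    have : ∀ l ∈ K, l ≠ a ∧ l ≠ b → bary K l (x + s • (b - a)) = bary K l x := fun l hl hne => by
      rw [bary_add, inner_smul_right, inner_baryGrad_sub hK hl hb ha, if_neg hne.2, if_neg hne.1]
      simp
    rw [memA, memA]
    exact forall₃_congr fun l hl hne => by rw [this l hl hne])
  rw [← restrict_interior_hull, ← integral_indicator isOpen_interior.measurableSet, ← h0,
    ← integral_indicator hA.measurableSet]
  refine integral_congr_ae ?_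
  filter_upwards [ae_bary_ne_zero hK ha, ae_bary_ne_zero hK hb] with x hxa hxb
  by_cases hx : x ∈ interior (hull K)
  · have hpos := (mem_interior_cell hK).1 hx
    have hxA : x ∈ A := memA.2 fun l hl _ => hpos l hl
    rw [Set.indicator_of_mem hx, Set.indicator_of_mem hxA]
    have e : f =ᶠ[𝓝 x] F := by
      filter_upwards [(cont a).continuousAt.eventually_const_lt (hpos a ha),
        (cont b).continuousAt.eventually_const_lt (hpos b hb)] with y h1 h2
      simp only [hfdef, hF, max_eq_left h1.le, max_eq_left h2.le]
    rw [e.lineDeriv_eq]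
    exact ((hFs.differentiable (by simp)).differentiableAt.lineDeriv_eq_fderiv).symm
  · rw [Set.indicator_of_notMem hx]
    by_cases hxA : x ∈ A
    · rw [Set.indicator_of_mem hxA]
      have e : f =ᶠ[𝓝 x] fun _ => 0 := by
        rcases lt_or_gt_of_ne hxa with h | h
        · filter_upwards [(cont a).continuousAt.eventually_lt_const h] with y hy
          simp only [hfdef, max_eq_right hy.le, zero_mul]
        rcases lt_or_gt_of_ne hxb with h' | h'
        · filter_upwards [(cont b).continuousAt.eventually_lt_const h'] with y hy
          simp only [hfdef, max_eq_right hy.le, mul_zero, zero_mul]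
        · refine absurd ((mem_interior_cell hK).2 fun l hl => ?_) hx
          by_cases hla : l = a
          · rwa [hla]
          by_cases hlb : l = b
          · rwa [hlb]
          exact memA.1 hxA l hl ⟨hla, hlb⟩
      rw [e.lineDeriv_eq]
      simp [lineDeriv]
    · rw [Set.indicator_of_notMem hxA]

end Lipschitz

/-! ### H¹-conformity of continuous piecewise polynomials. -/

section Conformity

variable {n : ℕ} {Ω : Set (Pt n)} {T : Mesh Ω}

/-- The function given by `g K` on the interior of each element `K`. -/
def Mesh.piecewise (T : Mesh Ω) (g : Finset (Pt n) → Pt n → ℝ) (x : Pt n) : ℝ :=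
  ∑ K ∈ T.cells, (interior (hull K)).indicator (g K) x

theorem Mesh.piecewise_eq (g : Finset (Pt n) → Pt n → ℝ) {K : Finset (Pt n)} (hK : K ∈ T.cells)
    {x : Pt n} (hx : x ∈ interior (hull K)) : T.piecewise g x = g K x := by
  rw [Mesh.piecewise, Finset.sum_eq_single K, Set.indicator_of_mem hx]
  · intro L hL hne
    refine Set.indicator_of_notMem (fun h => hne ?_) _
    exact (T.eq_of_mem_interior hK hL hx (_root_.interior_subset h)).symm
  · exact fun h => absurd hK h

theorem Mesh.piecewise_ae (g : Finset (Pt n) → Pt n → ℝ) {K : Finset (Pt n)} (hK : K ∈ T.cells) :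
    T.piecewise g =ᵐ[volume.restrict (hull K)] g K := by
  rw [← restrict_interior_hull]
  exact (ae_restrict_mem isOpen_interior.measurableSet).mono fun x hx => Mesh.piecewise_eq g hK hx

theorem Mesh.memLp_of_piecewise {f : Pt n → ℝ} {g : Finset (Pt n) → Pt n → ℝ}
    (hg : ∀ K ∈ T.cells, Continuous (g K)) (hfg : ∀ K ∈ T.cells, f =ᵐ[volume.restrict (hull K)] g K) :
    MemLp f 2 (volume.restrict Ω) := by
  have h1 : MemLp (T.piecewise g) 2 volume := by
    refine memLp_finsetSum _ fun K hK => ?_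
    rw [memLp_indicator_iff_restrict isOpen_interior.measurableSet, restrict_interior_hull]
    exact memLp_hull_of_continuous K (hg K hK)
  refine (memLp_congr_ae ?_).1 (h1.restrict Ω)
  exact T.ae_iff.2 fun K hK => (Mesh.piecewise_ae g hK).trans (hfg K hK).symm

/-- Continuous piecewise polynomials lie in `H¹`. -/
theorem Mesh.memSobolev_lagrange {k : ℕ} {w : Pt n → ℝ}
    (h : ∀ K ∈ T.cells, ∃ p, IsPoly k p ∧ ∀ x ∈ hull K, w x = p x) : MemSobolev Ω 1 w := by
  choose! p hp hw using h
  have hwae : ∀ K ∈ T.cells, w =ᵐ[volume.restrict (hull K)] p K := fun K hK =>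
    (ae_restrict_mem (isCompact_hull K).isClosed.measurableSet).mono fun x hx => hw K hK x hx
  have hwm := Mesh.memLp_of_piecewise (fun K hK => (hp K hK).continuous) hwae
  refine memSobolev_one hwm fun i => ?_
  set g : Finset (Pt n) → Pt n → ℝ := fun K => partialDeriv (fun _ : Fin 1 => i) (p K) with hg
  have hgc : ∀ K ∈ T.cells, Continuous (g K) := fun K hK =>
    (contDiff_partialDeriv _ (hp K hK).contDiff).continuous
  refine ⟨T.piecewise g, Mesh.memLp_of_piecewise hgc fun K hK => Mesh.piecewise_ae g hK,
    fun φ hφ => ?_⟩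
  set f : Pt n → ℝ := fun x => φ x * w x with hf
  have hfc : HasCompactSupport f := hφ.2.1.mul_right
  have hlip : ∀ K ∈ T.cells, ∃ L, LipschitzWith L fun x => φ x * p K x := fun K hK =>
    ContDiff.lipschitzWith_of_hasCompactSupport (n := ∞) hφ.2.1.mul_right
      (hφ.1.mul (hp K hK).contDiff) (by simp)
  choose! L hL using hlip
  have hflip : LipschitzWith (∑ K ∈ T.cells, L K) f := by
    -- The elements and the complement of Ω form the cover; on the complement the product vanishes
    -- because the test function is supported in Ω. The Lipschitz function φw then has derivatives
    -- of integral zero, which is the weak differentiation formula.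
    refine lipschitzWith_of_closed_cover (ι := Option T.cells)
      (A := fun o => o.elim Ωᶜ fun K => hull K.1)
      (g := fun o => o.elim (fun _ => 0) fun K x => φ x * p K.1 x) ?_ ?_ ?_ ?_
    · rintro (_ | K)
      · exact T.isOpen.isClosed_compl
      · exact (isCompact_hull K.1).isClosed
    · intro x
      by_cases hx : x ∈ Ω
      · obtain ⟨K, hK, hxK⟩ := T.mem_space.1 (T.subset_space hx)
        exact ⟨some ⟨K, hK⟩, hxK⟩
      · exact ⟨none, hx⟩
    · rintro (_ | K)
      · exact (LipschitzWith.const 0).weaken bot_le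
      · exact (hL K.1 K.2).weaken (Finset.single_le_sum (fun _ _ => bot_le) K.2)
    · rintro (_ | K) x hx
      · have : φ x = 0 := image_eq_zero_of_notMem_tsupport fun h => hx (hφ.2.2 h)
        simp only [hf, this, zero_mul, Option.elim]
      · simp only [hf, Option.elim, hw K.1 K.2 x hx]
  have h0 := setIntegral_lineDeriv_eq_zero hflip hfc (v := EuclideanSpace.single i (1 : ℝ))
    MeasurableSet.univ (fun _ _ => by simp)
  have hzero : ∀ x ∉ Ω, lineDeriv ℝ f x (EuclideanSpace.single i (1 : ℝ)) = 0 := fun x hx => by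
    have : x ∉ tsupport f := fun h => hx (hφ.2.2 (tsupport_mul_subset_left h))
    rw [(notMem_tsupport_iff_eventuallyEq.1 this).lineDeriv_eq]
    simp [lineDeriv]
  rw [setIntegral_univ, ← setIntegral_eq_integral_of_forall_compl_eq_zero hzero] at h0
  have hae : (fun x => lineDeriv ℝ f x (EuclideanSpace.single i (1 : ℝ))) =ᵐ[volume.restrict Ω]
      fun x => w x * partialDeriv (fun _ : Fin 1 => i) φ x + T.piecewise g x * φ x := by
    rw [← Measure.restrict_congr_set T.ae_eq_biUnion]
    refine (ae_restrict_mem (T.cells.measurableSet_biUnion fun K _ =>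
      isOpen_interior.measurableSet)).mono fun x hx => ?_
    obtain ⟨K, hK, hxK⟩ := Set.mem_iUnion₂.1 hx
    have e : f =ᶠ[𝓝 x] fun x => φ x * p K x := by
      filter_upwards [isOpen_interior.mem_nhds hxK] with y hy
      simp only [hf, hw K hK y (_root_.interior_subset hy)]
    have d1 : DifferentiableAt ℝ φ x := (hφ.1.differentiable (by simp)).differentiableAt
    have d2 : DifferentiableAt ℝ (p K) x :=
      ((hp K hK).contDiff (m := 1)).differentiable one_ne_zero |>.differentiableAt
    have d12 : DifferentiableAt ℝ (fun x => φ x * p K x) x := d1.mul d2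
    beta_reduce
    rw [Mesh.piecewise_eq g hK hxK, e.lineDeriv_eq, d12.lineDeriv_eq_fderiv, fderiv_fun_mul d1 d2,
      hw K hK x (_root_.interior_subset hxK)]
    simp only [hg, partialDeriv_one, add_apply, smul_apply, smul_eq_mul]
    ring
  have i1 : Integrable (fun x => w x * partialDeriv (fun _ : Fin 1 => i) φ x) (volume.restrict Ω) :=
    hwm.integrable_mul (hφ.memLp_partialDeriv _)
  have i2 : Integrable (fun x => T.piecewise g x * φ x) (volume.restrict Ω) :=
    (Mesh.memLp_of_piecewise hgc fun K hK => Mesh.piecewise_ae g hK).integrable_mul hφ.memLp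
  rw [integral_congr_ae hae, integral_add i1 i2] at h0
  rw [pow_one, neg_one_mul]
  linarith

end Conformity

/-! ### H(div)-conformity of bubbles and well-posedness of their interpolation. -/

section BubbleConformity

variable {n : ℕ} {Ω : Set (Pt n)} {T : Mesh Ω}

theorem integrableOn_fderiv {f : Pt n → ℝ} (hf : ContDiff ℝ ∞ f) (K : Finset (Pt n)) (v : Pt n) :
    IntegrableOn (fun x => fderiv ℝ f x v) (hull K) :=
  integrableOn_hull K ((hf.continuous_fderiv (by simp)).clm_apply continuous_const)

/-- The divergence of a bubble times a smooth function has mean zero. -/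
theorem IsFaceBubble.integral_div {K : Finset (Pt n)} (hK : IsCell K) {k : ℕ} (hk : 1 ≤ k)
    {q : TensorField n} (hq : IsPolySym k q) (hb : IsFaceBubble K q) {φ : Pt n → ℝ}
    (hφ : ContDiff ℝ ∞ φ) (hφc : HasCompactSupport φ) (i : Fin n) :
    ∫ x in hull K, ∑ j, fderiv ℝ (fun x => q x i j * φ x) x (EuclideanSpace.single j 1) = 0 := by
  obtain ⟨r, hr, hrb⟩ := hb.exists_factor hK hk hq
  have heq := IsFaceBubble.eq_sum_edges hK hq hrb
  set F : Pt n × Pt n → Pt n → ℝ :=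
    fun p x => bary K p.1 x * bary K p.2 x * (r p.1 p.2 x * φ x) with hF
  have hρ : ∀ p : Pt n × Pt n, ContDiff ℝ ∞ fun x => r p.1 p.2 x * φ x := fun p =>
    (hr p.1 p.2).contDiff.mul hφ
  have hFs : ∀ p, ContDiff ℝ ∞ (F p) := fun p =>
    ((bary_isPoly K p.1).contDiff.mul (bary_isPoly K p.2).contDiff).mul (hρ p)
  have hdiff : ∀ p x, DifferentiableAt ℝ (F p) x := fun p x =>
    ((hFs p).differentiable (by simp)).differentiableAt
  have e1 : ∀ j, (fun x => q x i j * φ x) =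
      fun x => ∑ p ∈ K.offDiag, (-(1 / 2) * ((p.2 - p.1) i * (p.2 - p.1) j)) * F p x := by
    intro j
    funext x
    rw [heq x i j, Finset.mul_sum, Finset.sum_mul]
    refine Finset.sum_congr rfl fun p _ => ?_
    simp only [hF]; ring
  -- Each summand is a scalar times the constant tensor t tᵀ of an edge, so its divergence is the
  -- derivative of the scalar along t, times the component of t.
  have e2 : ∀ x, ∑ j, fderiv ℝ (fun x => q x i j * φ x) x (EuclideanSpace.single j 1) =
      ∑ p ∈ K.offDiag, (-(1 / 2) * (p.2 - p.1) i) * fderiv ℝ (F p) x (p.2 - p.1) := by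
    intro x
    have : ∀ j, fderiv ℝ (fun x => q x i j * φ x) x (EuclideanSpace.single j 1) =
        ∑ p ∈ K.offDiag, (-(1 / 2) * ((p.2 - p.1) i * (p.2 - p.1) j)) *
          fderiv ℝ (F p) x (EuclideanSpace.single j 1) := by
      intro j
      rw [e1 j, fderiv_fun_sum fun p _ => (hdiff p x).const_mul _, sum_apply]
      refine Finset.sum_congr rfl fun p _ => ?_
      rw [fderiv_const_mul (hdiff p x), smul_apply, smul_eq_mul]
    simp only [this]
    rw [Finset.sum_comm]
    refine Finset.sum_congr rfl fun p _ => ?_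
    have hv : p.2 - p.1 = ∑ j, (p.2 - p.1) j • EuclideanSpace.single j (1 : ℝ) := by
      ext l
      simp [Finset.sum_apply, Pi.single_apply]
    conv_rhs => rw [hv, map_sum]
    rw [← hv, Finset.mul_sum]
    refine Finset.sum_congr rfl fun j _ => ?_
    rw [map_smul, smul_eq_mul]; ring
  simp only [e2]
  rw [integral_finsetSum _ fun p _ => (integrableOn_fderiv (hFs p) K _).const_mul _]
  refine Finset.sum_eq_zero fun p hp => ?_
  have hp' := Finset.mem_offDiag.1 hp
  rw [integral_const_mul, integral_fderiv_edge hK hp'.1 hp'.2.1 (hρ p) hφc.mul_left, mul_zero]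

/-- The elementwise divergence is the weak one: on each element the divergence of the bubble times a
test function has integral zero, so no facet terms remain. -/
theorem Mesh.memBubble {k : ℕ} (hk : 1 ≤ k) {b : TensorField n}
    (h : ∀ K ∈ T.cells, ∃ q, IsPolySym k q ∧ IsFaceBubble K q ∧ ∀ x ∈ interior (hull K), b x = q x) :
    T.MemBubble k b := by
  choose! q hq hqb hbq using h
  have hae : ∀ K ∈ T.cells, b =ᵐ[volume.restrict (hull K)] q K := fun K hK => by
    rw [← restrict_interior_hull]
    exact (ae_restrict_mem isOpen_interior.measurableSet).mono fun x hx => hbq K hK x hx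
  have hmem : ∀ i j, MemLp (fun x => b x i j) 2 (volume.restrict Ω) := fun i j =>
    Mesh.memLp_of_piecewise (g := fun K x => q K x i j) (fun K hK => (hq K hK).continuous i j)
      fun K hK => (hae K hK).mono fun x hx => by simp only [hx]
  refine ⟨⟨⟨?_, fun i j => ⟨hmem i j, ?_⟩⟩, fun i => ?_⟩, fun K hK =>
    ⟨q K, (hqb K hK).isCellBubble (T.isCell hK) (hq K hK), hae K hK⟩⟩
  · refine T.ae_iff.2 fun K hK => (hae K hK).mono fun x hx => ?_
    rw [hx]
    exact (hq K hK).1 x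
  · intro l hl α
    obtain rfl : l = 0 := by omega
    exact ⟨_, hasWeakDeriv_zero (hmem i j)⟩
  · set g : Finset (Pt n) → Pt n → ℝ := fun K x =>
      ∑ j, partialDeriv (fun _ : Fin 1 => j) (fun y => q K y i j) x with hg
    have hqs : ∀ K ∈ T.cells, ∀ j, ContDiff ℝ ∞ fun y => q K y i j := fun K hK j =>
      ((hq K hK).2 i j).contDiff
    have hgc : ∀ K ∈ T.cells, Continuous (g K) := fun K hK =>
      continuous_finsetSum _ fun j _ => (contDiff_partialDeriv _ (hqs K hK j)).continuous
    have hgm := Mesh.memLp_of_piecewise hgc fun K hK => Mesh.piecewise_ae (T := T) g hK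
    refine ⟨T.piecewise g, hgm, fun φ hφ => ?_⟩
    have i1 : Integrable (fun x => ∑ j, b x i j * partialDeriv (fun _ : Fin 1 => j) φ x)
        (volume.restrict Ω) :=
      integrable_finsetSum _ fun j _ => (hmem i j).integrable_mul (hφ.memLp_partialDeriv _)
    have i2 : Integrable (fun x => T.piecewise g x * φ x) (volume.restrict Ω) :=
      hgm.integrable_mul hφ.memLp
    have hKae : ∀ K ∈ T.cells, (fun x => ∑ j, b x i j * partialDeriv (fun _ : Fin 1 => j) φ x +
        T.piecewise g x * φ x) =ᵐ[volume.restrict (hull K)] fun x =>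
        ∑ j, fderiv ℝ (fun x => q K x i j * φ x) x (EuclideanSpace.single j 1) := by
      intro K hK
      filter_upwards [hae K hK, Mesh.piecewise_ae (T := T) g hK] with x h1 h2
      have d1 : DifferentiableAt ℝ φ x := (hφ.1.differentiable (by simp)).differentiableAt
      have d2 : ∀ j, DifferentiableAt ℝ (fun y => q K y i j) x := fun j =>
        ((hqs K hK j).differentiable (by simp)).differentiableAt
      rw [h1, h2]
      simp only [hg, Finset.sum_mul, ← Finset.sum_add_distrib]
      refine Finset.sum_congr rfl fun j _ => ?_
      rw [fderiv_fun_mul (d2 j) d1, partialDeriv_one, partialDeriv_one]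
      simp only [add_apply, smul_apply, smul_eq_mul]
      ring
    have hsm : ∀ K ∈ T.cells, ∀ j, ContDiff ℝ ∞ fun x => q K x i j * φ x := fun K hK j =>
      (hqs K hK j).mul hφ.1
    have hint : ∀ K ∈ T.cells, IntegrableOn (fun x =>
        ∑ j, fderiv ℝ (fun x => q K x i j * φ x) x (EuclideanSpace.single j 1)) (hull K) :=
      fun K hK => integrable_finsetSum _ fun j _ => integrableOn_fderiv (hsm K hK j) K _
    have h0 : ∫ x in Ω, (∑ j, b x i j * partialDeriv (fun _ : Fin 1 => j) φ x +
        T.piecewise g x * φ x) = 0 := by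
      rw [T.integral_eq_sum fun K hK => (hint K hK).congr (hKae K hK).symm]
      refine Finset.sum_eq_zero fun K hK => ?_
      rw [integral_congr_ae (hKae K hK)]
      exact (hqb K hK).integral_div (T.isCell hK) hk (hq K hK) hφ.1 hφ.2.1 i
    rw [integral_add i1 i2] at h0
    linarith

/-! #### The bubble interpolation -/

theorem Mesh.existsUnique_bubbleInterp (hn : 1 ≤ n) {k : ℕ} (hk : 1 ≤ k) {τ : TensorField n}
    (hτ : ∀ K ∈ T.cells, ∀ i j, MemLp (fun x => τ x i j) 2 (volume.restrict (hull K))) :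
    ∃! b, T.IsBubbleInterp k τ b := by
  classical
  have hex : ∀ K ∈ T.cells, ∃ q, IsPolySym k q ∧ VanishingBoundaryDofs K k q ∧ IsFaceBubble K q ∧
      ∀ ς, IsPolySym ((k : ℤ) - 2) ς →
        ∫ x in hull K, frob (q x) (ς x) = ∫ x in hull K, frob (τ x) (ς x) := fun K hK =>
    exists_bubble (T.isCell hK) k τ (hτ K hK)
  choose! q hq hqv hqb hqm using hex
  have huniq : ∀ b b', T.IsBubbleInterp k τ b → T.IsBubbleInterp k τ b' → b = b' := by
    rintro b b' ⟨h1, h2⟩ ⟨h1', h2'⟩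
    funext x
    by_cases hx : ∃ K ∈ T.cells, x ∈ interior (hull K)
    · obtain ⟨K, hK, hxK⟩ := hx
      obtain ⟨p, hp, hpv, hpm, hpx⟩ := h1 K hK
      obtain ⟨p', hp', hpv', hpm', hpx'⟩ := h1' K hK
      rw [hpx x hxK, hpx' x hxK, bubble_unique hn (T.isCell hK) hk hp hp' hpv hpv' fun ς hς => by
        rw [hpm ς hς, hpm' ς hς]]
    · push Not at hx
      rw [h2 x hx, h2' x hx]
  have hint : T.IsBubbleInterp k τ
      fun x => if h : ∃ K ∈ T.cells, x ∈ interior (hull K) then q h.choose x else 0 := by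
    refine ⟨fun K hK => ⟨q K, hq K hK, hqv K hK, hqm K hK, fun x hx => ?_⟩, fun x hx => ?_⟩
    · have h : ∃ K ∈ T.cells, x ∈ interior (hull K) := ⟨K, hK, hx⟩
      simp only [dif_pos h]
      rw [T.eq_of_mem_interior h.choose_spec.1 hK h.choose_spec.2 (_root_.interior_subset hx)]
    · have h : ¬ ∃ K ∈ T.cells, x ∈ interior (hull K) := by push Not; exact hx
      simp only [dif_neg h]
  exact ⟨_, hint, fun b hb => huniq _ _ hb hint⟩

end BubbleConformity

/-! ### The combined interpolation: conformity and moments. -/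

section StressInterpolation

variable {n : ℕ} {Ω : Set (Pt n)} {T : Mesh Ω} {k : ℕ} {σ : Pt n → Finset (Pt n)} {τ : TensorField n}

theorem frob_sub_left (A B C : Matrix (Fin n) (Fin n) ℝ) : frob (A - B) C = frob A C - frob B C := by
  simp only [frob, Matrix.sub_apply, sub_mul, Finset.sum_sub_distrib]

theorem Mesh.scottZhang_symm (hσ : T.IsNodeChoice k σ) (hτ : ∀ᵐ x ∂(volume.restrict Ω), (τ x).IsSymm)
    (i j : Fin n) : T.scottZhang k σ (fun y => τ y i j) = T.scottZhang k σ (fun y => τ y j i) :=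
  Mesh.scottZhang_congr hσ (hτ.mono fun x hx => by simpa using hx.apply j i)

theorem Mesh.scottZhangTensor_poly (hn : 1 ≤ n) (hk : 1 ≤ k) (hσ : T.IsNodeChoice k σ)
    (hτ : MemSobolevSym Ω 1 τ) {K : Finset (Pt n)} (hK : K ∈ T.cells) :
    ∃ P, IsPolySym k P ∧ ∀ x ∈ hull K, T.scottZhangTensor k σ τ x = P x := by
  have h : ∀ i j, ∃ p, IsPoly k p ∧ ∀ x ∈ hull K, T.scottZhang k σ (fun y => τ y i j) x = p x :=
    fun i j => (Mesh.isScottZhang_scottZhang hn hk hσ (hτ.2 i j)).1 K hK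
  choose p hp hpw using h
  refine ⟨fun x => Matrix.of fun i j => p i j x, ⟨fun x => ?_, fun i j => hp i j⟩, fun x hx => ?_⟩
  · refine Matrix.IsSymm.ext fun i j => ?_
    -- Symmetry is known on K only; as an identity between polynomials it extends to ℝⁿ.
    have := poly_eq_zero_of_hull (T.isCell hK) ((hp j i).sub (hp i j)) fun y hy => by
      rw [← hpw j i y hy, ← hpw i j y hy, Mesh.scottZhang_symm hσ hτ.1 j i, sub_self]
    exact sub_eq_zero.1 (congrFun this x)
  · ext i j
    exact hpw i j x hx

theorem Mesh.memLagrange_scottZhangTensor (hn : 1 ≤ n) (hk : 1 ≤ k) (hσ : T.IsNodeChoice k σ)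
    (hτ : MemSobolevSym Ω 1 τ) : T.MemLagrange k (T.scottZhangTensor k σ τ) := by
  refine ⟨⟨ae_of_all _ fun x => ?_, fun i j => ?_⟩, fun K hK => ?_⟩
  · ext i j
    exact congrFun (Mesh.scottZhang_symm hσ hτ.1 j i) x
  · exact Mesh.memSobolev_lagrange (Mesh.isScottZhang_scottZhang hn hk hσ (hτ.2 i j)).1
  · obtain ⟨P, hP, h⟩ := Mesh.scottZhangTensor_poly hn hk hσ hτ hK
    exact ⟨P, hP, (ae_restrict_mem (isCompact_hull K).isClosed.measurableSet).mono h⟩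

theorem Mesh.memLp_sub_scottZhangTensor (hn : 1 ≤ n) (hk : 1 ≤ k) (hσ : T.IsNodeChoice k σ)
    (hτ : MemSobolevSym Ω 1 τ) {K : Finset (Pt n)} (hK : K ∈ T.cells) (i j : Fin n) :
    MemLp (fun x => (τ - T.scottZhangTensor k σ τ) x i j) 2 (volume.restrict (hull K)) := by
  have h1 := ((hτ.2 i j).mono (T.interior_subset hK)).memLp_hull
  have h2 := (((Mesh.memLagrange_scottZhangTensor hn hk hσ hτ).1.2 i j).mono
    (T.interior_subset hK)).memLp_hull
  exact h1.sub h2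

theorem Mesh.isBubbleInterp_bubbleInterp (hn : 1 ≤ n) (hk : 1 ≤ k) (hσ : T.IsNodeChoice k σ)
    (hτ : MemSobolevSym Ω 1 τ) : T.IsBubbleInterp k (τ - T.scottZhangTensor k σ τ)
      (T.bubbleInterp k (τ - T.scottZhangTensor k σ τ)) :=
  Classical.epsilon_spec (Mesh.existsUnique_bubbleInterp hn hk fun _ hK i j =>
    Mesh.memLp_sub_scottZhangTensor hn hk hσ hτ hK i j).exists

theorem Mesh.memStress_stressInterp (hn : 1 ≤ n) (hk : 1 ≤ k) (hσ : T.IsNodeChoice k σ)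
    (hτ : MemSobolevSym Ω 1 τ) : T.MemStress k (T.stressInterp k σ τ) := by
  refine ⟨_, _, Mesh.memLagrange_scottZhangTensor hn hk hσ hτ, Mesh.memBubble hk fun K hK => ?_,
    ae_eq_refl _⟩
  obtain ⟨q, hq, hv, -, hx⟩ := (Mesh.isBubbleInterp_bubbleInterp hn hk hσ hτ).1 K hK
  exact ⟨q, hq, hv.isFaceBubble (T.isCell hK) hk hq, hx⟩

theorem Mesh.stressInterp_moments (hn : 1 ≤ n) (hk : 1 ≤ k) (hσ : T.IsNodeChoice k σ)
    (hτ : MemSobolevSym Ω 1 τ) {K : Finset (Pt n)} (hK : K ∈ T.cells) {ς : TensorField n}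
    (hς : IsPolySym ((k : ℤ) - 2) ς) :
    ∫ x in hull K, frob (T.stressInterp k σ τ x - τ x) (ς x) = 0 := by
  obtain ⟨q, hq, -, hm, hx⟩ := (Mesh.isBubbleInterp_bubbleInterp hn hk hσ hτ).1 K hK
  have i1 : IntegrableOn (fun x => frob (q x) (ς x)) (hull K) :=
    integrable_frob (fun a b => memLp_hull_of_continuous K (hq.continuous a b)) hς.continuous
  have i2 : IntegrableOn (fun x => frob ((τ - T.scottZhangTensor k σ τ) x) (ς x)) (hull K) :=
    integrable_frob (Mesh.memLp_sub_scottZhangTensor hn hk hσ hτ hK) hς.continuous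
  have e : (fun x => frob (T.stressInterp k σ τ x - τ x) (ς x)) =ᵐ[volume.restrict (hull K)]
      fun x => frob (q x) (ς x) - frob ((τ - T.scottZhangTensor k σ τ) x) (ς x) := by
    rw [← restrict_interior_hull]
    refine (ae_restrict_mem isOpen_interior.measurableSet).mono fun x hxK => ?_
    beta_reduce
    rw [← frob_sub_left, ← hx x hxK, Mesh.stressInterp]
    congr 1
    simp only [Pi.add_apply, Pi.sub_apply]
    abel
  rw [integral_congr_ae e, integral_sub i1 i2, hm ς hς, sub_self]

end StressInterpolation

/-! ### Scott-Zhang nodal values against local polynomial approximations. -/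

section NodalEstimate

variable {n : ℕ} {Ω : Set (Pt n)} {T : Mesh Ω} {k : ℕ} {γ : ℝ}

/-- `p` is a polynomial of degree at most `k` with scaled `H¹(K)`-distance from `u` at most `√E`. -/
def CellApprox (K : Finset (Pt n)) (k : ℕ) (u p : Pt n → ℝ) (E : ℝ) : Prop :=
  IsPoly k p ∧ ∫ x in hull K, (u x - p x) ^ 2 ≤ E ∧ cellDiam K ^ 2 * gradSq K (fun x => u x - p x) ≤ E

theorem CellApprox.nonneg {K : Finset (Pt n)} {u p : Pt n → ℝ} {E : ℝ} (h : CellApprox K k u p E) :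
    0 ≤ E := (integral_nonneg fun _ => sq_nonneg _).trans h.2.1

theorem CellApprox.traceBound_le (hn : 1 ≤ n) {K : Finset (Pt n)} (hK : IsCell K)
    (hγ : RegularCell γ K) {u p : Pt n → ℝ} {E : ℝ} (h : CellApprox K k u p E) :
    cellDiam K * traceBound K (fun x => u x - p x) ≤ (n + 1) * (n + 2) * γ * E := by
  have h1 := hγ.gradSum_mul_le hn hK
  have hE := h.nonneg
  have h2 : ((n : ℝ) + 1) * (∫ x in hull K, (u x - p x) ^ 2) +
      cellDiam K ^ 2 * gradSq K (fun x => u x - p x) ≤ (n + 2) * E := by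
    have := mul_le_mul_of_nonneg_left h.2.1 (by positivity : (0 : ℝ) ≤ n + 1)
    linarith [h.2.2]
  have h3 : 0 ≤ ((n : ℝ) + 2) * E := by positivity
  have h4 : 0 ≤ gradSum K * cellDiam K := mul_nonneg (gradSum_nonneg K) (cellDiam_pos hn hK).le
  calc cellDiam K * traceBound K (fun x => u x - p x)
      = (gradSum K * cellDiam K) * (((n : ℝ) + 1) * (∫ x in hull K, (u x - p x) ^ 2) +
        cellDiam K ^ 2 * gradSq K (fun x => u x - p x)) := by rw [traceBound]; ring
    _ ≤ (gradSum K * cellDiam K) * ((n + 2) * E) := mul_le_mul_of_nonneg_left h2 h4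
    _ ≤ ((n + 1) * γ) * ((n + 2) * E) := mul_le_mul_of_nonneg_right h1 h3
    _ = (n + 1) * (n + 2) * γ * E := by ring

theorem isTrace_trace_sub (hn : 1 ≤ n) {K : Finset (Pt n)} (hK : IsCell K) {u p : Pt n → ℝ}
    (hu : MemSobolev (interior (hull K)) 1 u) (hp : ContDiff ℝ ∞ p) :
    IsTrace K (fun x => u x - p x) (fun x => trace K u x - p x) :=
  (isTrace_trace hn hK hu).sub hn hK (isTrace_of_contDiff hn hK hp)

theorem facet_real_pos (hn : 1 ≤ n) {K F : Finset (Pt n)} (hK : IsCell K) (hF : F ⊆ K)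
    (hc : F.card = n) : 0 < (simplexMeasure F).real Set.univ ∧
      volume.real (hull K) ≤ cellDiam K * (simplexMeasure F).real Set.univ := by
  obtain ⟨v, hv, rfl⟩ := eq_erase_of_card hK hF hc
  rw [simplexMeasure, measureReal_restrict_apply_univ, hc, facet_measure_eq hn hK hv]
  have h1 := one_le_norm_baryGrad_mul hn hK hv
  have h2 := volume_hull_pos hK
  have h3 := norm_baryGrad_pos hn hK hv
  have h4 : (1 : ℝ) ≤ n := by exact_mod_cast hn
  refine ⟨by positivity, ?_⟩
  calc volume.real (hull K) = 1 * 1 * volume.real (hull K) := by ring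
    _ ≤ n * (‖baryGrad K v‖ * cellDiam K) * volume.real (hull K) := by gcongr
    _ = cellDiam K * (n * ‖baryGrad K v‖ * volume.real (hull K)) := by ring

/-- The volume is at most the diameter times the facet area, and diameter times trace bound is of
order γE. -/
theorem CellApprox.integral_facet_le (hn : 1 ≤ n) {K F : Finset (Pt n)} (hK : IsCell K)
    (hF : F ⊆ K) (hc : F.card = n) (hγ : RegularCell γ K) {u p : Pt n → ℝ} {E : ℝ}
    (hu : MemSobolev (interior (hull K)) 1 u) (h : CellApprox K k u p E) :
    volume.real (hull K) * ∫ x, (trace K u x - p x) ^ 2 ∂(simplexMeasure F) ≤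
      4 * ((n + 1) * (n + 2) * γ) * E * (simplexMeasure F).real Set.univ := by
  have h1 := (isTrace_trace_sub hn hK hu h.1.contDiff).integral_facet_sq_le hn hK hF hc
  have h2 := h.traceBound_le hn hK hγ
  obtain ⟨h3, h4⟩ := facet_real_pos hn hK hF hc
  have h5 : 0 ≤ ∫ x, (trace K u x - p x) ^ 2 ∂(simplexMeasure F) := integral_nonneg fun _ => sq_nonneg _
  have h6 := cellDiam_pos hn hK
  set m := (simplexMeasure F).real Set.univ
  calc _ ≤ (cellDiam K * m) * ∫ x, (trace K u x - p x) ^ 2 ∂(simplexMeasure F) :=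
        mul_le_mul_of_nonneg_right h4 h5
    _ ≤ (cellDiam K * m) * (4 * traceBound K (fun x => u x - p x)) :=
        mul_le_mul_of_nonneg_left h1 (by positivity)
    _ = 4 * m * (cellDiam K * traceBound K (fun x => u x - p x)) := by ring
    _ ≤ 4 * m * ((n + 1) * (n + 2) * γ * E) := mul_le_mul_of_nonneg_left h2 (by positivity)
    _ = _ := by ring

/-- The nodal functional reproduces p, so only u − p is seen; on a facet its trace is controlled by
the scaled H¹-error. The facet trace may be taken from K although the nodal value was defined with
another element. -/
theorem exists_nodal_bound (n k : ℕ) (hn : 1 ≤ n) : ∃ C : ℝ, 0 < C ∧ ∀ (γ : ℝ), 1 ≤ γ →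
    ∀ (Ω : Set (Pt n)) (T : Mesh Ω), T.ShapeRegular γ → ∀ u, MemSobolev Ω 1 u → ∀ K ∈ T.cells,
    ∀ s ⊆ K, ∀ a ∈ hull s, ∀ c, T.IsNodalValue k s a u c → ∀ p E, CellApprox K k u p E →
    (c - p a) ^ 2 * volume.real (hull K) ≤ C * γ * E := by
  obtain ⟨C₁, hC₁, h₁⟩ := exists_dual_bound n k
  obtain ⟨C₂, hC₂, h₂⟩ := exists_dual_bound (n - 1) k
  refine ⟨C₁ + C₂ * (4 * ((n + 1) * (n + 2))), by positivity,
    fun γ hγ Ω T hT u hu K hK s hs a ha c hc p E hp => ?_⟩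
  have cK := T.isCell hK
  have huK := hu.mono (T.interior_subset hK)
  have hE := hp.nonneg
  have hV := volume_hull_pos cK
  have hp2 : 0 ≤ C₂ * (4 * ((n + 1) * (n + 2))) * γ * E := by positivity
  have hp1 : C₁ * E ≤ C₁ * γ * E := by nlinarith [mul_nonneg hC₁.le hE]
  obtain ⟨ψ, hψ, ⟨hcard, rfl⟩ | ⟨hcard, K', hK', hsK', rfl⟩⟩ := hc
  · obtain rfl : s = K := Finset.eq_of_subset_of_card_le hs (by rw [hcard, cK.2])
    have hm : simplexMeasure s = volume.restrict (hull s) := by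
      rw [simplexMeasure, hcard, Nat.add_sub_cancel, euclideanHausdorffMeasure_eq_volume]
    have h := h₁ n s hcard (by
      rw [hcard, Nat.add_sub_cancel, euclideanHausdorffMeasure_eq_volume]
      exact (isCompact_hull s).measure_lt_top.ne) a ha ψ hψ p hp.1 u (by rw [hm]; exact huK.memLp_hull)
    rw [hm, measureReal_restrict_apply_univ] at h
    rw [hm]
    have := mul_le_mul_of_nonneg_left hp.2.1 hC₁.le
    linarith
  · have hfin := (facet_real_pos hn cK hs hcard)
    have hne : (μHE[s.card - 1] : Measure (Pt n)) (hull s) ≠ ⊤ := by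
      obtain ⟨v, hv, rfl⟩ := eq_erase_of_card cK hs hcard
      rw [hcard]
      exact (facet_measure hn cK hv).1
    have e : ∫ x, ψ x * trace K' u x ∂(simplexMeasure s) = ∫ x, ψ x * trace K u x ∂(simplexMeasure s) :=
      integral_congr_ae ((Mesh.trace_ae_eq hn hu hK' hK hsK' hs hcard).mono fun x hx => by
        simp only [hx])
    rw [e]
    have h := h₂ n s (by omega) hne a ha ψ hψ p hp.1 (trace K u)
      ((isTrace_trace hn cK huK).memLp_facet cK hs hcard)
    have h' := hp.integral_facet_le hn cK hs hcard (hT K hK) huK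
    set m := (simplexMeasure s).real Set.univ
    set x := (∫ x, ψ x * trace K u x ∂(simplexMeasure s)) - p a
    refine le_of_mul_le_mul_right ?_ hfin.1
    calc x ^ 2 * volume.real (hull K) * m = (x ^ 2 * m) * volume.real (hull K) := by ring
      _ ≤ (C₂ * ∫ x, (trace K u x - p x) ^ 2 ∂(simplexMeasure s)) * volume.real (hull K) :=
          mul_le_mul_of_nonneg_right h hV.le
      _ = C₂ * (volume.real (hull K) * ∫ x, (trace K u x - p x) ^ 2 ∂(simplexMeasure s)) := by ring
      _ ≤ C₂ * (4 * ((n + 1) * (n + 2) * γ) * E * m) := mul_le_mul_of_nonneg_left h' hC₂.le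
      _ = (C₂ * (4 * ((n + 1) * (n + 2))) * γ * E) * m := by ring
      _ ≤ _ := by
        refine mul_le_mul_of_nonneg_right ?_ hfin.1.le
        have : 0 ≤ C₁ * γ * E := by positivity
        linarith

/-- On the common facet the jump is the difference of the errors of the two approximations with
respect to the same trace of u; the inverse inequality passes from the mean square to the value at
a. -/
theorem exists_jump_bound (n k : ℕ) (hn : 1 ≤ n) : ∃ C : ℝ, 0 < C ∧ ∀ (γ : ℝ), 1 ≤ γ →
    ∀ (Ω : Set (Pt n)) (T : Mesh Ω), T.ShapeRegular γ → ∀ u, MemSobolev Ω 1 u →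
    ∀ (p : Finset (Pt n) → Pt n → ℝ) (E : Finset (Pt n) → ℝ),
    (∀ K ∈ T.cells, CellApprox K k u (p K) (E K)) → ∀ a K K', T.Adjacent a K K' →
    (p K a - p K' a) ^ 2 ≤ C * γ * (E K / volume.real (hull K)) + C * γ * (E K' / volume.real (hull K')) := by
  obtain ⟨C, hC, h⟩ := exists_sq_le_integral_simplex (n - 1) k
  refine ⟨2 * C * (4 * ((n + 1) * (n + 2))), by positivity,
    fun γ hγ Ω T hT u hu p E hp a K K' ⟨hK, hK', hcard, ha⟩ => ?_⟩
  set F := K ∩ K' with hF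
  have cK := T.isCell hK
  have cK' := T.isCell hK'
  have hFK : F ⊆ K := Finset.inter_subset_left
  have hFK' : F ⊆ K' := Finset.inter_subset_right
  have huK := hu.mono (T.interior_subset hK)
  have huK' := hu.mono (T.interior_subset hK')
  obtain ⟨hm, -⟩ := facet_real_pos hn cK hFK hcard
  have hne : (μHE[F.card - 1] : Measure (Pt n)) (hull F) ≠ ⊤ := by
    obtain ⟨v, hv, hFv⟩ := eq_erase_of_card cK hFK hcard
    rw [hcard, hFv]
    exact (facet_measure hn cK hv).1
  have h1 := h n F (by omega) hne _ ((hp K hK).1.sub (hp K' hK').1) a ha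
  have t := (isTrace_trace_sub hn cK huK (hp K hK).1.contDiff).memLp_facet cK hFK hcard
  have t' := (isTrace_trace_sub hn cK' huK' (hp K' hK').1.contDiff).memLp_facet cK' hFK' hcard
  have h2 : ∫ x, (p K x - p K' x) ^ 2 ∂(simplexMeasure F) ≤
      2 * (∫ x, (trace K' u x - p K' x) ^ 2 ∂(simplexMeasure F)) +
        2 * ∫ x, (trace K u x - p K x) ^ 2 ∂(simplexMeasure F) := by
    refine le_trans (le_of_eq (integral_congr_ae ?_)) (integral_sq_sub_le t' t)
    refine (Mesh.trace_ae_eq hn hu hK hK' hFK hFK' hcard).mono fun x hx => ?_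
    simp only [hx, sub_sub_sub_cancel_left]
  have V := volume_hull_pos cK
  have V' := volume_hull_pos cK'
  have i := (hp K hK).integral_facet_le hn cK hFK hcard (hT K hK) huK
  have i' := (hp K' hK').integral_facet_le hn cK' hFK' hcard (hT K' hK') huK'
  set m := (simplexMeasure F).real Set.univ
  set D : ℝ := 4 * ((n + 1) * (n + 2) * γ) with hD
  rw [mul_comm, ← le_div_iff₀ V] at i
  rw [mul_comm, ← le_div_iff₀ V'] at i'
  refine le_of_mul_le_mul_right ?_ hm
  calc (p K a - p K' a) ^ 2 * m ≤ C * ∫ x, (p K x - p K' x) ^ 2 ∂(simplexMeasure F) := h1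
    _ ≤ C * (2 * (D * E K' * m / volume.real (hull K')) + 2 * (D * E K * m / volume.real (hull K))) :=
        mul_le_mul_of_nonneg_left (by linarith) hC.le
    _ = _ := by rw [hD]; ring

theorem abs_le_sqrt_add_sqrt {x A B : ℝ} (hA : 0 ≤ A) (hB : 0 ≤ B) (h : x ^ 2 ≤ A + B) :
    |x| ≤ √A + √B := by
  refine abs_le_of_sq_le_sq (h.trans ?_) (by positivity)
  rw [add_sq, Real.sq_sqrt hA, Real.sq_sqrt hB]
  have : 0 ≤ 2 * √A * √B := by positivity
  linarith

/-- The scaled distance of a Scott-Zhang nodal value from the local approximation. -/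
theorem exists_nodal_estimate (n k : ℕ) (hn : 1 ≤ n) (γ : ℝ) (hγ : 1 ≤ γ) : ∃ C : ℝ, 0 < C ∧
    ∀ (Ω : Set (Pt n)), LocallyConnectedAtBoundary Ω → ∀ (T : Mesh Ω), T.ShapeRegular γ →
    ∀ σ, T.IsNodeChoice k σ → ∀ u, MemSobolev Ω 1 u →
    ∀ (p : Finset (Pt n) → Pt n → ℝ) (E : Finset (Pt n) → ℝ),
    (∀ K ∈ T.cells, CellApprox K k u (p K) (E K)) → ∀ a ∈ T.nodes k, ∀ K ∈ T.star a,
    ∀ c, T.IsNodalValue k (σ a) a u c →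
    (c - p K a) ^ 2 * volume.real (hull K) * (cellDiam K ^ 2)⁻¹ ≤
      C * ∑ L ∈ T.star a, (cellDiam L ^ 2)⁻¹ * E L := by
  obtain ⟨C₁, hC₁, h₁⟩ := exists_nodal_bound n k hn
  obtain ⟨C₂, hC₂, h₂⟩ := exists_jump_bound n k hn
  set N : ℕ := ⌈(2 * γ) ^ n⌉₊ with hN
  -- N bounds the number of elements at a node. Across a facet volumes change by at most γ² and
  -- diameters by at most γ, so Q bounds the change of |K| h_K⁻² between any two of them.
  set Q : ℝ := (γ ^ 2) ^ N * (γ ^ N) ^ 2 with hQ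
  have hγ0 : 0 < γ := by linarith
  have hQ1 : 1 ≤ Q := by
    rw [hQ]
    exact one_le_mul_of_one_le_of_one_le (one_le_pow₀ (one_le_pow₀ hγ)) (one_le_pow₀ (one_le_pow₀ hγ))
  refine ⟨(2 * (C₁ * γ) + 8 * N * (C₂ * γ)) * Q, by positivity,
    fun Ω hΩ T hT σ hσ u hu p E hp a ha K hKa c hc => ?_⟩
  obtain ⟨hK, haK⟩ := Mesh.mem_star.1 hKa
  obtain ⟨hσf, haσ, -, -⟩ := hσ a ha
  have cK := T.isCell hK
  have hcell : ∀ L ∈ T.star a, IsCell L := fun L hL => T.isCell (Mesh.mem_star.1 hL).1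
  have hh : ∀ L ∈ T.star a, 0 < cellDiam L := fun L hL => cellDiam_pos hn (hcell L hL)
  have hV : ∀ L ∈ T.star a, 0 < volume.real (hull L) := fun L hL => volume_hull_pos (hcell L hL)
  have hE : ∀ L ∈ T.star a, 0 ≤ E L := fun L hL => (hp L (Mesh.mem_star.1 hL).1).nonneg
  have hG : ∀ L ∈ T.star a, 0 ≤ (cellDiam L ^ 2)⁻¹ * E L := fun L hL =>
    mul_nonneg (by positivity) (hE L hL)
  have hsum : ∀ L ∈ T.star a, (cellDiam L ^ 2)⁻¹ * E L ≤ ∑ L ∈ T.star a, (cellDiam L ^ 2)⁻¹ * E L :=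
    fun L hL => Finset.single_le_sum hG hL
  set S := ∑ L ∈ T.star a, (cellDiam L ^ 2)⁻¹ * E L with hS
  have hS0 : 0 ≤ S := Finset.sum_nonneg hG
  -- For n = 1 facets are points and neighbouring elements need not be comparable in size. But σ a
  -- is then K itself or the point a, contained in K in either case, and the direct estimate
  -- suffices.
  rcases hn.eq_or_lt with h1 | h2
  · have hsK : σ a ⊆ K := by
      have hint := T.mem_hull_inter hσf (T.mem_cells.1 hK).1 haσ haK
      have hne : 0 < (σ a ∩ K).card := by
        rw [Finset.card_pos, Finset.nonempty_iff_ne_empty]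
        intro h0
        rw [h0, hull_eq_empty_iff.2 rfl] at hint
        exact hint
      rcases hσ.card ha with hcard | hcard
      · by_cases hi : a ∈ interior (hull K)
        · have := T.subset_of_mem_interior hK hσf hi haσ
          exact (Finset.eq_of_subset_of_card_le this (by rw [hcard, cK.2])).symm ▸ subset_rfl
        · exfalso
          have hni : ¬ ∃ L ∈ T.cells, a ∈ interior (hull L) := by
            rintro ⟨L, hL, haL⟩
            exact hi (T.eq_of_mem_interior hL hK haL haK ▸ haL)
          have := (hσ a ha).2.2.2 hni
          omega
      · exact Finset.inter_eq_left.1 (Finset.eq_of_subset_of_card_le Finset.inter_subset_left (by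
          rw [hcard]; omega))
    have h := h₁ γ hγ Ω T hT u hu K hK (σ a) hsK a haσ c hc (p K) (E K) (hp K hK)
    have hd : 0 < (cellDiam K ^ 2)⁻¹ := by have := hh K hKa; positivity
    calc _ ≤ C₁ * γ * E K * (cellDiam K ^ 2)⁻¹ := mul_le_mul_of_nonneg_right h hd.le
      _ = C₁ * γ * ((cellDiam K ^ 2)⁻¹ * E K) := by ring
      _ ≤ C₁ * γ * S := mul_le_mul_of_nonneg_left (hsum K hKa) (by positivity)
      _ ≤ (2 * (C₁ * γ) + 8 * N * (C₂ * γ)) * Q * S := by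
        refine mul_le_mul_of_nonneg_right ?_ hS0
        have p1 : 0 ≤ C₁ * γ := by positivity
        have p2 : 0 ≤ 8 * N * (C₂ * γ) := by positivity
        nlinarith
  -- The nodal value is compared with the approximation on an element K₀ containing σ a, and this
  -- one with that on K along a chain of facets through a.
  · obtain ⟨K₀, hK₀f, hsK₀, hK₀c⟩ := T.pure (σ a) hσf
    have hK₀ : K₀ ∈ T.cells := T.mem_cells.2 ⟨hK₀f, hK₀c⟩
    have hK₀a : K₀ ∈ T.star a := Mesh.mem_star.2 ⟨hK₀, hull_mono hsK₀ haσ⟩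
    have hcardN : (T.star a).card ≤ N := by
      have := Mesh.card_star_le hn hγ0.le hT a
      exact_mod_cast this.trans (Nat.le_ceil _)
    set x : Finset (Pt n) → ℝ := fun L => E L / volume.real (hull L) with hx
    have hx0 : ∀ L ∈ T.star a, 0 ≤ x L := fun L hL => div_nonneg (hE L hL) (hV L hL).le
    have hcmp : ∀ L ∈ T.star a, volume.real (hull K) * (cellDiam K ^ 2)⁻¹ * x L ≤
        Q * ((cellDiam L ^ 2)⁻¹ * E L) := by
      intro L hL
      obtain ⟨hLT, haL⟩ := Mesh.mem_star.1 hL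
      have v := le_pow_mul_of_chain (R := T.Adjacent a) (S := T.star a) (c := γ ^ 2)
        (f := fun L => volume.real (hull L)) (one_le_pow₀ hγ) hV (fun A B hAB =>
          ⟨hAB.mem_star.1, hAB.mem_star.2, hAB.volume_le h2 hT, hAB.symm.volume_le h2 hT⟩)
        hKa hL (Mesh.chain hΩ hK hLT haK haL)
      have d := le_pow_mul_of_chain (R := T.Adjacent a) (S := T.star a) (c := γ)
        (f := fun L => cellDiam L) hγ hh (fun A B hAB =>
          ⟨hAB.mem_star.1, hAB.mem_star.2, hAB.cellDiam_le h2 hT, hAB.symm.cellDiam_le h2 hT⟩)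
        hL hKa (Mesh.chain hΩ hLT hK haL haK)
      have v' : volume.real (hull K) ≤ (γ ^ 2) ^ N * volume.real (hull L) :=
        v.trans (mul_le_mul_of_nonneg_right (pow_le_pow_right₀ (one_le_pow₀ hγ) hcardN) (hV L hL).le)
      have d' : cellDiam L ≤ γ ^ N * cellDiam K :=
        d.trans (mul_le_mul_of_nonneg_right (pow_le_pow_right₀ hγ hcardN) (hh K hKa).le)
      have d2 : (cellDiam K ^ 2)⁻¹ ≤ (γ ^ N) ^ 2 * (cellDiam L ^ 2)⁻¹ := by
        have p1 := hh L hL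
        have p2 := hh K hKa
        rw [← div_eq_mul_inv, inv_le_comm₀ (by positivity) (by positivity), inv_div,
          div_le_iff₀ (by positivity), ← mul_pow, mul_comm]
        exact pow_le_pow_left₀ p1.le d' 2
      have p1 := hV L hL
      have p2 := hh K hKa
      have p3 := hE L hL
      calc volume.real (hull K) * (cellDiam K ^ 2)⁻¹ * x L
          ≤ ((γ ^ 2) ^ N * volume.real (hull L)) * ((γ ^ N) ^ 2 * (cellDiam L ^ 2)⁻¹) * x L := by
            gcongr
        _ = Q * ((cellDiam L ^ 2)⁻¹ * E L) := by
            simp only [hx, hQ]; field_simp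
    have hown := h₁ γ hγ Ω T hT u hu K₀ hK₀ (σ a) hsK₀ a haσ c hc (p K₀) (E K₀) (hp K₀ hK₀)
    rw [← le_div_iff₀ (hV K₀ hK₀a), mul_div_assoc] at hown
    have hchain := abs_sub_le_of_chain (R := T.Adjacent a) (S := T.star a) (x := fun L => p L a)
      (d := fun L => √(C₂ * γ * x L)) (fun A B hAB => ⟨hAB.mem_star.1, hAB.mem_star.2,
        abs_le_sqrt_add_sqrt (mul_nonneg (by positivity) (hx0 A hAB.mem_star.1))
          (mul_nonneg (by positivity) (hx0 B hAB.mem_star.2)) (h₂ γ hγ Ω T hT u hu p E hp a A B hAB)⟩)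
      (fun _ => Real.sqrt_nonneg _) (Mesh.chain hΩ hK₀ hK (hull_mono hsK₀ haσ) haK)
    have hjump : (p K₀ a - p K a) ^ 2 ≤ 4 * N * (C₂ * γ) * ∑ L ∈ T.star a, x L := by
      have e1 := sq_sum_le_card_mul_sum_sq (s := T.star a) (f := fun L => √(C₂ * γ * x L))
      have e2 : ∑ L ∈ T.star a, √(C₂ * γ * x L) ^ 2 = C₂ * γ * ∑ L ∈ T.star a, x L := by
        rw [Finset.mul_sum]
        exact Finset.sum_congr rfl fun L hL => Real.sq_sqrt (mul_nonneg (by positivity) (hx0 L hL))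
      rw [e2] at e1
      have e3 : 0 ≤ C₂ * γ * ∑ L ∈ T.star a, x L :=
        mul_nonneg (by positivity) (Finset.sum_nonneg hx0)
      have e4 : ((T.star a).card : ℝ) ≤ N := by exact_mod_cast hcardN
      have e5 := sq_le_sq' (by linarith [abs_nonneg (p K₀ a - p K a)]) hchain
      rw [sq_abs, mul_pow] at e5
      have e6 := mul_le_mul_of_nonneg_right e4 e3
      linarith
    set X := ∑ L ∈ T.star a, x L with hX
    have hX1 : x K₀ ≤ X := Finset.single_le_sum hx0 hK₀a
    have htot : (c - p K a) ^ 2 ≤ (2 * (C₁ * γ) + 8 * N * (C₂ * γ)) * X := by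
      have e : (c - p K a) ^ 2 ≤ 2 * (c - p K₀ a) ^ 2 + 2 * (p K₀ a - p K a) ^ 2 := by
        nlinarith [sq_nonneg ((c - p K₀ a) - (p K₀ a - p K a))]
      have e' : C₁ * γ * x K₀ ≤ C₁ * γ * X := mul_le_mul_of_nonneg_left hX1 (by positivity)
      linarith
    have hd : 0 ≤ volume.real (hull K) * (cellDiam K ^ 2)⁻¹ :=
      mul_nonneg measureReal_nonneg (by positivity)
    have hXs : volume.real (hull K) * (cellDiam K ^ 2)⁻¹ * X ≤ Q * S := by
      rw [hX, hS, Finset.mul_sum, Finset.mul_sum]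
      exact Finset.sum_le_sum hcmp
    calc (c - p K a) ^ 2 * volume.real (hull K) * (cellDiam K ^ 2)⁻¹
        = (volume.real (hull K) * (cellDiam K ^ 2)⁻¹) * (c - p K a) ^ 2 := by ring
      _ ≤ (volume.real (hull K) * (cellDiam K ^ 2)⁻¹) *
          ((2 * (C₁ * γ) + 8 * N * (C₂ * γ)) * X) := mul_le_mul_of_nonneg_left htot hd
      _ = (2 * (C₁ * γ) + 8 * N * (C₂ * γ)) * (volume.real (hull K) * (cellDiam K ^ 2)⁻¹ * X) := by ring
      _ ≤ (2 * (C₁ * γ) + 8 * N * (C₂ * γ)) * (Q * S) :=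
          mul_le_mul_of_nonneg_left hXs (by positivity)
      _ = _ := by ring

end NodalEstimate

/-! ### The global error estimate. -/

section ErrorEstimate

variable {n : ℕ} {Ω : Set (Pt n)} {T : Mesh Ω} {k : ℕ} {γ : ℝ}

theorem RegularCell.mono {γ' : ℝ} {K : Finset (Pt n)} (h : RegularCell γ K) (hγ : γ ≤ γ') :
    RegularCell γ' K := by
  obtain ⟨c, r, hr, hc, hd⟩ := h
  exact ⟨c, r, hr, hc, hd.trans (by gcongr)⟩

theorem Mesh.cellDiam_le_size {K : Finset (Pt n)} (hK : K ∈ T.cells) : cellDiam K ≤ T.size :=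
  le_csSup ((Finset.finite_toSet T.cells).image _).bddAbove ⟨K, hK, rfl⟩

/-- Weak derivatives on Ω restrict to those on each element, and the elements tile Ω up to a null
set. -/
theorem Mesh.sum_weakSemiSq_le {r m : ℕ} (hr : r ≤ m) {u : Pt n → ℝ} (hu : MemSobolev Ω m u) :
    ∑ K ∈ T.cells, weakSemiSq K r u ≤ sobolevNormSq Ω m u := by
  have h1 : ∀ α : Fin r → Fin n,
      ∑ K ∈ T.cells, ∫ x in hull K, weakDeriv (interior (hull K)) α u x ^ 2 =
        ∫ x in Ω, weakDeriv Ω α u x ^ 2 := by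
    intro α
    have hd := weakDeriv_spec (hu.2 r hr α)
    have ae : ∀ K ∈ T.cells, (fun x => weakDeriv (interior (hull K)) α u x ^ 2)
        =ᵐ[volume.restrict (hull K)] fun x => weakDeriv Ω α u x ^ 2 := fun K hK => by
      have := (hd.mono (T.interior_subset hK)).weakDeriv_ae isOpen_interior
      rw [restrict_interior_hull] at this
      exact this.fun_comp (· ^ 2)
    have hi : ∀ K ∈ T.cells, IntegrableOn (fun x => weakDeriv Ω α u x ^ 2) (hull K) := fun K hK => by
      have := (hd.mono (T.interior_subset hK)).1.integrable_sq
      rwa [restrict_interior_hull] at this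
    rw [T.integral_eq_sum hi]
    exact Finset.sum_congr rfl fun K hK => integral_congr_ae (ae K hK)
  simp only [weakSemiSq, sobolevNormSq]
  rw [Finset.sum_comm, Finset.sum_congr rfl fun α _ => h1 α]
  exact Finset.single_le_sum (f := fun j => ∑ α : Fin j → Fin n, ∫ x in Ω, weakDeriv Ω α u x ^ 2)
    (fun j _ => Finset.sum_nonneg fun _ _ => integral_nonneg fun _ => sq_nonneg _)
    (Finset.mem_range.2 (Nat.lt_succ_of_le hr))

/-- Each element is counted boundedly often by the stars of the nodes of all elements. -/
theorem Mesh.sum_star_le (hn : 1 ≤ n) (hk : 1 ≤ k) (hγ : 0 ≤ γ) (hT : T.ShapeRegular γ)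
    {G : Finset (Pt n) → ℝ} (hG : ∀ L ∈ T.cells, 0 ≤ G L) :
    ∑ K ∈ T.cells, ∑ a ∈ simplexNodes K k, ∑ L ∈ T.star a, G L ≤
      ((k : ℝ) + 1) ^ (n + 1) * (2 * γ) ^ n * ∑ L ∈ T.cells, G L := by
  classical
  -- A node of K lying in L is also a node of L, so the triples (K, a, L) are symmetric in K and L
  -- and the sums may be exchanged.
  have e : ∑ K ∈ T.cells, ∑ a ∈ simplexNodes K k, ∑ L ∈ T.star a, G L =
      ∑ L ∈ T.cells, ∑ a ∈ simplexNodes L k, ∑ K ∈ T.star a, G L := by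
    simp only [Finset.sum_sigma']
    refine Finset.sum_bij' (fun x _ => ⟨x.2.2, x.2.1, x.1⟩) (fun x _ => ⟨x.2.2, x.2.1, x.1⟩)
      ?_ ?_ (fun _ _ => rfl) (fun _ _ => rfl) (fun _ _ => rfl) <;>
    · rintro ⟨K, a, L⟩ h
      simp only [Finset.mem_sigma, Mesh.mem_star] at h ⊢
      obtain ⟨hK, ha, hL, haL⟩ := h
      exact ⟨hL, Mesh.mem_simplexNodes_of_mem_hull hk hK hL ha haL, hK,
        simplexNodes_subset_hull hk ha⟩
  rw [e, Finset.mul_sum]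
  refine Finset.sum_le_sum fun L hL => ?_
  have hc : ((simplexNodes L k).card : ℝ) ≤ ((k : ℝ) + 1) ^ (n + 1) := by
    have := card_simplexNodes_le L k
    rw [(T.mem_cells.1 hL).2] at this
    exact_mod_cast this
  have h0 := hG L hL
  calc ∑ a ∈ simplexNodes L k, ∑ K ∈ T.star a, G L
      ≤ ∑ a ∈ simplexNodes L k, (2 * γ) ^ n * G L := by
        refine Finset.sum_le_sum fun a _ => ?_
        rw [Finset.sum_const, nsmul_eq_mul]
        exact mul_le_mul_of_nonneg_right (T.card_star_le hn hγ hT a) h0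
    _ = (simplexNodes L k).card * ((2 * γ) ^ n * G L) := by rw [Finset.sum_const, nsmul_eq_mul]
    _ ≤ ((k : ℝ) + 1) ^ (n + 1) * ((2 * γ) ^ n * G L) := by gcongr
    _ = _ := by ring

theorem integral_sq_le_sum_nodes {K : Finset (Pt n)} (hK : IsCell K) (hk : 1 ≤ k) {f : Pt n → ℝ}
    (hf : IsPoly k f) : ∫ x in hull K, f x ^ 2 ≤ ((k : ℝ) ^ k * (k + 1) ^ (n + 1)) ^ 2 *
      (∑ a ∈ simplexNodes K k, f a ^ 2) * volume.real (hull K) := by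
  have hint : IntegrableOn (fun x => f x ^ 2) (hull K) :=
    (memLp_hull_of_continuous K (hf.contDiff (m := 0)).continuous).integrable_sq
  refine (setIntegral_mono_on hint (integrableOn_const (isCompact_hull K).measure_lt_top.ne)
    (isCompact_hull K).isClosed.measurableSet fun x hx => sq_le_sum_nodes hK hk hf hx).trans_eq ?_
  rw [setIntegral_const, smul_eq_mul, mul_comm]

/-- On an element w − p_K is a polynomial, controlled by its nodal values. Each of these is bounded
by the errors on the star of the node, and the stars overlap boundedly often. -/
theorem exists_scottZhang_estimate (n k : ℕ) (hn : 1 ≤ n) (hk : 1 ≤ k) (γ : ℝ) (hγ : 1 ≤ γ) :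
    ∃ C : ℝ, 0 < C ∧ ∀ (Ω : Set (Pt n)), LocallyConnectedAtBoundary Ω → ∀ (T : Mesh Ω),
      T.ShapeRegular γ → ∀ σ, T.IsNodeChoice k σ → ∀ u w, T.IsScottZhang k σ u w →
      MemSobolev Ω 1 u → ∀ (p : Finset (Pt n) → Pt n → ℝ) (E : Finset (Pt n) → ℝ),
      (∀ K ∈ T.cells, CellApprox K k u (p K) (E K)) →
      ∑ K ∈ T.cells, (cellDiam K ^ 2)⁻¹ * ∫ x in hull K, (w x - p K x) ^ 2 ≤
        C * ∑ K ∈ T.cells, (cellDiam K ^ 2)⁻¹ * E K := by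
  obtain ⟨C, hC, h⟩ := exists_nodal_estimate n k hn γ hγ
  set B : ℝ := ((k : ℝ) ^ k * (k + 1) ^ (n + 1)) ^ 2 with hB
  have hk0 : (0 : ℝ) < k := by exact_mod_cast hk
  have hB0 : 0 < B := by positivity
  refine ⟨B * C * (((k : ℝ) + 1) ^ (n + 1) * (2 * γ) ^ n), by positivity,
    fun Ω hΩ T hT σ hσ u w hw hu p E hp => ?_⟩
  have key : ∀ K ∈ T.cells, (cellDiam K ^ 2)⁻¹ * ∫ x in hull K, (w x - p K x) ^ 2 ≤
      B * C * ∑ a ∈ simplexNodes K k, ∑ L ∈ T.star a, (cellDiam L ^ 2)⁻¹ * E L := by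
    intro K hK
    obtain ⟨q, hq, hqw⟩ := hw.1 K hK
    have hf : IsPoly k (fun x => q x - p K x) := hq.sub (hp K hK).1
    set s := ∑ a ∈ simplexNodes K k, (w a - p K a) ^ 2 with hs
    have hm : MeasurableSet (hull K) := (isCompact_hull K).isClosed.measurableSet
    have e1 : ∫ x in hull K, (w x - p K x) ^ 2 ≤ B * s * volume.real (hull K) := by
      rw [setIntegral_congr_fun hm (g := fun x => (q x - p K x) ^ 2) fun x hx => by
        simp only [hqw x hx]]
      have hsq : ∑ a ∈ simplexNodes K k, (q a - p K a) ^ 2 = s :=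
        Finset.sum_congr rfl fun a ha => by rw [hqw a (simplexNodes_subset_hull hk ha)]
      rw [← hsq]
      exact integral_sq_le_sum_nodes (T.isCell hK) hk hf
    have hh : 0 ≤ (cellDiam K ^ 2)⁻¹ := inv_nonneg.2 (sq_nonneg _)
    calc (cellDiam K ^ 2)⁻¹ * ∫ x in hull K, (w x - p K x) ^ 2
        ≤ (cellDiam K ^ 2)⁻¹ * (B * s * volume.real (hull K)) := mul_le_mul_of_nonneg_left e1 hh
      _ = B * ∑ a ∈ simplexNodes K k,
            (w a - p K a) ^ 2 * volume.real (hull K) * (cellDiam K ^ 2)⁻¹ := by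
          rw [← Finset.sum_mul, ← Finset.sum_mul, ← hs]; ring
      _ ≤ B * ∑ a ∈ simplexNodes K k, C * ∑ L ∈ T.star a, (cellDiam L ^ 2)⁻¹ * E L := by
          refine mul_le_mul_of_nonneg_left (Finset.sum_le_sum fun a ha => ?_) hB0.le
          have han : a ∈ T.nodes k := Mesh.mem_nodes.2 ⟨K, hK, ha⟩
          exact h Ω hΩ T hT σ hσ u hu p E hp a han K
            (Mesh.mem_star.2 ⟨hK, simplexNodes_subset_hull hk ha⟩) _ (hw.2.1 a han)
      _ = _ := by rw [← Finset.mul_sum]; ring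
  calc _ ≤ ∑ K ∈ T.cells, B * C * ∑ a ∈ simplexNodes K k, ∑ L ∈ T.star a,
        (cellDiam L ^ 2)⁻¹ * E L := Finset.sum_le_sum key
    _ = B * C * ∑ K ∈ T.cells, ∑ a ∈ simplexNodes K k, ∑ L ∈ T.star a,
        (cellDiam L ^ 2)⁻¹ * E L := by rw [← Finset.mul_sum]
    _ ≤ B * C * (((k : ℝ) + 1) ^ (n + 1) * (2 * γ) ^ n *
        ∑ L ∈ T.cells, (cellDiam L ^ 2)⁻¹ * E L) := by
        refine mul_le_mul_of_nonneg_left (T.sum_star_le hn hk (by linarith) hT fun L hL => ?_)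
          (by positivity)
        exact mul_nonneg (by positivity) (hp L hL).nonneg
    _ = _ := by ring

/-- By linearity the trace of v minus f is a trace of u − p. The trace inequality contributes the
factor 4 and the splitting of the square another 2. -/
theorem CellApprox.boundary_le (hn : 1 ≤ n) {K : Finset (Pt n)} (hK : IsCell K)
    (hγ : RegularCell γ K) {u p f v : Pt n → ℝ} {E : ℝ} (h : CellApprox K k u p E)
    (hu : MemSobolev (interior (hull K)) 1 u) (hf : IsPoly k f)
    (hv : v =ᵐ[volume.restrict (hull K)] fun x => u x - p x + f x) :
    ∫ x in hull K, v x ^ 2 ≤ 2 * E + 2 * ∫ x in hull K, f x ^ 2 ∧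
    cellDiam K * ∫ x, trace K v x ^ 2 ∂(boundaryMeasure K) ≤
      8 * ((n + 1) * (n + 2) * γ) * E +
        2 * (cellDiam K * ∫ x, f x ^ 2 ∂(boundaryMeasure K)) := by
  have hup := isTrace_trace_sub hn hK hu (h.1.contDiff)
  have hfc : ContDiff ℝ ∞ (fun x => -f x) := hf.neg.contDiff
  have hv' : v =ᵐ[volume.restrict (interior (hull K))] fun x => (u x - p x) - -f x := by
    rw [restrict_interior_hull]
    exact hv.trans (ae_of_all _ fun x => by simp)
  constructor
  · have e : ∫ x in hull K, v x ^ 2 = ∫ x in hull K, (u x - p x + f x) ^ 2 :=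
      integral_congr_ae (hv.fun_comp (· ^ 2))
    rw [e]
    have := integral_sq_sub_le hup.1.memLp_hull (memLp_hull_of_continuous K hfc.continuous)
    simp only [sub_neg_eq_add, neg_sq] at this
    exact this.trans (by linarith [h.2.1])
  · have h1 := (hup.sub hn hK (isTrace_of_contDiff hn hK hfc)).congr hv'.symm
    have h2 := isTrace_trace hn hK h1.1
    have h3 : IsTrace K (fun x => u x - p x) (fun x => trace K v x - f x) := by
      refine (h2.sub hn hK (isTrace_of_contDiff hn hK hf.contDiff)).congr ?_
      filter_upwards [hv'] with x hx
      rw [hx]; ring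
    have h4 := h3.integral_sq_le hn hK
    have h5 := integral_sq_sub_le h3.2.1 (memLp_boundary hn hK hfc.continuous)
    simp only [sub_neg_eq_add, neg_sq, sub_add_cancel] at h5
    have h6 := h.traceBound_le hn hK hγ
    have h7 := cellDiam_pos hn hK
    have h8 := mul_le_mul_of_nonneg_left (h5.trans (by linarith :
      _ ≤ 8 * traceBound K (fun x => u x - p x) + 2 * ∫ x, f x ^ 2 ∂(boundaryMeasure K))) h7.le
    linarith

/-- The error is (τ − p) + (p − P − q), with P the Scott-Zhang part and q the bubble. Stability
bounds q by τ − P, hence by τ − p and P − p, and on polynomials the boundary norm is controlled by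
the interior one. -/
theorem exists_cell_error_le (n k : ℕ) (hn : 1 ≤ n) (hk : 1 ≤ k) (γ : ℝ) (hγ : 1 ≤ γ) :
    ∃ C : ℝ, 0 < C ∧ ∀ (Ω : Set (Pt n)) (T : Mesh Ω), T.ShapeRegular γ → ∀ σ,
      T.IsNodeChoice k σ → ∀ τ, MemSobolevSym Ω 1 τ → ∀ K ∈ T.cells,
      ∀ (p : Fin n → Fin n → Pt n → ℝ) (E : Fin n → Fin n → ℝ),
      (∀ i j, CellApprox K k (fun x => τ x i j) (p i j) (E i j)) →
      cellNormSq K (τ - T.stressInterp k σ τ) +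
        cellDiam K * boundaryNormSq K (τ - T.stressInterp k σ τ) ≤
        C * ∑ i, ∑ j, (E i j + ∫ x in hull K, (T.scottZhangTensor k σ τ x i j - p i j x) ^ 2) := by
  obtain ⟨Cb, hCb, hstab⟩ := exists_bubble_stability n hn k hk γ
  obtain ⟨Cp, hCp, hbd⟩ := exists_boundary_poly_le n k hn
  set A : ℝ := 2 + 8 * ((n + 1) * (n + 2) * γ) with hA
  set D : ℝ := 2 + 2 * (Cp * γ) with hD
  refine ⟨A + D * (2 + 4 * Cb), by positivity, fun Ω T hT σ hσ τ hτ K hK p E hp => ?_⟩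
  have hcell := T.isCell hK
  have hreg : RegularCell γ K := hT K hK
  obtain ⟨P, hP, hPS⟩ := Mesh.scottZhangTensor_poly hn hk hσ hτ hK
  obtain ⟨q, hq, hv, hmom, hqx⟩ := (Mesh.isBubbleInterp_bubbleInterp hn hk hσ hτ).1 K hK
  have hm : MeasurableSet (hull K) := (isCompact_hull K).isClosed.measurableSet
  have hu : ∀ i j, MemSobolev (interior (hull K)) 1 (fun x => τ x i j) := fun i j =>
    (hτ.2 i j).mono (T.interior_subset hK)
  obtain ⟨c, ρ, hρ, hball, hd⟩ := hreg
  have hbub := hstab K hcell c ρ hρ hball hd q hq (hv.isFaceBubble hcell hk hq) _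
    (Mesh.memLp_sub_scottZhangTensor hn hk hσ hτ hK) hmom
  set Y : Fin n → Fin n → ℝ := fun i j =>
    ∫ x in hull K, (T.scottZhangTensor k σ τ x i j - p i j x) ^ 2 with hY
  have hYP : ∀ i j, ∫ x in hull K, (P x i j - p i j x) ^ 2 = Y i j := fun i j =>
    setIntegral_congr_fun hm fun x hx => by simp only [hPS x hx]
  have hpoly : ∀ i j, IsPoly k (fun x => P x i j - p i j x) := fun i j => (hP.2 i j).sub (hp i j).1
  have hL : ∀ {f : Pt n → ℝ}, IsPoly k f → MemLp f 2 (volume.restrict (hull K)) := fun hf =>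
    memLp_hull_of_continuous K (hf.contDiff (m := 0)).continuous
  have hsz : cellNormSq K (τ - T.scottZhangTensor k σ τ) ≤ 2 * ∑ i, ∑ j, (E i j + Y i j) := by
    simp only [cellNormSq, Finset.mul_sum]
    refine Finset.sum_le_sum fun i _ => Finset.sum_le_sum fun j _ => ?_
    have h1 := integral_sq_sub_le ((hu i j).memLp_hull.sub (hL (hp i j).1)) (hL (hpoly i j))
    rw [hYP] at h1
    rw [setIntegral_congr_fun hm (g := fun x => (τ x i j - p i j x - (P x i j - p i j x)) ^ 2)
      fun x hx => by simp only [Pi.sub_apply, Matrix.sub_apply, hPS x hx]; ring]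
    refine h1.trans ?_
    have := (hp i j).2.1
    simp only [Pi.sub_apply]
    linarith
  have hf : ∀ i j, IsPoly k (fun x => p i j x - P x i j - q x i j) := fun i j =>
    ((hp i j).1.sub (hP.2 i j)).sub (hq.2 i j)
  set Z : Fin n → Fin n → ℝ := fun i j => ∫ x in hull K, (p i j x - P x i j - q x i j) ^ 2 with hZ
  have hZle : ∀ i j, Z i j ≤ 2 * Y i j + 2 * ∫ x in hull K, q x i j ^ 2 := fun i j => by
    have := integral_sq_sub_le (hL ((hp i j).1.sub (hP.2 i j))) (hL (hq.2 i j))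
    have e : ∫ x in hull K, (p i j x - P x i j) ^ 2 = Y i j := by
      rw [← hYP]
      exact integral_congr_ae (ae_of_all _ fun x => by ring)
    rwa [e] at this
  have hent : ∀ i j, (fun x => (τ - T.stressInterp k σ τ) x i j) =ᵐ[volume.restrict (hull K)]
      fun x => τ x i j - p i j x + (p i j x - P x i j - q x i j) := fun i j => by
    rw [← restrict_interior_hull]
    filter_upwards [ae_restrict_mem isOpen_interior.measurableSet] with x hx
    simp only [Mesh.stressInterp, Pi.sub_apply, Pi.add_apply, Matrix.sub_apply, Matrix.add_apply,
      hqx x hx, hPS x (interior_subset hx)]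
    ring
  have hij : ∀ i j, (∫ x in hull K, ((τ - T.stressInterp k σ τ) x i j) ^ 2) +
      cellDiam K * ∫ x, trace K (fun y => (τ - T.stressInterp k σ τ) y i j) x ^ 2
        ∂(boundaryMeasure K) ≤ A * E i j + D * Z i j := fun i j => by
    obtain ⟨h1, h2⟩ := (hp i j).boundary_le hn hcell (hT K hK) (hu i j) (hf i j) (hent i j)
    have h3 := hbd γ K hcell (hT K hK) _ (hf i j)
    have e : A * E i j + D * Z i j = (2 * E i j + 2 * Z i j) +
      (8 * ((n + 1) * (n + 2) * γ) * E i j + 2 * (Cp * γ * Z i j)) := by rw [hA, hD]; ring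
    rw [e]
    exact add_le_add h1 (h2.trans (by gcongr))
  have hE : 0 ≤ ∑ i, ∑ j, E i j :=
    Finset.sum_nonneg fun i _ => Finset.sum_nonneg fun j _ => (hp i j).nonneg
  have hY0 : 0 ≤ ∑ i, ∑ j, Y i j := Finset.sum_nonneg fun i _ => Finset.sum_nonneg fun j _ =>
    integral_nonneg fun _ => sq_nonneg _
  have hZsum : ∑ i, ∑ j, Z i j ≤ 2 * ∑ i, ∑ j, Y i j + 2 * cellNormSq K q := by
    simp only [cellNormSq, Finset.mul_sum, ← Finset.sum_add_distrib]
    exact Finset.sum_le_sum fun i _ => Finset.sum_le_sum fun j _ => hZle i j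
  have hsum : cellNormSq K (τ - T.stressInterp k σ τ) +
      cellDiam K * boundaryNormSq K (τ - T.stressInterp k σ τ) ≤
      A * ∑ i, ∑ j, E i j + D * ∑ i, ∑ j, Z i j := by
    simp only [cellNormSq, boundaryNormSq, Finset.mul_sum, ← Finset.sum_add_distrib]
    exact Finset.sum_le_sum fun i _ => Finset.sum_le_sum fun j _ => hij i j
  simp only [Finset.sum_add_distrib] at hsz ⊢
  set X := ∑ i, ∑ j, E i j
  set W := ∑ i, ∑ j, Y i j
  have hA0 : 0 ≤ A := by positivity
  have hD0 : 0 ≤ D := by positivity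
  have h1 : ∑ i, ∑ j, Z i j ≤ (2 + 4 * Cb) * (X + W) := by
    have := mul_le_mul_of_nonneg_left hsz hCb.le
    nlinarith
  have h2 := mul_le_mul_of_nonneg_left h1 hD0
  have h3 := mul_nonneg hA0 hY0
  calc _ ≤ A * X + D * ∑ i, ∑ j, Z i j := hsum
    _ ≤ (A + D * (2 + 4 * Cb)) * (X + W) := by linarith

theorem exists_error_le (n k : ℕ) (hn : 1 ≤ n) (hk : 1 ≤ k) (γ : ℝ) (hγ : 1 ≤ γ) :
    ∃ C : ℝ, 0 < C ∧ ∀ (Ω : Set (Pt n)), LocallyConnectedAtBoundary Ω → ∀ (T : Mesh Ω),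
      T.ShapeRegular γ → ∀ σ, T.IsNodeChoice k σ → ∀ τ, MemSobolevSym Ω 1 τ →
      ∀ (p : Fin n → Fin n → Finset (Pt n) → Pt n → ℝ) (E : Fin n → Fin n → Finset (Pt n) → ℝ),
      (∀ i j, ∀ K ∈ T.cells, CellApprox K k (fun x => τ x i j) (p i j K) (E i j K)) →
      ∑ K ∈ T.cells, (cellDiam K ^ 2)⁻¹ * (cellNormSq K (τ - T.stressInterp k σ τ) +
        cellDiam K * boundaryNormSq K (τ - T.stressInterp k σ τ)) ≤
        C * ∑ i, ∑ j, ∑ K ∈ T.cells, (cellDiam K ^ 2)⁻¹ * E i j K := by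
  obtain ⟨C₁, hC₁, h₁⟩ := exists_cell_error_le n k hn hk γ hγ
  obtain ⟨C₂, hC₂, h₂⟩ := exists_scottZhang_estimate n k hn hk γ hγ
  refine ⟨C₁ * (1 + C₂), by positivity, fun Ω hΩ T hT σ hσ τ hτ p E hp => ?_⟩
  set Y : Fin n → Fin n → Finset (Pt n) → ℝ := fun i j K =>
    ∫ x in hull K, (T.scottZhangTensor k σ τ x i j - p i j K x) ^ 2
  calc _ ≤ ∑ K ∈ T.cells, (cellDiam K ^ 2)⁻¹ * (C₁ * ∑ i, ∑ j, (E i j K + Y i j K)) :=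
        Finset.sum_le_sum fun K hK => mul_le_mul_of_nonneg_left
          (h₁ Ω T hT σ hσ τ hτ K hK _ _ fun i j => hp i j K hK) (by positivity)
    _ = C₁ * ∑ i, ∑ j, ((∑ K ∈ T.cells, (cellDiam K ^ 2)⁻¹ * E i j K) +
        ∑ K ∈ T.cells, (cellDiam K ^ 2)⁻¹ * Y i j K) := by
        simp only [← Finset.sum_add_distrib, ← mul_add]
        rw [Finset.sum_congr rfl fun i _ => Finset.sum_comm, Finset.sum_comm, Finset.mul_sum]
        refine Finset.sum_congr rfl fun K _ => ?_
        simp only [← Finset.mul_sum]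
        ring
    _ ≤ C₁ * ∑ i, ∑ j, ((∑ K ∈ T.cells, (cellDiam K ^ 2)⁻¹ * E i j K) +
        C₂ * ∑ K ∈ T.cells, (cellDiam K ^ 2)⁻¹ * E i j K) := by
        refine mul_le_mul_of_nonneg_left (Finset.sum_le_sum fun i _ => Finset.sum_le_sum fun j _ =>
          add_le_add_right (h₂ Ω hΩ T hT σ hσ _ _ (Mesh.isScottZhang_scottZhang hn hk hσ (hτ.2 i j))
            (hτ.2 i j) (p i j) (E i j) (hp i j)) _) hC₁.le
    _ = _ := by
        simp only [← one_add_mul, ← Finset.mul_sum]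
        ring

/-- Degree s = min{k, m−1} is both available in P_k and supported by the regularity of τ. The weight
h_K⁻² reduces the local bound h_K^(2(s+1)) to h_K^(2s). -/
theorem exists_sobolev_error_le (n k : ℕ) (hn : 1 ≤ n) (hk : 1 ≤ k) (γ : ℝ) (hγ : 1 ≤ γ) (m : ℕ)
    (hm : 1 ≤ m) : ∃ C : ℝ, 0 < C ∧ ∀ (Ω : Set (Pt n)), LocallyConnectedAtBoundary Ω →
      ∀ (T : Mesh Ω), T.ShapeRegular γ → ∀ σ, T.IsNodeChoice k σ → ∀ τ, MemSobolevSym Ω m τ →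
      ∑ K ∈ T.cells, (cellDiam K ^ 2)⁻¹ * (cellNormSq K (τ - T.stressInterp k σ τ) +
        cellDiam K * boundaryNormSq K (τ - T.stressInterp k σ τ)) ≤
        C * T.size ^ (2 * min k (m - 1)) * tensorSobolevNormSq Ω m τ := by
  obtain ⟨C, hC, h⟩ := exists_error_le n k hn hk γ hγ
  set s := min k (m - 1) with hs
  have hsm : s + 1 ≤ m := by omega
  set C₀ : ℝ := 4 * (2 ^ n) ^ (s + 1) + 1 with hC₀
  refine ⟨C * C₀, by positivity, fun Ω hΩ T hT σ hσ τ hτ => ?_⟩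
  have hτ1 : MemSobolevSym Ω 1 τ := ⟨hτ.1, fun i j => (hτ.2 i j).of_le hm⟩
  set N : ℝ := ∑ _i : Fin n, ∑ _j : Fin n, ∑ _K ∈ T.cells, (1 : ℝ)
  set H : ℝ := T.size ^ (2 * s)
  have key : ∀ δ : ℝ, 0 < δ → ∑ K ∈ T.cells, (cellDiam K ^ 2)⁻¹ *
      (cellNormSq K (τ - T.stressInterp k σ τ) +
        cellDiam K * boundaryNormSq K (τ - T.stressInterp k σ τ)) ≤
      C * C₀ * H * (tensorSobolevNormSq Ω m τ + δ * N) := by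
    intro δ hδ
    have hex : ∀ i j K, ∃ p, K ∈ T.cells → CellApprox K k (fun x => τ x i j) p
        (C₀ * (cellDiam K ^ (2 * (s + 1)) * (weakSemiSq K (s + 1) (fun x => τ x i j) + δ))) := by
      intro i j K
      by_cases hK : K ∈ T.cells
      · obtain ⟨p, hp, h1, h2⟩ := exists_poly_approx hn (T.isCell hK) s
          (((hτ.2 i j).of_le hsm).mono (T.interior_subset hK)) hδ
        exact ⟨p, fun _ => ⟨hp.mono (by exact_mod_cast min_le_left _ _), h1, h2⟩⟩
      · exact ⟨0, fun h => absurd h hK⟩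
    choose p hp using hex
    refine (h Ω hΩ T hT σ hσ τ hτ1 p _ fun i j K hK => hp i j K hK).trans ?_
    rw [mul_assoc C, mul_assoc C]
    refine mul_le_mul_of_nonneg_left ?_ hC.le
    simp only [tensorSobolevNormSq, N, Finset.mul_sum, ← Finset.sum_add_distrib, mul_one]
    refine Finset.sum_le_sum fun i _ => Finset.sum_le_sum fun j _ => ?_
    calc _ ≤ ∑ K ∈ T.cells, C₀ * H * (weakSemiSq K (s + 1) (fun x => τ x i j) + δ) := by
          refine Finset.sum_le_sum fun K hK => ?_
          have hd := cellDiam_pos hn (T.isCell hK)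
          have hw := weakSemiSq_nonneg K (s + 1) (fun x => τ x i j)
          calc _ = C₀ * cellDiam K ^ (2 * s) * (weakSemiSq K (s + 1) (fun x => τ x i j) + δ) := by
                rw [mul_add 2, pow_add, mul_one]; field_simp
            _ ≤ _ := by
                have := pow_le_pow_left₀ hd.le (T.cellDiam_le_size hK) (2 * s)
                gcongr
      _ = C₀ * H * ((∑ K ∈ T.cells, weakSemiSq K (s + 1) (fun x => τ x i j)) +
          ∑ _K ∈ T.cells, δ) := by rw [← Finset.mul_sum, Finset.sum_add_distrib]
      _ ≤ C₀ * H * (sobolevNormSq Ω m (fun x => τ x i j) + ∑ _K ∈ T.cells, δ) := by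
          have := T.sum_weakSemiSq_le hsm (hτ.2 i j)
          have hH : 0 ≤ H := (even_two_mul s).pow_nonneg _
          gcongr
  -- The number of elements enters only through δN, which disappears as δ tends to 0 on the fixed
  -- grid.
  have hlim : Tendsto (fun l : ℕ => C * C₀ * H * (tensorSobolevNormSq Ω m τ +
      1 / ((l : ℝ) + 1) * N)) atTop (𝓝 (C * C₀ * H * (tensorSobolevNormSq Ω m τ + 0 * N))) :=
    ((tendsto_one_div_add_atTop_nhds_zero_nat.mul_const N).const_add _).const_mul _
  rw [zero_mul, add_zero] at hlim
  exact ge_of_tendsto' hlim fun l => key _ (by positivity)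

end ErrorEstimate

end FEM

end

theorem mainTheorem6 (n : ℕ) (hn : 1 ≤ n) (k : ℕ) (hk : 1 ≤ k) (Ω : Set (FEM.Pt n))
    (hΩ : FEM.LocallyConnectedAtBoundary Ω) :
    -- the operators are well defined, `I_h` maps into `Σ_{k,h}` and preserves moments
    (∀ (T : FEM.Mesh Ω) (σ : FEM.Pt n → Finset (FEM.Pt n)), T.IsNodeChoice k σ →
      ∀ τ : FEM.TensorField n, FEM.MemSobolevSym Ω 1 τ →
        (∀ i j, ∃! w, T.IsScottZhang k σ (fun x => τ x i j) w) ∧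
        (∃! b, T.IsBubbleInterp k (τ - T.scottZhangTensor k σ τ) b) ∧
        T.MemStress k (T.stressInterp k σ τ) ∧
        ∀ K ∈ T.cells, ∀ ς : FEM.TensorField n, FEM.IsPolySym ((k : ℤ) - 2) ς →
          ∫ x in FEM.hull K, FEM.frob (T.stressInterp k σ τ x - τ x) (ς x) = 0) ∧
    -- the error estimate
    ∀ (m : ℕ), 1 ≤ m → ∀ γ : ℝ, ∃ C : ℝ, 0 < C ∧
      ∀ (T : FEM.Mesh Ω) (σ : FEM.Pt n → Finset (FEM.Pt n)), T.ShapeRegular γ →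
        T.IsNodeChoice k σ → ∀ τ : FEM.TensorField n, FEM.MemSobolevSym Ω m τ →
          ∑ K ∈ T.cells, (FEM.cellDiam K ^ 2)⁻¹ *
              (FEM.cellNormSq K (τ - T.stressInterp k σ τ) +
                FEM.cellDiam K * FEM.boundaryNormSq K (τ - T.stressInterp k σ τ))
            ≤ C * T.size ^ (2 * min k (m - 1)) * FEM.tensorSobolevNormSq Ω m τ := by
  refine ⟨fun T σ hσ τ hτ => ⟨fun i j => FEM.Mesh.existsUnique_scottZhang hn hk hσ (hτ.2 i j),
    FEM.Mesh.existsUnique_bubbleInterp hn hk fun K hK i j =>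
      FEM.Mesh.memLp_sub_scottZhangTensor hn hk hσ hτ hK i j,
    FEM.Mesh.memStress_stressInterp hn hk hσ hτ,
    fun K hK ς hς => FEM.Mesh.stressInterp_moments hn hk hσ hτ hK hς⟩, fun m hm γ => ?_⟩
  -- The estimates assume γ ≥ 1; a grid that is regular with constant γ is regular with any larger
  -- one.
  obtain ⟨C, hC, h⟩ := FEM.exists_sobolev_error_le n k hn hk (max γ 1) (le_max_right _ _) m hm
  exact ⟨C, hC, fun T σ hT hσ τ hτ => h Ω hΩ T
    (fun K hK => FEM.RegularCell.mono (hT K hK) (le_max_left _ _)) σ hσ τ hτ⟩
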